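/- **Conventions.** All spaces are $\mathbb{Q}$-vector spaces spanned by abstract graphs with univalent vertices ("legs") and cyclically oriented trivalent vertices (vertex-free closed loops are allowed), modulo the AS and IHX relations and the following relations on legs. Pictures of trivalent vertices are oriented anticlockwise. A *fork* at an edge $e$ is a trivalent vertex with edges $(e,y,z)$ in cyclic order, whose edges $y,z$ end, in this order from left to right, in two legs of grade 1. * $\mathcal{B}$: one kind of leg, legs unordered, no further relation. In all other spaces the legs are ordered from left to right and have grade 1 or 2. * $\mathcal{W}$: adjacent legs of grades $x,y$ may be transposed with sign $(-1)^{xy}$. $\widetilde{\mathcal{W}}$: no further relation. * $\widehat{\mathcal{W}}$: $[2,2]=$ the two legs joined by a trivalent vertex to one grade 2 leg (STU); $[2,1]=$ the two legs joined likewise to one grade 1 leg; $1\,1'+1'\,1=$ the diagram with the two grade 1 legs joined to each other. * $\widehat{\mathcal{W}}_F$ (grade 2 legs are now called curvature legs $F$): $[F,F]=$ STU, $[F,1]=0$, and $1\,1'+1'\,1=$ the joined diagram. $\widehat{\mathcal{W}}_\wedge$: the same, except $1\,1'+1'\,1=0$. **Maps.** $\Upsilon:\mathcal{B}\to\mathcal{W}$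 orders the legs and replaces each by (grade 2 leg) $-\frac12$(fork). $\chi_{\mathcal W}:\mathcal{W}\to\widetilde{\mathcal{W}}$ averages over all permutations of the legs, with the sign $-1$ for each pair of grade 1 legs whose order is reversed. $\pi:\widetilde{\mathcal{W}}\to\widehat{\mathcal{W}}$ is the quotient map. $B_{\bullet\to F}:\widehat{\mathcal{W}}\to\widehat{\mathcal{W}}_F$ replaces each grade 2 leg by (curvature leg) $+\frac12$(fork). $\lambda:\widehat{\mathcal{W}}_F\to\widehat{\mathcal{W}}_\wedge$ sends a diagram $w$ to $\sum_\wp(-1)^{x}2^{-|\wp|}w_\wp$, over all sets $\wp$ of disjoint pairs of grade 1 legs, where $w_\wp$ is $w$ with these pairs glued together, and $x$ is the number of crossings between lines of grade 1 when the pairs are joined by arcs below the ordering line and the remaining legs are carried straight down. **Operator diagrams.** Let $a$ and $b$ be formal parameters of grades 2 and 1. For $\mathcal{V}=\widehat{\mathcal{W}}_F$ or $\widehat{\mathcal{W}}_\wedge$ let $\mathcal{V}[a,b]^{(i,j)}$ be the space defined like $\mathcal{V}$, where diagrams may also have parameter legs $a,b$ (of total grade $i$) anywhere and operator legs $\partial_a,\partial_b$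 (of total grade $j$) in a group at the far right; parameter legs may be transposed with all legs, and operator legs with each other, with sign $(-1)^{xy}$. Put $\mathcal{V}[[a,b]]=\prod_{i,j}\mathcal{V}[a,b]^{(i,j)}$, and let $[\,\cdot\,]_{a,b,\partial_a,\partial_b=0}$ be the projection to $\mathcal{V}[a,b]^{(0,0)}=\mathcal{V}$. The map $\lambda$ extends to $\lambda:\widehat{\mathcal{W}}_F[[a,b]]\to\widehat{\mathcal{W}}_\wedge[[a,b]]$ by the same formula (only ordinary grade 1 legs are glued, but $b$- and $\partial_b$-legs count for the crossings). For diagrams $v,w$, $v\vdash w$ is obtained by placing $v$ to the left of $w$ and pushing the operator legs of $v$ to the far right as graded differential operators: passing a leg costs the sign $(-1)^{xy}$, and passing a parameter leg of the same parameter yields a further term in which the two are glued together. $v\# w$ is juxtaposition (the term of $v\vdash w$ without gluings). Both are extended to power series whenever only finitely many pairs of types contribute to each type of the result; $\exp_{\#}$ and $\exp_{\vdash}$ are the corresponding exponential series. Finally $B_{l\mapsto\partial_a}:\mathcal{B}\to\widehat{\mathcal{W}}_\wedge[[a,b]]$ orders the legs and labels each with $\partial_a$. **Theorem.** All the maps and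 products above are well defined, all the exponentials and products below converge, and for every $v\in\mathcal{B}$ $$(\lambda\circ B_{\bullet\to F}\circ\pi\circ\chi_{\mathcal W}\circ\Upsilon)(v)=\Big[B_{l\mapsto\partial_a}(v)\vdash\big(\exp_\#(j)\,\#\,\mathcal{X}\big)\Big]_{a,b,\partial_a,\partial_b=0}\quad\text{in }\widehat{\mathcal{W}}_\wedge,$$ $$\mathcal{X}=\exp_\vdash\!\big(-\tfrac12 z\big)\vdash\lambda\big(\exp_\#(\tfrac12k+l)\big),$$ where $j$ is a single edge with one end a curvature leg and the other an $a$-leg; $k$ is a trivalent vertex with edges ending (in cyclic order and from left to right) in an $a$-leg and two grade 1 legs; $l$ is a single edge whose ends are a $b$-leg and, to its right, a grade 1 leg; and $z$ is a trivalent vertex with edges ending (in cyclic order and from left to right) in an $a$-leg and two $\partial_b$-legs. -/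

import Mathlib

noncomputable section

namespace Weil

/-! ### Graphs with univalent and trivalent vertices -/

/-- A presentation of an abstract graph in "index notation". Natural numbers name the edges.
* `tri` lists the trivalent vertices; `(x, y, z)` is a vertex whose incoming edges are
  `x, y, z` in this (anticlockwise) cyclic order.
* `legs` is the list of univalent vertices, from left to right along the ordering line, each with
  its label in `L` and the edge it lies on.
* `link` lists auxiliary bivalent points subdividing an edge: `(x, y)` says that an end of the
  segment `x` is joined to an end of the segment `y`. They are immaterial
  (see `GraphRel.smooth`); gluing two legs together produces one. A vertex-free closed
  loop is `(x, x)`.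
The condition that every name in use is the name of exactly two ends is `Diagram.Valid`. -/
@[ext]
structure Diagram (L : Type) where
  tri : Multiset (ℕ × ℕ × ℕ)
  link : Multiset (ℕ × ℕ)
  legs : List (L × ℕ)

/-- The multiset of names of all the ends of edges. -/
def Diagram.ends {L : Type} (D : Diagram L) : Multiset ℕ :=
  D.tri.bind (fun t => {t.1, t.2.1, t.2.2}) + D.link.bind (fun k => {k.1, k.2})
    + ((D.legs.map Prod.snd : List ℕ) : Multiset ℕ)

/-- Every edge has exactly two ends. -/
def Diagram.Valid {L : Type} (D : Diagram L) : Prop :=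
  ∀ e, D.ends.count e = 0 ∨ D.ends.count e = 2

/-- Rename the edges. -/
def Diagram.rename {L : Type} (f : ℕ → ℕ) (D : Diagram L) : Diagram L where
  tri := D.tri.map (fun t => (f t.1, f t.2.1, f t.2.2))
  link := D.link.map (fun k => (f k.1, f k.2))
  legs := D.legs.map (fun x => (x.1, f x.2))

/-- Formal `ℚ`-linear combinations of diagrams. -/
abbrev Comb (L : Type) : Type := Diagram L →₀ ℚ

/-- The diagram, as a formal linear combination. -/
def gen {L : Type} (D : Diagram L) : Comb L := Finsupp.single D 1

/-- The relations that concern the graph only. `rename`, `cyc` and `smooth` identify different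
presentations of the same oriented graph; `anti` and `ihx` are the AS and IHX relations. -/
inductive GraphRel {L : Type} : Comb L → Prop
  | rename (σ : Equiv.Perm ℕ) (D : Diagram L) : GraphRel (gen D - gen (D.rename σ))
  | cyc (x y z : ℕ) (T K) (w : List (L × ℕ)) :
      GraphRel (gen ⟨(x, y, z) ::ₘ T, K, w⟩ - gen ⟨(y, z, x) ::ₘ T, K, w⟩)
  | smooth (x y : ℕ) (T K) (w : List (L × ℕ)) (hxy : x ≠ y) :
      GraphRel (gen ⟨T, (x, y) ::ₘ K, w⟩
        - gen (Diagram.rename (fun n => if n = y then x else n) ⟨T, K, w⟩))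
  | anti (x y z : ℕ) (T K) (w : List (L × ℕ)) :
      GraphRel (gen ⟨(x, y, z) ::ₘ T, K, w⟩ + gen ⟨(y, x, z) ::ₘ T, K, w⟩)
  | ihx (x y z t e : ℕ) (T K) (w : List (L × ℕ)) :
      GraphRel (gen ⟨(x, y, e) ::ₘ (e, z, t) ::ₘ T, K, w⟩
        + gen ⟨(y, z, e) ::ₘ (e, x, t) ::ₘ T, K, w⟩
        + gen ⟨(z, x, e) ::ₘ (e, y, t) ::ₘ T, K, w⟩)

/-! ### Vector spaces presented by diagrams and relations -/

/-- A set of generating diagrams and a set of relation vectors. A relation vector is imposed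
when all the diagrams occurring in it are among the generators. -/
structure Presentation (L : Type) where
  adm : Set (Diagram L)
  rel : Set (Comb L)

/-- The span of the relations. -/
def Presentation.relations {L : Type} (P : Presentation L) : Submodule ℚ (P.adm →₀ ℚ) :=
  Submodule.span ℚ {x | x.mapDomain Subtype.val ∈ P.rel}

/-- The presented vector space. -/
abbrev Presentation.Space {L : Type} (P : Presentation L) : Type :=
  (P.adm →₀ ℚ) ⧸ P.relations

/-- The class of a linear combination of diagrams; diagrams that are not generators of `P`
are discarded. -/
def Presentation.cls {L : Type} (P : Presentation L) : Comb L →ₗ[ℚ] P.Space :=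
  P.relations.mkQ ∘ₗ Finsupp.lsubtypeDomain P.adm

/-- A linear map given on diagrams, read as a map from the combinations of generators of `P` to
the space presented by `Q`. -/
def onGenerators {L M : Type} (P : Presentation L) (Q : Presentation M)
    (f : Comb L →ₗ[ℚ] Comb M) : (P.adm →₀ ℚ) →ₗ[ℚ] Q.Space :=
  Q.cls ∘ₗ f ∘ₗ Finsupp.lmapDomain ℚ ℚ Subtype.val

/-- The map given on diagrams by `f` respects relations, that is, it is well defined as a map
from the space presented by `P` to the space presented by `Q`. -/
def WellDefined {L M : Type} (P : Presentation L) (Q : Presentation M)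
    (f : Comb L →ₗ[ℚ] Comb M) : Prop :=
  ∀ x ∈ P.relations, onGenerators P Q f x = 0

open Classical in
/-- The map between the presented spaces given by `f` on diagrams (meaningful only if
`WellDefined P Q f`; zero otherwise). -/
def induced {L M : Type} (P : Presentation L) (Q : Presentation M)
    (f : Comb L →ₗ[ℚ] Comb M) : P.Space →ₗ[ℚ] Q.Space :=
  if h : WellDefined P Q f then
    P.relations.liftQ (onGenerators P Q f) (fun x hx => LinearMap.mem_ker.2 (h x hx))
  else 0

/-- The two-variable version of `onGenerators`. -/
def onGenerators₂ {L : Type} (P Q S : Presentation L)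
    (f : Comb L →ₗ[ℚ] Comb L →ₗ[ℚ] Comb L) :
    (P.adm →₀ ℚ) →ₗ[ℚ] (Q.adm →₀ ℚ) →ₗ[ℚ] S.Space :=
  (f.compl₁₂ (Finsupp.lmapDomain ℚ ℚ Subtype.val)
    (Finsupp.lmapDomain ℚ ℚ Subtype.val)).compr₂ S.cls

/-- The two-variable version of `WellDefined`. -/
def WellDefined₂ {L : Type} (P Q S : Presentation L)
    (f : Comb L →ₗ[ℚ] Comb L →ₗ[ℚ] Comb L) : Prop :=
  (∀ x ∈ P.relations, ∀ y, onGenerators₂ P Q S f x y = 0) ∧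
  (∀ y ∈ Q.relations, ∀ x, onGenerators₂ P Q S f x y = 0)

/-- A bilinear map that respects relations in both variables descends. -/
def lift₂ {L : Type} (P Q S : Presentation L) (f : Comb L →ₗ[ℚ] Comb L →ₗ[ℚ] Comb L)
    (h : WellDefined₂ P Q S f) : P.Space →ₗ[ℚ] Q.Space →ₗ[ℚ] S.Space :=
  (Q.relations.liftQ
    (P.relations.liftQ (onGenerators₂ P Q S f)
      (fun x hx => LinearMap.mem_ker.2 (LinearMap.ext fun y => h.1 x hx y))).flip
    (fun y hy => LinearMap.mem_ker.2 (LinearMap.ext fun p => by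
      induction p using Submodule.Quotient.induction_on with
      | H x => exact h.2 y hy x))).flip

open Classical in
/-- The two-variable version of `induced`. -/
def induced₂ {L : Type} (P Q S : Presentation L) (f : Comb L →ₗ[ℚ] Comb L →ₗ[ℚ] Comb L) :
    P.Space →ₗ[ℚ] Q.Space →ₗ[ℚ] S.Space :=
  if h : WellDefined₂ P Q S f then lift₂ P Q S f h else 0

/-- Linear extension of a map defined on diagrams. -/
def extend {L M : Type} (f : Diagram L → Comb M) : Comb L →ₗ[ℚ] Comb M :=
  Finsupp.linearCombination ℚ f

/-- Bilinear extension of a map defined on pairs of diagrams. -/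
def extend₂ {L : Type} (f : Diagram L → Diagram L → Comb L) :
    Comb L →ₗ[ℚ] Comb L →ₗ[ℚ] Comb L :=
  Finsupp.linearCombination ℚ (fun D => extend (f D))

/-! ### Kinds of legs -/

/-- The two formal parameters, `a` of grade 2 and `b` of grade 1. -/
inductive Param
  | a
  | b
  deriving DecidableEq

/-- Kinds of legs: ordinary legs of leg-grade 1 and 2, parameter legs, and operator legs
(`op a` is `∂_a`, `op b` is `∂_b`). A leg `two` is drawn with a fat dot in the spaces `𝒲`,
`𝒲~`, `𝒲^`, and is a curvature leg in the spaces `𝒲^_F` and `𝒲^_∧`. -/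
inductive Leg
  | one
  | two
  | par (p : Param)
  | op (p : Param)
  deriving DecidableEq

def Param.grade : Param → ℕ
  | .a => 2
  | .b => 1

def Leg.grade : Leg → ℕ
  | .one => 1
  | .two => 2
  | .par p => p.grade
  | .op p => p.grade

def Leg.isOp : Leg → Bool
  | .op _ => true
  | _ => false

def Leg.parGrade : Leg → ℕ
  | .par p => p.grade
  | _ => 0

def Leg.opGrade : Leg → ℕ
  | .op p => p.grade
  | _ => 0

/-- The sign picked up when legs of kinds `x` and `y` are transposed. -/
def sgn (x y : Leg) : ℚ := (-1) ^ (x.grade * y.grade)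

/-- The non-operator legs. -/
def body (w : List (Leg × ℕ)) : List (Leg × ℕ) := w.filter (fun x => !x.1.isOp)

/-- The operator legs. -/
def ops (w : List (Leg × ℕ)) : List (Leg × ℕ) := w.filter (fun x => x.1.isOp)

/-- Operator Weil diagrams of type `(i, j)`: the operator legs are at the far right, the
parameter-grade is `i` and the operator-grade is `j`. -/
def opDiagrams (t : ℕ × ℕ) : Set (Diagram Leg) :=
  {D | D.Valid ∧ D.legs = body D.legs ++ ops D.legs ∧
    (D.legs.map (fun x => x.1.parGrade)).sum = t.1 ∧
    (D.legs.map (fun x => x.1.opGrade)).sum = t.2}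

/-! ### Relations that involve legs -/

/-- Adjacent legs whose kinds satisfy `A` may be transposed, with sign `s`. -/
def swapRel {L : Type} (A : L → L → Prop) (s : L → L → ℚ) : Set (Comb L) :=
  {r | ∃ (T : Multiset (ℕ × ℕ × ℕ)) (K : Multiset (ℕ × ℕ)) (u v : List (L × ℕ)) (p q : L)
      (x y : ℕ), A p q ∧
      r = gen ⟨T, K, u ++ (p, x) :: (q, y) :: v⟩ - s p q • gen ⟨T, K, u ++ (q, y) :: (p, x) :: v⟩}

/-- STU: the commutator of a leg of kind `p` and a leg of kind `q` is the
trivalent vertex joining them to one leg of kind `r`. -/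
def stuRel (p q r : Leg) : Set (Comb Leg) :=
  {c | ∃ (T : Multiset (ℕ × ℕ × ℕ)) (K : Multiset (ℕ × ℕ)) (u v : List (Leg × ℕ)) (x y z : ℕ),
      c = gen ⟨T, K, u ++ (p, x) :: (q, y) :: v⟩ - gen ⟨T, K, u ++ (q, y) :: (p, x) :: v⟩
        - gen ⟨(x, z, y) ::ₘ T, K, u ++ (r, z) :: v⟩}

/-- The Clifford-type relation: the anticommutator of two legs of grade 1 is the diagram in which
they are joined. -/
def cliffordRel : Set (Comb Leg) :=
  {c | ∃ (T : Multiset (ℕ × ℕ × ℕ)) (K : Multiset (ℕ × ℕ)) (u v : List (Leg × ℕ)) (x y : ℕ),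
      c = gen ⟨T, K, u ++ (.one, x) :: (.one, y) :: v⟩
        + gen ⟨T, K, u ++ (.one, y) :: (.one, x) :: v⟩ - gen ⟨T, (x, y) ::ₘ K, u ++ v⟩}

/-- Parameter and operator legs move about freely, up to sign. (As only relations between operator
Weil diagrams are imposed, operator legs stay at the far right.) -/
def paramRel : Set (Comb Leg) :=
  swapRel (fun p q => (∃ x, p = .par x) ∨ (∃ y, q = .par y) ∨
    ((∃ x, p = .op x) ∧ ∃ y, q = .op y)) sgn

/-- `ℬ`: symmetric Jacobi diagrams modulo AS and IHX. The order in which the legs are listed is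
immaterial. -/
def spB : Presentation Unit where
  adm := {D | D.Valid}
  rel := {r | GraphRel r} ∪ swapRel (fun _ _ => True) (fun _ _ => 1)

/-- `𝒲`: symmetric Weil diagrams. -/
def spW : Presentation Leg where
  adm := opDiagrams (0, 0)
  rel := {r | GraphRel r} ∪ swapRel (fun _ _ => True) sgn

/-- `𝒲~`: non-commutative Weil diagrams. -/
def spWTilde : Presentation Leg where
  adm := opDiagrams (0, 0)
  rel := {r | GraphRel r}

/-- `𝒲^`. -/
def spWHat : Presentation Leg where
  adm := opDiagrams (0, 0)
  rel := {r | GraphRel r} ∪ stuRel .two .two .two ∪ stuRel .two .one .one ∪ cliffordRel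

/-- `𝒲^_F[a,b]^{(i,j)}`. The space `𝒲^_F` itself is the case `(i,j) = (0,0)` of diagrams without
parameter or operator legs. -/
def spF (t : ℕ × ℕ) : Presentation Leg where
  adm := opDiagrams t
  rel := {r | GraphRel r} ∪ stuRel .two .two .two
    ∪ swapRel (fun p q => p = .two ∧ q = .one) sgn ∪ cliffordRel ∪ paramRel

/-- `𝒲^_∧[a,b]^{(i,j)}`. The space `𝒲^_∧` itself is the case `(i,j) = (0,0)` of diagrams without
parameter or operator legs. -/
def spWedge (t : ℕ × ℕ) : Presentation Leg where
  adm := opDiagrams t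
  rel := {r | GraphRel r} ∪ stuRel .two .two .two
    ∪ swapRel (fun p q => p = .two ∧ q = .one) sgn
    ∪ swapRel (fun p q => p = .one ∧ q = .one) sgn ∪ paramRel

/-! ### The maps of the composition, on diagrams -/

/-- Replace legs from left to right. A leg of kind `l` on the edge `e` is replaced by
(a leg of kind `f l`) `+ c l` (a fork: a trivalent vertex with edges `e`, `y`, `z`, where `y`, `z`
end, in this order, in two legs of grade 1). All choices are listed, as triples (coefficient,
vertices of forks, legs). An old edge `e` is renamed `2e`, and the
`i`-th leg uses the new names `4i+1` and `4i+3`. -/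
def splitLegs {L : Type} (f : L → Leg) (c : L → ℚ) :
    ℕ → List (L × ℕ) → List (ℚ × List (ℕ × ℕ × ℕ) × List (Leg × ℕ))
  | _, [] => [(1, [], [])]
  | i, (l, e) :: w => (splitLegs f c (i + 1) w).flatMap fun t =>
      [(t.1, t.2.1, (f l, 2 * e) :: t.2.2),
       (c l * t.1, (2 * e, 4 * i + 1, 4 * i + 3) :: t.2.1,
        (.one, 4 * i + 1) :: (.one, 4 * i + 3) :: t.2.2)]

def splitDiagram {L : Type} (f : L → Leg) (c : L → ℚ) (D : Diagram L) : Comb Leg :=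
  ((splitLegs f c 0 D.legs).map fun t =>
    t.1 • gen ⟨(D.rename (2 * ·)).tri + t.2.1, (D.rename (2 * ·)).link, t.2.2⟩).sum

/-- Hair-splitting: every leg becomes (grade 2 leg) `- 1/2` fork. -/
def hairSplit : Comb Unit →ₗ[ℚ] Comb Leg :=
  extend (splitDiagram (fun _ => .two) (fun _ => -1 / 2))

/-- Change to curvature legs: every leg of grade 2 becomes (curvature leg) `+ 1/2` fork, and the
other legs are unchanged. -/
def toCurvature : Comb Leg →ₗ[ℚ] Comb Leg :=
  extend (splitDiagram id (fun l => if l = .two then 1 / 2 else 0))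

/-- The sign with which a permutation of the legs is performed in `𝒲`: a factor `-1` for every pair
of grade 1 legs whose order is reversed. -/
def permSign (w : List (Leg × ℕ)) (σ : Equiv.Perm (Fin w.length)) : ℚ :=
  (-1) ^ (Finset.univ.filter fun p : Fin w.length × Fin w.length =>
    p.1 < p.2 ∧ σ p.2 < σ p.1 ∧ (w.get (σ p.1)).1.grade = 1 ∧ (w.get (σ p.2)).1.grade = 1).card

/-- Graded averaging over all rearrangements of the legs. -/
def average : Comb Leg →ₗ[ℚ] Comb Leg :=
  extend fun D => ((Nat.factorial D.legs.length : ℚ))⁻¹ •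
    ∑ σ : Equiv.Perm (Fin D.legs.length),
      permSign D.legs σ • gen ⟨D.tri, D.link, List.ofFn fun i => D.legs.get (σ i)⟩

open Classical in
/-- The pairings: families of disjoint two-element sets of positions of (ordinary) grade 1 legs. A
two-element set is written as a pair `(i, j)` with `i < j`. -/
def pairings (w : List (Leg × ℕ)) : Finset (Finset (Fin w.length × Fin w.length)) :=
  Finset.univ.filter fun P =>
    (∀ p ∈ P, p.1 < p.2 ∧ (w.get p.1).1 = .one ∧ (w.get p.2).1 = .one) ∧
    (∀ p ∈ P, ∀ q ∈ P, p ≠ q → p.1 ≠ q.1 ∧ p.1 ≠ q.2 ∧ p.2 ≠ q.1 ∧ p.2 ≠ q.2)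

/-- The leg at position `k` does not belong to the pairing. -/
def Unpaired {n : ℕ} (P : Finset (Fin n × Fin n)) (k : Fin n) : Prop :=
  ∀ p ∈ P, p.1 ≠ k ∧ p.2 ≠ k

open Classical in
/-- The number of intersections between full lines when the pairs are joined by arcs below the
ordering line and the other legs are carried straight down: two arcs cross if their ends
interleave, and an arc crosses every unpaired leg of grade 1 between its ends. -/
def crossings (w : List (Leg × ℕ)) (P : Finset (Fin w.length × Fin w.length)) : ℕ :=
  ((P ×ˢ P).filter fun r => r.1.1 < r.2.1 ∧ r.2.1 < r.1.2 ∧ r.1.2 < r.2.2).card +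
  ((P ×ˢ Finset.univ).filter fun r : (Fin w.length × Fin w.length) × Fin w.length =>
    Unpaired P r.2 ∧ (w.get r.2).1.grade = 1 ∧ r.1.1 < r.2 ∧ r.2 < r.1.2).card

open Classical in
/-- The map `λ`: glue the grade 1 legs to each other in all possible ways. -/
def lam : Comb Leg →ₗ[ℚ] Comb Leg :=
  extend fun D => ∑ P ∈ pairings D.legs,
    ((-1) ^ crossings D.legs P * (1 / 2) ^ P.card : ℚ) •
      gen ⟨D.tri, D.link + P.val.map (fun p => ((D.legs.get p.1).2, (D.legs.get p.2).2)),
        ((List.finRange D.legs.length).filter fun k => Unpaired P k).map D.legs.get⟩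

/-- `B_{l ↦ ∂_a}`: label every leg with `∂_a`. -/
def toPartialA : Comb Unit →ₗ[ℚ] Comb Leg :=
  extend fun D => gen ⟨D.tri, D.link, D.legs.map fun x => (.op .a, x.2)⟩

/-! ### Products of operator Weil diagrams, on diagrams -/

/-- Edges of the left factor of a product of diagrams. -/
def left (n : ℕ) : ℕ := 2 * n

/-- Edges of the right factor of a product of diagrams. -/
def right (n : ℕ) : ℕ := 2 * n + 1

def weight (w : List (Leg × ℕ)) : ℕ := (w.map fun x => x.1.grade).sum

/-- Juxtaposition `#`. The operator legs of the left factor are carried (without acting) past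
the other legs of the right factor, with the corresponding sign. -/
def hash : Comb Leg →ₗ[ℚ] Comb Leg →ₗ[ℚ] Comb Leg :=
  extend₂ fun D E =>
    let D' := D.rename left
    let E' := E.rename right
    ((-1) ^ (weight (ops D'.legs) * weight (body E'.legs)) : ℚ) •
      gen ⟨D'.tri + E'.tri, D'.link + E'.link,
        body D'.legs ++ body E'.legs ++ ops D'.legs ++ ops E'.legs⟩

/-- An operator leg operates on a parameter leg of the same parameter. -/
def matchesParam : Leg → Leg → Bool
  | .op p, .par q => p = q
  | _, _ => false

/-- Push the operator leg `o` through a list of legs to the group of operator legs at the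
right-hand end. Passing a leg costs the sign of the transposition; passing a matching parameter
leg produces moreover a term in which the two are glued together. The terms are triples
(coefficient, glued pairs of edges, legs). -/
def push (o : Leg × ℕ) : List (Leg × ℕ) → List (ℚ × List (ℕ × ℕ) × List (Leg × ℕ))
  | [] => [(1, [], [o])]
  | x :: w =>
    if x.1.isOp then [(1, [], o :: x :: w)] else
      (push o w).map (fun t => (sgn o.1 x.1 * t.1, t.2.1, x :: t.2.2)) ++
        (if matchesParam o.1 x.1 then [(1, [(o.2, x.2)], w)] else [])

/-- Push a list of operator legs through a list of legs, the rightmost operator first. -/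
def pushAll : List (Leg × ℕ) → List (Leg × ℕ) → List (ℚ × List (ℕ × ℕ) × List (Leg × ℕ))
  | [], w => [(1, [], w)]
  | o :: os, w => (pushAll os w).flatMap fun t =>
      (push o t.2.2).map fun s => (t.1 * s.1, s.2.1 ++ t.2.1, s.2.2)

/-- The operation `⊢` of a diagram on a diagram. -/
def operate : Comb Leg →ₗ[ℚ] Comb Leg →ₗ[ℚ] Comb Leg :=
  extend₂ fun D E =>
    let D' := D.rename left
    let E' := E.rename right
    ((pushAll (ops D'.legs) E'.legs).map fun t =>
      t.1 • gen ⟨D'.tri + E'.tri, D'.link + E'.link + t.2.1, body D'.legs ++ t.2.2⟩).sum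

/-! ### Formal power series of operator Weil diagrams -/

/-- Formal power series: a vector of each type `(i, j)`. -/
abbrev Series (P : ℕ × ℕ → Presentation Leg) : Type := ∀ t : ℕ × ℕ, (P t).Space

/-- A linear combination of operator Weil diagrams as a power series. -/
def Series.of (P : ℕ × ℕ → Presentation Leg) (x : Comb Leg) : Series P := fun t => (P t).cls x

/-- The part of type `r` of the product (given on diagrams by `m`) of a vector of type `p` and a
vector of type `q`. -/
def part (P : ℕ × ℕ → Presentation Leg) (m : Comb Leg →ₗ[ℚ] Comb Leg →ₗ[ℚ] Comb Leg)
    (p q r : ℕ × ℕ) : (P p).Space →ₗ[ℚ] (P q).Space →ₗ[ℚ] (P r).Space :=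
  induced₂ (P p) (P q) (P r) m

variable {P : ℕ × ℕ → Presentation Leg}

/-- The product of two power series is convergent: the part of any given type receives
only finitely many non-zero contributions. -/
def Converges (m : Comb Leg →ₗ[ℚ] Comb Leg →ₗ[ℚ] Comb Leg) (v w : Series P) : Prop :=
  ∀ r, {s : (ℕ × ℕ) × (ℕ × ℕ) | part P m s.1 s.2 r (v s.1) (w s.2) ≠ 0}.Finite

/-- The product of two power series (meaningful when it converges). -/
def mul (m : Comb Leg →ₗ[ℚ] Comb Leg →ₗ[ℚ] Comb Leg) (v w : Series P) : Series P :=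
  fun r => ∑ᶠ s : (ℕ × ℕ) × (ℕ × ℕ), part P m s.1 s.2 r (v s.1) (w s.2)

/-- Powers with respect to the product `m`; the zeroth power is the empty diagram. -/
def pow (m : Comb Leg →ₗ[ℚ] Comb Leg →ₗ[ℚ] Comb Leg) (v : Series P) : ℕ → Series P
  | 0 => Series.of P (gen ⟨0, 0, []⟩)
  | n + 1 => mul m v (pow m v n)

/-- All powers of `v` converge, and so does their exponential sum. -/
def ExpConverges (m : Comb Leg →ₗ[ℚ] Comb Leg →ₗ[ℚ] Comb Leg) (v : Series P) : Prop :=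
  (∀ n, Converges m v (pow m v n)) ∧ ∀ t, {n | pow m v n t ≠ 0}.Finite

/-- The exponential `∑ vⁿ / n!` with respect to the product `m` (meaningful when it converges). -/
def exp (m : Comb Leg →ₗ[ℚ] Comb Leg →ₗ[ℚ] Comb Leg) (v : Series P) : Series P :=
  fun t => ∑ᶠ n : ℕ, ((Nat.factorial n : ℚ))⁻¹ • pow m v n t

/-- The extension of `λ` to power series. -/
def lamSeries (v : Series spF) : Series spWedge := fun t => induced (spF t) (spWedge t) lam (v t)

/-- The map `B_{l ↦ ∂_a}` from `ℬ` to power series. -/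
def partialA (v : spB.Space) : Series spWedge := fun t => induced spB (spWedge t) toPartialA v

/-- The map which sets all the parameters to zero: the projection to type `(0,0)`. -/
def setZero (v : Series P) : (P (0, 0)).Space := v (0, 0)

/-! ### The particular diagrams -/

/-- An edge joining a curvature leg and an `a`-leg. -/
def edgeFA : Comb Leg := gen ⟨0, 0, [(.two, 0), (.par .a, 0)]⟩

/-- An edge joining a `b`-leg and a grade 1 leg. -/
def edgeB : Comb Leg := gen ⟨0, 0, [(.par .b, 0), (.one, 0)]⟩

/-- A fork with an `a`-leg and two grade 1 legs. -/
def forkA : Comb Leg := gen ⟨{(0, 1, 2)}, 0, [(.par .a, 0), (.one, 1), (.one, 2)]⟩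

/-- A fork with an `a`-leg and two `∂_b`-legs. -/
def forkOp : Comb Leg := gen ⟨{(0, 1, 2)}, 0, [(.par .a, 0), (.op .b, 1), (.op .b, 2)]⟩

/-- `exp_#` of the edge joining a curvature leg and an `a`-leg, in `𝒲^_∧[[a,b]]`. -/
def expEdge : Series spWedge := exp hash (Series.of spWedge edgeFA)

/-- `exp_⊢ (-1/2 fork)` in `𝒲^_∧[[a,b]]`. -/
def expForkOp : Series spWedge := exp operate (Series.of spWedge ((-1 / 2 : ℚ) • forkOp))

/-- `1/2 k + l` in `𝒲^_F[[a,b]]`. -/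
def innerTerm : Series spF := Series.of spF ((1 / 2 : ℚ) • forkA + edgeB)

/-- The series `𝒳`. -/
def seriesX : Series spWedge := mul operate expForkOp (lamSeries (exp hash innerTerm))

/-- The maps of the composition. -/
def mapUpsilon : spB.Space →ₗ[ℚ] spW.Space := induced spB spW hairSplit

def mapChi : spW.Space →ₗ[ℚ] spWTilde.Space := induced spW spWTilde average

def mapPi : spWTilde.Space →ₗ[ℚ] spWHat.Space :=
  Submodule.mapQ spWTilde.relations spWHat.relations LinearMap.id
    (Submodule.span_mono fun _ hx => Or.inl (Or.inl (Or.inl hx)))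

def mapBF : spWHat.Space →ₗ[ℚ] (spF (0, 0)).Space := induced spWHat (spF (0, 0)) toCurvature

def mapLambda : (spF (0, 0)).Space →ₗ[ℚ] (spWedge (0, 0)).Space :=
  induced (spF (0, 0)) (spWedge (0, 0)) lam

end Weil

end

/-!
The idea of the proof is that both sides of the formula are contractions. Pair the legs of the
hair-split diagram with the `a`- and `b`-legs of a power of `j + 1/2 k + l` in all possible ways:
on the one hand this averages the legs over all orders and puts (curvature leg) `+ 1/2` fork for
each leg of grade 2, since a leg of grade 1 meets the `b`-leg of a copy of `l`, and a leg of grade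
2 meets the `a`-leg of a copy of `j` or of `1/2 k`; so it gives `B_{• → F} ∘ π ∘ χ_W`. On the other
hand, the forks with two `∂_b`-legs in `exp (-1/2 z)` glue themselves to pairs of `b`-legs, and the
legs `∂_a` of `B_{l ↦ ∂_a} v` to all the `a`-legs, those of `z` included; so the operators on the
right hand side contract each leg of `v` either with an `a`-leg, or, through `-1/2` fork, with two
`b`-legs. That is the contraction of the hair-split diagram. Finally `λ` commutes with
contractions.

Relations. All maps and products are compositions of a few elementary operators on combinations of
diagrams: renaming (`ren`), adding vertices and links (`addG`), adding a leg on the left (`consL`),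
contracting a half-edge with the legs of a word (`ctr`), and pushing a leg through a word
(`pushC`). It suffices to see that each of them respects the relations. Two families are treated
together: the presentations `sp q`, where the Clifford relation has the coefficient `q` (`q = 1`
for curvature diagrams, `q = 0` for the exterior ones), and the products `star k`, which are
juxtaposition for `k = 0` and operation for `k = 1`. This gives `IsStar.wellDefined₂`,
`wellDefined_lam`, `wellDefined_hairSplit` and `wellDefined_average`. That the passage to curvature
legs respects the relations (`wellDefined_toCurvature`) is the fact that forks of legs of grade 1
satisfy, by the Clifford relation, the commutation relations of legs of grade 2.

Convergence. The types of the factors of a product restrict the type of the result: operating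
lowers the number of parameter legs at most by the number of operator legs. Hence, to compute the
component of type `(0, 0)` for a diagram with at most `M` legs, all series may be replaced by
finite partial sums (`Low`, `Grows`, `Agree`, `setZero_eq`). The operator legs of `z` are
`∂_b`-legs and `j` has no `b`-leg and no leg of grade 1; so `j` commutes with the operation of `z`
and with `λ`, and the exponentials of `j` and of `1/2 k + l` combine into one (`cls_rhs`).

Gluings. If diagrams have disjoint names and diagrams with remaining operator legs are discarded,
pushing an operator through a diagram is the sum of all its gluings (`cls_star_partialA`). A
half-edge glued to a product of forks is glued by a derivation (`forkVal_cons`); summing over the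
exponential of `-1/2 z` gives the contraction of the hair-split diagram (`sum_forkVal`).

The other side. The contraction with the `N`-th power of `j + 1/2 k + l` only contributes if `N` is
the number of legs, because otherwise legs or parameters remain; its value is then `N!` times the
average, with legs of grade 2 changed to curvature leg `+ 1/2` fork (`delW_blkU`,
`sum_contract_blkU`). As `λ` only glues ordinary legs of grade 1 to each other, counting crossings
in the order of the legs, it commutes with contractions (`lam_contract`), and the two sides agree
(`cls_lhs`, `formula_gen`).
-/

noncomputable section

namespace Weil

/-! ### Presented spaces -/

variable {L M : Type}

theorem cls_gen_of_notMem {P : Presentation L} {D : Diagram L} (h : D ∉ P.adm) :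
    P.cls (gen D) = 0 := by
  have : Finsupp.lsubtypeDomain (R := ℚ) P.adm (gen D) = 0 := by
    ext ⟨E, hE⟩
    exact Finsupp.single_eq_of_ne fun h' => h (h' ▸ hE)
  simp [Presentation.cls, this]

theorem subtypeDomain_mapDomain (s : Set (Diagram L)) (x : s →₀ ℚ) :
    Finsupp.lsubtypeDomain (R := ℚ) s (x.mapDomain Subtype.val) = x := by
  ext a
  exact Finsupp.mapDomain_apply Subtype.val_injective _ a

theorem mapDomain_subtypeDomain {s : Set (Diagram L)} {c : Comb L}
    (h : c ∈ Finsupp.supported ℚ ℚ s) :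
    (Finsupp.lsubtypeDomain (R := ℚ) s c).mapDomain Subtype.val = c := by
  ext a
  by_cases ha : a ∈ s
  · exact Finsupp.mapDomain_apply Subtype.val_injective _ (⟨a, ha⟩ : s)
  · rw [Finsupp.mapDomain_of_notMem_range _ _ (by simpa using ha)]
    by_contra h'
    exact ha (h (Finsupp.mem_support_iff.2 (Ne.symm h')))

theorem cls_mapDomain (P : Presentation L) (x : P.adm →₀ ℚ) :
    P.cls (x.mapDomain Subtype.val) = P.relations.mkQ x := by
  simp only [Presentation.cls, LinearMap.comp_apply, subtypeDomain_mapDomain]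

theorem mapDomain_mem_supported (s : Set (Diagram L)) (x : s →₀ ℚ) :
    x.mapDomain Subtype.val ∈ Finsupp.supported ℚ ℚ s := by
  classical
  intro D hD
  obtain ⟨a, -, rfl⟩ := Finset.mem_image.1 (Finsupp.mapDomain_support hD)
  exact a.2

theorem exists_cls_eq (P : Presentation L) (v : P.Space) :
    ∃ c ∈ Finsupp.supported ℚ ℚ P.adm, P.cls c = v := by
  obtain ⟨x, rfl⟩ := Submodule.mkQ_surjective _ v
  refine ⟨x.mapDomain Subtype.val, ?_, cls_mapDomain P x⟩
  exact mapDomain_mem_supported P.adm x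

theorem cls_rel {P : Presentation L} {r : Comb L} (hr : r ∈ P.rel)
    (h : r ∈ Finsupp.supported ℚ ℚ P.adm) : P.cls r = 0 := by
  rw [← mapDomain_subtypeDomain h, cls_mapDomain, Submodule.mkQ_apply,
    Submodule.Quotient.mk_eq_zero]
  refine Submodule.subset_span ?_
  rwa [Set.mem_ofPred_eq, mapDomain_subtypeDomain h]

theorem gen_mem_supported {s : Set (Diagram L)} {D : Diagram L} :
    gen D ∈ Finsupp.supported ℚ ℚ s ↔ D ∈ s := by
  simp [gen, Finsupp.mem_supported]

theorem onGenerators_eq (P : Presentation L) (Q : Presentation M) (f : Comb L →ₗ[ℚ] Comb M)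
    (x : P.adm →₀ ℚ) : onGenerators P Q f x = Q.cls (f (x.mapDomain Subtype.val)) := rfl

theorem wellDefined_of_rel {P : Presentation L} {Q : Presentation M} {f : Comb L →ₗ[ℚ] Comb M}
    (h : ∀ r ∈ P.rel, r ∈ Finsupp.supported ℚ ℚ P.adm → Q.cls (f r) = 0) :
    WellDefined P Q f := by
  intro x hx
  have : P.relations ≤ LinearMap.ker (onGenerators P Q f) := by
    refine Submodule.span_le.2 fun y hy => ?_
    exact h _ hy (mapDomain_mem_supported P.adm y)
  exact this hx

theorem induced_cls {P : Presentation L} {Q : Presentation M} {f : Comb L →ₗ[ℚ] Comb M}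
    (h : WellDefined P Q f) {c : Comb L} (hc : c ∈ Finsupp.supported ℚ ℚ P.adm) :
    induced P Q f (P.cls c) = Q.cls (f c) := by
  rw [induced, dif_pos h]
  nth_rw 1 [← mapDomain_subtypeDomain hc]
  rw [cls_mapDomain, Submodule.mkQ_apply, Submodule.liftQ_apply, onGenerators_eq,
    mapDomain_subtypeDomain hc]

theorem onGenerators₂_eq (P Q S : Presentation L) (f : Comb L →ₗ[ℚ] Comb L →ₗ[ℚ] Comb L)
    (x : P.adm →₀ ℚ) (y : Q.adm →₀ ℚ) :
    onGenerators₂ P Q S f x y =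
      S.cls (f (x.mapDomain Subtype.val) (y.mapDomain Subtype.val)) := rfl

theorem wellDefined₂_of_rel {P Q S : Presentation L} {f : Comb L →ₗ[ℚ] Comb L →ₗ[ℚ] Comb L}
    (h₁ : ∀ r ∈ P.rel, r ∈ Finsupp.supported ℚ ℚ P.adm → ∀ E ∈ Q.adm, S.cls (f r (gen E)) = 0)
    (h₂ : ∀ r ∈ Q.rel, r ∈ Finsupp.supported ℚ ℚ Q.adm → ∀ D ∈ P.adm, S.cls (f (gen D) r) = 0) :
    WellDefined₂ P Q S f := by
  constructor
  · intro x hx y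
    have : P.relations ≤ LinearMap.ker (onGenerators₂ P Q S f) := by
      refine Submodule.span_le.2 fun x hx => ?_
      rw [SetLike.mem_coe, LinearMap.mem_ker]
      ext E
      simp only [LinearMap.comp_apply, onGenerators₂_eq, Finsupp.lsingle_apply,
        Finsupp.mapDomain_single, LinearMap.zero_apply]
      exact h₁ _ hx (mapDomain_mem_supported _ _) E.1 E.2
    exact LinearMap.congr_fun (this hx) y
  · intro y hy x
    have : Q.relations ≤ LinearMap.ker (onGenerators₂ P Q S f).flip := by
      refine Submodule.span_le.2 fun x hx => ?_
      rw [SetLike.mem_coe, LinearMap.mem_ker]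
      ext E
      simp only [LinearMap.comp_apply, LinearMap.flip_apply, onGenerators₂_eq,
        Finsupp.lsingle_apply, Finsupp.mapDomain_single, LinearMap.zero_apply]
      exact h₂ _ hx (mapDomain_mem_supported _ _) E.1 E.2
    exact LinearMap.congr_fun (this hy) x

theorem induced₂_cls {P Q S : Presentation L} {f : Comb L →ₗ[ℚ] Comb L →ₗ[ℚ] Comb L}
    (h : WellDefined₂ P Q S f) {c d : Comb L} (hc : c ∈ Finsupp.supported ℚ ℚ P.adm)
    (hd : d ∈ Finsupp.supported ℚ ℚ Q.adm) :
    induced₂ P Q S f (P.cls c) (Q.cls d) = S.cls (f c d) := by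
  rw [induced₂, dif_pos h]
  nth_rw 1 [← mapDomain_subtypeDomain hc]
  nth_rw 1 [← mapDomain_subtypeDomain hd]
  rw [cls_mapDomain, cls_mapDomain, lift₂]
  simp only [Submodule.mkQ_apply, LinearMap.flip_apply, Submodule.liftQ_apply]
  rw [onGenerators₂_eq, mapDomain_subtypeDomain hc, mapDomain_subtypeDomain hd]

/-! ### Elementary operators on combinations of diagrams -/

/-- Renaming of edges. -/
def ren (f : ℕ → ℕ) : Comb L →ₗ[ℚ] Comb L := Finsupp.lmapDomain ℚ ℚ (Diagram.rename f)

/-- Adding trivalent vertices and bivalent points. -/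
def addG (T : Multiset (ℕ × ℕ × ℕ)) (K : Multiset (ℕ × ℕ)) : Comb L →ₗ[ℚ] Comb L :=
  Finsupp.lmapDomain ℚ ℚ fun D => ⟨T + D.tri, K + D.link, D.legs⟩

/-- Adding a leg at the far left. -/
def consL (x : L × ℕ) : Comb L →ₗ[ℚ] Comb L :=
  Finsupp.lmapDomain ℚ ℚ fun D => ⟨D.tri, D.link, x :: D.legs⟩

@[simp] theorem ren_gen (f : ℕ → ℕ) (D : Diagram L) : ren f (gen D) = gen (D.rename f) := by
  simp [ren, gen]

@[simp] theorem addG_gen (T K) (D : Diagram L) :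
    addG T K (gen D) = gen ⟨T + D.tri, K + D.link, D.legs⟩ := by
  simp [addG, gen]

@[simp] theorem consL_gen (x) (D : Diagram L) :
    consL x (gen D) = gen ⟨D.tri, D.link, x :: D.legs⟩ := by
  simp [consL, gen]

@[simp] theorem extend_gen (f : Diagram L → Comb M) (D : Diagram L) :
    extend f (gen D) = f D := by
  simp [extend, gen]

theorem extend₂_gen (f : Diagram L → Diagram L → Comb L) (D E : Diagram L) :
    extend₂ f (gen D) (gen E) = f D E := by
  simp [extend₂, extend, gen]

/-- Linear maps which agree on diagrams are equal. -/
theorem comb_ext {V : Type*} [AddCommMonoid V] [Module ℚ V] {f g : Comb L →ₗ[ℚ] V}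
    (h : ∀ D, f (gen D) = g (gen D)) : f = g := by
  refine Finsupp.lhom_ext' fun D => LinearMap.ext_ring ?_
  exact h D

/-- Induction on the list of legs, for identities between linear maps. -/
theorem comb_ind {V : Type*} [AddCommMonoid V] [Module ℚ V] {f g : Comb L →ₗ[ℚ] V}
    (h₀ : ∀ T K, f (gen ⟨T, K, []⟩) = g (gen ⟨T, K, []⟩))
    (h₁ : ∀ x T K w, (∀ T K, f (gen ⟨T, K, w⟩) = g (gen ⟨T, K, w⟩)) →
      f (consL x (gen ⟨T, K, w⟩)) = g (consL x (gen ⟨T, K, w⟩))) : f = g := by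
  refine comb_ext ?_
  rintro ⟨T, K, w⟩
  induction w generalizing T K with
  | nil => exact h₀ T K
  | cons x w ih => simpa using h₁ x T K w ih

theorem addG_addG (T K T' K') (c : Comb L) :
    addG T K (addG T' K' c) = addG (T + T') (K + K') c := by
  refine LinearMap.congr_fun (f := addG T K ∘ₗ addG T' K') (comb_ext fun D => ?_) c
  simp [add_assoc]

theorem addG_zero (c : Comb L) : addG 0 0 c = c := by
  refine LinearMap.congr_fun (f := addG 0 0) (g := LinearMap.id) (comb_ext fun D => ?_) c
  simp

theorem addG_comm (T K T' K') (c : Comb L) :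
    addG T K (addG T' K' c) = addG T' K' (addG T K c) := by
  rw [addG_addG, addG_addG, add_comm T, add_comm K]

theorem consL_addG (x T K) (c : Comb L) : consL x (addG T K c) = addG T K (consL x c) := by
  refine LinearMap.congr_fun (f := consL x ∘ₗ addG T K) (g := addG T K ∘ₗ consL x)
    (comb_ext fun D => ?_) c
  simp

theorem ren_consL (f : ℕ → ℕ) (x) (c : Comb L) :
    ren f (consL x c) = consL (x.1, f x.2) (ren f c) := by
  refine LinearMap.congr_fun (f := ren f ∘ₗ consL x) (g := consL _ ∘ₗ ren f)
    (comb_ext fun D => ?_) c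
  simp [Diagram.rename]

theorem ren_addG (f : ℕ → ℕ) (T K) (c : Comb L) :
    ren f (addG T K c) = addG (T.map fun t => (f t.1, f t.2.1, f t.2.2))
      (K.map fun k => (f k.1, f k.2)) (ren f c) := by
  refine LinearMap.congr_fun (f := ren f ∘ₗ addG T K) (g := addG _ _ ∘ₗ ren f)
    (comb_ext fun D => ?_) c
  simp [Diagram.rename]

theorem ren_ren (f g : ℕ → ℕ) (c : Comb L) : ren f (ren g c) = ren (f ∘ g) c := by
  refine LinearMap.congr_fun (f := ren f ∘ₗ ren g) (comb_ext fun D => ?_) c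
  simp [Diagram.rename, Function.comp_def]

/-! ### Ends and names -/

@[simp] theorem ends_mk (T K) (w : List (L × ℕ)) : Diagram.ends ⟨T, K, w⟩ =
    T.bind (fun t => {t.1, t.2.1, t.2.2}) + K.bind (fun k => {k.1, k.2})
      + ((w.map Prod.snd : List ℕ) : Multiset ℕ) := rfl

theorem ends_rename (f : ℕ → ℕ) (D : Diagram L) : (D.rename f).ends = D.ends.map f := by
  simp [Diagram.ends, Diagram.rename, Multiset.map_bind, Multiset.bind_map, Function.comp_def]

theorem valid_rename_iff {f : ℕ → ℕ} {D : Diagram L} (hf : Set.InjOn f {e | e ∈ D.ends}) :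
    (D.rename f).Valid ↔ D.Valid := by
  have key : ∀ e ∈ D.ends, (D.ends.map f).count (f e) = D.ends.count e := by
    intro e he
    exact Multiset.count_map_eq_count f D.ends hf e he
  constructor
  · intro h e
    by_cases he : e ∈ D.ends
    · rw [← key e he, ← ends_rename]; exact h _
    · left; exact Multiset.count_eq_zero_of_notMem he
  · intro h e
    rw [ends_rename]
    by_cases he : e ∈ D.ends.map f
    · obtain ⟨a, ha, rfl⟩ := Multiset.mem_map.1 he
      rw [key a ha]; exact h _
    · left; exact Multiset.count_eq_zero_of_notMem he

/-- Combinations of diagrams all of whose edges have names in `s`. -/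
def named (s : Set ℕ) : Submodule ℚ (Comb L) :=
  Finsupp.supported ℚ ℚ {D | ∀ e ∈ D.ends, e ∈ s}

theorem supported_induction {s : Set (Diagram L)} {p : Comb L → Prop} {c : Comb L}
    (hc : c ∈ Finsupp.supported ℚ ℚ s) (zero : p 0) (add : ∀ x y, p x → p y → p (x + y))
    (smul : ∀ (a : ℚ) x, p x → p (a • x)) (single : ∀ D ∈ s, p (gen D)) : p c := by
  rw [Finsupp.supported_eq_span_single] at hc
  induction hc using Submodule.span_induction with
  | mem x hx => obtain ⟨D, hD, rfl⟩ := hx; exact single D hD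
  | zero => exact zero
  | add x y _ _ hx hy => exact add x y hx hy
  | smul a x _ hx => exact smul a x hx

/-- A linear map sends combinations of diagrams in `s` into `N` if it does so on diagrams. -/
theorem map_mem_of_gen {V : Type*} [AddCommMonoid V] [Module ℚ V] {s : Set (Diagram L)}
    {N : Submodule ℚ V} {f : Comb L →ₗ[ℚ] V} (h : ∀ D ∈ s, f (gen D) ∈ N) {c : Comb L}
    (hc : c ∈ Finsupp.supported ℚ ℚ s) : f c ∈ N := by
  refine supported_induction (p := fun c => f c ∈ N) hc (by simp) ?_ ?_ h
  · intro x y hx hy; rw [map_add]; exact N.add_mem hx hy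
  · intro a x hx; rw [map_smul]; exact N.smul_mem a hx

theorem eq_of_gen {V : Type*} [AddCommMonoid V] [Module ℚ V] {s : Set (Diagram L)}
    {f g : Comb L →ₗ[ℚ] V} (h : ∀ D ∈ s, f (gen D) = g (gen D)) {c : Comb L}
    (hc : c ∈ Finsupp.supported ℚ ℚ s) : f c = g c := by
  refine supported_induction (p := fun c => f c = g c) hc (by simp) ?_ ?_ h
  · intro x y hx hy; rw [map_add, map_add, hx, hy]
  · intro a x hx; rw [map_smul, map_smul, hx]

theorem named_consL {s : Set ℕ} {x : L × ℕ} (hx : x.2 ∈ s) {c : Comb L} (hc : c ∈ named s) :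
    consL x c ∈ named s := by
  refine map_mem_of_gen (fun D hD => ?_) hc
  rw [consL_gen]
  refine gen_mem_supported.2 fun e he => ?_
  simp only [ends_mk, List.map_cons, Multiset.mem_add, Multiset.mem_coe, List.mem_cons] at he
  have := hD e
  simp only [Diagram.ends, Multiset.mem_add, Multiset.mem_coe] at this
  rcases he with (he | he) | rfl | he
  · exact this (Or.inl (Or.inl he))
  · exact this (Or.inl (Or.inr he))
  · exact hx
  · exact this (Or.inr he)

theorem named_addG {s : Set ℕ} {T K} (hT : ∀ t ∈ T, t.1 ∈ s ∧ t.2.1 ∈ s ∧ t.2.2 ∈ s)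
    (hK : ∀ k ∈ K, k.1 ∈ s ∧ k.2 ∈ s) {c : Comb L} (hc : c ∈ named s) :
    addG T K c ∈ named s := by
  refine map_mem_of_gen (fun D hD => ?_) hc
  rw [addG_gen]
  refine gen_mem_supported.2 fun e he => ?_
  have := hD e
  simp only [Multiset.add_bind, Diagram.ends, Multiset.mem_add, Multiset.mem_bind] at he this
  rcases he with ((⟨t, ht, he⟩ | he) | ⟨k, hk, he⟩ | he) | he
  · have := hT t ht
    simp only [Multiset.insert_eq_cons, Multiset.mem_cons, Multiset.mem_singleton] at he
    rcases he with rfl | rfl | rfl <;> tauto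
  · exact this (Or.inl (Or.inl he))
  · have := hK k hk
    simp only [Multiset.insert_eq_cons, Multiset.mem_cons, Multiset.mem_singleton] at he
    rcases he with rfl | rfl <;> tauto
  · exact this (Or.inl (Or.inr he))
  · exact this (Or.inr he)

theorem named_mono {s t : Set ℕ} (h : s ⊆ t) {c : Comb L} (hc : c ∈ named s) : c ∈ named t :=
  Finsupp.supported_mono (by intro D hD e he; exact h (hD e he)) hc

theorem named_ren {s t : Set ℕ} {f : ℕ → ℕ} (h : ∀ e ∈ s, f e ∈ t) {c : Comb L}
    (hc : c ∈ named s) : ren f c ∈ named t := by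
  refine map_mem_of_gen (fun D hD => ?_) hc
  rw [ren_gen]
  refine gen_mem_supported.2 fun e he => ?_
  rw [ends_rename] at he
  obtain ⟨a, ha, rfl⟩ := Multiset.mem_map.1 he
  exact h a (hD a ha)

theorem ren_congr {s : Set ℕ} {f g : ℕ → ℕ} (h : ∀ e ∈ s, f e = g e) {c : Comb L}
    (hc : c ∈ named s) : ren f c = ren g c := by
  refine eq_of_gen (fun D hD => ?_) hc
  rw [ren_gen, ren_gen]
  congr 1
  have hD' : ∀ e ∈ D.ends, f e = g e := fun e he => h e (hD e he)
  simp only [Diagram.ends, Multiset.mem_add, Multiset.mem_bind, Multiset.mem_coe, List.mem_map,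
    Multiset.insert_eq_cons, Multiset.mem_cons, Multiset.mem_singleton] at hD'
  unfold Diagram.rename
  congr 1
  · refine Multiset.map_congr rfl fun t ht => ?_
    rw [hD' t.1 (by grind), hD' t.2.1 (by grind), hD' t.2.2 (by grind)]
  · refine Multiset.map_congr rfl fun t ht => ?_
    rw [hD' t.1 (by grind), hD' t.2 (by grind)]
  · refine List.map_congr_left fun t ht => ?_
    rw [hD' t.2 (by grind)]

theorem ren_id (c : Comb L) : ren id c = c := by
  refine LinearMap.congr_fun (f := ren id) (g := LinearMap.id) (comb_ext fun D => ?_) c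
  simp [Diagram.rename]

theorem exists_perm_of_injOn {s : Set ℕ} (hs : s.Finite) {f : ℕ → ℕ} (hf : Set.InjOn f s) :
    ∃ σ : Equiv.Perm ℕ, ∀ n ∈ s, σ n = f n := by
  have : Finite s := hs
  obtain ⟨σ, hσ⟩ := Equiv.Perm.exists_extending_pair (fun x : s => (x : ℕ)) (fun x : s => f x)
    Subtype.val_injective (fun x y h => Subtype.ext (hf x.2 y.2 h))
  exact ⟨σ, fun n hn => hσ ⟨n, hn⟩⟩

/-! ### Presentations given by graph relations and conditions on the kinds of legs -/

/-- The graph relations hold, and whether a valid diagram is a generator depends on the sequence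
of kinds of its legs only. -/
structure GraphLike (P : Presentation L) : Prop where
  rel : ∀ r, GraphRel r → r ∈ P.rel
  valid : ∀ D ∈ P.adm, D.Valid
  adm : ∀ D E : Diagram L, D.legs.map Prod.fst = E.legs.map Prod.fst → E.Valid →
    D ∈ P.adm → E ∈ P.adm

theorem GraphLike.adm_congr {P : Presentation L} (hP : GraphLike P) {D E : Diagram L}
    (h : D.legs.map Prod.fst = E.legs.map Prod.fst) (hv : D.Valid ↔ E.Valid) :
    D ∈ P.adm ↔ E ∈ P.adm :=
  ⟨fun hD => hP.adm D E h (hv.1 (hP.valid D hD)) hD,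
    fun hE => hP.adm E D h.symm (hv.2 (hP.valid E hE)) hE⟩

theorem cls_gen_eq {P : Presentation L} {D E : Diagram L} (a : ℚ)
    (h : gen D - a • gen E ∈ P.rel) (hadm : D ∈ P.adm ↔ E ∈ P.adm) :
    P.cls (gen D) = a • P.cls (gen E) := by
  by_cases hD : D ∈ P.adm
  · have := cls_rel h (Submodule.sub_mem _ (gen_mem_supported.2 hD)
      (Submodule.smul_mem _ _ (gen_mem_supported.2 (hadm.1 hD))))
    rwa [map_sub, map_smul, sub_eq_zero] at this
  · rw [cls_gen_of_notMem hD, cls_gen_of_notMem fun h => hD (hadm.2 h), smul_zero]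

theorem GraphLike.cls_rename {P : Presentation L} (hP : GraphLike P) {f : ℕ → ℕ} {D : Diagram L}
    (hf : Set.InjOn f {e | e ∈ D.ends}) : P.cls (gen (D.rename f)) = P.cls (gen D) := by
  have hfin : {e | e ∈ D.ends}.Finite :=
    (D.ends.toFinset.finite_toSet).subset fun e he => by simpa using he
  obtain ⟨σ, hσ⟩ := exists_perm_of_injOn hfin hf
  have h1 : D.rename f = D.rename σ := by
    have := ren_congr (L := L) (s := {e | e ∈ D.ends}) (f := f) (g := σ)
      (fun e he => (hσ e he).symm) (c := gen D) (gen_mem_supported.2 fun e he => he)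
    rw [ren_gen, ren_gen] at this
    exact Finsupp.single_left_injective one_ne_zero this
  have h2 : D ∈ P.adm ↔ D.rename σ ∈ P.adm := by
    refine hP.adm_congr ?_ (valid_rename_iff σ.injective.injOn).symm
    simp [Diagram.rename, Function.comp_def]
  rw [h1]
  have := cls_gen_eq (P := P) (D := D) (E := D.rename σ) 1
    (by rw [one_smul]; exact hP.rel _ (.rename σ D)) h2
  rw [this, one_smul]

theorem GraphLike.cls_ren {P : Presentation L} (hP : GraphLike P) {s : Set ℕ} {f : ℕ → ℕ}
    (hf : Set.InjOn f s) {c : Comb L} (hc : c ∈ named s) : P.cls (ren f c) = P.cls c := by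
  refine eq_of_gen (f := P.cls ∘ₗ ren f) (fun D hD => ?_) hc
  rw [LinearMap.comp_apply, ren_gen]
  exact hP.cls_rename fun a ha b hb h => hf (hD a ha) (hD b hb) h

theorem mem_named_univ (c : Comb L) : c ∈ named Set.univ := fun _ _ _ _ => Set.mem_univ _

theorem GraphLike.cls_ren_inj {P : Presentation L} (hP : GraphLike P) {f : ℕ → ℕ}
    (hf : f.Injective) (c : Comb L) : P.cls (ren f c) = P.cls c :=
  hP.cls_ren hf.injOn (mem_named_univ c)

/-- A bivalent point may be smoothed by renaming one of its edges, if this edge has just one other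
end. -/
theorem GraphLike.cls_smooth {P : Presentation L} (hP : GraphLike P) {x y : ℕ} (hxy : x ≠ y)
    {D : Diagram L} (hy : D.ends.count y = 1) :
    P.cls (addG 0 {(x, y)} (gen D)) = P.cls (ren (fun n => if n = y then x else n) (gen D)) := by
  rw [addG_gen, ren_gen]
  have := cls_gen_eq (P := P) (D := ⟨D.tri, (x, y) ::ₘ D.link, D.legs⟩)
    (E := D.rename (fun n => if n = y then x else n)) 1 ?_ ?_
  · rw [one_smul] at this
    simpa using this
  · rw [one_smul]
    exact hP.rel _ (.smooth x y D.tri D.link D.legs hxy)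
  · refine hP.adm_congr ?_ ?_
    · simp [Diagram.rename, Function.comp_def]
    have e1 : Diagram.ends ⟨D.tri, (x, y) ::ₘ D.link, D.legs⟩ = {x, y} + D.ends := by
      simp only [Diagram.ends, Multiset.cons_bind]
      abel
    have e2 : ∀ n, (D.ends.map (fun n => if n = y then x else n)).count n =
        if n = y then 0 else if n = x then D.ends.count x + 1 else D.ends.count n := by
      intro n
      rw [← hy]
      generalize D.ends = m
      induction m using Multiset.induction_on with
      | empty => simp
      | cons a m ih =>
        simp only [Multiset.map_cons, Multiset.count_cons, ih]
        split_ifs <;> omega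
    unfold Diagram.Valid
    rw [ends_rename, e1]
    refine forall_congr' fun n => ?_
    rw [e2, Multiset.count_add]
    by_cases hn : n = y
    · subst hn; simp [hy, hxy, hxy.symm, Multiset.insert_eq_cons, Multiset.count_cons]
    by_cases hn' : n = x
    · subst hn'
      simp [hxy, hxy.symm, Multiset.insert_eq_cons, Multiset.count_cons,
        Multiset.count_singleton, add_comm]
    · simp [hn, hn', Multiset.insert_eq_cons, Multiset.count_cons, Multiset.count_singleton]

theorem GraphLike.cls_anti {P : Presentation L} (hP : GraphLike P) (x y z : ℕ) (c : Comb L) :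
    P.cls (addG {(x, y, z)} 0 c) = - P.cls (addG {(y, x, z)} 0 c) := by
  refine LinearMap.congr_fun (f := P.cls ∘ₗ addG {(x, y, z)} 0)
    (g := - P.cls ∘ₗ addG {(y, x, z)} 0) (comb_ext fun D => ?_) c
  have := cls_gen_eq (P := P) (D := ⟨(x, y, z) ::ₘ D.tri, D.link, D.legs⟩)
    (E := ⟨(y, x, z) ::ₘ D.tri, D.link, D.legs⟩) (-1) ?_ ?_
  · simpa using this
  · rw [neg_one_smul, sub_neg_eq_add]
    exact hP.rel _ (.anti x y z D.tri D.link D.legs)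
  · refine hP.adm_congr rfl ?_
    simp [Diagram.Valid, Diagram.ends, Multiset.cons_swap x y]

theorem GraphLike.cls_cyc {P : Presentation L} (hP : GraphLike P) (x y z : ℕ) (c : Comb L) :
    P.cls (addG {(x, y, z)} 0 c) = P.cls (addG {(y, z, x)} 0 c) := by
  refine LinearMap.congr_fun (f := P.cls ∘ₗ addG {(x, y, z)} 0)
    (g := P.cls ∘ₗ addG {(y, z, x)} 0) (comb_ext fun D => ?_) c
  have := cls_gen_eq (P := P) (D := ⟨(x, y, z) ::ₘ D.tri, D.link, D.legs⟩)
    (E := ⟨(y, z, x) ::ₘ D.tri, D.link, D.legs⟩) 1 ?_ ?_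
  · simpa using this
  · rw [one_smul]
    exact hP.rel _ (.cyc x y z D.tri D.link D.legs)
  · refine hP.adm_congr rfl ?_
    have : ({x, y, z} : Multiset ℕ) = {y, z, x} := by
      simp only [Multiset.insert_eq_cons, ← Multiset.singleton_add]; abel
    simp only [Diagram.Valid, ends_mk, Multiset.cons_bind, this]

theorem GraphLike.cls_ihx {P : Presentation L} (hP : GraphLike P) (x y z t e : ℕ) (c : Comb L) :
    P.cls (addG {(x, y, e), (e, z, t)} 0 c) + P.cls (addG {(y, z, e), (e, x, t)} 0 c)
      + P.cls (addG {(z, x, e), (e, y, t)} 0 c) = 0 := by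
  refine LinearMap.congr_fun (f := P.cls ∘ₗ addG {(x, y, e), (e, z, t)} 0 +
    P.cls ∘ₗ addG {(y, z, e), (e, x, t)} 0 + P.cls ∘ₗ addG {(z, x, e), (e, y, t)} 0)
    (g := 0) (comb_ext fun D => ?_) c
  have h := hP.rel _ (.ihx x y z t e D.tri D.link D.legs)
  have e1 : ({y, z, e} + {e, x, t} : Multiset ℕ) = {x, y, e} + {e, z, t} := by
    simp only [Multiset.insert_eq_cons, ← Multiset.singleton_add]; abel
  have e2 : ({z, x, e} + {e, y, t} : Multiset ℕ) = {x, y, e} + {e, z, t} := by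
    simp only [Multiset.insert_eq_cons, ← Multiset.singleton_add]; abel
  have h1 : (⟨(y, z, e) ::ₘ (e, x, t) ::ₘ D.tri, D.link, D.legs⟩ : Diagram L) ∈ P.adm ↔
      ⟨(x, y, e) ::ₘ (e, z, t) ::ₘ D.tri, D.link, D.legs⟩ ∈ P.adm := by
    refine hP.adm_congr rfl ?_
    simp only [Diagram.Valid, ends_mk, Multiset.cons_bind, ← add_assoc, e1]
  have h2 : (⟨(z, x, e) ::ₘ (e, y, t) ::ₘ D.tri, D.link, D.legs⟩ : Diagram L) ∈ P.adm ↔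
      ⟨(x, y, e) ::ₘ (e, z, t) ::ₘ D.tri, D.link, D.legs⟩ ∈ P.adm := by
    refine hP.adm_congr rfl ?_
    simp only [Diagram.Valid, ends_mk, Multiset.cons_bind, ← add_assoc, e2]
  simp only [LinearMap.add_apply, LinearMap.comp_apply, addG_gen, zero_add, LinearMap.zero_apply,
    Multiset.insert_eq_cons, Multiset.cons_add, Multiset.singleton_add]
  by_cases hD : (⟨(x, y, e) ::ₘ (e, z, t) ::ₘ D.tri, D.link, D.legs⟩ : Diagram L) ∈ P.adm
  · rw [← map_add, ← map_add]
    exact cls_rel h (Submodule.add_mem _ (Submodule.add_mem _ (gen_mem_supported.2 hD)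
      (gen_mem_supported.2 (h1.2 hD))) (gen_mem_supported.2 (h2.2 hD)))
  · rw [cls_gen_of_notMem hD, cls_gen_of_notMem fun h => hD (h1.1 h),
      cls_gen_of_notMem fun h => hD (h2.1 h)]
    simp

/-- A linear map which is natural with respect to renamings of edges, only changes the legs of
diagrams, and preserves validity, respects the relations between graphs. -/
theorem cls_graphRel {P : Presentation L} {Q : Presentation M} (hQ : GraphLike Q)
    (hP : ∀ D ∈ P.adm, D.Valid) {ρ : ℕ → ℕ}
    (hρ : ρ.Injective) {f : Comb L →ₗ[ℚ] Comb M}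
    (hren : ∀ g g' : ℕ → ℕ, (∀ n, g' (ρ n) = ρ (g n)) → (∀ m ∉ Set.range ρ, g' m = m) →
      ∀ c, f (ren g c) = ren g' (f c))
    (hadd : ∀ T K c, f (addG T K c) = addG (T.map fun t => (ρ t.1, ρ t.2.1, ρ t.2.2))
      (K.map fun k => (ρ k.1, ρ k.2)) (f c))
    (hval : ∀ D, D.Valid → f (gen D) ∈ Finsupp.supported ℚ ℚ {E | E.Valid})
    {r : Comb L} (hr : GraphRel r) (hs : r ∈ Finsupp.supported ℚ ℚ P.adm) :
    Q.cls (f r) = 0 := by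
  cases hr with
  | rename σ D =>
    have h := hren σ (σ.viaEmbedding ⟨ρ, hρ⟩) (fun n => Equiv.Perm.viaEmbedding_apply σ ⟨ρ, hρ⟩ n)
      (fun m hm => Equiv.Perm.viaEmbedding_apply_of_notMem σ ⟨ρ, hρ⟩ m hm) (gen D)
    rw [map_sub, map_sub, ← ren_gen, h, hQ.cls_ren_inj (Equiv.injective _), sub_self]
  | cyc x y z T K w =>
    have h1 := hadd {(x, y, z)} 0 (gen ⟨T, K, w⟩)
    have h2 := hadd {(y, z, x)} 0 (gen ⟨T, K, w⟩)
    simp only [addG_gen, zero_add, Multiset.singleton_add, Multiset.map_singleton,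
      Multiset.map_zero] at h1 h2
    rw [map_sub, map_sub, h1, h2, hQ.cls_cyc, sub_self]
  | anti x y z T K w =>
    have h1 := hadd {(x, y, z)} 0 (gen ⟨T, K, w⟩)
    have h2 := hadd {(y, x, z)} 0 (gen ⟨T, K, w⟩)
    simp only [addG_gen, zero_add, Multiset.singleton_add, Multiset.map_singleton,
      Multiset.map_zero] at h1 h2
    rw [map_add, map_add, h1, h2, hQ.cls_anti, neg_add_cancel]
  | ihx x y z t e T K w =>
    have h1 := hadd {(x, y, e), (e, z, t)} 0 (gen ⟨T, K, w⟩)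
    have h2 := hadd {(y, z, e), (e, x, t)} 0 (gen ⟨T, K, w⟩)
    have h3 := hadd {(z, x, e), (e, y, t)} 0 (gen ⟨T, K, w⟩)
    simp only [addG_gen, zero_add, Multiset.singleton_add, Multiset.map_singleton,
      Multiset.map_zero, Multiset.insert_eq_cons, Multiset.cons_add, Multiset.map_cons] at h1 h2 h3
    rw [map_add, map_add, map_add, map_add, h1, h2, h3]
    exact hQ.cls_ihx _ _ _ _ _ _
  | smooth x y T K w hxy =>
    have hA : (⟨T, (x, y) ::ₘ K, w⟩ : Diagram L).Valid := by
      refine hP _ (hs (Finsupp.mem_support_iff.2 ?_))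
      have hne : Diagram.rename (fun n => if n = y then x else n) ⟨T, K, w⟩ ≠
          ⟨T, (x, y) ::ₘ K, w⟩ := by
        intro h
        have := congrArg (fun D => Multiset.card D.link) h
        simp [Diagram.rename] at this
      rw [gen, gen, Finsupp.sub_apply, Finsupp.single_eq_same, Finsupp.single_eq_of_ne hne.symm]
      norm_num
    have h1 := hadd 0 {(x, y)} (gen ⟨T, K, w⟩)
    simp only [addG_gen, zero_add, Multiset.singleton_add, Multiset.map_singleton,
      Multiset.map_zero] at h1
    have h2 := hren (fun n => if n = y then x else n) (fun n => if n = ρ y then ρ x else n)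
      (fun n => by
        by_cases hn : n = y
        · simp [hn]
        · simp [hn, hρ.eq_iff])
      (fun m hm => if_neg fun h => hm ⟨y, h.symm⟩) (gen ⟨T, K, w⟩)
    rw [map_sub, map_sub, ← ren_gen, h1, h2, sub_eq_zero]
    have h3 := hval _ hA
    rw [h1] at h3
    have hinj : Function.Injective
        fun D : Diagram M => (⟨0 + D.tri, {(ρ x, ρ y)} + D.link, D.legs⟩ : Diagram M) := by
      intro D E h
      simpa [Diagram.ext_iff] using h
    have h4 : f (gen ⟨T, K, w⟩) ∈ Finsupp.supported ℚ ℚ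
        {D | (⟨0 + D.tri, {(ρ x, ρ y)} + D.link, D.legs⟩ : Diagram M).Valid} := by
      intro D hD
      refine h3 (Finsupp.mem_support_iff.2 ?_)
      have := Finsupp.mapDomain_apply hinj (f (gen ⟨T, K, w⟩)) D
      rw [addG, Finsupp.lmapDomain_apply, this]
      exact Finsupp.mem_support_iff.1 hD
    refine eq_of_gen (f := Q.cls ∘ₗ addG 0 {(ρ x, ρ y)})
      (g := Q.cls ∘ₗ ren fun n => if n = ρ y then ρ x else n) (fun D hD => ?_) h4
    refine hQ.cls_smooth (hρ.ne hxy) ?_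
    have h5 := hD (ρ y)
    have e1 : Diagram.ends ⟨0 + D.tri, {(ρ x, ρ y)} + D.link, D.legs⟩ = {ρ x, ρ y} + D.ends := by
      simp only [Diagram.ends, zero_add, Multiset.add_bind, Multiset.singleton_bind]
      abel
    rw [e1, Multiset.count_add] at h5
    have h6 : ρ y ≠ ρ x := hρ.ne hxy.symm
    simp only [Multiset.insert_eq_cons, Multiset.count_cons, Multiset.count_singleton, h6] at h5
    simp at h5
    omega

end Weil

namespace Weil

variable {L M : Type}

/-! ### Contractions and operators on Weil diagrams -/

/-- Combinations of diagrams with a given multiset of names of ends. -/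
def endsIn (m : Multiset ℕ) : Submodule ℚ (Comb L) :=
  Finsupp.supported ℚ ℚ {D | D.ends = m}

theorem gen_mem_endsIn (D : Diagram L) : gen D ∈ endsIn D.ends :=
  gen_mem_supported.2 rfl

theorem endsIn_consL {m : Multiset ℕ} {c : Comb L} (hc : c ∈ endsIn m) (x : L × ℕ) :
    consL x c ∈ endsIn (x.2 ::ₘ m) := by
  refine map_mem_of_gen (fun D (hD : D.ends = m) => ?_) hc
  rw [consL_gen]
  refine gen_mem_supported.2 ?_
  subst hD
  simp only [Set.mem_ofPred_eq, ends_mk, List.map_cons, ← Multiset.cons_coe, Diagram.ends,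
    ← Multiset.singleton_add]
  abel

theorem endsIn_addG {m : Multiset ℕ} {c : Comb L} (hc : c ∈ endsIn m) (T K) :
    addG T K c ∈ endsIn (T.bind (fun t => {t.1, t.2.1, t.2.2}) + K.bind (fun k => {k.1, k.2}) + m) := by
  refine map_mem_of_gen (fun D (hD : D.ends = m) => ?_) hc
  rw [addG_gen]
  refine gen_mem_supported.2 ?_
  subst hD
  simp only [Set.mem_ofPred_eq, ends_mk, Diagram.ends, Multiset.add_bind]
  abel

theorem endsIn_link {m : Multiset ℕ} {c : Comb L} (hc : c ∈ endsIn m) (x y : ℕ) :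
    addG 0 {(x, y)} c ∈ endsIn (x ::ₘ y ::ₘ m) := by
  have := endsIn_addG hc 0 {(x, y)}
  simpa [Multiset.insert_eq_cons, Multiset.cons_add] using this

theorem endsIn_named {m : Multiset ℕ} {s : Set ℕ} (h : ∀ e ∈ m, e ∈ s) {c : Comb L}
    (hc : c ∈ endsIn m) : c ∈ named s :=
  Finsupp.supported_mono (by rintro D rfl e he; exact h e he) hc

/-- A linear map which adds `e` to the names of ends preserves `named s` if `e ∈ s`. -/
theorem named_of_endsIn {s : Set ℕ} {f : Comb L →ₗ[ℚ] Comb M} {e : ℕ} (he : e ∈ s)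
    (hf : ∀ D, f (gen D) ∈ endsIn (e ::ₘ D.ends)) {c : Comb L} (hc : c ∈ named s) :
    f c ∈ named s := by
  refine map_mem_of_gen (fun D hD => endsIn_named (fun a ha => ?_) (hf D)) hc
  rcases Multiset.mem_cons.1 ha with rfl | ha
  · exact he
  · exact hD a ha

/-- The contraction of a list of legs with an end of the edge `e`; see `ctr`. -/
def ctrW (m : Leg → ℚ) (g e : ℕ) (T : Multiset (ℕ × ℕ × ℕ)) (K : Multiset (ℕ × ℕ)) :
    List (Leg × ℕ) → Comb Leg
  | [] => 0
  | y :: w => m y.1 • gen ⟨T, (e, y.2) ::ₘ K, w⟩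
      + (-1 : ℚ) ^ (g * y.1.grade) • consL y (ctrW m g e T K w)

/-- The graded derivation of parity `g` which glues an end of the edge `e` to the legs of kind `x`,
with coefficient `m x`. -/
def ctr (m : Leg → ℚ) (g e : ℕ) : Comb Leg →ₗ[ℚ] Comb Leg :=
  extend fun D => ctrW m g e D.tri D.link D.legs

@[simp] theorem ctr_nil (m g e T K) : ctr m g e (gen ⟨T, K, []⟩) = 0 := by
  simp [ctr, ctrW]

theorem ctr_consL (m g e) (y) (c : Comb Leg) : ctr m g e (consL y c) =
    m y.1 • addG 0 {(e, y.2)} c + (-1 : ℚ) ^ (g * y.1.grade) • consL y (ctr m g e c) := by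
  refine LinearMap.congr_fun (f := ctr m g e ∘ₗ consL y) (g := m y.1 • addG 0 {(e, y.2)} +
    (-1 : ℚ) ^ (g * y.1.grade) • consL y ∘ₗ ctr m g e) (comb_ext fun D => ?_) c
  simp [ctr, ctrW]

theorem ctr_addG (m g e T K) (c : Comb Leg) :
    ctr m g e (addG T K c) = addG T K (ctr m g e c) := by
  refine LinearMap.congr_fun (f := ctr m g e ∘ₗ addG T K) (g := addG T K ∘ₗ ctr m g e)
    (comb_ind (fun T' K' => by simp) fun x T' K' w ih => ?_) c
  have := ih T' K'
  simp only [LinearMap.comp_apply] at this ⊢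
  rw [← consL_addG, ctr_consL, ctr_consL, this]
  simp only [map_add, map_smul, consL_addG, addG_comm T K 0]

theorem ctr_ren (m g e) (f : ℕ → ℕ) (c : Comb Leg) :
    ctr m g (f e) (ren f c) = ren f (ctr m g e c) := by
  refine LinearMap.congr_fun (f := ctr m g (f e) ∘ₗ ren f) (g := ren f ∘ₗ ctr m g e)
    (comb_ind (fun T' K' => by simp [Diagram.rename]) fun x T' K' w ih => ?_) c
  have := ih T' K'
  simp only [LinearMap.comp_apply] at this ⊢
  rw [ren_consL, ctr_consL, ctr_consL, this]
  simp only [map_add, map_smul, ren_consL, ren_addG, Multiset.map_zero, Multiset.map_singleton]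

theorem ctr_endsIn (m g e) (D : Diagram Leg) : ctr m g e (gen D) ∈ endsIn (e ::ₘ D.ends) := by
  obtain ⟨T, K, w⟩ := D
  induction w generalizing T K with
  | nil => simp
  | cons y w ih =>
    have := ctr_consL m g e y (gen ⟨T, K, w⟩)
    rw [consL_gen] at this
    rw [this]
    have h := endsIn_consL (gen_mem_endsIn (⟨T, K, w⟩ : Diagram Leg)) y
    have e1 : Diagram.ends ⟨T, K, y :: w⟩ = y.2 ::ₘ Diagram.ends ⟨T, K, w⟩ := by
      simp only [ends_mk, List.map_cons, ← Multiset.cons_coe, ← Multiset.singleton_add]; abel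
    rw [e1]
    refine Submodule.add_mem _ (Submodule.smul_mem _ _ ?_) (Submodule.smul_mem _ _ ?_)
    · exact endsIn_link (gen_mem_endsIn _) e y.2
    · rw [Multiset.cons_swap]
      exact endsIn_consL (ih T K) y

theorem ctr_named {s : Set ℕ} {e : ℕ} (he : e ∈ s) (m g) {c : Comb Leg} (hc : c ∈ named s) :
    ctr m g e c ∈ named s := named_of_endsIn he (ctr_endsIn m g e) hc

theorem neg_one_pow_mul_self (n : ℕ) : ((-1 : ℚ) ^ n) * (-1) ^ n = 1 := by
  rw [← mul_pow]; simp

/-- The contraction `ctr m g` is homogeneous: it involves only legs whose grade has the same parity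
as `g`. -/
def Homog (m : Leg → ℚ) (g : ℕ) : Prop := ∀ y n, m y ≠ 0 → (-1 : ℚ) ^ (g * n) = (-1) ^ (y.grade * n)

theorem ctr_ctr {m m' : Leg → ℚ} {g g' : ℕ} (h : Homog m g) (h' : Homog m' g') (e e' : ℕ)
    (c : Comb Leg) : ctr m g e (ctr m' g' e' c) =
      (-1 : ℚ) ^ (g * g') • ctr m' g' e' (ctr m g e c) := by
  refine LinearMap.congr_fun (f := ctr m g e ∘ₗ ctr m' g' e')
    (g := (-1 : ℚ) ^ (g * g') • ctr m' g' e' ∘ₗ ctr m g e)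
    (comb_ind (fun T' K' => by simp) fun y T' K' w ih => ?_) c
  have := ih T' K'
  simp only [LinearMap.comp_apply, LinearMap.smul_apply] at this ⊢
  simp only [ctr_consL, map_add, map_smul, ctr_addG, smul_add, smul_smul, this]
  have h1 : m y.1 * (-1 : ℚ) ^ (g' * y.1.grade) = (-1 : ℚ) ^ (g * g') * m y.1 := by
    by_cases hm : m y.1 = 0
    · simp [hm]
    · rw [h _ _ hm, mul_comm g' y.1.grade]; ring
  have h2 : m' y.1 = (-1 : ℚ) ^ (g * g') * ((-1) ^ (g * y.1.grade) * m' y.1) := by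
    by_cases hm : m' y.1 = 0
    · simp [hm]
    · rw [mul_comm g y.1.grade, ← h' _ _ hm, mul_comm g g', ← mul_assoc, neg_one_pow_mul_self,
        one_mul]
  rw [mul_comm _ (m y.1), h1, h2]
  simp only [← h2]
  module

/-- Push an operator leg through a list of legs; see `pushC`. -/
def pushW (k : ℚ) (o : Leg × ℕ) (T : Multiset (ℕ × ℕ × ℕ)) (K : Multiset (ℕ × ℕ)) :
    List (Leg × ℕ) → Comb Leg
  | [] => gen ⟨T, K, [o]⟩
  | y :: w => if y.1.isOp then gen ⟨T, K, o :: y :: w⟩ else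
      sgn o.1 y.1 • consL y (pushW k o T K w)
        + (if matchesParam o.1 y.1 then k else 0) • gen ⟨T, (o.2, y.2) ::ₘ K, w⟩

/-- Push an operator leg to the group of operator legs, the gluings to parameter legs being counted
with coefficient `k`. The case `k = 1` is `push`, and for `k = 0` the operator does not act. -/
def pushC (k : ℚ) (o : Leg × ℕ) : Comb Leg →ₗ[ℚ] Comb Leg :=
  extend fun D => pushW k o D.tri D.link D.legs

@[simp] theorem pushC_nil (k o T K) : pushC k o (gen ⟨T, K, []⟩) = gen ⟨T, K, [o]⟩ := by
  simp [pushC, pushW]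

theorem pushC_consL_op (k o) {y : Leg × ℕ} (hy : y.1.isOp) (c : Comb Leg) :
    pushC k o (consL y c) = consL o (consL y c) := by
  refine LinearMap.congr_fun (f := pushC k o ∘ₗ consL y) (g := consL o ∘ₗ consL y)
    (comb_ext fun D => ?_) c
  simp [pushC, pushW, hy]

theorem pushC_consL (k o) {y : Leg × ℕ} (hy : y.1.isOp = false) (c : Comb Leg) :
    pushC k o (consL y c) = sgn o.1 y.1 • consL y (pushC k o c)
      + (if matchesParam o.1 y.1 then k else 0) • addG 0 {(o.2, y.2)} c := by
  refine LinearMap.congr_fun (f := pushC k o ∘ₗ consL y) (g := sgn o.1 y.1 • consL y ∘ₗ pushC k o +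
    (if matchesParam o.1 y.1 then k else 0) • addG 0 {(o.2, y.2)}) (comb_ext fun D => ?_) c
  simp only [pushC, pushW, hy, LinearMap.comp_apply, LinearMap.add_apply, LinearMap.smul_apply,
    consL_gen, extend_gen, addG_gen]
  simp

theorem pushC_addG (k o T K) (c : Comb Leg) :
    pushC k o (addG T K c) = addG T K (pushC k o c) := by
  refine LinearMap.congr_fun (f := pushC k o ∘ₗ addG T K) (g := addG T K ∘ₗ pushC k o)
    (comb_ind (fun T' K' => by simp) fun x T' K' w ih => ?_) c
  have := ih T' K'
  simp only [LinearMap.comp_apply] at this ⊢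
  rw [← consL_addG]
  cases hx : x.1.isOp
  · rw [pushC_consL _ _ hx, pushC_consL _ _ hx, this]
    simp only [map_add, map_smul, consL_addG, addG_comm T K 0]
  · rw [pushC_consL_op _ _ hx, pushC_consL_op _ _ hx, consL_addG, consL_addG]

theorem pushC_ren (k) (o : Leg × ℕ) (f : ℕ → ℕ) (c : Comb Leg) :
    pushC k (o.1, f o.2) (ren f c) = ren f (pushC k o c) := by
  refine LinearMap.congr_fun (f := pushC k (o.1, f o.2) ∘ₗ ren f) (g := ren f ∘ₗ pushC k o)
    (comb_ind (fun T' K' => by simp [Diagram.rename]) fun x T' K' w ih => ?_) c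
  have := ih T' K'
  simp only [LinearMap.comp_apply] at this ⊢
  rw [ren_consL]
  cases hx : x.1.isOp
  · rw [pushC_consL _ _ (y := (x.1, f x.2)) hx, pushC_consL _ _ hx, this]
    simp only [map_add, map_smul, ren_consL, ren_addG, Multiset.map_zero, Multiset.map_singleton]
  · rw [pushC_consL_op _ _ (y := (x.1, f x.2)) hx, pushC_consL_op _ _ hx, ren_consL, ren_consL]

theorem pushC_endsIn (k o) (D : Diagram Leg) :
    pushC k o (gen D) ∈ endsIn (o.2 ::ₘ D.ends) := by
  obtain ⟨T, K, w⟩ := D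
  induction w generalizing T K with
  | nil =>
    rw [pushC_nil, ← consL_gen o ⟨T, K, []⟩]
    exact endsIn_consL (gen_mem_endsIn _) o
  | cons y w ih =>
    have h := endsIn_consL (gen_mem_endsIn (⟨T, K, w⟩ : Diagram Leg)) y
    have e1 : Diagram.ends ⟨T, K, y :: w⟩ = y.2 ::ₘ Diagram.ends ⟨T, K, w⟩ := by
      simp only [ends_mk, List.map_cons, ← Multiset.cons_coe, ← Multiset.singleton_add]; abel
    rw [e1, ← consL_gen y ⟨T, K, w⟩]
    cases hy : y.1.isOp
    · rw [pushC_consL _ _ hy]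
      refine Submodule.add_mem _ (Submodule.smul_mem _ _ ?_) (Submodule.smul_mem _ _ ?_)
      · rw [Multiset.cons_swap]
        exact endsIn_consL (ih T K) y
      · exact endsIn_link (gen_mem_endsIn _) o.2 y.2
    · rw [pushC_consL_op _ _ hy]
      exact endsIn_consL h o

theorem pushC_named {s : Set ℕ} {o : Leg × ℕ} (ho : o.2 ∈ s) (k) {c : Comb Leg}
    (hc : c ∈ named s) : pushC k o c ∈ named s := named_of_endsIn ho (pushC_endsIn k o) hc

/-- The action of a leg from the left. -/
def act (k : ℚ) (x : Leg × ℕ) : Comb Leg →ₗ[ℚ] Comb Leg :=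
  if x.1.isOp then pushC k x else consL x

/-- The action of a list of legs from the left. -/
def actW (k : ℚ) : List (Leg × ℕ) → Comb Leg →ₗ[ℚ] Comb Leg
  | [] => LinearMap.id
  | x :: w => act k x ∘ₗ actW k w

theorem actW_append (k) (u v : List (Leg × ℕ)) : actW k (u ++ v) = actW k u ∘ₗ actW k v := by
  induction u with
  | nil => rfl
  | cons x u ih => simp [actW, ih, LinearMap.comp_assoc]

theorem act_addG (k x T K) (c : Comb Leg) : act k x (addG T K c) = addG T K (act k x c) := by
  unfold act; split_ifs
  · exact pushC_addG ..
  · exact consL_addG ..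

theorem actW_addG (k w T K) (c : Comb Leg) : actW k w (addG T K c) = addG T K (actW k w c) := by
  induction w with
  | nil => rfl
  | cons x w ih => simp [actW, ih, act_addG]

theorem act_ren (k) (x : Leg × ℕ) (f : ℕ → ℕ) (c : Comb Leg) :
    act k (x.1, f x.2) (ren f c) = ren f (act k x c) := by
  unfold act; simp only; split_ifs
  · exact pushC_ren ..
  · exact (ren_consL ..).symm

theorem actW_ren (k) (w : List (Leg × ℕ)) (f : ℕ → ℕ) (c : Comb Leg) :
    actW k (w.map fun x => (x.1, f x.2)) (ren f c) = ren f (actW k w c) := by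
  induction w with
  | nil => rfl
  | cons x w ih => simp [actW, ih, act_ren]

/-- The action of diagrams from the left; names of edges are not changed. -/
def actC (k : ℚ) : Comb Leg →ₗ[ℚ] Comb Leg →ₗ[ℚ] Comb Leg :=
  Finsupp.linearCombination ℚ fun D => addG D.tri D.link ∘ₗ actW k D.legs

@[simp] theorem actC_gen (k) (D : Diagram Leg) :
    actC k (gen D) = addG D.tri D.link ∘ₗ actW k D.legs := by
  simp [actC, gen]

theorem actC_consL (k x) (c d : Comb Leg) : actC k (consL x c) d = act k x (actC k c d) := by
  refine LinearMap.congr_fun (f := (actC k).flip d ∘ₗ consL x) (g := act k x ∘ₗ (actC k).flip d)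
    (comb_ext fun D => ?_) c
  simp [actW, act_addG]

theorem actC_addG (k T K) (c d : Comb Leg) : actC k (addG T K c) d = addG T K (actC k c d) := by
  refine LinearMap.congr_fun (f := (actC k).flip d ∘ₗ addG T K) (g := addG T K ∘ₗ (actC k).flip d)
    (comb_ext fun D => ?_) c
  simp [addG_addG]

theorem actC_addG_right (k T K) (c d : Comb Leg) :
    actC k c (addG T K d) = addG T K (actC k c d) := by
  refine LinearMap.congr_fun (f := (actC k).flip (addG T K d)) (g := addG T K ∘ₗ (actC k).flip d)
    (comb_ext fun D => ?_) c
  simp [actW_addG, addG_comm T K]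

theorem actC_ren (k) (f : ℕ → ℕ) (c d : Comb Leg) :
    actC k (ren f c) (ren f d) = ren f (actC k c d) := by
  refine LinearMap.congr_fun (f := (actC k).flip (ren f d) ∘ₗ ren f)
    (g := ren f ∘ₗ (actC k).flip d) (comb_ext fun D => ?_) c
  simp [Diagram.rename, actW_ren, ren_addG]

theorem actC_pushC (k) {o : Leg × ℕ} (ho : o.1.isOp) (c d : Comb Leg) :
    actC k (pushC k o c) d = pushC k o (actC k c d) := by
  refine LinearMap.congr_fun (f := (actC k).flip d ∘ₗ pushC k o)
    (g := pushC k o ∘ₗ (actC k).flip d)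
    (comb_ind (fun T K => ?_) fun x T K w ih => ?_) c
  · simp [actW, pushC_addG, act, ho]
  · have := ih T K
    simp only [LinearMap.comp_apply, LinearMap.flip_apply] at this ⊢
    rw [actC_consL]
    cases hx : x.1.isOp
    · rw [pushC_consL _ _ hx, map_add, LinearMap.add_apply, map_smul, map_smul, LinearMap.smul_apply,
        LinearMap.smul_apply, actC_consL, actC_addG, this]
      simp only [act, hx, Bool.false_eq_true, if_false]
      rw [pushC_consL _ _ hx]
    · rw [pushC_consL_op _ _ hx, actC_consL, actC_consL]
      simp [act, ho]

theorem actC_act (k x) (c d : Comb Leg) : actC k (act k x c) d = act k x (actC k c d) := by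
  cases hx : x.1.isOp
  · simp [act, hx, actC_consL]
  · have := actC_pushC k hx c d
    simpa [act, hx] using this

/-- The product of diagrams is associative. -/
theorem actC_assoc (k) (c d e : Comb Leg) : actC k (actC k c d) e = actC k c (actC k d e) := by
  refine LinearMap.congr_fun (f := (actC k).flip e ∘ₗ (actC k).flip d)
    (g := (actC k).flip (actC k d e)) (comb_ext fun D => ?_) c
  obtain ⟨T, K, w⟩ := D
  simp only [LinearMap.comp_apply, LinearMap.flip_apply, actC_gen, actC_addG]
  congr 1
  induction w with
  | nil => rfl
  | cons x w ih => simp only [actW, LinearMap.comp_apply, actC_act, ih]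

theorem act_endsIn (k x) (D : Diagram Leg) : act k x (gen D) ∈ endsIn (x.2 ::ₘ D.ends) := by
  unfold act; split_ifs
  · exact pushC_endsIn ..
  · exact endsIn_consL (gen_mem_endsIn _) x

theorem act_endsIn' (k x) {m : Multiset ℕ} {c : Comb Leg} (hc : c ∈ endsIn m) :
    act k x c ∈ endsIn (x.2 ::ₘ m) :=
  map_mem_of_gen (by rintro D rfl; exact act_endsIn k x D) hc

theorem actC_endsIn (k) (D : Diagram Leg) {m : Multiset ℕ} {c : Comb Leg} (hc : c ∈ endsIn m) :
    actC k (gen D) c ∈ endsIn (D.ends + m) := by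
  obtain ⟨T, K, w⟩ := D
  have : actW k w c ∈ endsIn (((w.map Prod.snd : List ℕ) : Multiset ℕ) + m) := by
    induction w with
    | nil => simpa [actW] using hc
    | cons x w ih =>
      have := act_endsIn' k x ih
      simpa only [actW, LinearMap.comp_apply, List.map_cons, ← Multiset.cons_coe,
        Multiset.cons_add] using this
  have := endsIn_addG this T K
  simpa [Diagram.ends, add_assoc] using this

end Weil

namespace Weil

variable {L M : Type}

/-! ### The spaces of operator Weil diagrams -/

/-- The kinds of legs that may be transposed in the spaces of operator Weil diagrams, apart from two
legs of grade 1. -/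
def SwapOK (p q : Leg) : Prop :=
  (p = .two ∧ q = .one) ∨ (∃ x, p = .par x) ∨ (∃ y, q = .par y) ∨
    ((∃ x, p = .op x) ∧ ∃ y, q = .op y)

/-- The relations on legs, the anticommutator of two legs of grade 1 being `q` times the diagram in
which they are joined. -/
inductive LegRel (q : ℚ) : Comb Leg → Prop
  | stu (T K u v) (x y z : ℕ) : LegRel q (gen ⟨T, K, u ++ (.two, x) :: (.two, y) :: v⟩
      - gen ⟨T, K, u ++ (.two, y) :: (.two, x) :: v⟩
      - gen ⟨(x, z, y) ::ₘ T, K, u ++ (.two, z) :: v⟩)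
  | swap (T K u v) (p p' : Leg) (x y : ℕ) (h : SwapOK p p') :
      LegRel q (gen ⟨T, K, u ++ (p, x) :: (p', y) :: v⟩
        - sgn p p' • gen ⟨T, K, u ++ (p', y) :: (p, x) :: v⟩)
  | cliff (T K u v) (x y : ℕ) : LegRel q (gen ⟨T, K, u ++ (.one, x) :: (.one, y) :: v⟩
      + gen ⟨T, K, u ++ (.one, y) :: (.one, x) :: v⟩ - q • gen ⟨T, (x, y) ::ₘ K, u ++ v⟩)

/-- The common generalization of `spF` (the case `q = 1`) and `spWedge` (the case `q = 0`). -/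
def sp (q : ℚ) (t : ℕ × ℕ) : Presentation Leg where
  adm := opDiagrams t
  rel := {r | GraphRel r ∨ LegRel q r}

/-- The presentations of the spaces with curvature legs are those with the coefficient 1 in the
Clifford relation. -/
theorem spF_eq (t) : spF t = sp 1 t := by
  unfold spF sp
  congr 1
  ext r
  constructor
  · rintro ((((h | h) | h) | h) | h)
    · exact Or.inl h
    · obtain ⟨T, K, u, v, x, y, z, rfl⟩ := h
      exact Or.inr (.stu T K u v x y z)
    · obtain ⟨T, K, u, v, p, q, x, y, h, rfl⟩ := h
      exact Or.inr (.swap T K u v p q x y (Or.inl h))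
    · obtain ⟨T, K, u, v, x, y, rfl⟩ := h
      have := LegRel.cliff (q := 1) T K u v x y
      rw [one_smul] at this
      exact Or.inr this
    · obtain ⟨T, K, u, v, p, q, x, y, h, rfl⟩ := h
      exact Or.inr (.swap T K u v p q x y (Or.inr h))
  · rintro (h | h)
    · exact Or.inl (Or.inl (Or.inl (Or.inl h)))
    · cases h with
      | stu T K u v x y z => exact Or.inl (Or.inl (Or.inl (Or.inr ⟨T, K, u, v, x, y, z, rfl⟩)))
      | swap T K u v p p' x y h =>
        rcases h with h | h
        · exact Or.inl (Or.inl (Or.inr ⟨T, K, u, v, p, p', x, y, h, rfl⟩))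
        · exact Or.inr ⟨T, K, u, v, p, p', x, y, h, rfl⟩
      | cliff T K u v x y => exact Or.inl (Or.inr ⟨T, K, u, v, x, y, by rw [one_smul]⟩)

/-- The presentations of the exterior spaces are those with the coefficient 0 in the Clifford
relation. -/
theorem spWedge_eq (t) : spWedge t = sp 0 t := by
  unfold spWedge sp
  congr 1
  ext r
  constructor
  · rintro ((((h | h) | h) | h) | h)
    · exact Or.inl h
    · obtain ⟨T, K, u, v, x, y, z, rfl⟩ := h
      exact Or.inr (.stu T K u v x y z)
    · obtain ⟨T, K, u, v, p, q, x, y, h, rfl⟩ := h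
      exact Or.inr (.swap T K u v p q x y (Or.inl h))
    · obtain ⟨T, K, u, v, p, q, x, y, ⟨rfl, rfl⟩, rfl⟩ := h
      have := LegRel.cliff (q := 0) T K u v x y
      refine Or.inr ?_
      convert this using 1
      simp [sgn, Leg.grade]
    · obtain ⟨T, K, u, v, p, q, x, y, h, rfl⟩ := h
      exact Or.inr (.swap T K u v p q x y (Or.inr h))
  · rintro (h | h)
    · exact Or.inl (Or.inl (Or.inl (Or.inl h)))
    · cases h with
      | stu T K u v x y z => exact Or.inl (Or.inl (Or.inl (Or.inr ⟨T, K, u, v, x, y, z, rfl⟩)))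
      | swap T K u v p p' x y h =>
        rcases h with h | h
        · exact Or.inl (Or.inl (Or.inr ⟨T, K, u, v, p, p', x, y, h, rfl⟩))
        · exact Or.inr ⟨T, K, u, v, p, p', x, y, h, rfl⟩
      | cliff T K u v x y =>
        refine Or.inl (Or.inr ⟨T, K, u, v, .one, .one, x, y, ⟨rfl, rfl⟩, ?_⟩)
        simp [sgn, Leg.grade]

/-- The operator legs are at the far right. -/
def Normal (w : List (Leg × ℕ)) : Prop := w.Pairwise fun x y => x.1.isOp → y.1.isOp

theorem normal_cons_of_not_op {x : Leg × ℕ} (hx : x.1.isOp = false) {w} :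
    Normal (x :: w) ↔ Normal w := by
  simp [Normal, List.pairwise_cons, hx]

theorem normal_cons_of_op {x : Leg × ℕ} (hx : x.1.isOp) {w} :
    Normal (x :: w) ↔ ∀ y ∈ w, y.1.isOp := by
  simp only [Normal, List.pairwise_cons, hx, forall_const]
  refine ⟨fun h => h.1, fun h => ⟨h, ?_⟩⟩
  exact List.pairwise_of_forall_mem_list fun a _ b hb _ => h b hb

theorem normal_iff (w : List (Leg × ℕ)) : w = body w ++ ops w ↔ Normal w := by
  induction w with
  | nil => simp [Normal, body, ops]
  | cons x w ih =>
    cases hx : x.1.isOp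
    · rw [normal_cons_of_not_op hx, ← ih]
      simp [body, ops, hx]
    · rw [normal_cons_of_op hx]
      constructor
      · intro h
        have hb : body (x :: w) = [] := by
          cases hb : body (x :: w) with
          | nil => rfl
          | cons z t =>
            rw [hb] at h
            have h1 : x = z := by simpa using congrArg List.head? h
            have h2 : z ∈ body (x :: w) := by simp [hb]
            simp [body, ← h1, hx] at h2
        intro y hy
        by_contra hy'
        have : y ∈ body (x :: w) := by
          simp only [body, List.mem_filter, List.mem_cons]
          exact ⟨Or.inr hy, by simpa using hy'⟩
        simp [hb] at this
      · intro h
        have h1 : body (x :: w) = [] := by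
          simp only [body, List.filter_eq_nil_iff]
          intro y hy
          rcases List.mem_cons.1 hy with rfl | hy
          · simp [hx]
          · simp [h y hy]
        have h2 : ops (x :: w) = x :: w := by
          simp only [ops, List.filter_eq_self]
          intro y hy
          rcases List.mem_cons.1 hy with rfl | hy
          · exact hx
          · exact h y hy
        rw [h1, h2, List.nil_append]

theorem mem_opDiagrams {t : ℕ × ℕ} {D : Diagram Leg} : D ∈ opDiagrams t ↔ D.Valid ∧
    Normal D.legs ∧ (D.legs.map (fun x => x.1.parGrade)).sum = t.1 ∧
      (D.legs.map (fun x => x.1.opGrade)).sum = t.2 := by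
  rw [← normal_iff]; rfl

theorem normal_congr {w w' : List (Leg × ℕ)} (h : w.map Prod.fst = w'.map Prod.fst) :
    Normal w ↔ Normal w' := by
  have : ∀ v : List (Leg × ℕ), Normal v ↔
      (v.map Prod.fst).Pairwise fun x y => x.isOp → y.isOp := fun v => by
    rw [List.pairwise_map]; rfl
  rw [this, this, h]

theorem opDiagrams_congr {t : ℕ × ℕ} {D E : Diagram Leg}
    (h : D.legs.map Prod.fst = E.legs.map Prod.fst) (hE : E.Valid) (hD : D ∈ opDiagrams t) :
    E ∈ opDiagrams t := by
  rw [mem_opDiagrams] at hD ⊢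
  obtain ⟨-, h2, h3, h4⟩ := hD
  have e1 : ∀ (f : Leg → ℕ), D.legs.map (fun x => f x.1) = E.legs.map (fun x => f x.1) := by
    intro f
    have := congrArg (List.map f) h
    simpa [Function.comp_def] using this
  exact ⟨hE, (normal_congr h).1 h2, by rw [← e1]; exact h3, by rw [← e1]; exact h4⟩

theorem graphLike_sp (q t) : GraphLike (sp q t) where
  rel _ h := Or.inl h
  valid _ hD := hD.1
  adm _ _ h hE hD := opDiagrams_congr h hE hD

/-! ### The relations on legs, locally -/

/-- Add a list of legs at the far left. -/
def consW (u : List (L × ℕ)) : Comb L →ₗ[ℚ] Comb L :=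
  Finsupp.lmapDomain ℚ ℚ fun D => ⟨D.tri, D.link, u ++ D.legs⟩

@[simp] theorem consW_gen (u) (D : Diagram L) :
    consW u (gen D) = gen ⟨D.tri, D.link, u ++ D.legs⟩ := by
  simp [consW, gen]

@[simp] theorem consW_nil (c : Comb L) : consW [] c = c := by
  refine LinearMap.congr_fun (f := consW []) (g := LinearMap.id) (comb_ext fun D => ?_) c
  simp

theorem consW_cons (x u) (c : Comb L) : consW (x :: u) c = consL x (consW u c) := by
  refine LinearMap.congr_fun (f := consW (x :: u)) (g := consL x ∘ₗ consW u)
    (comb_ext fun D => ?_) c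
  simp

theorem consW_append (u v) (c : Comb L) : consW (u ++ v) c = consW u (consW v c) := by
  induction u with
  | nil => simp
  | cons x u ih => simp [consW_cons, ih]

theorem consW_addG (u T K) (c : Comb L) : consW u (addG T K c) = addG T K (consW u c) := by
  induction u with
  | nil => simp
  | cons x u ih => rw [consW_cons, consW_cons, ih, consL_addG]

theorem ren_consW (f : ℕ → ℕ) (u) (c : Comb L) :
    ren f (consW u c) = consW (u.map fun x => (x.1, f x.2)) (ren f c) := by
  induction u with
  | nil => simp
  | cons x u ih => rw [consW_cons, ren_consL, ih, List.map_cons, consW_cons]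

/-- The left hand side of the STU relation for two curvature legs, with new edge `z`. -/
def stuHead (z x y : ℕ) : Comb Leg →ₗ[ℚ] Comb Leg :=
  consL (.two, x) ∘ₗ consL (.two, y) - consL (.two, y) ∘ₗ consL (.two, x)
    - addG {(x, z, y)} 0 ∘ₗ consL (.two, z)

/-- The left hand side of the relation which transposes two legs. -/
def swapHead (a b : Leg × ℕ) : Comb Leg →ₗ[ℚ] Comb Leg :=
  consL a ∘ₗ consL b - sgn a.1 b.1 • consL b ∘ₗ consL a

/-- The left hand side of the Clifford relation. -/
def cliffHead (q : ℚ) (x y : ℕ) : Comb Leg →ₗ[ℚ] Comb Leg :=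
  consL (.one, x) ∘ₗ consL (.one, y) + consL (.one, y) ∘ₗ consL (.one, x) - q • addG 0 {(x, y)}

/-- Instances of the relation between operator legs. -/
inductive OpRel : Comb Leg → Prop
  | mk (u : List (Leg × ℕ)) (a b : Leg × ℕ) (c : Comb Leg)
      (ha : a.1.isOp) (hb : b.1.isOp) : OpRel (consW u (swapHead a b c))

/-- Instances of the relations on legs, with arbitrary combinations of diagrams to the right of
the legs concerned. The edge `z` plays the role of the new edge of all STU relations and is used
nowhere else in these. The relations between non-operator legs are to the left of all operator
legs. -/
inductive LocRel (q : ℚ) (z : ℕ) : Comb Leg → Prop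
  | stu (u : List (Leg × ℕ)) (x y : ℕ) (c : Comb Leg) (hu : ∀ a ∈ u, a.1.isOp = false)
      (hu' : ∀ a ∈ u, a.2 ≠ z) (hx : x ≠ z) (hy : y ≠ z) (hc : c ∈ named {z}ᶜ) :
      LocRel q z (consW u (stuHead z x y c))
  | swap (u : List (Leg × ℕ)) (a b : Leg × ℕ) (c : Comb Leg) (hu : ∀ a ∈ u, a.1.isOp = false)
      (hu' : ∀ a ∈ u, a.2 ≠ z)
      (ha : a.1.isOp = false) (hb : b.1.isOp = false) (h : SwapOK a.1 b.1) :
      LocRel q z (consW u (swapHead a b c))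
  | cliff (u : List (Leg × ℕ)) (x y : ℕ) (c : Comb Leg) (hu : ∀ a ∈ u, a.1.isOp = false)
      (hu' : ∀ a ∈ u, a.2 ≠ z) : LocRel q z (consW u (cliffHead q x y c))
  | op (c : Comb Leg) (h : OpRel c) : LocRel q z c

/-- The span of the relations on legs. -/
def locN (q : ℚ) (z : ℕ) : Submodule ℚ (Comb Leg) := Submodule.span ℚ {r | LocRel q z r}

/-- The span of the relations between operator legs. -/
def opN : Submodule ℚ (Comb Leg) := Submodule.span ℚ {r | OpRel r}

theorem span_map {R : Comb Leg → Prop} {V : Type*} [AddCommMonoid V] [Module ℚ V]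
    {f : Comb Leg →ₗ[ℚ] V} {N : Submodule ℚ V} (h : ∀ r, R r → f r ∈ N) {c : Comb Leg}
    (hc : c ∈ Submodule.span ℚ {r | R r}) : f c ∈ N := by
  have : Submodule.span ℚ {r | R r} ≤ N.comap f := Submodule.span_le.2 fun r hr => h r hr
  exact this hc

theorem locN_of {q z r} (h : LocRel q z r) : r ∈ locN q z := Submodule.subset_span h

theorem opN_of {r} (h : OpRel r) : r ∈ opN := Submodule.subset_span h

theorem opN_le (q z) : opN ≤ locN q z :=
  Submodule.span_le.2 fun r hr => locN_of (.op r hr)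

theorem opN_consL (x : Leg × ℕ) {c : Comb Leg}
    (hc : c ∈ opN) : consL x c ∈ opN := by
  refine span_map (fun r hr => opN_of ?_) hc
  obtain ⟨u, a, b, c, ha, hb⟩ := hr
  rw [← consW_cons]
  exact .mk _ _ _ _ ha hb

theorem locN_consL {q z} {x : Leg × ℕ} (hx : x.1.isOp = false) (hx' : x.2 ≠ z) {c : Comb Leg}
    (hc : c ∈ locN q z) : consL x c ∈ locN q z := by
  refine span_map (fun r hr => ?_) hc
  cases hr with
  | stu u a b c hu hu' ha hb hc =>
    rw [← consW_cons]
    exact locN_of (.stu _ _ _ _ (by simpa [hx] using hu) (by simpa [hx'] using hu') ha hb hc)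
  | swap u a b c hu hu' ha hb h =>
    rw [← consW_cons]
    exact locN_of (.swap _ _ _ _ (by simpa [hx] using hu) (by simpa [hx'] using hu') ha hb h)
  | cliff u a b c hu hu' =>
    rw [← consW_cons]
    exact locN_of (.cliff _ _ _ _ (by simpa [hx] using hu) (by simpa [hx'] using hu'))
  | op c h => exact opN_le q z (opN_consL x (opN_of h))

theorem locN_consW {q z} {u : List (Leg × ℕ)} (hu : ∀ x ∈ u, x.1.isOp = false)
    (hu' : ∀ x ∈ u, x.2 ≠ z) {c : Comb Leg} (hc : c ∈ locN q z) : consW u c ∈ locN q z := by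
  induction u with
  | nil => simpa using hc
  | cons x u ih =>
    rw [consW_cons]
    exact locN_consL (hu x (by simp)) (hu' x (by simp))
      (ih (fun a ha => hu a (by simp [ha])) fun a ha => hu' a (by simp [ha]))

theorem stuHead_addG (z x y T K) (c : Comb Leg) :
    stuHead z x y (addG T K c) = addG T K (stuHead z x y c) := by
  simp [stuHead, consL_addG, addG_comm T K]

theorem swapHead_addG (a b T K) (c : Comb Leg) :
    swapHead a b (addG T K c) = addG T K (swapHead a b c) := by
  simp [swapHead, consL_addG]

theorem cliffHead_addG (q x y T K) (c : Comb Leg) :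
    cliffHead q x y (addG T K c) = addG T K (cliffHead q x y c) := by
  simp [cliffHead, consL_addG, addG_comm T K]

theorem opN_addG (T K) {c : Comb Leg} (hc : c ∈ opN) : addG T K c ∈ opN := by
  refine span_map (fun r hr => opN_of ?_) hc
  obtain ⟨u, a, b, c, ha, hb⟩ := hr
  rw [← consW_addG, ← swapHead_addG]
  exact .mk _ _ _ _ ha hb

theorem locN_addG {q z T K} (hT : ∀ t ∈ T, t.1 ≠ z ∧ t.2.1 ≠ z ∧ t.2.2 ≠ z)
    (hK : ∀ k ∈ K, k.1 ≠ z ∧ k.2 ≠ z) {c : Comb Leg}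
    (hc : c ∈ locN q z) : addG T K c ∈ locN q z := by
  refine span_map (fun r hr => ?_) hc
  cases hr with
  | stu u a b c hu hu' ha hb hc =>
    rw [← consW_addG, ← stuHead_addG]
    exact locN_of (.stu _ _ _ _ hu hu' ha hb (named_addG hT hK hc))
  | swap u a b c hu hu' ha hb h =>
    rw [← consW_addG, ← swapHead_addG]
    exact locN_of (.swap _ _ _ _ hu hu' ha hb h)
  | cliff u a b c hu hu' =>
    rw [← consW_addG, ← cliffHead_addG]
    exact locN_of (.cliff _ _ _ _ hu hu')
  | op c h => exact opN_le q z (opN_addG T K (opN_of h))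

theorem locN_link {q z x y} (hx : x ≠ z) (hy : y ≠ z) {c : Comb Leg}
    (hc : c ∈ locN q z) : addG 0 {(x, y)} c ∈ locN q z :=
  locN_addG (by simp) (by simp [hx, hy]) hc

theorem sgn_mul_self (x y : Leg) : sgn x y * sgn x y = 1 := neg_one_pow_mul_self _

theorem sgn_comm (x y : Leg) : sgn x y = sgn y x := by rw [sgn, sgn, mul_comm]

/-- A coefficient of contractions which does not involve curvature legs and operator legs. -/
structure Contr (m : Leg → ℚ) (g : ℕ) : Prop where
  homog : Homog m g
  two : m .two = 0
  op : ∀ p, m (.op p) = 0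

/-- A linear map which behaves like the contraction `ctr m g e` on legs that are not operators. -/
structure Der (f : Comb Leg →ₗ[ℚ] Comb Leg) (m : Leg → ℚ) (g e : ℕ) : Prop where
  consL : ∀ (y : Leg × ℕ), y.1.isOp = false → ∀ c, f (consL y c) =
    m y.1 • addG 0 {(e, y.2)} c + (-1 : ℚ) ^ (g * y.1.grade) • consL y (f c)
  addG : ∀ T K c, f (addG T K c) = addG T K (f c)

theorem der_ctr (m g e) : Der (ctr m g e) m g e := ⟨fun _ _ => ctr_consL _ _ _ _, ctr_addG _ _ _⟩

/-- The coefficient of the contraction with an operator leg of kind `o`. -/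
def opCoeff (k : ℚ) (o : Leg) (y : Leg) : ℚ := if matchesParam o y then k else 0

theorem der_pushC (k) (o : Leg × ℕ) : Der (pushC k o) (opCoeff k o.1) o.1.grade o.2 :=
  ⟨fun y hy c => by rw [pushC_consL _ _ hy, add_comm]; rfl, pushC_addG _ _⟩

theorem contr_opCoeff (k : ℚ) (o : Leg) : Contr (opCoeff k o) o.grade := by
  refine ⟨fun y n h => ?_, ?_, fun p => ?_⟩
  · cases o <;> cases y <;> simp_all [opCoeff, matchesParam, Leg.grade]
  · cases o <;> simp [opCoeff, matchesParam]
  · cases o <;> simp [opCoeff, matchesParam]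

section
variable {f : Comb Leg →ₗ[ℚ] Comb Leg} {m : Leg → ℚ} {g e : ℕ}

theorem Der.stuHead (hf : Der f m g e) (h : Contr m g) (z x y : ℕ) (c : Comb Leg) :
    f (stuHead z x y c) = Weil.stuHead z x y (f c) := by
  have h2 : (-1 : ℚ) ^ (g * Leg.two.grade) = 1 := by
    rw [Leg.grade, mul_comm, pow_mul]; simp
  simp only [Weil.stuHead, LinearMap.sub_apply, LinearMap.comp_apply, map_sub,
    hf.consL (.two, _) rfl, hf.addG, h.two, h2, one_smul, zero_smul, zero_add]

theorem Der.cliffHead (hf : Der f m g e) (h : Contr m g) (q : ℚ) (x y : ℕ) (c : Comb Leg) :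
    f (cliffHead q x y c) = Weil.cliffHead q x y (f c) := by
  have h1 : m .one * (-1 : ℚ) ^ (g * Leg.one.grade) = - m .one := by
    by_cases hm : m .one = 0
    · simp [hm]
    · rw [h.homog _ _ hm]; simp [Leg.grade]
  simp only [Weil.cliffHead, LinearMap.sub_apply, LinearMap.add_apply, LinearMap.comp_apply,
    map_sub, map_add, map_smul, LinearMap.smul_apply, hf.consL (.one, _) rfl, hf.addG, smul_add,
    smul_smul, consL_addG]
  rw [mul_comm _ (m .one), h1, neg_one_pow_mul_self]
  module

theorem Der.swapHead (hf : Der f m g e) (h : Contr m g) {a b : Leg × ℕ} (ha : a.1.isOp = false)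
    (hb : b.1.isOp = false) (c : Comb Leg) : f (swapHead a b c) =
      ((-1 : ℚ) ^ (g * a.1.grade) * (-1 : ℚ) ^ (g * b.1.grade)) • Weil.swapHead a b (f c) := by
  have h1 : m b.1 * (-1 : ℚ) ^ (g * a.1.grade) = sgn a.1 b.1 * m b.1 := by
    by_cases hm : m b.1 = 0
    · simp [hm]
    · rw [h.homog _ _ hm, sgn_comm, sgn]; ring
  have h2 : m a.1 * (sgn a.1 b.1 * (-1 : ℚ) ^ (g * b.1.grade)) = m a.1 := by
    by_cases hm : m a.1 = 0
    · simp [hm]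
    · rw [h.homog _ _ hm, sgn, neg_one_pow_mul_self, mul_one]
  simp only [Weil.swapHead, LinearMap.sub_apply, LinearMap.comp_apply, map_sub,
    map_add, map_smul, LinearMap.smul_apply, hf.consL a ha, hf.consL b hb, hf.addG, smul_add,
    smul_smul, consL_addG]
  have e1 := congrArg (fun t : ℚ => t • Weil.addG 0 {(e, b.2)} (Weil.consL a c)) h1
  have e2 := congrArg (fun t : ℚ => t • Weil.addG 0 {(e, a.2)} (Weil.consL b c)) h2
  beta_reduce at e1 e2
  rw [mul_comm _ (m b.1), e1, ← mul_assoc, mul_comm _ (m a.1), e2]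
  module

theorem Der.consW_mem (hf : Der f m g e) {S : Submodule ℚ (Comb Leg)} {u : List (Leg × ℕ)}
    (hu : ∀ x ∈ u, x.1.isOp = false) (h1 : ∀ x ∈ u, ∀ c ∈ S, Weil.consL x c ∈ S)
    (h2 : ∀ x ∈ u, ∀ c ∈ S, Weil.addG 0 {(e, x.2)} c ∈ S) {c : Comb Leg} (hc : c ∈ S)
    (hfc : f c ∈ S) : f (consW u c) ∈ S := by
  suffices consW u c ∈ S ∧ f (consW u c) ∈ S from this.2
  induction u with
  | nil => simpa using ⟨hc, hfc⟩
  | cons x u ih =>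
    obtain ⟨i1, i2⟩ := ih (fun a ha => hu a (by simp [ha])) (fun a ha => h1 a (by simp [ha]))
      (fun a ha => h2 a (by simp [ha]))
    rw [consW_cons, hf.consL x (hu x (by simp))]
    exact ⟨h1 x (by simp) _ i1, S.add_mem (S.smul_mem _ (h2 x (by simp) _ i1))
      (S.smul_mem _ (h1 x (by simp) _ i2))⟩

/-- Contractions and operators preserve the span of the relations on legs. -/
theorem Der.locN (hf : Der f m g e) (h : Contr m g) {q z} (he : e ≠ z)
    (hn : ∀ c ∈ named {z}ᶜ, f c ∈ named {z}ᶜ) (hop : ∀ c ∈ opN, f c ∈ opN) {c : Comb Leg}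
    (hc : c ∈ locN q z) : f c ∈ locN q z := by
  have key : ∀ u : List (Leg × ℕ), (∀ a ∈ u, a.1.isOp = false) → (∀ a ∈ u, a.2 ≠ z) →
      ∀ c ∈ Weil.locN q z, f c ∈ Weil.locN q z → f (consW u c) ∈ Weil.locN q z :=
    fun u hu hu' c hc hfc => hf.consW_mem hu (fun x hx c hc => locN_consL (hu x hx) (hu' x hx) hc)
      (fun x hx c hc => locN_link he (hu' x hx) hc) hc hfc
  refine span_map (fun r hr => ?_) hc
  cases hr with
  | stu u a b c hu hu' ha hb hc =>
    refine key u hu hu' _ (locN_of ?_) (locN_of ?_)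
    · simpa using LocRel.stu (q := q) [] a b c (by simp) (by simp) ha hb hc
    · rw [hf.stuHead h]
      simpa using LocRel.stu (q := q) [] a b (f c) (by simp) (by simp) ha hb (hn c hc)
  | swap u a b c hu hu' ha hb hs =>
    refine key u hu hu' _ (locN_of ?_) ?_
    · simpa using LocRel.swap (q := q) (z := z) [] a b c (by simp) (by simp) ha hb hs
    · rw [hf.swapHead h ha hb]
      refine Submodule.smul_mem _ _ (locN_of ?_)
      simpa using LocRel.swap (q := q) (z := z) [] a b (f c) (by simp) (by simp) ha hb hs
  | cliff u a b c hu hu' =>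
    refine key u hu hu' _ (locN_of ?_) (locN_of ?_)
    · simpa using LocRel.cliff (q := q) (z := z) [] a b c (by simp) (by simp)
    · rw [hf.cliffHead h]
      simpa using LocRel.cliff (q := q) (z := z) [] a b (f c) (by simp) (by simp)
  | op c h => exact opN_le q z (hop _ (opN_of h))

end

theorem opN_ctr {m g} (h : Contr m g) {e : ℕ} {c : Comb Leg} (hc : c ∈ opN) :
    ctr m g e c ∈ opN := by
  refine span_map (fun r hr => ?_) hc
  obtain ⟨u, a, b, c, ha, hb⟩ := hr
  have hop : ∀ x : Leg, x.isOp → m x = 0 := by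
    rintro (_ | _ | p | p) hx <;> simp [Leg.isOp] at hx
    exact h.op p
  induction u with
  | nil =>
    have e1 : ctr m g e (swapHead a b c) = ((-1 : ℚ) ^ (g * a.1.grade) *
        (-1 : ℚ) ^ (g * b.1.grade)) • swapHead a b (ctr m g e c) := by
      simp only [swapHead, LinearMap.sub_apply, LinearMap.comp_apply, map_sub, map_smul,
        LinearMap.smul_apply, ctr_consL, hop _ ha, hop _ hb, zero_smul, zero_add]
      module
    rw [consW_nil, e1]
    refine Submodule.smul_mem _ _ (opN_of ?_)
    simpa using OpRel.mk [] a b (ctr m g e c) ha hb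
  | cons x u ih =>
    rw [consW_cons, ctr_consL]
    exact Submodule.add_mem _ (Submodule.smul_mem _ _ (opN_addG _ _ (opN_of (.mk u a b c ha hb))))
      (Submodule.smul_mem _ _ (opN_consL x ih))

theorem opN_pushC {k} {o : Leg × ℕ} {c : Comb Leg}
    (hc : c ∈ opN) : pushC k o c ∈ opN := by
  refine span_map (fun r hr => ?_) hc
  obtain ⟨u, a, b, c, ha, hb⟩ := hr
  induction u with
  | nil =>
    have e1 : pushC k o (swapHead a b c) = consL o (swapHead a b c) := by
      simp only [swapHead, LinearMap.sub_apply, LinearMap.comp_apply, map_sub, map_smul,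
        LinearMap.smul_apply, pushC_consL_op _ _ ha, pushC_consL_op _ _ hb]
    rw [consW_nil, e1]
    refine opN_consL o (opN_of ?_)
    simpa using OpRel.mk [] a b c ha hb
  | cons x u ih =>
    have h0 := opN_of (.mk u a b c ha hb)
    rw [consW_cons]
    cases hx : x.1.isOp
    · rw [pushC_consL _ _ hx]
      exact Submodule.add_mem _ (Submodule.smul_mem _ _ (opN_consL x ih))
        (Submodule.smul_mem _ _ (opN_addG _ _ h0))
    · rw [pushC_consL_op _ _ hx]
      exact opN_consL o (opN_consL x h0)

theorem locN_ctr {m g} (h : Contr m g) {q z} {e : ℕ} (he : e ≠ z) {c : Comb Leg}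
    (hc : c ∈ locN q z) : ctr m g e c ∈ locN q z :=
  (der_ctr m g e).locN h he (fun _ hc => ctr_named he _ _ hc) (fun _ hc => opN_ctr h hc) hc

theorem locN_act {k q z} {x : Leg × ℕ} (hx : x.2 ≠ z) {c : Comb Leg} (hc : c ∈ locN q z) :
    act k x c ∈ locN q z := by
  unfold act
  split_ifs with ho
  · exact (der_pushC k x).locN (contr_opCoeff k x.1) hx (fun _ hc => pushC_named hx _ hc)
      (fun _ hc => opN_pushC hc) hc
  · exact locN_consL (by simpa using ho) hx hc

/-- Operators supercommute, up to the relation between operator legs. -/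
theorem pushC_pushC {k} {a b : Leg × ℕ} (ha : a.1.isOp) (hb : b.1.isOp)
    (c : Comb Leg) :
    pushC k a (pushC k b c) - sgn a.1 b.1 • pushC k b (pushC k a c) ∈ opN := by
  suffices h : ∀ D : Diagram Leg, pushC k a (pushC k b (gen D)) -
      sgn a.1 b.1 • pushC k b (pushC k a (gen D)) ∈ opN from
    map_mem_of_gen (f := pushC k a ∘ₗ pushC k b - sgn a.1 b.1 • pushC k b ∘ₗ pushC k a)
      (s := Set.univ) (fun D _ => h D) (fun _ _ => Set.mem_univ _)
  intro D
  obtain ⟨T, K, w⟩ := D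
  have h0 : ∀ c, consL a (consL b c) - sgn a.1 b.1 • consL b (consL a c) ∈ opN := by
    intro c
    have := OpRel.mk [] a b c ha hb
    rw [consW_nil] at this
    exact opN_of this
  induction w generalizing T K with
  | nil =>
    have e : ∀ x : Leg × ℕ, (gen ⟨T, K, [x]⟩ : Comb Leg) = consL x (gen ⟨T, K, []⟩) := by simp
    rw [pushC_nil, pushC_nil, e, e, pushC_consL_op _ _ ha, pushC_consL_op _ _ hb]
    exact h0 _
  | cons y w ih =>
    rw [← consL_gen y ⟨T, K, w⟩]
    have := ih T K
    cases hy : y.1.isOp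
    · have ea := (der_pushC k a).consL y hy
      have eb := (der_pushC k b).consL y hy
      have h1 : opCoeff k b.1 y.1 * (1 - sgn a.1 b.1 * (-1) ^ (a.1.grade * y.1.grade)) = 0 := by
        by_cases hm : opCoeff k b.1 y.1 = 0
        · simp [hm]
        · rw [mul_comm a.1.grade, ← (contr_opCoeff k b.1).homog _ _ hm, mul_comm b.1.grade,
            ← sgn, sgn_mul_self, sub_self, mul_zero]
      have h2 : opCoeff k a.1 y.1 * ((-1) ^ (b.1.grade * y.1.grade) - sgn a.1 b.1) = 0 := by
        by_cases hm : opCoeff k a.1 y.1 = 0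
        · simp [hm]
        · rw [mul_comm b.1.grade, ← (contr_opCoeff k a.1).homog _ _ hm, ← sgn, sub_self, mul_zero]
      have e1 : pushC k a (pushC k b (consL y (gen ⟨T, K, w⟩))) -
          sgn a.1 b.1 • pushC k b (pushC k a (consL y (gen ⟨T, K, w⟩))) =
          ((-1 : ℚ) ^ (a.1.grade * y.1.grade) * (-1) ^ (b.1.grade * y.1.grade)) •
            consL y (pushC k a (pushC k b (gen ⟨T, K, w⟩))
              - sgn a.1 b.1 • pushC k b (pushC k a (gen ⟨T, K, w⟩))) := by
        simp only [ea, eb, map_add, map_smul, map_sub, pushC_addG]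
        have e1 := congrArg (fun t : ℚ => t • addG 0 {(b.2, y.2)} (pushC k a (gen ⟨T, K, w⟩))) h1
        have e2 := congrArg (fun t : ℚ => t • addG 0 {(a.2, y.2)} (pushC k b (gen ⟨T, K, w⟩))) h2
        simp only [zero_smul] at e1 e2
        rw [← sub_eq_zero, ← add_zero (0 : Comb Leg)]
        nth_rw 2 [← e1]
        rw [← e2]
        module
      rw [e1]
      exact Submodule.smul_mem _ _ (opN_consL y this)
    · rw [pushC_consL_op _ _ hy, pushC_consL_op _ _ hy, pushC_consL_op _ _ ha,
        pushC_consL_op _ _ hb]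
      exact h0 _

end Weil

namespace Weil

variable {L M : Type}

theorem opDiagrams_iff {t : ℕ × ℕ} {D E : Diagram Leg} (h1 : D.Valid ↔ E.Valid)
    (h2 : Normal D.legs ↔ Normal E.legs)
    (h3 : ∀ f : Leg → ℕ, f .one = 0 → f .two = 0 →
      (D.legs.map fun x => f x.1).sum = (E.legs.map fun x => f x.1).sum) :
    D ∈ opDiagrams t ↔ E ∈ opDiagrams t := by
  rw [mem_opDiagrams, mem_opDiagrams, h1, h2, h3 Leg.parGrade rfl rfl, h3 Leg.opGrade rfl rfl]

theorem normal_append_of_not_op {u : List (Leg × ℕ)} (hu : ∀ x ∈ u, x.1.isOp = false) {v} :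
    Normal (u ++ v) ↔ Normal v := by
  induction u with
  | nil => rfl
  | cons x u ih =>
    rw [List.cons_append, normal_cons_of_not_op (hu x (by simp)), ih fun a ha => hu a (by simp [ha])]

theorem not_op_of_normal {u v : List (Leg × ℕ)} {x : Leg × ℕ} (hx : x.1.isOp = false)
    (h : Normal (u ++ x :: v)) : ∀ y ∈ u, y.1.isOp = false := by
  intro y hy
  have := (List.pairwise_append.1 h).2.2 y hy x (by simp)
  by_contra hy'
  simp [hx, hy'] at this

theorem valid_congr {D : Diagram L} {E : Diagram M} (h : D.ends = E.ends) :
    D.Valid ↔ E.Valid := by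
  unfold Diagram.Valid; rw [h]

theorem valid_pair {D : Diagram L} {E : Diagram M} {z : ℕ} (hz : z ∉ D.ends)
    (h : E.ends = z ::ₘ z ::ₘ D.ends) : E.Valid ↔ D.Valid := by
  unfold Diagram.Valid
  rw [h]
  refine forall_congr' fun e => ?_
  by_cases he : e = z
  · subst he
    simp [Multiset.count_eq_zero_of_notMem hz]
  · simp [Multiset.count_cons, he]

theorem cls_three {P : Presentation L} {A B C : Diagram L} (a b c : ℚ)
    (h : a • gen A + b • gen B + c • gen C ∈ P.rel) (h1 : A ∈ P.adm ↔ B ∈ P.adm)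
    (h2 : A ∈ P.adm ↔ C ∈ P.adm) : P.cls (a • gen A + b • gen B + c • gen C) = 0 := by
  by_cases hA : A ∈ P.adm
  · exact cls_rel h (Submodule.add_mem _ (Submodule.add_mem _
      (Submodule.smul_mem _ _ (gen_mem_supported.2 hA))
      (Submodule.smul_mem _ _ (gen_mem_supported.2 (h1.1 hA))))
      (Submodule.smul_mem _ _ (gen_mem_supported.2 (h2.1 hA))))
  · simp only [map_add, map_smul]
    rw [cls_gen_of_notMem hA, cls_gen_of_notMem fun h => hA (h1.2 h),
      cls_gen_of_notMem fun h => hA (h2.2 h)]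
    simp

/-- The ends of a diagram, the ends on legs being listed explicitly. -/
theorem ends_append (T K) (u v : List (L × ℕ)) : Diagram.ends ⟨T, K, u ++ v⟩ =
    ((u.map Prod.snd : List ℕ) : Multiset ℕ) + Diagram.ends ⟨T, K, v⟩ := by
  simp only [ends_mk, List.map_append, ← Multiset.coe_add]
  abel

theorem ends_cons (T K) (x : L × ℕ) (v : List (L × ℕ)) : Diagram.ends ⟨T, K, x :: v⟩ =
    x.2 ::ₘ Diagram.ends ⟨T, K, v⟩ := by
  simp only [ends_mk, List.map_cons, ← Multiset.cons_coe, ← Multiset.singleton_add]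
  abel

theorem ends_tri (t K T) (v : List (L × ℕ)) : Diagram.ends ⟨t ::ₘ T, K, v⟩ =
    t.1 ::ₘ t.2.1 ::ₘ t.2.2 ::ₘ Diagram.ends ⟨T, K, v⟩ := by
  simp only [ends_mk, Multiset.cons_bind]
  simp only [Multiset.insert_eq_cons, ← Multiset.singleton_add]
  abel

theorem ends_link (k K T) (v : List (L × ℕ)) : Diagram.ends ⟨T, k ::ₘ K, v⟩ =
    k.1 ::ₘ k.2 ::ₘ Diagram.ends ⟨T, K, v⟩ := by
  simp only [ends_mk, Multiset.cons_bind]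
  simp only [Multiset.insert_eq_cons, ← Multiset.singleton_add]
  abel

/-- Relations between adjacent legs of the same type hold in the presented space. -/
theorem cls_swap {P : Presentation Leg} (q t) (hP : P = sp q t) (T K) (u v : List (Leg × ℕ))
    (a b : Leg × ℕ) (hn : Normal (u ++ a :: b :: v) ↔ Normal (u ++ b :: a :: v))
    (h : SwapOK a.1 b.1) :
    P.cls (gen ⟨T, K, u ++ a :: b :: v⟩ - sgn a.1 b.1 • gen ⟨T, K, u ++ b :: a :: v⟩) = 0 := by
  subst hP
  rw [map_sub, map_smul, sub_eq_zero]
  refine cls_gen_eq _ (Or.inr (.swap T K u v a.1 b.1 a.2 b.2 h)) ?_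
  refine opDiagrams_iff (valid_congr ?_) hn fun f _ _ => ?_
  · rw [ends_append, ends_append, ends_cons, ends_cons, ends_cons, ends_cons, Multiset.cons_swap]
  · simp only [List.map_append, List.map_cons, List.sum_append, List.sum_cons]; ring

theorem eq_op_of_isOp {l : Leg} (h : l.isOp) : ∃ p, l = .op p := by
  cases l with
  | op p => exact ⟨p, rfl⟩
  | one | two | par => simp [Leg.isOp] at h

theorem cls_locRel {q z r} (t) (h : LocRel q z r) : (sp q t).cls r = 0 := by
  cases h with
  | stu u x y c hu hu' hx hy hc =>
    refine eq_of_gen (f := (sp q t).cls ∘ₗ consW u ∘ₗ stuHead z x y) (g := 0) ?_ hc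
    rintro ⟨T, K, v⟩ hD
    have hz : z ∉ Diagram.ends ⟨T, K, v⟩ := fun h => hD z h rfl
    have hz' : z ∉ Diagram.ends ⟨T, K, u ++ (Leg.two, x) :: (Leg.two, y) :: v⟩ := by
      rw [ends_append, ends_cons, ends_cons]
      simp only [Multiset.mem_add, Multiset.mem_coe, List.mem_map, Multiset.mem_cons, not_or]
      refine ⟨?_, hx.symm, hy.symm, hz⟩
      rintro ⟨a, ha, rfl⟩
      exact hu' a ha rfl
    have h1 := cls_three (P := sp q t) (A := ⟨T, K, u ++ (Leg.two, x) :: (Leg.two, y) :: v⟩)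
      (B := ⟨T, K, u ++ (Leg.two, y) :: (Leg.two, x) :: v⟩)
      (C := ⟨(x, z, y) ::ₘ T, K, u ++ (Leg.two, z) :: v⟩) 1 (-1) (-1) ?_ ?_ ?_
    · refine Eq.trans ?_ h1
      simp only [LinearMap.comp_apply, stuHead, LinearMap.sub_apply, consL_gen, addG_gen, map_sub,
        consW_gen, zero_add, Multiset.singleton_add]
      simp only [map_add, map_smul]
      module
    · refine Or.inr ?_
      convert LegRel.stu (q := q) T K u v x y z using 1
      module
    · refine opDiagrams_iff (valid_congr ?_) ?_ fun f _ _ => ?_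
      · rw [ends_append, ends_append, ends_cons, ends_cons, ends_cons, ends_cons,
          Multiset.cons_swap]
      · rw [normal_append_of_not_op hu, normal_append_of_not_op hu, normal_cons_of_not_op rfl,
          normal_cons_of_not_op rfl, normal_cons_of_not_op rfl, normal_cons_of_not_op rfl]
      · simp only [List.map_append, List.map_cons, List.sum_append, List.sum_cons]
    · refine opDiagrams_iff (valid_pair hz' ?_).symm ?_ fun f hf hf' => ?_
      · rw [ends_append, ends_append, ends_tri, ends_cons, ends_cons, ends_cons]
        simp only [ends_mk, ← Multiset.singleton_add]
        abel
      · rw [normal_append_of_not_op hu, normal_append_of_not_op hu, normal_cons_of_not_op rfl,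
          normal_cons_of_not_op rfl, normal_cons_of_not_op rfl]
      · simp [hf']
  | swap u a b c hu hu' ha hb h =>
    refine LinearMap.congr_fun (f := (sp q t).cls ∘ₗ consW u ∘ₗ swapHead a b) (g := 0)
      (comb_ext ?_) c
    rintro ⟨T, K, v⟩
    have := cls_swap q t rfl T K u v a b ?_ h
    · simpa [swapHead] using this
    · rw [normal_append_of_not_op hu, normal_append_of_not_op hu, normal_cons_of_not_op ha,
          normal_cons_of_not_op hb, normal_cons_of_not_op hb, normal_cons_of_not_op ha]
  | cliff u x y c hu hu' =>
    refine LinearMap.congr_fun (f := (sp q t).cls ∘ₗ consW u ∘ₗ cliffHead q x y) (g := 0)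
      (comb_ext ?_) c
    rintro ⟨T, K, v⟩
    have h1 := cls_three (P := sp q t) (A := ⟨T, K, u ++ (Leg.one, x) :: (Leg.one, y) :: v⟩)
      (B := ⟨T, K, u ++ (Leg.one, y) :: (Leg.one, x) :: v⟩)
      (C := ⟨T, (x, y) ::ₘ K, u ++ v⟩) 1 1 (-q) ?_ ?_ ?_
    · refine Eq.trans ?_ h1
      simp only [LinearMap.comp_apply, cliffHead, LinearMap.sub_apply, LinearMap.add_apply,
        LinearMap.smul_apply, consL_gen, addG_gen, map_sub, map_add, map_smul,
        consW_gen, zero_add, Multiset.singleton_add]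
      module
    · refine Or.inr ?_
      convert LegRel.cliff (q := q) T K u v x y using 1
      module
    · refine opDiagrams_iff (valid_congr ?_) ?_ fun f _ _ => ?_
      · rw [ends_append, ends_append, ends_cons, ends_cons, ends_cons, ends_cons,
          Multiset.cons_swap]
      · rw [normal_append_of_not_op hu, normal_append_of_not_op hu, normal_cons_of_not_op rfl,
          normal_cons_of_not_op rfl, normal_cons_of_not_op rfl, normal_cons_of_not_op rfl]
      · simp only [List.map_append, List.map_cons, List.sum_append, List.sum_cons]
    · refine opDiagrams_iff (valid_congr ?_) ?_ fun f hf hf' => ?_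
      · rw [ends_append, ends_append, ends_link, ends_cons, ends_cons]
      · rw [normal_append_of_not_op hu, normal_append_of_not_op hu, normal_cons_of_not_op rfl,
          normal_cons_of_not_op rfl]
      · simp [hf]
  | op _ h =>
    obtain ⟨u, a, b, c, ha, hb⟩ := h
    refine LinearMap.congr_fun (f := (sp q t).cls ∘ₗ consW u ∘ₗ swapHead a b) (g := 0)
      (comb_ext ?_) c
    rintro ⟨T, K, v⟩
    have hs : SwapOK a.1 b.1 := by
      refine Or.inr (Or.inr (Or.inr ?_))
      exact ⟨eq_op_of_isOp ha, eq_op_of_isOp hb⟩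
    have := cls_swap q t rfl T K u v a b ?_ hs
    · simpa [swapHead] using this
    · simp [Normal, List.pairwise_append, ha, hb]

theorem cls_locN {q z} (t) {c : Comb Leg} (hc : c ∈ locN q z) : (sp q t).cls c = 0 := by
  have := span_map (f := (sp q t).cls) (N := ⊥) (fun r hr => by
    rw [Submodule.mem_bot]; exact cls_locRel t hr) hc
  simpa using this

/-- The relations on legs between operator Weil diagrams are instances of `LocRel`. -/
theorem legRel_mem_locN {q t r} (h : LegRel q r)
    (hs : r ∈ Finsupp.supported ℚ ℚ (opDiagrams t)) : ∃ z, r ∈ locN q z := by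
  have adm : ∀ D : Diagram Leg, r D ≠ 0 → D ∈ opDiagrams t :=
    fun D hD => hs (Finsupp.mem_support_iff.2 hD)
  have fresh : ∀ u : List (Leg × ℕ), ∃ z, ∀ a ∈ u, a.2 ≠ z := by
    intro u
    obtain ⟨z, hz⟩ := Infinite.exists_notMem_finset (u.map Prod.snd).toFinset
    refine ⟨z, ?_⟩
    rintro a ha rfl
    exact hz (by simpa using ⟨a.1, ha⟩)
  cases h with
  | stu T K u v x y z =>
    refine ⟨z, ?_⟩
    have h3 : (⟨(x, z, y) ::ₘ T, K, u ++ (Leg.two, z) :: v⟩ : Diagram Leg) ∈ opDiagrams t := by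
      refine adm _ ?_
      have h1 : ∀ w, (⟨T, K, w⟩ : Diagram Leg) ≠
          ⟨(x, z, y) ::ₘ T, K, u ++ (Leg.two, z) :: v⟩ := by
        intro w h
        have := congrArg (fun D => Multiset.card D.tri) h
        simp at this
      simp [gen, Finsupp.sub_apply, Finsupp.single_eq_of_ne (h1 _).symm]
    rw [mem_opDiagrams] at h3
    have hu := not_op_of_normal rfl h3.2.1
    have hz := h3.1 z
    rw [ends_tri, ends_append, ends_cons] at hz
    have hz' : z ∉ x ::ₘ y ::ₘ (((u.map Prod.snd : List ℕ) : Multiset ℕ) +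
        Diagram.ends ⟨T, K, v⟩) := by
      rw [← Multiset.count_eq_zero]
      simp only [Multiset.count_cons, Multiset.count_add, if_true] at hz ⊢
      omega
    simp only [Multiset.mem_cons, Multiset.mem_add, not_or, Multiset.mem_coe, List.mem_map] at hz'
    have := LocRel.stu (q := q) (z := z) u x y (gen ⟨T, K, v⟩) hu
      (fun a ha h => hz'.2.2.1 ⟨a, ha, h⟩) (Ne.symm hz'.1) (Ne.symm hz'.2.1)
      (gen_mem_supported.2 fun e he h => hz'.2.2.2 (by rwa [← show e = z from h]))
    simpa [stuHead] using locN_of this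
  | swap T K u v p p' x y h =>
    obtain ⟨z, hz⟩ := fresh u
    refine ⟨z, ?_⟩
    by_cases hD : (⟨T, K, u ++ (p, x) :: (p', y) :: v⟩ : Diagram Leg) =
        ⟨T, K, u ++ (p', y) :: (p, x) :: v⟩
    · have hp : p = p' ∧ x = y := by simp at hD; exact hD.1
      obtain ⟨rfl, rfl⟩ := hp
      cases hp : p.isOp
      · by_cases hsgn : sgn p p = 1
        · rw [hsgn, one_smul, sub_self]
          exact Submodule.zero_mem _
        · have := adm ⟨T, K, u ++ (p, x) :: (p, x) :: v⟩ (by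
            simp [gen, sub_eq_zero, Ne.symm hsgn])
          have hu := not_op_of_normal hp (mem_opDiagrams.1 this).2.1
          have := LocRel.swap (q := q) (z := z) u (p, x) (p, x) (gen ⟨T, K, v⟩) hu hz hp hp h
          simpa [swapHead] using locN_of this
      · have := LocRel.op (q := q) (z := z) _ (.mk u (p, x) (p, x) (gen ⟨T, K, v⟩) hp hp)
        simpa [swapHead] using locN_of this
    · have h1 := adm ⟨T, K, u ++ (p, x) :: (p', y) :: v⟩ (by
        simp only [gen, Finsupp.sub_apply, Finsupp.smul_apply, Finsupp.single_eq_same,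
          Finsupp.single_eq_of_ne hD]
        simp)
      have h2 := adm ⟨T, K, u ++ (p', y) :: (p, x) :: v⟩ (by
        simp only [gen, Finsupp.sub_apply, Finsupp.smul_apply, Finsupp.single_eq_same,
          Finsupp.single_eq_of_ne (Ne.symm hD)]
        simp [sgn])
      have n1 := (mem_opDiagrams.1 h1).2.1
      have n2 := (mem_opDiagrams.1 h2).2.1
      have hpp : p.isOp = p'.isOp := by
        have e1 : p.isOp → p'.isOp := (List.pairwise_cons.1 (List.pairwise_append.1 n1).2.1).1 (p', y) (by simp)
        have e2 : p'.isOp → p.isOp := (List.pairwise_cons.1 (List.pairwise_append.1 n2).2.1).1 (p, x) (by simp)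
        rw [Bool.eq_iff_iff]; exact ⟨e1, e2⟩
      cases hp : p.isOp
      · have hu := not_op_of_normal hp n1
        have := LocRel.swap (q := q) (z := z) u (p, x) (p', y) (gen ⟨T, K, v⟩) hu hz hp
          (hpp ▸ hp) h
        simpa [swapHead] using locN_of this
      · have := LocRel.op (q := q) (z := z) _
          (.mk u (p, x) (p', y) (gen ⟨T, K, v⟩) hp (by simpa [← hpp] using hp))
        simpa [swapHead] using locN_of this
  | cliff T K u v x y =>
    obtain ⟨z, hz⟩ := fresh u
    refine ⟨z, ?_⟩
    have h3 : (⟨T, K, u ++ (Leg.one, x) :: (Leg.one, y) :: v⟩ : Diagram Leg) ∈ opDiagrams t := by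
      refine adm _ ?_
      have h1 : (⟨T, K, u ++ (Leg.one, x) :: (Leg.one, y) :: v⟩ : Diagram Leg) ≠
          ⟨T, (x, y) ::ₘ K, u ++ v⟩ := by
        intro h
        have := congrArg (fun D => D.legs.length) h
        simp at this
        omega
      simp only [gen, Finsupp.sub_apply, Finsupp.add_apply, Finsupp.smul_apply,
        Finsupp.single_eq_same, Finsupp.single_eq_of_ne h1]
      by_cases h2 : (⟨T, K, u ++ (Leg.one, x) :: (Leg.one, y) :: v⟩ : Diagram Leg) =
          ⟨T, K, u ++ (Leg.one, y) :: (Leg.one, x) :: v⟩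
      · rw [h2]; simp
      · rw [Finsupp.single_eq_of_ne h2]; simp
    have hu := not_op_of_normal rfl (mem_opDiagrams.1 h3).2.1
    have := LocRel.cliff (q := q) (z := z) u x y (gen ⟨T, K, v⟩) hu hz
    simpa [cliffHead] using locN_of this

/-! ### Products are well defined -/

theorem locN_ren {q z} {f : ℕ → ℕ} (hf : f.Injective) {c : Comb Leg} (hc : c ∈ locN q z) :
    ren f c ∈ locN q (f z) := by
  refine span_map (fun r hr => ?_) hc
  have not_op : ∀ u : List (Leg × ℕ), (∀ a ∈ u, a.1.isOp = false) →
      ∀ a ∈ u.map fun x => (x.1, f x.2), a.1.isOp = false := by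
    intro u hu a ha
    obtain ⟨b, hb, rfl⟩ := List.mem_map.1 ha
    exact hu b hb
  have not_eq : ∀ u : List (Leg × ℕ), (∀ a ∈ u, a.2 ≠ z) →
      ∀ a ∈ u.map fun x => (x.1, f x.2), a.2 ≠ f z := by
    intro u hu a ha
    obtain ⟨b, hb, rfl⟩ := List.mem_map.1 ha
    exact hf.ne (hu b hb)
  cases hr with
  | stu u x y c hu hu' hx hy hc =>
    have := LocRel.stu (q := q) (z := f z) (u.map fun x => (x.1, f x.2)) (f x) (f y) (ren f c)
      (not_op u hu) (not_eq u hu') (hf.ne hx) (hf.ne hy)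
      (named_ren (fun e he => hf.ne he) hc)
    rw [ren_consW]
    convert locN_of this using 2
    simp [stuHead, ren_consL, ren_addG]
  | swap u a b c hu hu' ha hb h =>
    have := LocRel.swap (q := q) (z := f z) (u.map fun x => (x.1, f x.2)) (a.1, f a.2) (b.1, f b.2)
      (ren f c) (not_op u hu) (not_eq u hu') ha hb h
    rw [ren_consW]
    convert locN_of this using 2
    simp [swapHead, ren_consL]
  | cliff u x y c hu hu' =>
    have := LocRel.cliff (q := q) (z := f z) (u.map fun x => (x.1, f x.2)) (f x) (f y)
      (ren f c) (not_op u hu) (not_eq u hu')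
    rw [ren_consW]
    convert locN_of this using 2
    simp [cliffHead, ren_consL, ren_addG]
  | op _ h =>
    obtain ⟨u, a, b, c, ha, hb⟩ := h
    have := OpRel.mk (u.map fun x => (x.1, f x.2)) (a.1, f a.2) (b.1, f b.2) (ren f c) ha hb
    rw [ren_consW]
    convert opN_le q (f z) (opN_of this) using 2
    simp [swapHead, ren_consL]

theorem actC_named (k) {s : Set ℕ} {c d : Comb Leg} (hc : c ∈ named s) (hd : d ∈ named s) :
    actC k c d ∈ named s := by
  refine map_mem_of_gen (f := (actC k).flip d) (fun D hD => ?_) hc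
  refine map_mem_of_gen (f := actC k (gen D)) (fun E hE => ?_) hd
  refine endsIn_named (fun e he => ?_) (actC_endsIn k D (gen_mem_endsIn E))
  rcases Multiset.mem_add.1 he with he | he
  · exact hD e he
  · exact hE e he

theorem actC_consW (k u) (c d : Comb Leg) : actC k (consW u c) d = actW k u (actC k c d) := by
  induction u with
  | nil => simp [actW]
  | cons x u ih => rw [consW_cons, actC_consL, ih]; rfl

theorem locN_actW {k q z} {u : List (Leg × ℕ)} (hu : ∀ x ∈ u, x.2 ≠ z) {c : Comb Leg}
    (hc : c ∈ locN q z) : actW k u c ∈ locN q z := by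
  induction u with
  | nil => exact hc
  | cons x u ih => exact locN_act (hu x (by simp)) (ih fun a ha => hu a (by simp [ha]))

theorem opN_act {k} (x) {c : Comb Leg} (hc : c ∈ opN) : act k x c ∈ opN := by
  unfold act
  split_ifs with ho
  · exact opN_pushC hc
  · exact opN_consL x hc

theorem act_of_not_op (k) {x : Leg × ℕ} (hx : x.1.isOp = false) : act k x = consL x := by
  simp [act, hx]

theorem act_of_op (k) {x : Leg × ℕ} (hx : x.1.isOp) : act k x = pushC k x := by
  simp [act, hx]

/-- The relations on legs are respected by the product from the right. -/
theorem locN_actC_left {k q z} {c d : Comb Leg} (hc : c ∈ locN q z) (hd : d ∈ named {z}ᶜ) :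
    actC k c d ∈ locN q z := by
  refine span_map (f := (actC k).flip d) (fun r hr => ?_) hc
  rw [LinearMap.flip_apply]
  cases hr with
  | stu u x y c hu hu' hx hy hc =>
    rw [actC_consW]
    refine locN_actW hu' ?_
    have := LocRel.stu (q := q) (z := z) [] x y (actC k c d) (by simp) (by simp) hx hy
      (actC_named k hc hd)
    rw [consW_nil] at this
    convert locN_of this using 1
    simp only [stuHead, LinearMap.sub_apply, LinearMap.comp_apply, map_sub, actC_consL, actC_addG,
      act_of_not_op k (x := (Leg.two, _)) rfl]
  | swap u a b c hu hu' ha hb h =>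
    rw [actC_consW]
    refine locN_actW hu' ?_
    have := LocRel.swap (q := q) (z := z) [] a b (actC k c d) (by simp) (by simp) ha hb h
    rw [consW_nil] at this
    convert locN_of this using 1
    simp only [swapHead, LinearMap.sub_apply, LinearMap.comp_apply, map_sub, actC_consL,
      LinearMap.smul_apply, map_smul, act_of_not_op k ha, act_of_not_op k hb]
  | cliff u x y c hu hu' =>
    rw [actC_consW]
    refine locN_actW hu' ?_
    have := LocRel.cliff (q := q) (z := z) [] x y (actC k c d) (by simp) (by simp)
    rw [consW_nil] at this
    convert locN_of this using 1
    simp only [cliffHead, LinearMap.sub_apply, LinearMap.add_apply, LinearMap.comp_apply, map_sub,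
      map_add, actC_consL, LinearMap.smul_apply, map_smul, actC_addG,
      act_of_not_op k (x := (Leg.one, _)) rfl]
  | op _ h =>
    obtain ⟨u, a, b, c, ha, hb⟩ := h
    rw [actC_consW]
    refine opN_le q z ?_
    have h0 : actC k (swapHead a b c) d ∈ opN := by
      have := pushC_pushC (k := k) ha hb (actC k c d)
      convert this using 1
      simp only [swapHead, LinearMap.sub_apply, LinearMap.comp_apply, map_sub, actC_consL,
        LinearMap.smul_apply, map_smul, act_of_op k ha, act_of_op k hb]
    induction u with
    | nil => exact h0
    | cons x u ih => exact opN_act x ih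

theorem locN_actC_right {k q z} {c d : Comb Leg} (hc : c ∈ named {z}ᶜ) (hd : d ∈ locN q z) :
    actC k c d ∈ locN q z := by
  refine map_mem_of_gen (f := (actC k).flip d) (fun D hD => ?_) hc
  obtain ⟨T, K, w⟩ := D
  rw [LinearMap.flip_apply, actC_gen, LinearMap.comp_apply]
  have hD' : ∀ e ∈ Diagram.ends ⟨T, K, w⟩, e ≠ z := hD
  simp only [Diagram.ends, Multiset.mem_add, Multiset.mem_bind, Multiset.mem_coe, List.mem_map,
    Multiset.insert_eq_cons, Multiset.mem_cons, Multiset.mem_singleton] at hD'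
  refine locN_addG (fun t ht => ?_) (fun t ht => ?_) (locN_actW (fun x hx => ?_) hd)
  · exact ⟨hD' _ (Or.inl (Or.inl ⟨t, ht, by simp⟩)), hD' _ (Or.inl (Or.inl ⟨t, ht, by simp⟩)),
      hD' _ (Or.inl (Or.inl ⟨t, ht, by simp⟩))⟩
  · exact ⟨hD' _ (Or.inl (Or.inr ⟨t, ht, by simp⟩)), hD' _ (Or.inl (Or.inr ⟨t, ht, by simp⟩))⟩
  · exact hD' _ (Or.inr ⟨x, hx, rfl⟩)

theorem left_injective : left.Injective := fun a b h => by simpa [left] using h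

theorem right_injective : right.Injective := fun a b h => by simpa [right] using h

theorem left_ne_right (a b : ℕ) : left a ≠ right b := by unfold left right; omega

theorem valid_left_right {m m' : Multiset ℕ} (hm : ∀ e, m.count e = 0 ∨ m.count e = 2)
    (hm' : ∀ e, m'.count e = 0 ∨ m'.count e = 2) (e : ℕ) :
    (m.map left + m'.map right).count e = 0 ∨ (m.map left + m'.map right).count e = 2 := by
  rw [Multiset.count_add]
  obtain ⟨n, rfl | rfl⟩ : ∃ n, e = left n ∨ e = right n := by
    rcases Nat.even_or_odd' e with ⟨n, h | h⟩
    · exact ⟨n, Or.inl h⟩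
    · exact ⟨n, Or.inr h⟩
  · rw [Multiset.count_map_eq_count' _ _ left_injective,
      Multiset.count_eq_zero_of_notMem (s := m'.map right), add_zero]
    · exact hm n
    · simp only [Multiset.mem_map, not_exists, not_and]
      exact fun a _ h => left_ne_right n a h.symm
  · rw [Multiset.count_map_eq_count' _ _ right_injective,
      Multiset.count_eq_zero_of_notMem (s := m.map left), zero_add]
    · exact hm' n
    · simp only [Multiset.mem_map, not_exists, not_and]
      exact fun a _ h => left_ne_right a n h

theorem mem_valid_of_endsIn {m : Multiset ℕ} (hm : ∀ e, m.count e = 0 ∨ m.count e = 2)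
    {c : Comb L} (hc : c ∈ endsIn m) : c ∈ Finsupp.supported ℚ ℚ {E : Diagram L | E.Valid} :=
  Finsupp.supported_mono (by rintro D rfl; exact hm) hc

/-- The product of combinations of diagrams, after making their names disjoint. -/
def star (k : ℚ) (c d : Comb Leg) : Comb Leg := actC k (ren left c) (ren right d)

theorem star_gen_endsIn (k) (D E : Diagram Leg) :
    star k (gen D) (gen E) ∈ endsIn (D.ends.map left + E.ends.map right) := by
  rw [star, ren_gen, ren_gen, ← ends_rename, ← ends_rename]
  exact actC_endsIn k _ (gen_mem_endsIn _)

theorem cls_star_left {k q t t'} {r : Comb Leg} (hr : r ∈ (sp q t).rel)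
    (hs : r ∈ Finsupp.supported ℚ ℚ (sp q t).adm) {E : Diagram Leg} (hE : E.Valid) :
    (sp q t').cls (star k r (gen E)) = 0 := by
  rcases hr with hr | hr
  · refine cls_graphRel (graphLike_sp q t') (P := sp q t) (fun D hD => hD.1) left_injective
      (f := (actC k).flip (ren right (gen E)) ∘ₗ ren left) ?_ ?_ ?_ hr hs
    · intro g g' h h' c
      have e1 : ren right (gen E) = ren g' (ren right (gen E)) := by
        rw [ren_ren]
        congr 2
        funext n
        exact (h' _ (by rintro ⟨a, ha⟩; exact left_ne_right a n ha)).symm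
      have e2 : ren left (ren g c) = ren g' (ren left c) := by
        rw [ren_ren, ren_ren]
        congr 2
        funext n
        exact (h n).symm
      simp only [LinearMap.comp_apply, LinearMap.flip_apply]
      rw [e2]
      nth_rw 1 [e1]
      rw [actC_ren]
    · intro T K c
      simp only [LinearMap.comp_apply, LinearMap.flip_apply, ren_addG, actC_addG]
    · intro D hD
      exact mem_valid_of_endsIn (valid_left_right hD hE) (star_gen_endsIn k D E)
  · obtain ⟨z, hz⟩ := legRel_mem_locN hr hs
    refine cls_locN t' (z := left z) (locN_actC_left (locN_ren left_injective hz) ?_)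
    exact named_ren (s := Set.univ) (t := {left z}ᶜ)
      (fun e _ (h : right e = left z) => left_ne_right z e h.symm) (mem_named_univ _)

theorem cls_star_right {k q t t'} {r : Comb Leg} (hr : r ∈ (sp q t).rel)
    (hs : r ∈ Finsupp.supported ℚ ℚ (sp q t).adm) {E : Diagram Leg} (hE : E.Valid) :
    (sp q t').cls (star k (gen E) r) = 0 := by
  rcases hr with hr | hr
  · refine cls_graphRel (graphLike_sp q t') (P := sp q t) (fun D hD => hD.1) right_injective
      (f := actC k (ren left (gen E)) ∘ₗ ren right) ?_ ?_ ?_ hr hs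
    · intro g g' h h' c
      have e1 : ren left (gen E) = ren g' (ren left (gen E)) := by
        rw [ren_ren]
        congr 2
        funext n
        exact (h' _ (by rintro ⟨a, ha⟩; exact left_ne_right n a ha.symm)).symm
      have e2 : ren right (ren g c) = ren g' (ren right c) := by
        rw [ren_ren, ren_ren]
        congr 2
        funext n
        exact (h n).symm
      simp only [LinearMap.comp_apply]
      rw [e2]
      nth_rw 1 [e1]
      rw [actC_ren]
    · intro T K c
      simp only [LinearMap.comp_apply, ren_addG, actC_addG_right]
    · intro D hD
      exact mem_valid_of_endsIn (valid_left_right hE hD) (star_gen_endsIn k E D)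
  · obtain ⟨z, hz⟩ := legRel_mem_locN hr hs
    refine cls_locN t' (z := right z) (locN_actC_right ?_ (locN_ren right_injective hz))
    exact named_ren (s := Set.univ) (t := {right z}ᶜ)
      (fun e _ (h : left e = right z) => left_ne_right e z h) (mem_named_univ _)

/-- The diagrams that are generators of one of the spaces of operator Weil diagrams. -/
def Good : Set (Diagram Leg) := {D | D.Valid ∧ Normal D.legs}

theorem opDiagrams_subset (t) : opDiagrams t ⊆ Good := fun _ hD =>
  ⟨(mem_opDiagrams.1 hD).1, (mem_opDiagrams.1 hD).2.1⟩

/-- The product `m` is given on diagrams by `star k`. -/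
def IsStar (k : ℚ) (m : Comb Leg →ₗ[ℚ] Comb Leg →ₗ[ℚ] Comb Leg) : Prop :=
  ∀ D ∈ Good, ∀ E ∈ Good, m (gen D) (gen E) = star k (gen D) (gen E)

theorem IsStar.eq {k m} (hm : IsStar k m) {c d : Comb Leg} (hc : c ∈ Finsupp.supported ℚ ℚ Good)
    (hd : d ∈ Finsupp.supported ℚ ℚ Good) : m c d = star k c d := by
  refine eq_of_gen (f := m.flip d) (g := (actC k).flip (ren right d) ∘ₗ ren left)
    (fun D hD => ?_) hc
  exact eq_of_gen (f := m (gen D)) (g := actC k (ren left (gen D)) ∘ₗ ren right)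
    (fun E hE => hm D hD E hE) hd

/-- The products are well defined: a relation in either factor stays a combination of local
relations after the operators which build the product have been applied. -/
theorem IsStar.wellDefined₂ {k m} (hm : IsStar k m) (q t t' t'') :
    WellDefined₂ (sp q t) (sp q t') (sp q t'') m := by
  refine wellDefined₂_of_rel (fun r hr hs E hE => ?_) (fun r hr hs E hE => ?_)
  · rw [hm.eq (Finsupp.supported_mono (opDiagrams_subset t) hs)
      (gen_mem_supported.2 (opDiagrams_subset t' hE))]
    exact cls_star_left hr hs hE.1
  · rw [hm.eq (gen_mem_supported.2 (opDiagrams_subset t hE))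
      (Finsupp.supported_mono (opDiagrams_subset t') hs)]
    exact cls_star_right hr hs hE.1

theorem actW_of_not_op {k} {w : List (Leg × ℕ)} (hw : ∀ x ∈ w, x.1.isOp = false) :
    actW k w = consW w := by
  induction w with
  | nil => exact LinearMap.ext fun c => (consW_nil c).symm
  | cons x w ih =>
    refine LinearMap.ext fun c => ?_
    rw [actW, LinearMap.comp_apply, ih fun a ha => hw a (by simp [ha]), consW_cons,
      act_of_not_op k (hw x (by simp))]

theorem sum_flatMap {α β : Type*} [AddCommMonoid β] (f : α → List β) (l : List α) :
    (l.flatMap f).sum = (l.map fun a => (f a).sum).sum := by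
  induction l with
  | nil => rfl
  | cons a l ih => simp [ih]

/-- Pushing operator legs through a word, term by term, is the action of these legs with `k = 1`. -/
theorem pushAll_eq (os : List (Leg × ℕ)) (hos : ∀ x ∈ os, x.1.isOp) (T K) (w : List (Leg × ℕ)) :
    ((pushAll os w).map fun t => t.1 • (gen ⟨T, K + t.2.1, t.2.2⟩ : Comb Leg)).sum =
      actW 1 os (gen ⟨T, K, w⟩) := by
  have hpush : ∀ (o : Leg × ℕ) (T K) (w : List (Leg × ℕ)),
      ((push o w).map fun t => t.1 • (gen ⟨T, K + t.2.1, t.2.2⟩ : Comb Leg)).sum =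
        pushC 1 o (gen ⟨T, K, w⟩) := by
    intro o T K w
    induction w with
    | nil => simp [push]
    | cons x w ih =>
      rw [← consL_gen x ⟨T, K, w⟩, push]
      cases hx : x.1.isOp
      · rw [pushC_consL _ _ hx, ← ih]
        simp only [Bool.false_eq_true, if_false, List.map_append, List.sum_append, List.map_map]
        congr 1
        · rw [map_list_sum, List.smul_sum, List.map_map, List.map_map]
          congr 2
          funext t
          simp [mul_smul]
        · split_ifs
          · simp [add_comm K, ← Multiset.singleton_add]
          · simp
      · rw [pushC_consL_op _ _ hx]
        simp
  induction os with
  | nil => simp [pushAll, actW]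
  | cons o os ih =>
    rw [actW, LinearMap.comp_apply, ← ih fun a ha => hos a (by simp [ha]), map_list_sum,
      List.map_map, pushAll, act_of_op 1 (hos o (by simp))]
    rw [List.map_flatMap, sum_flatMap]
    congr 2
    funext t
    simp only [Function.comp_apply, map_smul, ← hpush, List.smul_sum, List.map_map]
    congr 2
    funext s
    simp only [Function.comp_apply, mul_smul, ← Multiset.coe_add]
    rw [add_assoc, add_comm (t.2.1 : Multiset (ℕ × ℕ))]

theorem body_not_op (w : List (Leg × ℕ)) : ∀ x ∈ body w, x.1.isOp = false := by
  intro x hx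
  simpa [body] using (List.mem_filter.1 hx).2

theorem ops_isOp (w : List (Leg × ℕ)) : ∀ x ∈ ops w, x.1.isOp := by
  intro x hx
  simpa [ops] using (List.mem_filter.1 hx).2

theorem normal_rename {D : Diagram Leg} (f : ℕ → ℕ) (h : Normal D.legs) :
    Normal (D.rename f).legs := List.pairwise_map.2 h

theorem isStar_operate : IsStar 1 operate := by
  intro D hD E _
  have h := (normal_iff _).2 (normal_rename left hD.2)
  rw [star, ren_gen, ren_gen, actC_gen, h, actW_append, actW_of_not_op (body_not_op _),
    operate, extend₂_gen]
  simp only [LinearMap.comp_apply]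
  rw [← pushAll_eq _ (ops_isOp _), map_list_sum, map_list_sum, List.map_map, List.map_map]
  congr 2
  funext t
  simp [add_assoc]

theorem pushC_zero_consW {o : Leg × ℕ} {b : List (Leg × ℕ)}
    (hb : ∀ x ∈ b, x.1.isOp = false) (c : Comb Leg) :
    pushC 0 o (consW b c) = (-1 : ℚ) ^ (o.1.grade * weight b) • consW b (pushC 0 o c) := by
  induction b with
  | nil => simp [weight]
  | cons x b ih =>
    rw [consW_cons, pushC_consL _ _ (hb x (by simp)), ih fun a ha => hb a (by simp [ha]),
      consW_cons]
    simp [weight, sgn, mul_add, pow_add, mul_smul]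

/-- Without gluings, operator legs which are moved to the operator legs on the right give a sign
only. -/
theorem actW_zero_of_isOp {u b : List (Leg × ℕ)} (hu : ∀ x ∈ u, x.1.isOp)
    (hb : ∀ x ∈ b, x.1.isOp = false) (T K) {o : List (Leg × ℕ)} (ho : ∀ x ∈ o, x.1.isOp) :
    actW 0 u (gen ⟨T, K, b ++ o⟩) =
      (-1 : ℚ) ^ (weight u * weight b) • gen ⟨T, K, b ++ (u ++ o)⟩ := by
  induction u with
  | nil => simp [actW, weight]
  | cons x u ih =>
    rw [actW, LinearMap.comp_apply, ih fun a ha => hu a (by simp [ha]),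
      act_of_op 0 (hu x (by simp)), map_smul]
    have h1 : (gen ⟨T, K, b ++ (u ++ o)⟩ : Comb Leg) = consW b (gen ⟨T, K, u ++ o⟩) := by simp
    have h2 : pushC 0 x (gen ⟨T, K, u ++ o⟩) = gen ⟨T, K, x :: (u ++ o)⟩ := by
      have : ∀ y ∈ u ++ o, y.1.isOp := fun y hy => by
        rcases List.mem_append.1 hy with hy | hy
        · exact hu y (by simp [hy])
        · exact ho y hy
      revert this
      rcases u ++ o with _ | ⟨y, w⟩
      · intro _; simp
      · intro this
        rw [← consL_gen y ⟨T, K, w⟩, pushC_consL_op 0 x (this y (by simp))]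
        simp
    rw [h1, pushC_zero_consW hb, h2]
    rw [smul_smul, ← pow_add]
    simp only [consW_gen, weight, List.map_cons, List.sum_cons, List.cons_append]
    congr 2
    ring

theorem isStar_hash : IsStar 0 hash := by
  intro D hD E hE
  have h := (normal_iff _).2 (normal_rename left hD.2)
  have h' := (normal_iff _).2 (normal_rename right hE.2)
  have h3 : (gen (E.rename right) : Comb Leg) = gen ⟨(E.rename right).tri, (E.rename right).link,
      body (E.rename right).legs ++ ops (E.rename right).legs⟩ := by rw [← h']
  rw [star, ren_gen, ren_gen, actC_gen, h, actW_append, actW_of_not_op (body_not_op _), h3,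
    hash, extend₂_gen]
  simp only [LinearMap.comp_apply]
  rw [actW_zero_of_isOp (ops_isOp _) (body_not_op _) _ _ (ops_isOp _)]
  simp

end Weil

namespace Weil

variable {L M : Type}

/-! ### Gluing legs of grade 1 in pairs -/

/-- The pairing of the positions of `w`, as a pairing of the positions of `x :: w`. -/
def shiftPair (n : ℕ) : Fin n × Fin n ↪ Fin (n + 1) × Fin (n + 1) :=
  (Fin.succEmb n).prodMap (Fin.succEmb n)

@[simp] theorem shiftPair_apply {n} (p : Fin n × Fin n) :
    shiftPair n p = (p.1.succ, p.2.succ) := rfl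

open Classical in
/-- The pairings of `x :: w` in terms of those of `w`: the first leg is unpaired or it is paired
with one of the legs that `P` leaves unpaired. -/
def extendPairing {n : ℕ} (P : Finset (Fin n × Fin n)) : Option (Fin n) →
    Finset (Fin (n + 1) × Fin (n + 1))
  | none => P.map (shiftPair n)
  | some j => insert (0, j.succ) (P.map (shiftPair n))

theorem mem_extendPairing_none {n} {P : Finset (Fin n × Fin n)} {p} :
    p ∈ extendPairing P none ↔ ∃ q ∈ P, (q.1.succ, q.2.succ) = p := by
  simp [extendPairing]

theorem mem_extendPairing_some {n} {P : Finset (Fin n × Fin n)} {j p} :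
    p ∈ extendPairing P (some j) ↔ p = (0, j.succ) ∨ ∃ q ∈ P, (q.1.succ, q.2.succ) = p := by
  simp [extendPairing]

theorem shift_mem_extendPairing {n} {P : Finset (Fin n × Fin n)} {o} {q : Fin n × Fin n} :
    (q.1.succ, q.2.succ) ∈ extendPairing P o ↔ q ∈ P := by
  cases o with
  | none => simp [mem_extendPairing_none]
  | some j => simp [mem_extendPairing_some, Fin.succ_ne_zero]

theorem unpaired_extendPairing_none {n} {P : Finset (Fin n × Fin n)} {k : Fin n} :
    Unpaired (extendPairing P none) k.succ ↔ Unpaired P k := by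
  simp only [Unpaired, extendPairing, Finset.forall_mem_map, shiftPair_apply, ne_eq, Fin.succ_inj]

theorem unpaired_extendPairing_none_zero {n} {P : Finset (Fin n × Fin n)} :
    Unpaired (extendPairing P none) 0 := by
  simp only [Unpaired, extendPairing, Finset.forall_mem_map, shiftPair_apply, ne_eq,
    Fin.succ_ne_zero, not_false_eq_true, and_self, implies_true]

theorem unpaired_extendPairing_some {n} {P : Finset (Fin n × Fin n)} {j k : Fin n} :
    Unpaired (extendPairing P (some j)) k.succ ↔ Unpaired P k ∧ k ≠ j := by
  simp only [Unpaired, extendPairing, Finset.forall_mem_insert, Finset.forall_mem_map,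
    shiftPair_apply, ne_eq, Fin.succ_inj, (Fin.succ_ne_zero k).symm, not_false_eq_true, true_and]
  rw [and_comm, eq_comm]

theorem unpaired_extendPairing_some_zero {n} {P : Finset (Fin n × Fin n)} {j : Fin n} :
    ¬ Unpaired (extendPairing P (some j)) 0 := by
  simp [Unpaired, extendPairing]

open Classical in
/-- The positions of the legs with which a new first leg `x` may be paired. -/
def partners (x : Leg × ℕ) (w : List (Leg × ℕ)) (P : Finset (Fin w.length × Fin w.length)) :
    Finset (Option (Fin w.length)) :=
  insert none ((Finset.univ.filter fun j => x.1 = .one ∧ Unpaired P j ∧ (w.get j).1 = .one).map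
    Function.Embedding.some)

theorem some_mem_partners {x : Leg × ℕ} {w P j} : some j ∈ partners x w P ↔
    x.1 = .one ∧ Unpaired P j ∧ (w.get j).1 = .one := by
  simp [partners]

theorem none_mem_partners {x : Leg × ℕ} {w P} : none ∈ partners x w P := by
  simp [partners]

theorem mem_pairings {w : List (Leg × ℕ)} {P} : P ∈ pairings w ↔
    (∀ p ∈ P, p.1 < p.2 ∧ (w.get p.1).1 = .one ∧ (w.get p.2).1 = .one) ∧
    (∀ p ∈ P, ∀ q ∈ P, p ≠ q → p.1 ≠ q.1 ∧ p.1 ≠ q.2 ∧ p.2 ≠ q.1 ∧ p.2 ≠ q.2) := by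
  simp [pairings]

theorem extendPairing_mem_pairings {x : Leg × ℕ} {w P} (hP : P ∈ pairings w)
    {o} (ho : o ∈ partners x w P) :
    (extendPairing P o : Finset (Fin (x :: w).length × Fin (x :: w).length)) ∈
      pairings (x :: w) := by
  rw [mem_pairings] at hP ⊢
  have key : ∀ q ∈ P, ∀ q' ∈ P, ((q.1.succ, q.2.succ) : Fin (w.length + 1) × Fin (w.length + 1)) ≠
      (q'.1.succ, q'.2.succ) → q.1.succ ≠ q'.1.succ ∧ q.1.succ ≠ q'.2.succ ∧ q.2.succ ≠ q'.1.succ ∧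
      q.2.succ ≠ q'.2.succ := by
    intro q hq q' hq' h
    have h' : q ≠ q' := by rintro rfl; exact h rfl
    simpa using hP.2 q hq q' hq' h'
  cases o with
  | none =>
    constructor
    · intro p hp
      obtain ⟨q, hq, rfl⟩ := mem_extendPairing_none.1 hp
      exact ⟨Fin.succ_lt_succ_iff.2 (hP.1 q hq).1, (hP.1 q hq).2⟩
    · intro p hp p' hp' h
      obtain ⟨q, hq, rfl⟩ := mem_extendPairing_none.1 hp
      obtain ⟨q', hq', rfl⟩ := mem_extendPairing_none.1 hp'
      exact key q hq q' hq' h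
  | some j =>
    obtain ⟨hx, hj, hj'⟩ := some_mem_partners.1 ho
    have hj0 : ∀ q ∈ P, q.1.succ ≠ j.succ ∧ q.2.succ ≠ j.succ := fun q hq => by
      simpa using hj q hq
    constructor
    · intro p hp
      obtain rfl | ⟨q, hq, rfl⟩ := mem_extendPairing_some.1 hp
      · exact ⟨Fin.succ_pos j, hx, hj'⟩
      · exact ⟨Fin.succ_lt_succ_iff.2 (hP.1 q hq).1, (hP.1 q hq).2⟩
    · intro p hp p' hp' h
      obtain rfl | ⟨q, hq, rfl⟩ := mem_extendPairing_some.1 hp <;>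
        obtain rfl | ⟨q', hq', rfl⟩ := mem_extendPairing_some.1 hp'
      · exact absurd rfl h
      · exact ⟨(Fin.succ_ne_zero _).symm, (Fin.succ_ne_zero _).symm, (hj0 q' hq').1.symm,
          (hj0 q' hq').2.symm⟩
      · exact ⟨Fin.succ_ne_zero _, (hj0 q hq).1, Fin.succ_ne_zero _, (hj0 q hq).2⟩
      · exact key q hq q' hq' h

/-- Every pairing of the legs of a word arises from a pairing of all legs but the first, by choosing
a partner of the first leg, or none. -/
theorem exists_extendPairing {x : Leg × ℕ} {w : List (Leg × ℕ)}
    {Q : Finset (Fin (x :: w).length × Fin (x :: w).length)} (hQ : Q ∈ pairings (x :: w)) :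
    ∃ P ∈ pairings w, ∃ o ∈ partners x w P, extendPairing P o = Q := by
  classical
  rw [mem_pairings] at hQ
  let P : Finset (Fin w.length × Fin w.length) :=
    Finset.univ.filter fun p => (p.1.succ, p.2.succ) ∈ Q
  have hP : ∀ p, p ∈ P ↔ (p.1.succ, p.2.succ) ∈ Q := by simp [P]
  have succ_of_ne : ∀ p ∈ Q, p.1 ≠ 0 → ∃ q ∈ P, (q.1.succ, q.2.succ) = p := by
    rintro ⟨a, b⟩ hp h0
    have hlt : a < b := (hQ.1 _ hp).1
    obtain ⟨a', rfl⟩ := Fin.exists_succ_eq.2 h0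
    obtain ⟨b', rfl⟩ := Fin.exists_succ_eq.2 (Fin.ne_zero_of_lt hlt)
    exact ⟨(a', b'), (hP _).2 hp, rfl⟩
  refine ⟨P, mem_pairings.2 ⟨fun p hp => ?_, fun p hp q hq h => ?_⟩, ?_⟩
  · have := hQ.1 _ ((hP p).1 hp)
    exact ⟨Fin.succ_lt_succ_iff.1 this.1, this.2⟩
  · have := hQ.2 _ ((hP p).1 hp) _ ((hP q).1 hq) (fun h' => h (by
      simp only [Prod.mk.injEq, Fin.succ_inj] at h'; exact Prod.ext h'.1 h'.2))
    simpa using this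
  · by_cases h0 : ∃ j : Fin w.length, ((0, j.succ) : Fin (w.length + 1) × Fin (w.length + 1)) ∈ Q
    · obtain ⟨j, hj⟩ := h0
      have h1 := hQ.1 _ hj
      refine ⟨some j, some_mem_partners.2 ⟨h1.2.1, fun p hp => ?_, h1.2.2⟩, ?_⟩
      · have := hQ.2 _ ((hP p).1 hp) _ hj (by simp [Fin.succ_ne_zero])
        simp only [ne_eq, Fin.succ_inj] at this
        exact ⟨this.2.1, this.2.2.2⟩
      · ext p
        rw [mem_extendPairing_some]
        constructor
        · rintro (rfl | ⟨q, hq, rfl⟩)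
          · exact hj
          · exact (hP q).1 hq
        · intro hp
          by_cases hp0 : p.1 = 0
          · left
            by_contra hne
            exact (hQ.2 _ hp _ hj hne).1 hp0
          · exact Or.inr (succ_of_ne p hp hp0)
    · refine ⟨none, none_mem_partners, ?_⟩
      ext p
      rw [mem_extendPairing_none]
      constructor
      · rintro ⟨q, hq, rfl⟩
        exact (hP q).1 hq
      · intro hp
        refine succ_of_ne p hp fun hp0 => h0 ?_
        obtain ⟨a, b⟩ := p
        obtain ⟨b', rfl⟩ := Fin.exists_succ_eq.2 (Fin.ne_zero_of_lt (hQ.1 _ hp).1)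
        exact ⟨b', by simpa [show a = 0 from hp0] using hp⟩

theorem extendPairing_injective {n} {P P' : Finset (Fin n × Fin n)} {o o'}
    (h : extendPairing P o = extendPairing P' o') : P = P' ∧ o = o' := by
  have h1 : P = P' := by
    ext q
    rw [← shift_mem_extendPairing (o := o), h, shift_mem_extendPairing]
  refine ⟨h1, ?_⟩
  have key : ∀ j P o, (0, j.succ) ∈ extendPairing (n := n) P o ↔ o = some j := by
    intro j P o
    cases o with
    | none => simp [mem_extendPairing_none, Fin.succ_ne_zero]
    | some i => simp [mem_extendPairing_some, Fin.succ_ne_zero, eq_comm]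
  ext j
  rw [← key j P o, h, key]

open Classical in
theorem crossings_eq_sum (w : List (Leg × ℕ)) (P) : crossings w P =
    (∑ p ∈ P, ∑ q ∈ P, if p.1 < q.1 ∧ q.1 < p.2 ∧ p.2 < q.2 then 1 else 0) +
    ∑ p ∈ P, ∑ k, if Unpaired P k ∧ (w.get k).1.grade = 1 ∧ p.1 < k ∧ k < p.2 then 1 else 0 := by
  rw [crossings, Finset.card_filter, Finset.card_filter, Finset.sum_product, Finset.sum_product]

theorem crossings_extendPairing_none (x : Leg × ℕ) (w : List (Leg × ℕ)) (P) :
    crossings (x :: w) (extendPairing P none) = crossings w P := by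
  classical
  rw [crossings_eq_sum, crossings_eq_sum]
  rw [show extendPairing P none = P.map (shiftPair _) from rfl]
  simp only [Finset.sum_map]
  congr 1
  · simp
  · refine Finset.sum_congr rfl fun p _ => ?_
    refine (Fin.sum_univ_succ _).trans ?_
    simp only [shiftPair_apply, Fin.not_lt_zero, false_and, and_false, if_false, zero_add,
      Fin.succ_lt_succ_iff]
    refine Finset.sum_congr rfl fun k _ => ?_
    have := unpaired_extendPairing_none (P := P) (k := k)
    rw [show extendPairing P none = P.map (shiftPair _) from rfl] at this
    simp only [this]
    rfl

open Classical in
/-- The arc from a new first leg to the leg `j` crosses the unpaired lines before `j`, and its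
crossings with the arcs over `j` make up for the crossings of these arcs with the line `j`. -/
theorem crossings_extendPairing_some (x : Leg × ℕ) (w : List (Leg × ℕ)) (P) {j}
    (hj : Unpaired P j) (hj' : (w.get j).1 = .one) :
    crossings (x :: w) (extendPairing P (some j)) = crossings w P +
      ∑ k, if Unpaired P k ∧ (w.get k).1.grade = 1 ∧ k < j then 1 else 0 := by
  rw [crossings_eq_sum, crossings_eq_sum]
  have h0 : ((0, j.succ) : Fin (w.length + 1) × Fin (w.length + 1)) ∉
      P.map (shiftPair w.length) := by simp [Fin.succ_ne_zero]
  have hu := fun k => unpaired_extendPairing_some (P := P) (j := j) (k := k)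
  have hu0 := unpaired_extendPairing_some_zero (P := P) (j := j)
  have he : extendPairing P (some j) = insert (0, j.succ) (P.map (shiftPair w.length)) := by
    simp only [extendPairing]
  have hmove : ∀ p ∈ P, (∑ k, if Unpaired P k ∧ (w.get k).1.grade = 1 ∧ p.1 < k ∧ k < p.2
      then 1 else 0) = (if p.1 < j ∧ j < p.2 then 1 else 0) +
      ∑ k, if (Unpaired P k ∧ k ≠ j) ∧ (w.get k).1.grade = 1 ∧ p.1 < k ∧ k < p.2
        then 1 else 0 := by
    intro p _
    rw [← Finset.add_sum_erase _ _ (Finset.mem_univ j), ← Finset.add_sum_erase (a := j) _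
      (fun k => if (Unpaired P k ∧ k ≠ j) ∧ (w.get k).1.grade = 1 ∧ p.1 < k ∧ k < p.2
        then 1 else 0) (Finset.mem_univ j)]
    have hg : (w.get j).1.grade = 1 := by rw [hj']; rfl
    simp only [hj, hg, ne_eq, not_true_eq_false, and_false, false_and, if_false, true_and, zero_add]
    congr 1
    refine Finset.sum_congr rfl fun k hk => ?_
    simp [Finset.ne_of_mem_erase hk]
  have second : ∀ p : Fin (w.length + 1) × Fin (w.length + 1),
      (∑ k : Fin (x :: w).length, if Unpaired (extendPairing P (some j)) k ∧
        ((x :: w).get k).1.grade = 1 ∧ p.1 < k ∧ k < p.2 then 1 else 0) =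
      ∑ k : Fin w.length, if (Unpaired P k ∧ k ≠ j) ∧ (w.get k).1.grade = 1 ∧ p.1 < k.succ ∧
        k.succ < p.2 then 1 else 0 := by
    intro p
    refine (Fin.sum_univ_succ _).trans ?_
    rw [if_neg (fun h => hu0 h.1), zero_add]
    refine Finset.sum_congr rfl fun k _ => ?_
    simp only [hu]
    rfl
  have first : (∑ p ∈ extendPairing P (some j), ∑ q ∈ extendPairing P (some j),
      if p.1 < q.1 ∧ q.1 < p.2 ∧ p.2 < q.2 then 1 else 0 : ℕ) =
      (∑ q ∈ P, if q.1 < j ∧ j < q.2 then 1 else 0) +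
        ∑ p ∈ P, ∑ q ∈ P, if p.1 < q.1 ∧ q.1 < p.2 ∧ p.2 < q.2 then 1 else 0 := by
    rw [he, Finset.sum_insert h0]
    simp only [Finset.sum_map, shiftPair_apply, Finset.sum_insert h0, Fin.succ_lt_succ_iff,
      Fin.succ_pos, Fin.not_lt_zero, false_and, if_false, true_and, lt_irrefl, zero_add]
  refine (congrArg₂ (· + ·) first (Finset.sum_congr rfl fun p _ => second p)).trans ?_
  rw [he, Finset.sum_insert h0]
  simp only [Finset.sum_map, shiftPair_apply, Fin.succ_lt_succ_iff, Fin.succ_pos, true_and]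
  rw [Finset.sum_congr rfl hmove, Finset.sum_add_distrib]
  have e : ∀ k, (if (Unpaired P k ∧ k ≠ j) ∧ (w.get k).1.grade = 1 ∧ k < j then 1 else 0 : ℕ) =
      if Unpaired P k ∧ (w.get k).1.grade = 1 ∧ k < j then 1 else 0 := by
    intro k
    refine if_congr ?_ rfl rfl
    constructor
    · rintro ⟨⟨a, _⟩, b, c⟩; exact ⟨a, b, c⟩
    · rintro ⟨a, b, c⟩; exact ⟨⟨a, c.ne⟩, b, c⟩
  simp only [e]
  ring

/-- The contraction of a grade 1 leg on the edge `e` with the (ordinary) grade 1 legs. -/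
def oneCoeff : Leg → ℚ
  | .one => 1
  | _ => 0

open Classical in
theorem ctr_map_list {n : ℕ} (m : Leg → ℚ) (e) (T K) (v : Fin n → Leg × ℕ) {l : List (Fin n)}
    (hl : l.Pairwise (· < ·)) :
    ctr m 1 e (gen ⟨T, K, l.map v⟩) =
      ∑ j ∈ l.toFinset, (m (v j).1 * (-1) ^ (l.filter fun k => (v k).1.grade = 1 ∧ k < j).length) •
        gen ⟨T, (e, (v j).2) ::ₘ K, (l.filter (· ≠ j)).map v⟩ := by
  induction l with
  | nil => simp
  | cons i l ih =>
    have hi := (List.pairwise_cons.1 hl).1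
    have hi' : i ∉ l.toFinset := fun h => lt_irrefl _ (hi i (by simpa using h))
    rw [List.map_cons, ← consL_gen (v i) ⟨T, K, l.map v⟩, ctr_consL,
      ih (List.pairwise_cons.1 hl).2, List.toFinset_cons, Finset.sum_insert hi']
    congr 1
    · have h1 : (i :: l).filter (fun k => decide ((v k).1.grade = 1 ∧ k < i)) = [] := by
        rw [List.filter_eq_nil_iff]
        intro k hk
        rcases List.mem_cons.1 hk with rfl | hk
        · simp
        · simp [(hi k hk).not_gt]
      have h2 : (i :: l).filter (fun k => decide (k ≠ i)) = l := by
        rw [List.filter_cons_of_neg (by simp), List.filter_eq_self]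
        intro k hk
        simpa using (hi k hk).ne'
      rw [h1, h2]
      simp
    · rw [map_sum, Finset.smul_sum]
      refine Finset.sum_congr rfl fun j hj => ?_
      have hj' := hi j (by simpa using hj)
      have h2 : (i :: l).filter (fun k => decide (k ≠ j)) =
          i :: l.filter (fun k => decide (k ≠ j)) := by
        rw [List.filter_cons_of_pos (by simpa using hj'.ne)]
      have h1 : (-1 : ℚ) ^ ((i :: l).filter fun k => decide ((v k).1.grade = 1 ∧ k < j)).length =
          (-1) ^ (1 * (v i).1.grade) *
            (-1) ^ (l.filter fun k => decide ((v k).1.grade = 1 ∧ k < j)).length := by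
        have hg : ∀ y : Leg, y.grade = 1 ∨ y.grade = 2 := by rintro (_ | _ | (_ | _) | (_ | _)) <;> decide
        rcases hg (v i).1 with h | h
        · rw [List.filter_cons_of_pos (by simp [h, hj'])]
          simp [h, pow_succ]
        · rw [List.filter_cons_of_neg (by simp [h])]
          simp [h]
      rw [h1, h2, map_smul, consL_gen, smul_smul]
      congr 1
      ring

open Classical in
/-- The term of `λ` that belongs to the pairing `P`. -/
def lamTerm (T : Multiset (ℕ × ℕ × ℕ)) (K : Multiset (ℕ × ℕ)) (w : List (Leg × ℕ))
    (P : Finset (Fin w.length × Fin w.length)) : Comb Leg :=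
  ((-1) ^ crossings w P * (1 / 2) ^ P.card : ℚ) •
    gen ⟨T, K + P.val.map (fun p => ((w.get p.1).2, (w.get p.2).2)),
      ((List.finRange w.length).filter fun k => Unpaired P k).map w.get⟩

theorem lam_gen (D : Diagram Leg) :
    lam (gen D) = ∑ P ∈ pairings D.legs, lamTerm D.tri D.link D.legs P := by
  rw [lam, extend_gen]; rfl

theorem lamTerm_extendPairing_none (T K x w P) :
    lamTerm T K (x :: w) (extendPairing P none) = consL x (lamTerm T K w P) := by
  classical
  unfold lamTerm
  rw [crossings_extendPairing_none, map_smul, consL_gen]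
  have h1 : (extendPairing P none).card = P.card := by simp [extendPairing]
  rw [h1]
  congr 3
  · simp only [extendPairing, Finset.map_val, Multiset.map_map]
    rfl
  · have := List.finRange_succ (n := w.length)
    rw [show List.finRange (x :: w).length = List.finRange (w.length + 1) from rfl, this]
    rw [List.filter_cons_of_pos (by simpa using unpaired_extendPairing_none_zero),
      List.filter_map, List.map_cons, List.map_map]
    simp only [Function.comp_def, unpaired_extendPairing_none]
    rfl

open Classical in
/-- The terms of `λ` in which the first leg is glued are the contractions of this leg with the terms
of `λ` for the remaining legs. -/
theorem sum_lamTerm_extendPairing_some (T K) {x : Leg × ℕ} (hx : x.1 = .one) (w P) :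
    ∑ j with x.1 = .one ∧ Unpaired P j ∧ (w.get j).1 = .one,
        lamTerm T K (x :: w) (extendPairing P (some j)) =
      (1 / 2 : ℚ) • ctr oneCoeff 1 x.2 (lamTerm T K w P) := by
  unfold lamTerm
  rw [map_smul, ctr_map_list _ _ _ _ _ ((List.pairwise_lt_finRange _).filter _), Finset.smul_sum,
    Finset.smul_sum]
  have hsub : (Finset.univ.filter fun j => x.1 = .one ∧ Unpaired P j ∧ (w.get j).1 = .one) ⊆
      ((List.finRange w.length).filter fun k => Unpaired P k).toFinset := by
    intro j hj
    simp only [Finset.mem_filter, Finset.mem_univ, true_and] at hj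
    simp [hj.2.1]
  rw [← Finset.sum_subset hsub]
  · refine Finset.sum_congr rfl fun j hj => ?_
    simp only [Finset.mem_filter, Finset.mem_univ, true_and] at hj
    obtain ⟨-, hj, hj'⟩ := hj
    have h0 : ((0, j.succ) : Fin (w.length + 1) × Fin (w.length + 1)) ∉
        P.map (shiftPair w.length) := by simp [Fin.succ_ne_zero]
    have hcard : (extendPairing P (some j)).card = P.card + 1 := by
      simp only [extendPairing, Finset.card_insert_of_notMem h0, Finset.card_map]
    have hval : (extendPairing P (some j)).val.map
        (fun p : Fin (w.length + 1) × Fin (w.length + 1) =>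
          (((x :: w).get p.1).2, ((x :: w).get p.2).2)) =
        (x.2, (w.get j).2) ::ₘ P.val.map (fun p => ((w.get p.1).2, (w.get p.2).2)) := by
      simp only [extendPairing, Finset.insert_val_of_notMem h0, Multiset.map_cons, Finset.map_val,
        Multiset.map_map]
      rfl
    have hlist : ((List.finRange (x :: w).length).filter
          fun k => Unpaired (extendPairing P (some j)) k).map (x :: w).get =
        (((List.finRange w.length).filter fun k => Unpaired P k).filter (· ≠ j)).map w.get := by
      have := List.finRange_succ (n := w.length)
      rw [show List.finRange (x :: w).length = List.finRange (w.length + 1) from rfl, this,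
        List.filter_cons_of_neg (by simpa using unpaired_extendPairing_some_zero), List.filter_map,
        List.map_map, List.filter_filter]
      simp only [Function.comp_def, unpaired_extendPairing_some]
      congr 2
      funext k
      simp [and_comm]
    have hlen : (((List.finRange w.length).filter fun k => Unpaired P k).filter fun k =>
        (w.get k).1.grade = 1 ∧ k < j).length =
        ∑ k, if Unpaired P k ∧ (w.get k).1.grade = 1 ∧ k < j then 1 else 0 := by
      rw [← Finset.card_filter, List.filter_filter, ← List.toFinset_card_of_nodup
        ((List.nodup_finRange _).filter _)]
      congr 1
      ext k
      simp [and_comm]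
    rw [crossings_extendPairing_some x w P hj hj', hcard, hlen, hj', smul_smul, smul_smul]
    congr 1
    · simp only [oneCoeff, pow_add]
      ring
    · congr 1
      simp only [Diagram.mk.injEq, true_and]
      refine ⟨?_, hlist⟩
      rw [← Multiset.add_cons]
      exact congrArg _ hval
  · intro j hj hj'
    have : oneCoeff (w.get j).1 = 0 := by
      simp only [Finset.mem_filter, Finset.mem_univ, true_and, hx, not_and] at hj'
      have hj'' := hj' (by simpa using hj)
      generalize (w.get j).1 = l at *
      cases l <;> simp_all [oneCoeff]
    rw [this]
    simp

@[simp] theorem lam_gen_nil (T K) : lam (gen ⟨T, K, []⟩) = gen ⟨T, K, []⟩ := by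
  rw [lam_gen]
  have h : pairings ([] : List (Leg × ℕ)) = {∅} := by
    ext P
    rw [Finset.mem_singleton, Finset.eq_empty_iff_forall_notMem]
    constructor
    · intro _ p
      exact p.1.elim0
    · intro h
      rw [mem_pairings]
      exact ⟨fun p => p.1.elim0, fun p => p.1.elim0⟩
  have h2 : crossings ([] : List (Leg × ℕ)) ∅ = 0 := by simp [crossings]
  simp only [h, Finset.sum_singleton]
  simp [lamTerm, h2]

/-- The recursion for `λ`: the first leg is left alone, or it is glued to another one. -/
theorem lam_consL (x) (c : Comb Leg) : lam (consL x c) =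
    consL x (lam c) + (if x.1 = .one then (1 / 2 : ℚ) else 0) • ctr oneCoeff 1 x.2 (lam c) := by
  classical
  refine LinearMap.congr_fun (f := lam ∘ₗ consL x) (g := consL x ∘ₗ lam +
    (if x.1 = .one then (1 / 2 : ℚ) else 0) • ctr oneCoeff 1 x.2 ∘ₗ lam) (comb_ext fun D => ?_) c
  obtain ⟨T, K, w⟩ := D
  simp only [LinearMap.comp_apply, LinearMap.add_apply, LinearMap.smul_apply, consL_gen]
  rw [lam_gen, lam_gen]
  simp only
  have h : ∑ Q ∈ pairings (x :: w), lamTerm T K (x :: w) Q = ∑ P ∈ pairings w,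
      ∑ o ∈ partners x w P, lamTerm T K (x :: w) (extendPairing P o) := by
    rw [Finset.sum_sigma']
    refine (Finset.sum_bij (fun a _ => extendPairing a.1 a.2) ?_ ?_ ?_ ?_).symm
    · rintro ⟨P, o⟩ ha
      rw [Finset.mem_sigma] at ha
      exact extendPairing_mem_pairings ha.1 ha.2
    · rintro ⟨P, o⟩ _ ⟨P', o'⟩ _ h
      obtain ⟨h1, h2⟩ := extendPairing_injective h
      simp only at h1 h2
      subst h1 h2
      rfl
    · intro Q hQ
      obtain ⟨P, hP, o, ho, h⟩ := exists_extendPairing hQ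
      exact ⟨⟨P, o⟩, Finset.mem_sigma.2 ⟨hP, ho⟩, h⟩
    · intro _ _; rfl
  rw [h, map_sum, map_sum, Finset.smul_sum, ← Finset.sum_add_distrib]
  refine Finset.sum_congr rfl fun P _ => ?_
  rw [partners, Finset.sum_insert (by simp), Finset.sum_map, lamTerm_extendPairing_none]
  congr 1
  by_cases hx : x.1 = .one
  · rw [if_pos hx]
    exact sum_lamTerm_extendPairing_some T K hx w P
  · rw [if_neg hx, zero_smul]
    simp [hx]

end Weil

namespace Weil

/-! ### The map `λ` respects the relations -/

variable {L M : Type}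

theorem grade_one : Leg.one.grade = 1 := rfl

theorem grade_two : Leg.two.grade = 2 := rfl

theorem contr_oneCoeff : Contr oneCoeff 1 := by
  refine ⟨fun y n h => ?_, rfl, fun p => rfl⟩
  cases y <;> simp_all [oneCoeff, Leg.grade]

theorem lam_addG (T K) (c : Comb Leg) : lam (addG T K c) = addG T K (lam c) := by
  refine LinearMap.congr_fun (f := lam ∘ₗ addG T K) (g := addG T K ∘ₗ lam)
    (comb_ind (fun T' K' => by simp) fun x T' K' w ih => ?_) c
  have := ih T' K'
  simp only [LinearMap.comp_apply] at this ⊢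
  rw [← consL_addG, lam_consL, lam_consL, this, ctr_addG, consL_addG,
    map_add, map_smul]

theorem lam_ren (f : ℕ → ℕ) (c : Comb Leg) : lam (ren f c) = ren f (lam c) := by
  refine LinearMap.congr_fun (f := lam ∘ₗ ren f) (g := ren f ∘ₗ lam)
    (comb_ind (fun T' K' => by simp [Diagram.rename]) fun x T' K' w ih => ?_) c
  have := ih T' K'
  simp only [LinearMap.comp_apply] at this ⊢
  rw [ren_consL, lam_consL, lam_consL, this, ctr_ren, map_add, map_smul,
    ren_consL]

theorem lam_endsIn (D : Diagram Leg) : lam (gen D) ∈ endsIn D.ends := by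
  obtain ⟨T, K, w⟩ := D
  induction w generalizing T K with
  | nil => rw [lam_gen_nil]; exact gen_mem_endsIn _
  | cons x w ih =>
    rw [← consL_gen x ⟨T, K, w⟩, lam_consL, ends_cons]
    refine Submodule.add_mem _ (endsIn_consL (ih T K) x) (Submodule.smul_mem _ _ ?_)
    refine map_mem_of_gen (fun E hE => ?_) (ih T K)
    have : E.ends = _ := hE
    rw [← this]
    exact ctr_endsIn _ _ _ _

theorem lam_named {s : Set ℕ} {c : Comb Leg} (hc : c ∈ named s) : lam c ∈ named s :=
  map_mem_of_gen (fun D hD => endsIn_named hD (lam_endsIn D)) hc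

/-- Differences of diagrams which differ in the direction of a bivalent point. -/
def linkN : Submodule ℚ (Comb L) :=
  Submodule.span ℚ {r | ∃ x y c, r = addG 0 {(x, y)} c - addG 0 {(y, x)} c}

theorem linkN_map {f : Comb L →ₗ[ℚ] Comb L} (hf : ∀ T K c, f (addG T K c) = addG T K (f c))
    {c} (hc : c ∈ linkN) : f c ∈ (linkN : Submodule ℚ (Comb L)) := by
  have : (linkN : Submodule ℚ (Comb L)) ≤ linkN.comap f := by
    refine Submodule.span_le.2 ?_
    rintro _ ⟨x, y, c, rfl⟩
    refine Submodule.subset_span ⟨x, y, f c, ?_⟩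
    rw [map_sub, hf, hf]
  exact this hc

/-- A link may be reversed: smoothing it leaves the same graph in both cases, up to the name of the
edge. -/
theorem GraphLike.cls_link_comm {P : Presentation L} (hP : GraphLike P) (x y : ℕ) (c : Comb L) :
    P.cls (addG 0 {(x, y)} c) = P.cls (addG 0 {(y, x)} c) := by
  refine LinearMap.congr_fun (f := P.cls ∘ₗ addG 0 {(x, y)}) (g := P.cls ∘ₗ addG 0 {(y, x)})
    (comb_ext fun D => ?_) c
  simp only [LinearMap.comp_apply]
  by_cases hxy : x = y
  · rw [hxy]
  have e1 : ∀ x y, addG 0 {(x, y)} (gen D) = gen ⟨D.tri, (x, y) ::ₘ D.link, D.legs⟩ := by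
    intro x y; simp
  by_cases hD : (⟨D.tri, (x, y) ::ₘ D.link, D.legs⟩ : Diagram L).Valid
  · have hc : ∀ e, e = x ∨ e = y → D.ends.count e = 1 := by
      intro e he
      have h2 : (x ::ₘ y ::ₘ D.ends).count e = 0 ∨ (x ::ₘ y ::ₘ D.ends).count e = 2 := by
        have := hD e
        rwa [ends_link] at this
      have hyx := Ne.symm hxy
      rw [Multiset.count_cons, Multiset.count_cons] at h2
      generalize D.ends.count e = n at h2
      rcases he with rfl | rfl
      · rw [if_pos rfl, if_neg hxy] at h2; omega
      · rw [if_pos rfl, if_neg hyx] at h2; omega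
    rw [hP.cls_smooth hxy (hc y (Or.inr rfl)), hP.cls_smooth (Ne.symm hxy) (hc x (Or.inl rfl)),
      ← hP.cls_ren_inj (Equiv.swap x y).injective, ren_ren]
    congr 3
    funext n
    simp only [Function.comp_apply]
    by_cases h1 : n = y
    · simp [h1, Ne.symm hxy]
    · by_cases h2 : n = x
      · simp [h1, h2]
      · rw [if_neg h1, if_neg h2, Equiv.swap_apply_of_ne_of_ne h2 h1]
  · have hD' : ¬ (⟨D.tri, (y, x) ::ₘ D.link, D.legs⟩ : Diagram L).Valid := by
      rw [valid_congr (E := ⟨D.tri, (x, y) ::ₘ D.link, D.legs⟩)]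
      · exact hD
      · rw [ends_link, ends_link, Multiset.cons_swap]
    rw [e1, e1, cls_gen_of_notMem fun h => hD (hP.valid _ h),
      cls_gen_of_notMem fun h => hD' (hP.valid _ h)]

theorem GraphLike.cls_linkN {P : Presentation L} (hP : GraphLike P) {c : Comb L}
    (hc : c ∈ linkN) : P.cls c = 0 := by
  have : (linkN : Submodule ℚ (Comb L)) ≤ LinearMap.ker P.cls := by
    refine Submodule.span_le.2 ?_
    rintro _ ⟨x, y, c, rfl⟩
    rw [SetLike.mem_coe, LinearMap.mem_ker, map_sub, hP.cls_link_comm, sub_self]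
  exact LinearMap.mem_ker.1 (this hc)

/-- The map `λ` respects the relations on legs. -/
theorem lam_locN {z} {c : Comb Leg} (hc : c ∈ locN 1 z) : lam c ∈ locN 0 z ⊔ linkN := by
  have prefix_mem : ∀ u : List (Leg × ℕ), (∀ a ∈ u, a.1.isOp = false) → (∀ a ∈ u, a.2 ≠ z) →
      ∀ c, lam c ∈ locN 0 z ⊔ linkN → lam (consW u c) ∈ locN 0 z ⊔ linkN := by
    intro u hu hu' c hc
    induction u with
    | nil => simpa using hc
    | cons x u ih =>
      obtain ⟨a, ha, b, hb, hab⟩ := Submodule.mem_sup.1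
        (ih (fun a ha => hu a (by simp [ha])) fun a ha => hu' a (by simp [ha]))
      rw [consW_cons, lam_consL, ← hab, map_add, map_add]
      refine Submodule.add_mem _ (Submodule.add_mem_sup (locN_consL (hu x (by simp))
        (hu' x (by simp)) ha) (linkN_map (consL_addG x) hb)) (Submodule.smul_mem _ _ ?_)
      exact Submodule.add_mem_sup (locN_ctr contr_oneCoeff (hu' x (by simp)) ha)
        (linkN_map (ctr_addG _ _ _) hb)
  refine span_map (fun r hr => ?_) hc
  cases hr with
  | stu u x y c hu hu' hx hy hc =>
    refine prefix_mem u hu hu' _ (Submodule.mem_sup_left (locN_of ?_))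
    have := LocRel.stu (q := 0) [] x y (lam c) (by simp) (by simp) hx hy (lam_named hc)
    rw [consW_nil] at this
    convert this using 1
    simp [stuHead, lam_consL, lam_addG]
  | swap u a b c hu hu' ha hb h =>
    refine prefix_mem u hu hu' _ (Submodule.mem_sup_left (locN_of ?_))
    have := LocRel.swap (q := 0) (z := z) [] a b (lam c) (by simp) (by simp) ha hb h
    rw [consW_nil] at this
    convert this using 1
    have hone : ¬ (a.1 = .one ∧ b.1 = .one) := by
      rintro ⟨h1, h2⟩
      rw [h1, h2] at h
      simp [SwapOK] at h
    have h0 : ∀ l : Leg, l ≠ .one → oneCoeff l = 0 := by rintro (_ | _ | _ | _) hl <;> simp_all [oneCoeff]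
    simp only [swapHead, LinearMap.sub_apply, LinearMap.comp_apply, map_sub, LinearMap.smul_apply,
      map_smul, lam_consL, map_add, ctr_consL]
    by_cases h1 : a.1 = .one
    · have h2 : b.1 ≠ .one := fun h2 => hone ⟨h1, h2⟩
      simp only [h1, h2, if_true, if_false, h0 _ h2, sgn]
      simp only [grade_one, one_mul, zero_smul, zero_add, add_zero, smul_add, smul_smul]
      module
    · by_cases h2 : b.1 = .one
      · simp only [h1, h2, if_true, if_false, h0 _ h1, sgn]
        have e := neg_one_pow_mul_self (a.1.grade)
        simp only [grade_one, one_mul, mul_one, zero_smul, zero_add, add_zero, smul_add, smul_smul]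
        rw [mul_comm (1 / 2 : ℚ), ← mul_assoc ((-1 : ℚ) ^ a.1.grade), e]
        module
      · simp only [h1, h2, if_false, zero_smul, add_zero]
  | cliff u x y c hu hu' =>
    refine prefix_mem u hu hu' _ ?_
    have := LocRel.cliff (q := 0) (z := z) [] x y (lam c) (by simp) (by simp)
    rw [consW_nil] at this
    have h2 : addG 0 {(x, y)} (lam c) - addG 0 {(y, x)} (lam c) ∈ (linkN : Submodule ℚ (Comb Leg)) :=
      Submodule.subset_span ⟨x, y, _, rfl⟩
    have h3 := ctr_ctr contr_oneCoeff.homog contr_oneCoeff.homog x y (lam c)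
    convert Submodule.add_mem_sup (locN_of this) (Submodule.smul_mem _ (-1 / 2 : ℚ) h2) using 1
    simp only [cliffHead, LinearMap.sub_apply, LinearMap.comp_apply, map_sub, LinearMap.smul_apply,
      map_smul, lam_consL, map_add, ctr_consL, LinearMap.add_apply, if_true, lam_addG, h3]
    simp only [Leg.grade, oneCoeff]
    module
  | op _ h =>
    obtain ⟨u, a, b, c, ha, hb⟩ := h
    refine Submodule.mem_sup_left (opN_le 0 z ?_)
    have h0 : lam (swapHead a b c) = swapHead a b (lam c) := by
      have hl : ∀ x : Leg × ℕ, x.1.isOp → ∀ c, lam (consL x c) = consL x (lam c) := by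
        intro x hx c
        obtain ⟨p, hp⟩ := eq_op_of_isOp hx
        rw [lam_consL, if_neg (by simp [hp]), zero_smul, add_zero]
      simp [swapHead, hl a ha, hl b hb]
    induction u with
    | nil =>
      rw [consW_nil, h0]
      simpa using opN_of (OpRel.mk [] a b (lam c) ha hb)
    | cons x u ih =>
      rw [consW_cons, lam_consL]
      exact Submodule.add_mem _ (opN_consL x ih) (Submodule.smul_mem _ _ (opN_ctr contr_oneCoeff ih))

/-- The map `λ` is well defined. Since `λ` of a diagram with a first leg `x` is obtained by adding
`x` or contracting it with half the legs of grade 1, the Clifford relation becomes the exterior one: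
the two contractions of neighbouring legs with each other contribute the joined diagram. -/
theorem wellDefined_lam (t t') : WellDefined (sp 1 t) (sp 0 t') lam := by
  refine wellDefined_of_rel fun r hr hs => ?_
  rcases hr with hr | hr
  · refine cls_graphRel (graphLike_sp 0 t') (P := sp 1 t) (fun D hD => hD.1) (ρ := id)
      Function.injective_id ?_ ?_ ?_ hr hs
    · intro g g' h _ c
      rw [lam_ren]
      congr 2
      funext n
      exact (h n).symm
    · intro T K c
      simp [lam_addG]
    · intro D hD
      exact mem_valid_of_endsIn hD (lam_endsIn D)
  · obtain ⟨z, hz⟩ := legRel_mem_locN hr hs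
    obtain ⟨a, ha, b, hb, hab⟩ := Submodule.mem_sup.1 (lam_locN hz)
    rw [← hab, map_add, cls_locN t' ha, (graphLike_sp 0 t').cls_linkN hb, add_zero]

theorem graphLike_spB : GraphLike spB :=
  ⟨fun _ h => Or.inl h, fun _ h => h, fun _ _ _ h _ => h⟩

theorem toPartialA_gen (D : Diagram Unit) :
    toPartialA (gen D) = gen ⟨D.tri, D.link, D.legs.map fun x => (.op .a, x.2)⟩ := by
  rw [toPartialA, extend_gen]

theorem toPartialA_endsIn (D : Diagram Unit) : toPartialA (gen D) ∈ endsIn D.ends := by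
  rw [toPartialA_gen]
  refine gen_mem_supported.2 ?_
  simp [Diagram.ends, Function.comp_def]

theorem wellDefined_toPartialA (t) : WellDefined spB (sp 0 t) toPartialA := by
  refine wellDefined_of_rel fun r hr hs => ?_
  rcases hr with hr | hr
  · refine cls_graphRel (graphLike_sp 0 t) (P := spB) (fun D hD => hD) (ρ := id)
      Function.injective_id ?_ ?_ ?_ hr hs
    · intro g g' h _ c
      obtain rfl : g' = g := funext h
      refine LinearMap.congr_fun (f := toPartialA ∘ₗ ren g') (g := ren g' ∘ₗ toPartialA)
        (comb_ext fun D => ?_) c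
      simp [toPartialA_gen, Diagram.rename, Function.comp_def]
    · intro T K c
      refine LinearMap.congr_fun (f := toPartialA ∘ₗ addG T K) (g := addG _ _ ∘ₗ toPartialA)
        (comb_ext fun D => ?_) c
      simp [toPartialA_gen]
    · intro D hD
      exact mem_valid_of_endsIn hD (toPartialA_endsIn D)
  · obtain ⟨T, K, u, v, p, q, x, y, -, rfl⟩ := hr
    rw [one_smul, map_sub, toPartialA_gen, toPartialA_gen]
    have h := cls_swap 0 t rfl T K (u.map fun x => (Leg.op .a, x.2)) (v.map fun x => (Leg.op .a, x.2))
      (.op .a, x) (.op .a, y) ?_ (Or.inr (Or.inr (Or.inr ⟨⟨_, rfl⟩, ⟨_, rfl⟩⟩)))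
    · have hs : sgn (.op .a) (.op .a) = 1 := by norm_num [sgn, Leg.grade, Param.grade]
      simpa [hs] using h
    · simp [Normal, List.pairwise_append]

end Weil

namespace Weil

variable {L M : Type}

/-! ### Graded averaging -/

/-- The sum of the lists obtained by inserting `x` into a list, with signs. -/
def insW (x : Leg × ℕ) (T : Multiset (ℕ × ℕ × ℕ)) (K : Multiset (ℕ × ℕ)) :
    List (Leg × ℕ) → Comb Leg
  | [] => gen ⟨T, K, [x]⟩
  | y :: w => gen ⟨T, K, x :: y :: w⟩ + sgn x.1 y.1 • consL y (insW x T K w)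

/-- Insertion of a leg in all possible places, with signs. -/
def ins (x : Leg × ℕ) : Comb Leg →ₗ[ℚ] Comb Leg :=
  extend fun D => insW x D.tri D.link D.legs

@[simp] theorem ins_nil (x T K) : ins x (gen ⟨T, K, []⟩) = gen ⟨T, K, [x]⟩ := by
  simp [ins, insW]

theorem ins_consL (x y) (c : Comb Leg) :
    ins x (consL y c) = consL x (consL y c) + sgn x.1 y.1 • consL y (ins x c) := by
  refine LinearMap.congr_fun (f := ins x ∘ₗ consL y)
    (g := consL x ∘ₗ consL y + sgn x.1 y.1 • consL y ∘ₗ ins x) (comb_ext fun D => ?_) c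
  simp [ins, insW]

theorem ins_addG (x T K) (c : Comb Leg) : ins x (addG T K c) = addG T K (ins x c) := by
  refine LinearMap.congr_fun (f := ins x ∘ₗ addG T K) (g := addG T K ∘ₗ ins x)
    (comb_ind (fun T' K' => by simp) fun y T' K' w ih => ?_) c
  have := ih T' K'
  simp only [LinearMap.comp_apply] at this ⊢
  rw [← consL_addG, ins_consL, ins_consL, this, map_add, map_smul, consL_addG, consL_addG,
    consL_addG]

theorem ins_ren (x : Leg × ℕ) (f : ℕ → ℕ) (c : Comb Leg) :
    ins (x.1, f x.2) (ren f c) = ren f (ins x c) := by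
  refine LinearMap.congr_fun (f := ins (x.1, f x.2) ∘ₗ ren f) (g := ren f ∘ₗ ins x)
    (comb_ind (fun T' K' => by simp [Diagram.rename]) fun y T' K' w ih => ?_) c
  have := ih T' K'
  simp only [LinearMap.comp_apply] at this ⊢
  rw [ren_consL, ins_consL, ins_consL, this, map_add, map_smul, ren_consL, ren_consL, ren_consL]

theorem ins_ins (x y) (c : Comb Leg) : ins x (ins y c) = sgn x.1 y.1 • ins y (ins x c) := by
  refine LinearMap.congr_fun (f := ins x ∘ₗ ins y) (g := sgn x.1 y.1 • ins y ∘ₗ ins x)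
    (comb_ind (fun T K => ?_) fun z T K w ih => ?_) c
  · have h : ∀ a : Leg × ℕ, (gen ⟨T, K, [a]⟩ : Comb Leg) = consL a (gen ⟨T, K, []⟩) := by simp
    simp only [LinearMap.comp_apply, LinearMap.smul_apply, ins_nil, h, ins_consL, smul_add,
      smul_smul, sgn_comm y.1, sgn_mul_self]
    module
  · have := ih T K
    simp only [LinearMap.comp_apply, LinearMap.smul_apply] at this ⊢
    simp only [ins_consL, map_add, map_smul, this, smul_add, smul_smul]
    have e1 : sgn x.1 y.1 = 1 ∨ sgn x.1 y.1 = -1 := neg_one_pow_eq_or _ _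
    rw [sgn_comm y.1 x.1]
    rcases e1 with e1 | e1 <;> rw [e1] <;> module

theorem ins_endsIn (x : Leg × ℕ) (D : Diagram Leg) : ins x (gen D) ∈ endsIn (x.2 ::ₘ D.ends) := by
  obtain ⟨T, K, w⟩ := D
  induction w generalizing T K with
  | nil => rw [ins_nil, ← ends_cons]; exact gen_mem_endsIn _
  | cons y w ih =>
    rw [← consL_gen y ⟨T, K, w⟩, ins_consL, ends_cons]
    refine Submodule.add_mem _ ?_ (Submodule.smul_mem _ _ ?_)
    · exact endsIn_consL (endsIn_consL (gen_mem_endsIn _) _) _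
    · rw [Multiset.cons_swap]
      exact endsIn_consL (ih T K) _

/-- The signed sum of all rearrangements of the legs. -/
def symW (T : Multiset (ℕ × ℕ × ℕ)) (K : Multiset (ℕ × ℕ)) : List (Leg × ℕ) → Comb Leg
  | [] => gen ⟨T, K, []⟩
  | x :: w => ins x (symW T K w)

/-- The signed sum of all rearrangements of the legs, extended linearly. -/
def sym : Comb Leg →ₗ[ℚ] Comb Leg := extend fun D => symW D.tri D.link D.legs

@[simp] theorem sym_nil (T K) : sym (gen ⟨T, K, []⟩) = gen ⟨T, K, []⟩ := by
  simp [sym, symW]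

theorem sym_consL (x) (c : Comb Leg) : sym (consL x c) = ins x (sym c) := by
  refine LinearMap.congr_fun (f := sym ∘ₗ consL x) (g := ins x ∘ₗ sym) (comb_ext fun D => ?_) c
  simp [sym, symW]

theorem sym_addG (T K) (c : Comb Leg) : sym (addG T K c) = addG T K (sym c) := by
  refine LinearMap.congr_fun (f := sym ∘ₗ addG T K) (g := addG T K ∘ₗ sym)
    (comb_ind (fun T' K' => by simp) fun y T' K' w ih => ?_) c
  have := ih T' K'
  simp only [LinearMap.comp_apply] at this ⊢
  rw [← consL_addG, sym_consL, sym_consL, this, ins_addG]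

theorem sym_ren (f : ℕ → ℕ) (c : Comb Leg) : sym (ren f c) = ren f (sym c) := by
  refine LinearMap.congr_fun (f := sym ∘ₗ ren f) (g := ren f ∘ₗ sym)
    (comb_ind (fun T' K' => by simp [Diagram.rename]) fun y T' K' w ih => ?_) c
  have := ih T' K'
  simp only [LinearMap.comp_apply] at this ⊢
  rw [ren_consL, sym_consL, sym_consL, this, ins_ren]

theorem sym_endsIn (D : Diagram Leg) : sym (gen D) ∈ endsIn D.ends := by
  obtain ⟨T, K, w⟩ := D
  induction w generalizing T K with
  | nil => rw [sym_nil]; exact gen_mem_endsIn _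
  | cons y w ih =>
    rw [← consL_gen y ⟨T, K, w⟩, sym_consL, ends_cons]
    refine map_mem_of_gen (fun E hE => ?_) (ih T K)
    have : E.ends = _ := hE
    rw [← this]
    exact ins_endsIn _ _

theorem sym_swap (T K) (u v : List (Leg × ℕ)) (a b : Leg × ℕ) :
    sym (gen ⟨T, K, u ++ a :: b :: v⟩) = sgn a.1 b.1 • sym (gen ⟨T, K, u ++ b :: a :: v⟩) := by
  induction u with
  | nil =>
    have h : ∀ a b, (gen ⟨T, K, a :: b :: v⟩ : Comb Leg) = consL a (consL b (gen ⟨T, K, v⟩)) := by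
      simp
    rw [List.nil_append, List.nil_append, h, h]
    simp only [sym_consL]
    rw [ins_ins]
  | cons x u ih =>
    have h : ∀ w, (gen ⟨T, K, x :: w⟩ : Comb Leg) = consL x (gen ⟨T, K, w⟩) := by simp
    rw [List.cons_append, List.cons_append, h, h, sym_consL, sym_consL, ih, map_smul]

/-- The sign with which the element `p` of a sequence is moved to the front. -/
def pickSign {n : ℕ} (v : Fin n → Leg × ℕ) (p : Fin n) : ℚ :=
  ∏ q, if q < p then sgn (v q).1 (v p).1 else 1

/-- The signed sum over all orders of the legs, according to the leg which comes first. -/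
theorem sym_ofFn (T K) {n : ℕ} (v : Fin (n + 1) → Leg × ℕ) :
    sym (gen ⟨T, K, List.ofFn v⟩) = ∑ p, pickSign v p •
      consL (v p) (sym (gen ⟨T, K, List.ofFn fun k => v (p.succAbove k)⟩)) := by
  have h : ∀ (x : Leg × ℕ) w, (gen ⟨T, K, x :: w⟩ : Comb Leg) = consL x (gen ⟨T, K, w⟩) := by
    simp
  have h0 : ∀ {n} (v : Fin (n + 1) → Leg × ℕ), pickSign v 0 = 1 := by
    intro n v
    simp [pickSign]
  induction n with
  | zero =>
    rw [Fin.sum_univ_succ, List.ofFn_succ, h, sym_consL, h0]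
    simp
  | succ n ih =>
    rw [List.ofFn_succ, h, sym_consL, ih, map_sum, Fin.sum_univ_succ (n := n + 1)]
    have hs : ∀ p : Fin (n + 1), pickSign v p.succ =
        sgn (v 0).1 (v p.succ).1 * pickSign (fun k => v k.succ) p := by
      intro p
      rw [pickSign, Fin.prod_univ_succ, if_pos (Fin.succ_pos p), pickSign]
      simp
    simp only [map_smul, ins_consL, smul_add, Finset.sum_add_distrib]
    congr 1
    · rw [h0, one_smul]
      simp only [Fin.succAbove_zero, ih, map_sum, map_smul]
    · refine Finset.sum_congr rfl fun p _ => ?_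
      rw [hs, List.ofFn_succ, h, sym_consL, smul_smul, mul_comm (sgn _ _)]
      simp

/-- The permutation with `0 ↦ p` which is given by `τ` on the other elements. -/
def consPerm {n : ℕ} (p : Fin (n + 1)) (τ : Equiv.Perm (Fin n)) : Equiv.Perm (Fin (n + 1)) :=
  ((finSuccEquiv' 0).trans (Equiv.optionCongr τ)).trans (finSuccEquiv' p).symm

@[simp] theorem consPerm_zero {n : ℕ} (p : Fin (n + 1)) (τ : Equiv.Perm (Fin n)) :
    consPerm p τ 0 = p := by
  simp [consPerm]

@[simp] theorem consPerm_succ {n : ℕ} (p : Fin (n + 1)) (τ : Equiv.Perm (Fin n)) (k : Fin n) :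
    consPerm p τ k.succ = p.succAbove (τ k) := by
  have : finSuccEquiv' 0 k.succ = some k := by
    rw [← Fin.succAbove_zero_apply, finSuccEquiv'_succAbove]
  simp [consPerm, this]

theorem consPerm_bijective (n : ℕ) :
    Function.Bijective fun a : Fin (n + 1) × Equiv.Perm (Fin n) => consPerm a.1 a.2 := by
  rw [Fintype.bijective_iff_injective_and_card]
  constructor
  · rintro ⟨p, τ⟩ ⟨p', τ'⟩ h
    simp only at h
    obtain rfl : p = p' := by rw [← consPerm_zero p τ, h, consPerm_zero]
    congr 1
    ext k : 1
    apply p.succAbove_right_injective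
    rw [← consPerm_succ, h, consPerm_succ]
  · simp [Fintype.card_perm, Nat.factorial_succ]

/-- The sign of a rearrangement of a sequence of legs. -/
def invSign {n : ℕ} (v : Fin n → Leg × ℕ) (σ : Equiv.Perm (Fin n)) : ℚ :=
  ∏ i, ∏ j, if i < j ∧ σ j < σ i then sgn (v (σ i)).1 (v (σ j)).1 else 1

theorem invSign_consPerm {n : ℕ} (v : Fin (n + 1) → Leg × ℕ) (p : Fin (n + 1))
    (τ : Equiv.Perm (Fin n)) : invSign v (consPerm p τ) =
      pickSign v p * invSign (fun k => v (p.succAbove k)) τ := by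
  rw [invSign, Fin.prod_univ_succ, Fin.prod_univ_succ]
  congr 1
  · simp only [lt_irrefl, false_and, if_false, one_mul, Fin.succ_pos, true_and, consPerm_zero,
      consPerm_succ]
    rw [Equiv.prod_comp τ fun k => if p.succAbove k < p then
      sgn (v p).1 (v (p.succAbove k)).1 else 1, pickSign, Fin.prod_univ_succAbove _ p]
    simp [sgn_comm]
  · rw [invSign]
    refine Finset.prod_congr rfl fun i _ => ?_
    rw [Fin.prod_univ_succ]
    simp

theorem permSign_eq (w : List (Leg × ℕ)) (σ) : permSign w σ = invSign w.get σ := by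
  have hs : ∀ x y : Leg, sgn x y = if x.grade = 1 ∧ y.grade = 1 then -1 else 1 := by
    have hg : ∀ y : Leg, y.grade = 1 ∨ y.grade = 2 := by
      rintro (_ | _ | (_ | _) | (_ | _)) <;> decide
    intro x y
    rcases hg x with h | h <;> rcases hg y with h' | h' <;> norm_num [sgn, h, h']
  rw [permSign, ← Finset.prod_const, Finset.prod_filter, invSign, ← Finset.univ_product_univ,
    Finset.prod_product]
  refine Finset.prod_congr rfl fun i _ => Finset.prod_congr rfl fun j _ => ?_
  rw [hs, ← ite_and]
  simp only [and_assoc]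

theorem sum_perm_eq_sym (T K) {n : ℕ} (v : Fin n → Leg × ℕ) :
    ∑ σ, invSign v σ • gen ⟨T, K, List.ofFn fun i => v (σ i)⟩ =
      sym (gen ⟨T, K, List.ofFn v⟩) := by
  induction n with
  | zero => simp [invSign]
  | succ n ih =>
    rw [sym_ofFn, ← (consPerm_bijective n).sum_comp, Fintype.sum_prod_type]
    refine Finset.sum_congr rfl fun p _ => ?_
    rw [← ih, map_sum, Finset.smul_sum]
    refine Finset.sum_congr rfl fun τ _ => ?_
    rw [invSign_consPerm, map_smul, smul_smul, List.ofFn_succ]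
    simp

theorem average_gen (D : Diagram Leg) :
    average (gen D) = ((Nat.factorial D.legs.length : ℚ))⁻¹ • sym (gen D) := by
  rw [average, extend_gen]
  have := sum_perm_eq_sym D.tri D.link D.legs.get
  rw [List.ofFn_get] at this
  rw [show sym (gen D) = sym (gen ⟨D.tri, D.link, D.legs⟩) from rfl, ← this]
  simp only [permSign_eq]

theorem graphLike_spW : GraphLike spW :=
  ⟨fun _ h => Or.inl h, fun _ h => h.1, fun _ _ h hE hD => opDiagrams_congr h hE hD⟩

theorem graphLike_spWTilde : GraphLike spWTilde :=
  ⟨fun _ h => h, fun _ h => h.1, fun _ _ h hE hD => opDiagrams_congr h hE hD⟩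

/-- Averaging respects the transposition of legs, as it is invariant under permutations with signs.
-/
theorem wellDefined_average : WellDefined spW spWTilde average := by
  refine wellDefined_of_rel fun r hr hs => ?_
  rcases hr with hr | hr
  · refine cls_graphRel graphLike_spWTilde (P := spW) (fun D hD => hD.1) (ρ := id)
      Function.injective_id ?_ ?_ ?_ hr hs
    · intro g g' h _ c
      obtain rfl : g' = g := funext h
      refine LinearMap.congr_fun (f := average ∘ₗ ren g') (g := ren g' ∘ₗ average)
        (comb_ext fun D => ?_) c
      rw [LinearMap.comp_apply, LinearMap.comp_apply, ren_gen, average_gen, average_gen, map_smul,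
        ← sym_ren, ren_gen]
      simp [Diagram.rename]
    · intro T K c
      refine LinearMap.congr_fun (f := average ∘ₗ addG T K) (g := addG _ _ ∘ₗ average)
        (comb_ext fun D => ?_) c
      rw [LinearMap.comp_apply, LinearMap.comp_apply, addG_gen, average_gen, average_gen, map_smul,
        ← sym_addG, addG_gen]
      simp
    · intro D hD
      rw [average_gen]
      exact mem_valid_of_endsIn hD (Submodule.smul_mem _ _ (sym_endsIn D))
  · obtain ⟨T, K, u, v, p, q, x, y, -, rfl⟩ := hr
    rw [map_sub, map_smul, average_gen, average_gen, sym_swap]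
    simp only [List.length_append, List.length_cons]
    rw [smul_comm, sub_self, map_zero]

end Weil

namespace Weil

variable {L M : Type}

/-! ### Replacing legs by forks -/

/-- Add a leg of kind `k` on the edge `e`, plus `r` times a fork on `e` with new edges `p`, `q`. -/
def splitL (k : Leg) (r : ℚ) (e p q : ℕ) : Comb Leg →ₗ[ℚ] Comb Leg :=
  consL (k, e) + r • addG {(e, p, q)} 0 ∘ₗ consL (.one, p) ∘ₗ consL (.one, q)

/-- The replacement of legs on the edges `e` by forks with new edges `p`, `q`, these names being
given in a list of quadruples `(l, e, p, q)`. -/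
def splitG (f : L → Leg) (c : L → ℚ) : List (L × ℕ × ℕ × ℕ) → Comb Leg →ₗ[ℚ] Comb Leg
  | [] => LinearMap.id
  | x :: w => splitL (f x.1) (c x.1) x.2.1 x.2.2.1 x.2.2.2 ∘ₗ splitG f c w

/-- The names used in `splitLegs`. -/
def stdNames : ℕ → List (L × ℕ) → List (L × ℕ × ℕ × ℕ)
  | _, [] => []
  | i, (l, e) :: w => (l, 2 * e, 4 * i + 1, 4 * i + 3) :: stdNames (i + 1) w

/-- The names of the new edges. -/
def newNames (W : List (L × ℕ × ℕ × ℕ)) : List ℕ := W.flatMap fun x => [x.2.2.1, x.2.2.2]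

/-- The legs to be replaced. -/
def oldLegs (W : List (L × ℕ × ℕ × ℕ)) : List (L × ℕ) := W.map fun x => (x.1, x.2.1)

theorem splitL_addG (k r e p q T K) (c : Comb Leg) :
    splitL k r e p q (addG T K c) = addG T K (splitL k r e p q c) := by
  simp [splitL, consL_addG, addG_comm T K]

theorem splitG_addG (f : L → Leg) (a W T K) (c : Comb Leg) :
    splitG f a W (addG T K c) = addG T K (splitG f a W c) := by
  induction W with
  | nil => rfl
  | cons x W ih => rw [splitG, LinearMap.comp_apply, ih, splitL_addG]; rfl

theorem splitL_ren (k r e p q) (g : ℕ → ℕ) (c : Comb Leg) :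
    splitL k r (g e) (g p) (g q) (ren g c) = ren g (splitL k r e p q c) := by
  simp [splitL, ren_consL, ren_addG]

theorem splitG_ren (f : L → Leg) (a W) (g : ℕ → ℕ) (c : Comb Leg) :
    splitG f a (W.map fun x => (x.1, g x.2.1, g x.2.2.1, g x.2.2.2)) (ren g c) =
      ren g (splitG f a W c) := by
  induction W with
  | nil => rfl
  | cons x W ih => rw [List.map_cons, splitG, LinearMap.comp_apply, ih, splitL_ren]; rfl

theorem splitG_append (f : L → Leg) (a U W) (c : Comb Leg) :
    splitG f a (U ++ W) c = splitG f a U (splitG f a W c) := by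
  induction U with
  | nil => rfl
  | cons x U ih => rw [List.cons_append, splitG, LinearMap.comp_apply, ih]; rfl

theorem splitDiagram_eq (f : L → Leg) (a) (D : Diagram L) : splitDiagram f a D =
    splitG f a (stdNames 0 D.legs) (ren (2 * ·) (gen ⟨D.tri, D.link, []⟩)) := by
  have key : ∀ (w : List (L × ℕ)) (i T K), ((splitLegs f a i w).map fun t =>
      t.1 • (gen ⟨T + t.2.1, K, t.2.2⟩ : Comb Leg)).sum =
        splitG f a (stdNames i w) (gen ⟨T, K, []⟩) := by
    intro w
    induction w with
    | nil => intro i T K; simp [splitLegs, stdNames, splitG]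
    | cons x w ih =>
      intro i T K
      obtain ⟨l, e⟩ := x
      rw [splitLegs, stdNames, splitG, LinearMap.comp_apply, ← ih, map_list_sum, List.map_flatMap,
        sum_flatMap, List.map_map]
      congr 2
      funext t
      simp only [Function.comp_apply, List.map_cons, List.map_nil, List.sum_cons, List.sum_nil,
        add_zero, splitL, LinearMap.add_apply, LinearMap.smul_apply, LinearMap.comp_apply, map_smul,
        consL_gen, addG_gen, zero_add, Multiset.singleton_add, ← Multiset.cons_coe,
        Multiset.add_cons]
      module
  rw [splitDiagram, key]
  simp [Diagram.rename]

theorem oldLegs_stdNames (i) (w : List (L × ℕ)) :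
    oldLegs (stdNames i w) = w.map fun x => (x.1, 2 * x.2) := by
  induction w generalizing i with
  | nil => rfl
  | cons x w ih =>
    have := ih (i + 1)
    simp only [oldLegs] at this ⊢
    rw [stdNames, List.map_cons, this, List.map_cons]

theorem newNames_stdNames {i n} {w : List (L × ℕ)} (h : n ∈ newNames (stdNames i w)) :
    n % 2 = 1 ∧ 4 * i < n := by
  induction w generalizing i with
  | nil => simp [stdNames, newNames] at h
  | cons x w ih =>
    simp only [newNames, stdNames, List.flatMap_cons, List.mem_append, List.mem_cons,
      List.not_mem_nil, or_false] at h
    rcases h with (h | h) | h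
    · omega
    · omega
    · have := ih h
      omega

/-- The number of times the names of new edges occur does not depend on the order. -/
theorem splitG_ends (f : L → Leg) (a) {W : List (L × ℕ × ℕ × ℕ)} (hW : (newNames W).Nodup)
    (D : Diagram Leg) : splitG f a W (gen D) ∈ Finsupp.supported ℚ ℚ
      {E | ∃ s : Finset ℕ, (∀ n ∈ s, n ∈ newNames W) ∧
        E.ends = ((oldLegs W).map Prod.snd : List ℕ) + (s.val + s.val) + D.ends} := by
  induction W with
  | nil =>
    refine gen_mem_supported.2 ⟨∅, by simp, ?_⟩
    simp [oldLegs]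
  | cons x W ih =>
    rw [splitG, LinearMap.comp_apply]
    simp only [newNames, List.flatMap_cons, List.cons_append, List.nil_append] at hW
    rw [List.nodup_cons, List.nodup_cons] at hW
    refine map_mem_of_gen ?_ (ih hW.2.2)
    rintro E ⟨s, hs, hE⟩
    have hp : x.2.2.1 ∉ s := fun h => hW.1 (by simpa [newNames] using Or.inr (hs _ h))
    have hq : x.2.2.2 ∉ s := fun h => hW.2.1 (hs _ h)
    have hpq : x.2.2.1 ≠ x.2.2.2 := fun h => hW.1 (by simp [h])
    rw [splitL, LinearMap.add_apply]
    refine Submodule.add_mem _ ?_ (Submodule.smul_mem _ _ ?_)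
    · rw [consL_gen]
      refine gen_mem_supported.2 ⟨s, fun n hn => ?_, ?_⟩
      · have := hs n hn
        simp only [newNames, List.flatMap_cons, List.mem_append] at this ⊢
        exact Or.inr this
      · rw [ends_cons]
        rw [show Diagram.ends ⟨E.tri, E.link, E.legs⟩ = E.ends from rfl, hE]
        simp only [oldLegs, List.map_cons, ← Multiset.cons_coe, ← Multiset.singleton_add]
        abel
    · simp only [LinearMap.comp_apply, consL_gen, addG_gen, zero_add, Multiset.singleton_add]
      refine gen_mem_supported.2 ⟨(s.cons _ hq).cons x.2.2.1 (by simp [hpq, hp]), ?_, ?_⟩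
      · intro n hn
        simp only [Finset.mem_cons] at hn
        simp only [newNames, List.flatMap_cons, List.mem_append, List.mem_cons, List.not_mem_nil,
          or_false]
        rcases hn with hn | hn | hn
        · exact Or.inl (Or.inl hn)
        · exact Or.inl (Or.inr hn)
        · exact Or.inr (hs n hn)
      · rw [ends_tri, ends_cons, ends_cons]
        rw [show Diagram.ends ⟨E.tri, E.link, E.legs⟩ = E.ends from rfl, hE]
        simp only [oldLegs, List.map_cons, ← Multiset.cons_coe, ← Multiset.singleton_add,
          Finset.cons_val]
        abel

theorem nodup_stdNames (i) (w : List (L × ℕ)) : (newNames (stdNames i w)).Nodup := by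
  induction w generalizing i with
  | nil => simp [stdNames, newNames]
  | cons x w ih =>
    have h := ih (i + 1)
    have h' := fun n => newNames_stdNames (i := i + 1) (w := w) (n := n)
    simp only [newNames] at h h'
    simp only [newNames, stdNames, List.flatMap_cons, List.cons_append, List.nil_append,
      List.nodup_cons, List.mem_cons, not_or]
    refine ⟨⟨by omega, fun hn => ?_⟩, fun hn => ?_, h⟩
    · have := h' _ hn; omega
    · have := h' _ hn; omega

theorem splitDiagram_valid (f : L → Leg) (a) {D : Diagram L} (hD : D.Valid) :
    splitDiagram f a D ∈ Finsupp.supported ℚ ℚ {E | E.Valid} := by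
  rw [splitDiagram_eq, ren_gen]
  refine Finsupp.supported_mono ?_ (splitG_ends f a (nodup_stdNames 0 D.legs) _)
  rintro E ⟨s, hs, hE⟩ n
  have h2 : Function.Injective (2 * · : ℕ → ℕ) := fun a b h => by simpa using h
  have e1 : E.ends = D.ends.map (2 * ·) + (s.val + s.val) := by
    rw [hE, oldLegs_stdNames, show D.ends.map (2 * ·) =
      (D.rename (2 * ·)).ends from (ends_rename _ _).symm]
    simp only [ends_mk, Diagram.rename, List.map_map, List.map_nil, Multiset.coe_nil, add_zero,
      Function.comp_def]
    abel
  have hs1 : s.val.count n ≤ 1 := Multiset.nodup_iff_count_le_one.1 s.nodup n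
  rw [e1, Multiset.count_add, Multiset.count_add]
  by_cases hn : n ∈ s
  · have := newNames_stdNames (hs n hn)
    have h0 : (D.ends.map (2 * ·)).count n = 0 := by
      rw [Multiset.count_eq_zero, Multiset.mem_map]
      rintro ⟨b, _, rfl⟩
      omega
    have := Multiset.count_pos.2 (show n ∈ s.val from hn)
    omega
  · have h0 : s.val.count n = 0 := Multiset.count_eq_zero.2 hn
    rw [h0]
    rcases Nat.even_or_odd' n with ⟨b, rfl | rfl⟩
    · have := Multiset.count_map_eq_count' (2 * ·) D.ends h2 b
      rw [add_zero, add_zero, this]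
      exact hD b
    · left
      simp only [add_zero, Multiset.count_eq_zero, Multiset.mem_map, not_exists, not_and]
      intro b _
      omega

/-- The class does not depend on the choice of the names of the new edges. -/
theorem cls_splitG {P : Presentation Leg} (hP : GraphLike P) (f : L → Leg) (a)
    {W : List (L × ℕ × ℕ × ℕ)} {T K} (hW : (newNames W).Nodup)
    (hWD : ∀ n ∈ newNames W, n ∉ Diagram.ends ⟨T, K, oldLegs W⟩) :
    P.cls (splitG f a W (gen ⟨T, K, []⟩)) = P.cls (splitDiagram f a ⟨T, K, oldLegs W⟩) := by
  classical
  let ψ : ℕ → ℕ := fun m => if m ∈ newNames W then 2 * (newNames W).idxOf m + 1 else 2 * m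
  have hψ : ψ.Injective := by
    intro m n h
    simp only [ψ] at h
    split_ifs at h with h1 h2
    · exact (List.idxOf_inj h1).1 (by omega)
    · omega
    · omega
    · omega
  have h0 : ren ψ (gen ⟨T, K, []⟩ : Comb Leg) = ren (2 * ·) (gen ⟨T, K, []⟩) := by
    refine ren_congr (s := {n | n ∉ newNames W}) (fun n hn => if_neg hn)
      (gen_mem_supported.2 fun n hn hn' => hWD n hn' ?_)
    simp only [ends_mk, List.map_nil, Multiset.coe_nil, add_zero] at hn ⊢
    exact Multiset.mem_add.2 (Or.inl hn)
  have hold : ∀ x ∈ W, x.2.1 ∉ newNames W := by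
    intro x hx h
    refine hWD _ h ?_
    rw [ends_mk]
    refine Multiset.mem_add.2 (Or.inr ?_)
    simp only [oldLegs, List.map_map, Multiset.mem_coe, List.mem_map]
    exact ⟨x, hx, rfl⟩
  have hmap : W.map (fun x => (x.1, ψ x.2.1, ψ x.2.2.1, ψ x.2.2.2)) = stdNames 0 (oldLegs W) := by
    have key : ∀ (V : List (L × ℕ × ℕ × ℕ)) (i : ℕ) (u : List ℕ), u.length = 2 * i →
        newNames W = u ++ newNames V → (∀ x ∈ V, x.2.1 ∉ newNames W) →
        V.map (fun x => (x.1, ψ x.2.1, ψ x.2.2.1, ψ x.2.2.2)) = stdNames i (oldLegs V) := by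
      intro V
      induction V with
      | nil => intros; rfl
      | cons x V ih =>
        intro i u hu hV hx
        have e1 : newNames W = u ++ x.2.2.1 :: x.2.2.2 :: newNames V := by
          rw [hV]; simp [newNames]
        have hnd := hW
        rw [e1, List.nodup_append] at hnd
        obtain ⟨-, hnd, hdis⟩ := hnd
        rw [List.nodup_cons, List.nodup_cons] at hnd
        have hp : x.2.2.1 ∉ u := fun h => hdis _ h _ (by simp) rfl
        have hq : x.2.2.2 ∉ u := fun h => hdis _ h _ (by simp) rfl
        have hpq : x.2.2.1 ≠ x.2.2.2 := fun h => hnd.1 (by simp [h])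
        have ih' := ih (i + 1) (u ++ [x.2.2.1, x.2.2.2]) (by simp; omega) (by simp [e1])
          (fun y hy => hx y (by simp [hy]))
        have p1 : ψ x.2.2.1 = 4 * i + 1 := by
          simp only [ψ]
          rw [if_pos (by simp [e1]), e1, List.idxOf_append_of_notMem hp, List.idxOf_cons_self]
          omega
        have p2 : ψ x.2.2.2 = 4 * i + 3 := by
          simp only [ψ]
          rw [if_pos (by simp [e1]), e1, List.idxOf_append_of_notMem hq, List.idxOf_cons_ne _ hpq,
            List.idxOf_cons_self]
          omega
        have p3 : ψ x.2.1 = 2 * x.2.1 := if_neg (hx x (by simp))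
        rw [List.map_cons, ih', p1, p2, p3]
        rfl
    exact key W 0 [] rfl (by simp) hold
  rw [splitDiagram_eq, ← hmap, ← hP.cls_ren_inj hψ, ← splitG_ren, h0]

theorem exists_newNames (w : List (L × ℕ)) (F : Finset ℕ) : ∃ W : List (L × ℕ × ℕ × ℕ),
    oldLegs W = w ∧ (newNames W).Nodup ∧ ∀ n ∈ newNames W, n ∉ F := by
  classical
  induction w generalizing F with
  | nil => exact ⟨[], rfl, by simp [newNames], by simp [newNames]⟩
  | cons x w ih =>
    obtain ⟨p, hp⟩ := Infinite.exists_notMem_finset F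
    obtain ⟨q, hq⟩ := Infinite.exists_notMem_finset (insert p F)
    obtain ⟨W, h1, h2, h3⟩ := ih (insert q (insert p F))
    have hp' : p ∉ newNames W := fun h => h3 p h (by simp)
    have hq' : q ∉ newNames W := fun h => h3 q h (by simp)
    refine ⟨(x.1, x.2, p, q) :: W, ?_, ?_, ?_⟩
    · simp only [oldLegs, List.map_cons] at h1 ⊢
      rw [h1]
    · simp only [newNames, List.flatMap_cons, List.cons_append, List.nil_append, List.nodup_cons,
        List.mem_cons, not_or]
      exact ⟨⟨fun h => hq (by simp [h]), hp'⟩, hq', h2⟩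
    · intro n hn
      simp only [newNames, List.flatMap_cons, List.cons_append, List.nil_append,
        List.mem_cons] at hn
      rcases hn with rfl | rfl | hn
      · exact hp
      · exact fun h => hq (by simp [h])
      · exact fun h => h3 n hn (by simp [h])

theorem splitDiagram_ren (f : L → Leg) (a) {g g' : ℕ → ℕ} (h : ∀ n, g' (2 * n) = 2 * g n)
    (h' : ∀ m, m % 2 = 1 → g' m = m) (D : Diagram L) :
    splitDiagram f a (D.rename g) = ren g' (splitDiagram f a D) := by
  have key : ∀ i (w : List (L × ℕ)), stdNames i (w.map fun x => (x.1, g x.2)) =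
      (stdNames i w).map fun x => (x.1, g' x.2.1, g' x.2.2.1, g' x.2.2.2) := by
    intro i w
    induction w generalizing i with
    | nil => rfl
    | cons x w ih =>
      rw [List.map_cons, stdNames, stdNames, List.map_cons, ih, h, h' (4 * i + 1) (by omega),
        h' (4 * i + 3) (by omega)]
  rw [splitDiagram_eq, splitDiagram_eq, ← splitG_ren, ← key, ren_ren]
  congr 1
  rw [show (gen ⟨(D.rename g).tri, (D.rename g).link, []⟩ : Comb Leg) =
    ren g (gen ⟨D.tri, D.link, []⟩) by simp [Diagram.rename], ren_ren]
  congr 2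
  funext n
  exact (h n).symm

/-- Replacing legs by sums of legs and forks respects the relations of graphs. -/
theorem cls_split_graphRel {P : Presentation L} {Q : Presentation Leg} (hQ : GraphLike Q)
    (hP : ∀ D ∈ P.adm, D.Valid) (f : L → Leg) (a) {r : Comb L} (hr : GraphRel r)
    (hs : r ∈ Finsupp.supported ℚ ℚ P.adm) : Q.cls (extend (splitDiagram f a) r) = 0 := by
  refine cls_graphRel hQ hP (ρ := fun n => 2 * n) (fun a b h => by simpa using h) ?_ ?_ ?_ hr hs
  · intro g g' h h' c
    refine LinearMap.congr_fun (f := extend (splitDiagram f a) ∘ₗ ren g)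
      (g := ren g' ∘ₗ extend (splitDiagram f a)) (comb_ext fun D => ?_) c
    simp only [LinearMap.comp_apply, ren_gen, extend_gen]
    refine splitDiagram_ren f a h (fun m hm => h' m ?_) D
    rintro ⟨n, hn⟩
    simp only at hn
    omega
  · intro T K c
    refine LinearMap.congr_fun (f := extend (splitDiagram f a) ∘ₗ addG T K)
      (g := addG _ _ ∘ₗ extend (splitDiagram f a)) (comb_ext fun D => ?_) c
    simp only [LinearMap.comp_apply, addG_gen, extend_gen, splitDiagram_eq]
    rw [← splitG_addG]
    simp [Diagram.rename]
  · intro D hD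
    rw [extend_gen]
    exact splitDiagram_valid f a hD

end Weil

namespace Weil

variable {L M : Type}

/-! ### Combinations of diagrams which vanish after adding anything on the left -/

/-- The combinations of diagrams which are zero in the space presented by `P` after adding any
graph and any legs on the left that do not use the names in `F`. -/
def nullSub (P : Presentation Leg) (F : Set ℕ) : Submodule ℚ (Comb Leg) where
  carrier := {c | ∀ T K u, (∀ t ∈ T, t.1 ∉ F ∧ t.2.1 ∉ F ∧ t.2.2 ∉ F) →
    (∀ k ∈ K, k.1 ∉ F ∧ k.2 ∉ F) → (∀ x ∈ u, x.1.isOp = false ∧ x.2 ∉ F) →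
    P.cls (addG T K (consW u c)) = 0}
  zero_mem' := by simp
  add_mem' := by
    intro a b ha hb T K u hT hK hu
    rw [map_add, map_add, map_add, ha T K u hT hK hu, hb T K u hT hK hu, add_zero]
  smul_mem' := by
    intro a b hb T K u hT hK hu
    rw [map_smul, map_smul, map_smul, hb T K u hT hK hu, smul_zero]

section
variable {P : Presentation Leg} {F : Set ℕ}

theorem nullSub_consL {x : Leg × ℕ} (hx : x.1.isOp = false) (hx' : x.2 ∉ F) {c : Comb Leg}
    (hc : c ∈ nullSub P F) : consL x c ∈ nullSub P F := by
  intro T K u hT hK hu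
  have := hc T K (u ++ [x]) hT hK (fun y hy => by
    rcases List.mem_append.1 hy with hy | hy
    · exact hu y hy
    · rw [List.mem_singleton.1 hy]; exact ⟨hx, hx'⟩)
  rwa [consW_append, consW_cons, consW_nil] at this

theorem nullSub_addG {T K} (hT : ∀ t ∈ T, t.1 ∉ F ∧ t.2.1 ∉ F ∧ t.2.2 ∉ F)
    (hK : ∀ k ∈ K, k.1 ∉ F ∧ k.2 ∉ F) {c : Comb Leg} (hc : c ∈ nullSub P F) :
    addG T K c ∈ nullSub P F := by
  intro T' K' u hT' hK' hu
  rw [consW_addG, addG_addG]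
  refine hc _ _ u (fun t ht => ?_) (fun k hk => ?_) hu
  · rcases Multiset.mem_add.1 ht with ht | ht
    · exact hT' t ht
    · exact hT t ht
  · rcases Multiset.mem_add.1 hk with hk | hk
    · exact hK' k hk
    · exact hK k hk

theorem nullSub_tri {x y z} (hx : x ∉ F) (hy : y ∉ F) (hz : z ∉ F) {c : Comb Leg}
    (hc : c ∈ nullSub P F) : addG {(x, y, z)} 0 c ∈ nullSub P F :=
  nullSub_addG (by simp [hx, hy, hz]) (by simp) hc

theorem nullSub_mono {F' : Set ℕ} (h : F ⊆ F') {c : Comb Leg} (hc : c ∈ nullSub P F) :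
    c ∈ nullSub P F' := by
  intro T K u hT hK hu
  exact hc T K u (fun t ht => ⟨fun h' => (hT t ht).1 (h h'), fun h' => (hT t ht).2.1 (h h'),
    fun h' => (hT t ht).2.2 (h h')⟩) (fun k hk => ⟨fun h' => (hK k hk).1 (h h'),
    fun h' => (hK k hk).2 (h h')⟩) (fun x hx => ⟨(hu x hx).1, fun h' => (hu x hx).2 (h h')⟩)

theorem nullSub_cls {c : Comb Leg} (hc : c ∈ nullSub P F) : P.cls c = 0 := by
  have := hc 0 0 [] (by simp) (by simp) (by simp)
  rwa [consW_nil, addG_zero] at this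

theorem nullSub_two_one_one (hsw : ∀ x p c, swapHead (.two, x) (.one, p) c ∈ nullSub P ∅)
    (x p q : ℕ) (c : Comb Leg) :
    consL (.two, x) (consL (.one, p) (consL (.one, q) c)) -
      consL (.one, p) (consL (.one, q) (consL (.two, x) c)) ∈ nullSub P ∅ := by
  have h := Submodule.add_mem _ (hsw x p (consL (.one, q) c))
    (nullSub_consL (x := (.one, p)) rfl (by simp) (hsw x q c))
  have hs : sgn .two .one = 1 := by norm_num [sgn, Leg.grade]
  simp only [swapHead, LinearMap.sub_apply, LinearMap.comp_apply, LinearMap.smul_apply, map_sub,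
    map_smul, hs, one_smul] at h
  convert h using 1
  abel

/-- If curvature legs commute with legs of grade 1, the commutator of two replaced legs is the
commutator of the curvature legs plus that of the forks. -/
theorem nullSub_splitL (hsw : ∀ x p c, swapHead (.two, x) (.one, p) c ∈ nullSub P ∅) (r : ℚ)
    (x p q y p' q' : ℕ) (c : Comb Leg) :
    splitL .two r x p q (splitL .two r y p' q' c) - splitL .two r y p' q' (splitL .two r x p q c)
      - (consL (.two, x) (consL (.two, y) c) - consL (.two, y) (consL (.two, x) c))
      - r ^ 2 • addG {(x, p, q)} 0 (addG {(y, p', q')} 0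
        (consL (.one, p) (consL (.one, q) (consL (.one, p') (consL (.one, q') c)))
        - consL (.one, p') (consL (.one, q') (consL (.one, p) (consL (.one, q) c))))) ∈
      nullSub P ∅ := by
  have h1 := nullSub_tri (P := P) (F := ∅) (x := y) (y := p') (z := q') (by simp) (by simp)
    (by simp) (nullSub_two_one_one hsw x p' q' c)
  have h2 := nullSub_tri (P := P) (F := ∅) (x := x) (y := p) (z := q) (by simp) (by simp)
    (by simp) (nullSub_two_one_one hsw y p q c)
  convert Submodule.sub_mem _ (Submodule.smul_mem _ r h1) (Submodule.smul_mem _ r h2) using 1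
  simp only [splitL, LinearMap.add_apply, LinearMap.smul_apply, LinearMap.comp_apply, map_add,
    map_sub, map_smul, consL_addG, addG_comm {(y, p', q')}]
  module

end

theorem swapHead_mem_nullSub_spW {a b : Leg × ℕ} (ha : a.1.isOp = false) (hb : b.1.isOp = false)
    (c : Comb Leg) : swapHead a b c ∈ nullSub spW ∅ := by
  intro T K u _ _ hu
  rw [← consW_addG, ← swapHead_addG]
  refine LinearMap.congr_fun (f := spW.cls ∘ₗ consW u ∘ₗ swapHead a b) (g := 0)
    (comb_ext ?_) _
  rintro ⟨T, K, v⟩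
  have h : spW.cls (gen ⟨T, K, u ++ a :: b :: v⟩) =
      sgn a.1 b.1 • spW.cls (gen ⟨T, K, u ++ b :: a :: v⟩) := by
    refine cls_gen_eq _ (Or.inr ⟨T, K, u, v, a.1, b.1, a.2, b.2, trivial, rfl⟩) ?_
    refine opDiagrams_iff (valid_congr ?_) ?_ fun f _ _ => ?_
    · rw [ends_append, ends_append, ends_cons, ends_cons, ends_cons, ends_cons, Multiset.cons_swap]
    · rw [normal_append_of_not_op fun x hx => (hu x hx).1,
        normal_append_of_not_op fun x hx => (hu x hx).1, normal_cons_of_not_op ha,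
        normal_cons_of_not_op hb, normal_cons_of_not_op hb, normal_cons_of_not_op ha]
    · simp only [List.map_append, List.map_cons, List.sum_append, List.sum_cons]; ring
  simp [swapHead, h]

theorem splitL_comm_spW (r : ℚ) (x p q y p' q' : ℕ) (c : Comb Leg) :
    splitL .two r x p q (splitL .two r y p' q' c) - splitL .two r y p' q' (splitL .two r x p q c) ∈
      nullSub spW ∅ := by
  have hsw : ∀ (k l : Leg) x p c, k.isOp = false → l.isOp = false →
      swapHead (k, x) (l, p) c ∈ nullSub spW ∅ :=
    fun k l x p c hk hl => swapHead_mem_nullSub_spW hk hl c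
  have hO : ∀ p {c}, c ∈ nullSub spW ∅ → consL (Leg.one, p) c ∈ nullSub spW ∅ :=
    fun p c hc => nullSub_consL rfl (by simp) hc
  have h0 := nullSub_splitL (fun x p c => hsw .two .one x p c rfl rfl) r x p q y p' q' c
  have h1 := hsw .two .two x y c rfl rfl
  have g1 := hO p (hsw .one .one q p' (consL (.one, q') c) rfl rfl)
  have g2 := hsw .one .one p p' (consL (.one, q) (consL (.one, q') c)) rfl rfl
  have g3 := hO p' (hO p (hsw .one .one q q' c rfl rfl))
  have g4 := hO p' (hsw .one .one p q' (consL (.one, q) c) rfl rfl)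
  have g := Submodule.sub_mem _ (Submodule.add_mem _ (Submodule.sub_mem _ g1 g2) g3) g4
  have g' := nullSub_tri (x := x) (y := p) (z := q) (F := ∅) (by simp) (by simp) (by simp)
    (nullSub_tri (x := y) (y := p') (z := q') (by simp) (by simp) (by simp) g)
  convert Submodule.add_mem _ (Submodule.add_mem _ h0 h1) (Submodule.smul_mem _ (r ^ 2) g') using 1
  have s1 : sgn .one .one = -1 := by norm_num [sgn, Leg.grade]
  have s2 : sgn .two .two = 1 := by norm_num [sgn, Leg.grade]
  simp only [swapHead, LinearMap.sub_apply, LinearMap.comp_apply, LinearMap.smul_apply, map_sub,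
    map_smul, map_add, s1, s2]
  module

theorem splitG_cls_eq {P : Presentation Leg} {f : L → Leg} {a : L → ℚ} {W : List (L × ℕ × ℕ × ℕ)}
    {c d : Comb Leg} {F : Set ℕ} (hW : ∀ x ∈ W, (f x.1).isOp = false ∧ x.2.1 ∉ F ∧ x.2.2.1 ∉ F ∧
      x.2.2.2 ∉ F) (h : c - d ∈ nullSub P F) : splitG f a W c - splitG f a W d ∈ nullSub P F := by
  induction W with
  | nil => exact h
  | cons x W ih =>
    have hx := hW x (by simp)
    have ih := ih fun y hy => hW y (by simp [hy])
    simp only [splitG, LinearMap.comp_apply, ← map_sub]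
    rw [splitL, LinearMap.add_apply]
    rw [← map_sub] at ih
    refine Submodule.add_mem _ (nullSub_consL hx.1 hx.2.1 ih) (Submodule.smul_mem _ _ ?_)
    exact nullSub_tri hx.2.1 hx.2.2.1 hx.2.2.2 (nullSub_consL rfl hx.2.2.1
      (nullSub_consL rfl hx.2.2.2 ih))

theorem newNames_perm {W W' : List (L × ℕ × ℕ × ℕ)} (h : W.Perm W') :
    (newNames W).Perm (newNames W') := h.flatMap_right _

theorem mem_ends_perm {T K} {w w' : List (L × ℕ)} (h : w.Perm w') :
    Diagram.ends ⟨T, K, w⟩ = Diagram.ends ⟨T, K, w'⟩ := by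
  simp only [ends_mk]
  congr 1
  exact Multiset.coe_eq_coe.2 (h.map _)

theorem splitG_swap_spW (r : ℚ) (U W : List (L × ℕ × ℕ × ℕ)) (X Y : L × ℕ × ℕ × ℕ)
    (c : Comb Leg) : splitG (fun _ : L => .two) (fun _ => r) (U ++ X :: Y :: W) c -
      splitG (fun _ => .two) (fun _ => r) (U ++ Y :: X :: W) c ∈ nullSub spW ∅ := by
  rw [splitG_append, splitG_append]
  refine splitG_cls_eq (fun x _ => ⟨rfl, by simp⟩) ?_
  simp only [splitG, LinearMap.comp_apply]
  exact splitL_comm_spW _ _ _ _ _ _ _ _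

/-- Hair-splitting does not depend on the order of the legs: legs of grade 2 commute with all legs,
and so do forks of two legs of grade 1. -/
theorem wellDefined_hairSplit : WellDefined spB spW hairSplit := by
  refine wellDefined_of_rel fun r hr hs => ?_
  rcases hr with hr | hr
  · exact cls_split_graphRel (P := spB) graphLike_spW (fun D hD => hD) _ _ hr hs
  · obtain ⟨T, K, u, v, p, q, x, y, -, rfl⟩ := hr
    obtain ⟨W, hW, hnd, hfr⟩ := exists_newNames (u ++ (p, x) :: (q, y) :: v)
      (Diagram.ends ⟨T, K, u ++ (p, x) :: (q, y) :: v⟩).toFinset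
    obtain ⟨Wu, W1, rfl, hu, h1⟩ := List.map_eq_append_iff.1 hW
    obtain ⟨X, W2, rfl, hX, h2⟩ := List.map_eq_cons_iff.1 h1
    obtain ⟨Y, Wv, rfl, hY, hv⟩ := List.map_eq_cons_iff.1 h2
    have hperm : (Wu ++ X :: Y :: Wv).Perm (Wu ++ Y :: X :: Wv) :=
      (List.Perm.swap _ _ _).append_left _
    have hperm' := newNames_perm hperm
    have hW' : oldLegs (Wu ++ Y :: X :: Wv) = u ++ (q, y) :: (p, x) :: v := by
      rw [← hX, ← hY, ← hu, ← hv]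
      simp [oldLegs]
    have e1 := cls_splitG graphLike_spW (fun _ : Unit => Leg.two) (fun _ => -1 / 2)
      (T := T) (K := K) hnd (fun n hn => by
        rw [hW, ← Multiset.mem_toFinset]
        exact hfr n hn)
    have e2 := cls_splitG graphLike_spW (fun _ : Unit => Leg.two) (fun _ => -1 / 2)
      (T := T) (K := K) (hperm'.nodup_iff.1 hnd) (fun n hn => by
        rw [hW', mem_ends_perm ((List.Perm.swap (p, x) (q, y) v).append_left u),
          ← Multiset.mem_toFinset]
        exact hfr n (hperm'.mem_iff.2 hn))
    rw [hW] at e1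
    rw [hW'] at e2
    rw [one_smul, map_sub, hairSplit, extend_gen, extend_gen, map_sub, ← e1, ← e2, ← map_sub]
    exact nullSub_cls (splitG_swap_spW _ _ _ _ _ _)

/-! ### The map to curvature legs -/

section
variable {q : ℚ} {t : ℕ × ℕ}

theorem locN_mem_nullSub {F : Set ℕ} {z} (hz : z ∈ F) {c : Comb Leg} (hc : c ∈ locN q z) :
    c ∈ nullSub (sp q t) F := by
  intro T K u hT hK hu
  have ne : ∀ n, n ∉ F → n ≠ z := by rintro n hn rfl; exact hn hz
  exact cls_locN t (locN_addG (fun a ha => ⟨ne _ (hT a ha).1, ne _ (hT a ha).2.1,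
    ne _ (hT a ha).2.2⟩) (fun a ha => ⟨ne _ (hK a ha).1, ne _ (hK a ha).2⟩)
    (locN_consW (fun x hx => (hu x hx).1) (fun x hx => ne _ (hu x hx).2) hc))

theorem exists_fresh_legs (u : List (L × ℕ)) : ∃ z, ∀ a ∈ u, a.2 ≠ z := by
  obtain ⟨z, hz⟩ := Infinite.exists_notMem_finset (u.map Prod.snd).toFinset
  refine ⟨z, ?_⟩
  rintro a ha rfl
  exact hz (by simpa using ⟨a.1, ha⟩)

theorem swapHead_mem_nullSub {a b : Leg × ℕ} (ha : a.1.isOp = false) (hb : b.1.isOp = false)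
    (h : SwapOK a.1 b.1) (c : Comb Leg) : swapHead a b c ∈ nullSub (sp q t) ∅ := by
  intro T K u _ _ hu
  obtain ⟨z, hz⟩ := exists_fresh_legs u
  rw [← consW_addG, ← swapHead_addG]
  exact cls_locN t (locN_of (.swap (z := z) u a b _ (fun x hx => (hu x hx).1) hz ha hb h))

theorem cliffHead_mem_nullSub (x y : ℕ) (c : Comb Leg) :
    cliffHead q x y c ∈ nullSub (sp q t) ∅ := by
  intro T K u _ _ hu
  obtain ⟨z, hz⟩ := exists_fresh_legs u
  rw [← consW_addG, ← cliffHead_addG]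
  exact cls_locN t (locN_of (.cliff (z := z) u x y _ (fun x hx => (hu x hx).1) hz))

end

section
variable {P : Presentation Leg} {F : Set ℕ}

theorem nullSub_of_addG {T K T' K'} {c : Comb Leg}
    (h : ∀ c, P.cls (addG T K c) = P.cls (addG T' K' c)) :
    addG T K c - addG T' K' c ∈ nullSub P F := by
  intro T₀ K₀ u _ _ _
  rw [map_sub, map_sub, consW_addG, consW_addG, addG_comm T₀, addG_comm T₀, map_sub, h, sub_self]

theorem nullSub_cyc (hP : GraphLike P) (x y z : ℕ) (c : Comb Leg) :
    addG {(x, y, z)} 0 c - addG {(y, z, x)} 0 c ∈ nullSub P F :=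
  nullSub_of_addG fun c => hP.cls_cyc x y z c

theorem nullSub_anti (hP : GraphLike P) (x y z : ℕ) (c : Comb Leg) :
    addG {(x, y, z)} 0 c + addG {(y, x, z)} 0 c ∈ nullSub P F := by
  intro T₀ K₀ u _ _ _
  rw [map_add, map_add, consW_addG, consW_addG, addG_comm T₀, addG_comm T₀, map_add, hP.cls_anti,
    neg_add_cancel]

theorem nullSub_ihx (hP : GraphLike P) (x y z t e : ℕ) (c : Comb Leg) :
    addG {(x, y, e)} 0 (addG {(e, z, t)} 0 c) + addG {(y, z, e)} 0 (addG {(e, x, t)} 0 c)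
      + addG {(z, x, e)} 0 (addG {(e, y, t)} 0 c) ∈ nullSub P F := by
  intro T₀ K₀ u _ _ _
  have h := hP.cls_ihx x y z t e (addG T₀ K₀ (consW u c))
  have e1 : ∀ a b c : ℕ × ℕ × ℕ, ({a, b} : Multiset (ℕ × ℕ × ℕ)) = {a} + {b} := by
    intro a b _; rfl
  simp only [map_add, consW_addG, addG_comm T₀, addG_addG] at h ⊢
  simpa only [add_zero, zero_add, Multiset.insert_eq_cons, Multiset.singleton_add,
    Multiset.cons_add] using h

theorem ren_eq_self {s : Set ℕ} {f : ℕ → ℕ} (h : ∀ n ∈ s, f n = n) {c : Comb L}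
    (hc : c ∈ named s) : ren f c = c := by
  rw [ren_congr (g := id) h hc, ren_id]

theorem ren_prefix {f : ℕ → ℕ} (hf : ∀ n ∉ F, f n = n) {T : Multiset (ℕ × ℕ × ℕ)}
    {K : Multiset (ℕ × ℕ)} {u : List (L × ℕ)} (hT : ∀ t ∈ T, t.1 ∉ F ∧ t.2.1 ∉ F ∧ t.2.2 ∉ F)
    (hK : ∀ k ∈ K, k.1 ∉ F ∧ k.2 ∉ F) (hu : ∀ x ∈ u, x.2 ∉ F) (c : Comb L) :
    ren f (addG T K (consW u c)) = addG T K (consW u (ren f c)) := by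
  have h1 : T.map (fun t => (f t.1, f t.2.1, f t.2.2)) = T := by
    refine (Multiset.map_congr rfl fun t ht => ?_).trans (Multiset.map_id T)
    rw [hf _ (hT t ht).1, hf _ (hT t ht).2.1, hf _ (hT t ht).2.2]; rfl
  have h2 : K.map (fun k => (f k.1, f k.2)) = K := by
    refine (Multiset.map_congr rfl fun k hk => ?_).trans (Multiset.map_id K)
    rw [hf _ (hK k hk).1, hf _ (hK k hk).2]; rfl
  have h3 : u.map (fun x => (x.1, f x.2)) = u := by
    refine (List.map_congr_left fun x hx => ?_).trans (List.map_id u)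
    rw [hf _ (hu x hx)]; rfl
  rw [ren_addG, ren_consW, h1, h2, h3]

theorem nullSub_ren (hP : GraphLike P) (σ : Equiv.Perm ℕ) (hσ : ∀ n ∉ F, σ n = n) (c : Comb Leg) :
    c - ren σ c ∈ nullSub P F := by
  intro T K u hT hK hu
  have h := hP.cls_ren_inj σ.injective (addG T K (consW u c))
  rw [ren_prefix hσ hT hK fun x hx => (hu x hx).2] at h
  rw [map_sub, map_sub, map_sub, ← h, sub_self]

theorem nullSub_swap (hP : GraphLike P) {a b : ℕ} (ha : a ∈ F) (hb : b ∈ F) (c : Comb Leg) :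
    c - ren (Equiv.swap a b) c ∈ nullSub P F :=
  nullSub_ren hP _ (fun n hn => Equiv.swap_apply_of_ne_of_ne (by rintro rfl; exact hn ha)
    (by rintro rfl; exact hn hb)) c

end

end Weil

namespace Weil

/-! ### Commutators of forks -/

variable {L M : Type}

theorem ends_union (T T' K K') (u w : List (L × ℕ)) : Diagram.ends ⟨T + T', K + K', u ++ w⟩ =
    Diagram.ends ⟨T, K, u⟩ + Diagram.ends ⟨T', K', w⟩ := by
  simp only [Diagram.ends, Multiset.add_bind, List.map_append, ← Multiset.coe_add]
  abel

/-- The combinations of diagrams in which the name `e` occurs once. -/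
def once (e : ℕ) : Submodule ℚ (Comb L) := Finsupp.supported ℚ ℚ {D | D.ends.count e = 1}

theorem notMem_ends {F : Set ℕ} {e : ℕ} (he : e ∈ F) {T : Multiset (ℕ × ℕ × ℕ)}
    {K : Multiset (ℕ × ℕ)} {u : List (L × ℕ)} (hT : ∀ t ∈ T, t.1 ∉ F ∧ t.2.1 ∉ F ∧ t.2.2 ∉ F)
    (hK : ∀ k ∈ K, k.1 ∉ F ∧ k.2 ∉ F) (hu : ∀ x ∈ u, x.2 ∉ F) : e ∉ Diagram.ends ⟨T, K, u⟩ := by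
  simp only [Diagram.ends, Multiset.mem_add, Multiset.mem_bind, Multiset.mem_coe, List.mem_map,
    Multiset.insert_eq_cons, Multiset.mem_cons, Multiset.mem_singleton, not_or]
  refine ⟨⟨?_, ?_⟩, ?_⟩
  · rintro ⟨t, ht, rfl | rfl | rfl⟩
    · exact (hT t ht).1 he
    · exact (hT t ht).2.1 he
    · exact (hT t ht).2.2 he
  · rintro ⟨t, ht, rfl | rfl⟩
    · exact (hK t ht).1 he
    · exact (hK t ht).2 he
  · rintro ⟨t, ht, rfl⟩
    exact hu t ht he

/-- A bivalent point at the end `e` of a combination of diagrams may be smoothed. -/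
theorem nullSub_smooth {P : Presentation Leg} (hP : GraphLike P) {F : Set ℕ} {y e : ℕ}
    (hy : y ≠ e) (he : e ∈ F) {d : Comb Leg} (hd : d ∈ once e) :
    addG 0 {(y, e)} d - ren (fun n => if n = e then y else n) d ∈ nullSub P F := by
  intro T K u hT hK hu
  have he' := notMem_ends he hT hK fun x hx => (hu x hx).2
  have hf : ∀ n, n ∉ F → (if n = e then y else n) = n := by
    intro n hn
    rw [if_neg]
    rintro rfl
    exact hn he
  have hd' : addG T K (consW u d) ∈ once e := by
    refine map_mem_of_gen (f := addG T K ∘ₗ consW u) (fun D hD => ?_) hd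
    rw [LinearMap.comp_apply, consW_gen, addG_gen]
    refine gen_mem_supported.2 ?_
    rw [Set.mem_ofPred_eq, ends_union, Multiset.count_add, Multiset.count_eq_zero_of_notMem he',
      zero_add]
    exact hD
  rw [map_sub, map_sub, map_sub, sub_eq_zero, ← ren_prefix hf hT hK fun x hx => (hu x hx).2,
    consW_addG, addG_comm]
  exact eq_of_gen (f := P.cls ∘ₗ addG 0 {(y, e)})
    (g := P.cls ∘ₗ ren fun n => if n = e then y else n) (fun D hD => hP.cls_smooth hy hD) hd'

/-- A trivalent vertex and a leg of grade 1 on a new edge. -/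
theorem once_tri_one {x p e : ℕ} {s : Set ℕ} (he : e ∉ s) (hx : x ≠ e) (hp : p ≠ e) {c : Comb Leg}
    (hc : c ∈ named s) (l : Leg) : addG {(x, p, e)} 0 (consL (l, p) c) ∈ once e ∧
      addG {(x, e, p)} 0 (consL (l, p) c) ∈ once e := by
  constructor
  · refine map_mem_of_gen (f := addG {(x, p, e)} 0 ∘ₗ consL (l, p)) (fun D hD => ?_) hc
    have : D.ends.count e = 0 := Multiset.count_eq_zero_of_notMem fun h => he (hD e h)
    simp only [LinearMap.comp_apply, consL_gen, addG_gen, zero_add, Multiset.singleton_add]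
    refine gen_mem_supported.2 ?_
    simp only [Set.mem_ofPred_eq, ends_tri, ends_cons, Multiset.count_cons, hx.symm, hp.symm,
      if_true, if_false]
    rw [show Diagram.ends ⟨D.tri, D.link, D.legs⟩ = D.ends from rfl, this]
  · refine map_mem_of_gen (f := addG {(x, e, p)} 0 ∘ₗ consL (l, p)) (fun D hD => ?_) hc
    have : D.ends.count e = 0 := Multiset.count_eq_zero_of_notMem fun h => he (hD e h)
    simp only [LinearMap.comp_apply, consL_gen, addG_gen, zero_add, Multiset.singleton_add]
    refine gen_mem_supported.2 ?_
    simp only [Set.mem_ofPred_eq, ends_tri, ends_cons, Multiset.count_cons, hx.symm, hp.symm,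
      if_true, if_false]
    rw [show Diagram.ends ⟨D.tri, D.link, D.legs⟩ = D.ends from rfl, this]

section
variable {t : ℕ × ℕ}

/-- The commutator of a fork and a leg of grade 1, in the presence of the Clifford relation. -/
theorem fork_comm_one {F : Set ℕ} {x y p q z : ℕ} (hp : p ∈ F) (hq : q ∈ F) (hz : z ∈ F)
    (hpq : p ≠ q) (hx : x ∉ F) (hy : y ∉ F) {c : Comb Leg}
    (hc : c ∈ named Fᶜ) :
    addG {(x, p, q)} 0 (consL (.one, p) (consL (.one, q) (consL (.one, y) c))
      - consL (.one, y) (consL (.one, p) (consL (.one, q) c)))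
      - (2 : ℚ) • addG {(x, z, y)} 0 (consL (.one, z) c) ∈ nullSub (sp 1 t) F := by
  have hP := graphLike_sp 1 t
  have ne : ∀ n, n ∉ F → n ≠ p ∧ n ≠ q ∧ n ≠ z := fun n hn =>
    ⟨fun h => hn (h ▸ hp), fun h => hn (h ▸ hq), fun h => hn (h ▸ hz)⟩
  obtain ⟨xp, xq, xz⟩ := ne x hx
  obtain ⟨yp, yq, yz⟩ := ne y hy
  -- moving the leg on `y` to the left past the legs on `q` and `p`
  have a1 := nullSub_tri (P := sp 1 t) (x := x) (y := p) (z := q) (F := ∅) (by simp) (by simp)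
    (by simp) (nullSub_consL (x := (.one, p)) rfl (by simp) (cliffHead_mem_nullSub (q := 1) y q c))
  have a2 := nullSub_tri (P := sp 1 t) (x := x) (y := p) (z := q) (F := ∅) (by simp) (by simp)
    (by simp) (cliffHead_mem_nullSub (q := 1) y p (consL (.one, q) c))
  have a := nullSub_mono (Set.empty_subset F) (Submodule.sub_mem _ a1 a2)
  -- the two terms in which the leg on `y` is joined to the fork
  have b1 := nullSub_smooth hP yq hq
    (once_tri_one (e := q) (s := Fᶜ) (by simpa using hq) xq hpq hc .one).1
  have b2 := nullSub_swap hP hp hz (addG {(x, p, y)} 0 (consL (.one, p) c))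
  have d1 := nullSub_smooth hP yp hp
    (once_tri_one (e := p) (s := Fᶜ) (by simpa using hp) xp hpq.symm hc .one).2
  have d2 := nullSub_swap hP hq hz (addG {(x, y, q)} 0 (consL (.one, q) c))
  have f1 := nullSub_anti (F := F) hP x y z (consL (.one, z) c)
  have f2 := nullSub_cyc (F := F) hP y x z (consL (.one, z) c)
  have cfix : ∀ f : ℕ → ℕ, (∀ n ∉ F, f n = n) → ren f c = c := fun f hf =>
    ren_eq_self (s := Fᶜ) hf hc
  have c1 : ∀ a b, b ∈ F → ren (fun n => if n = b then a else n) c = c := by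
    intro a b hb
    refine cfix _ fun n hn => if_neg ?_
    rintro rfl
    exact hn hb
  have c2 : ∀ a b, a ∈ F → b ∈ F → ren (Equiv.swap a b) c = c := by
    intro a b ha hb
    refine cfix _ fun n hn => Equiv.swap_apply_of_ne_of_ne ?_ ?_
    · rintro rfl; exact hn ha
    · rintro rfl; exact hn hb
  simp only [ren_addG, ren_consL, Multiset.map_singleton, Multiset.map_zero, c1 _ _ hq, c1 _ _ hp,
    c2 _ _ hp hz, c2 _ _ hq hz, xq, xp, hpq, hpq.symm, if_true, if_false,
    Equiv.swap_apply_left, Equiv.swap_apply_of_ne_of_ne xp xz, Equiv.swap_apply_of_ne_of_ne yp yz,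
    Equiv.swap_apply_of_ne_of_ne xq xz, Equiv.swap_apply_of_ne_of_ne yq yz] at b1 b2 d1 d2
  convert Submodule.add_mem _ (Submodule.sub_mem _ (Submodule.sub_mem _ (Submodule.add_mem _
    (Submodule.add_mem _ a b1) b2) d1) d2) (Submodule.add_mem _ (Submodule.smul_mem _ (-1 : ℚ) f1)
      f2) using 1
  simp only [cliffHead, LinearMap.sub_apply, LinearMap.add_apply, LinearMap.comp_apply,
    LinearMap.smul_apply, one_smul, map_sub, map_add, consL_addG, addG_comm 0 {(y, q)},
    addG_comm 0 {(y, p)}]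
  module

theorem swapHead_two_one (x p : ℕ) (c : Comb Leg) :
    swapHead (.two, x) (.one, p) c ∈ nullSub (sp 1 t) ∅ :=
  swapHead_mem_nullSub rfl rfl (Or.inl ⟨rfl, rfl⟩) c

/-- The commutator of two forks, in the presence of the Clifford relation. -/
theorem fork_comm_fork {F : Set ℕ} {x y p q p' q' z r s : ℕ} (hF : F = {p, q, p', q', z, r, s})
    (hnd : [p, q, p', q', z, r, s].Nodup) (hx : x ∉ F) (hy : y ∉ F) {c : Comb Leg}
    (hc : c ∈ named Fᶜ) :
    addG {(x, p, q)} 0 (addG {(y, p', q')} 0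
        (consL (.one, p) (consL (.one, q) (consL (.one, p') (consL (.one, q') c)))
        - consL (.one, p') (consL (.one, q') (consL (.one, p) (consL (.one, q) c)))))
      - (2 : ℚ) • addG {(x, z, y)} 0 (addG {(z, r, s)} 0 (consL (.one, r) (consL (.one, s) c))) ∈
      nullSub (sp 1 t) F := by
  have hP := graphLike_sp 1 t
  have m : ∀ n, n ∈ [p, q, p', q', z, r, s] → n ∈ F := by
    intro n hn
    rw [hF]
    simpa using hn
  have cs : ∀ a b, a ∈ F → b ∈ F → ren (Equiv.swap a b) c = c := by
    intro a b ha hb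
    refine ren_eq_self (s := Fᶜ) (fun n hn => Equiv.swap_apply_of_ne_of_ne ?_ ?_) hc
    · rintro rfl; exact hn ha
    · rintro rfl; exact hn hb
  have sw : ∀ a b n : ℕ, n ≠ a → n ≠ b → Equiv.swap a b n = n :=
    fun a b n h h' => Equiv.swap_apply_of_ne_of_ne h h'
  have hx' : ∀ n ∈ [p, q, p', q', z, r, s], x ≠ n := by rintro n hn rfl; exact hx (m _ hn)
  have hy' : ∀ n ∈ [p, q, p', q', z, r, s], y ≠ n := by rintro n hn rfl; exact hy (m _ hn)
  simp only [List.nodup_cons, List.mem_cons, List.not_mem_nil, or_false, not_or, forall_eq_or_imp,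
    List.nodup_nil, and_true, not_false_eq_true, forall_eq] at hnd hx' hy'
  obtain ⟨⟨n1, n2, n3, n4, n5, n6⟩, ⟨n7, n8, n9, n10, n11⟩, ⟨n12, n13, n14, n15⟩,
    ⟨n16, n17, n18⟩, ⟨n19, n20⟩, n21⟩ := hnd
  obtain ⟨x1, x2, x3, x4, x5, x6, x7⟩ := hx'
  obtain ⟨y1, y2, y3, y4, y5, y6, y7⟩ := hy'
  -- the fork on `x` acts as a derivation on the fork on `y`
  have cq : consL (.one, q') c ∈ named {p, q, r}ᶜ := by
    refine named_consL (by simp [n17, Ne.symm n3, Ne.symm n8]) ?_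
    refine named_mono (Set.compl_subset_compl.2 ?_) hc
    rw [hF]
    intro a; simp only [Set.mem_insert_iff, Set.mem_singleton_iff]; tauto
  have cq' : c ∈ named {p, q, s}ᶜ := by
    refine named_mono (Set.compl_subset_compl.2 ?_) hc
    rw [hF]
    intro a; simp only [Set.mem_insert_iff, Set.mem_singleton_iff]; tauto
  have a1 := fork_comm_one (t := t) (F := {p, q, r}) (x := x) (y := p') (p := p) (q := q) (z := r)
    (by simp) (by simp) (by simp) n1 (by simp [x1, x2, x6])
    (by simp [Ne.symm n2, Ne.symm n7, n14]) cq
  have a2 := fork_comm_one (t := t) (F := {p, q, s}) (x := x) (y := q') (p := p) (q := q) (z := s)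
    (by simp) (by simp) (by simp) n1 (by simp [x1, x2, x7])
    (by simp [Ne.symm n3, Ne.symm n8, n18]) cq'
  have a1' := nullSub_tri (x := y) (y := p') (z := q') (by simp [y1, y2, y6])
    (by simp [Ne.symm n2, Ne.symm n7, n14]) (by simp [Ne.symm n3, Ne.symm n8, n17]) a1
  have a2' := nullSub_tri (x := y) (y := p') (z := q') (by simp [y1, y2, y7])
    (by simp [Ne.symm n2, Ne.symm n7, n15]) (by simp [Ne.symm n3, Ne.symm n8, n18])
    (nullSub_consL (x := (.one, p')) rfl (by simp [Ne.symm n2, Ne.symm n7, n15]) a2)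
  have a1'' := nullSub_mono (F' := F) (by
    rw [hF]; intro a; simp only [Set.mem_insert_iff, Set.mem_singleton_iff]; tauto) a1'
  have a2'' := nullSub_mono (F' := F) (by
    rw [hF]; intro a; simp only [Set.mem_insert_iff, Set.mem_singleton_iff]; tauto) a2'
  -- the names of the edges of the two resulting terms are adjusted
  have b1 := nullSub_swap hP (m q' (by simp)) (m s (by simp)) (addG {(y, p', q')} 0
    (addG {(x, r, p')} 0 (consL (.one, r) (consL (.one, q') c))))
  have b2 := nullSub_swap hP (m p' (by simp)) (m z (by simp)) (addG {(y, p', s)} 0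
    (addG {(x, r, p')} 0 (consL (.one, r) (consL (.one, s) c))))
  have d1 := nullSub_swap hP (m p' (by simp)) (m r (by simp)) (addG {(y, p', q')} 0
    (addG {(x, s, q')} 0 (consL (.one, p') (consL (.one, s) c))))
  have d2 := nullSub_swap hP (m q' (by simp)) (m z (by simp)) (addG {(y, r, q')} 0
    (addG {(x, s, q')} 0 (consL (.one, r) (consL (.one, s) c))))
  simp only [ren_addG, ren_consL, Multiset.map_singleton, Multiset.map_zero,
    cs _ _ (m q' (by simp)) (m s (by simp)), cs _ _ (m p' (by simp)) (m z (by simp)),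
    cs _ _ (m p' (by simp)) (m r (by simp)), cs _ _ (m q' (by simp)) (m z (by simp)),
    Equiv.swap_apply_left, sw q' s _ y4 y7, sw q' s _ x4 x7, sw q' s _ n12 n15,
    sw q' s _ (Ne.symm n17) n21,
    sw p' z _ y3 y5, sw p' z _ x3 x5, sw p' z _ (Ne.symm n14) (Ne.symm n19),
    sw p' z _ (Ne.symm n15) (Ne.symm n20), sw p' r _ y3 y6, sw p' r _ x3 x6,
    sw p' r _ (Ne.symm n12) n17, sw p' r _ (Ne.symm n15) (Ne.symm n21),
    sw q' z _ y4 y5, sw q' z _ x4 x5, sw q' z _ (Ne.symm n17) (Ne.symm n19),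
    sw q' z _ (Ne.symm n18) (Ne.symm n20)] at b1 b2 d1 d2
  -- the IHX relation
  set v := consL (.one, r) (consL (.one, s) c) with hv
  have i0 := nullSub_ihx (F := F) hP y x r s z v
  have i1 := nullSub_cyc (F := F) hP x z y (addG {(z, r, s)} 0 v)
  have i1' := nullSub_cyc (F := F) hP z y x (addG {(z, r, s)} 0 v)
  have i2 := nullSub_anti (F := F) hP y z s (addG {(x, r, z)} 0 v)
  have i3 := nullSub_anti (F := F) hP y r z (addG {(x, s, z)} 0 v)
  have i4 := nullSub_cyc (F := F) hP x s z (addG {(r, y, z)} 0 v)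
  have i5 := nullSub_cyc (F := F) hP s z x (addG {(r, y, z)} 0 v)
  have i := Submodule.sub_mem _ (Submodule.sub_mem _ (Submodule.sub_mem _ (Submodule.add_mem _ i2 i3)
    (Submodule.add_mem _ i4 i5)) (Submodule.add_mem _ i1 i1')) i0
  convert Submodule.add_mem _ (Submodule.add_mem _ a1'' a2'') (Submodule.smul_mem _ (2 : ℚ)
    (Submodule.add_mem _ (Submodule.add_mem _ (Submodule.add_mem _ b1 b2)
      (Submodule.add_mem _ d1 d2)) i)) using 1
  simp only [map_sub, map_smul, consL_addG, addG_comm {(y, p', q')} 0 {(x, p, q)},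
    addG_comm {(z, y, s)} 0 {(x, r, z)}, addG_comm {(r, y, z)} 0]
  module

end

end Weil

namespace Weil

/-! ### The map to curvature legs respects the relations -/

variable {L M : Type}

/-- The coefficient of the fork in `toCurvature`. -/
def curvCoeff (l : Leg) : ℚ := if l = .two then 1 / 2 else 0

theorem toCurvature_gen (D : Diagram Leg) :
    toCurvature (gen D) = splitDiagram id curvCoeff D := extend_gen _ _

theorem splitG_named (f : L → Leg) (a) {s : Set ℕ} {W : List (L × ℕ × ℕ × ℕ)}
    (hW : ∀ x ∈ W, x.2.1 ∈ s ∧ x.2.2.1 ∈ s ∧ x.2.2.2 ∈ s) {c : Comb Leg} (hc : c ∈ named s) :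
    splitG f a W c ∈ named s := by
  induction W with
  | nil => exact hc
  | cons x W ih =>
    have hx := hW x (by simp)
    have ih := ih fun y hy => hW y (by simp [hy])
    rw [splitG, LinearMap.comp_apply, splitL, LinearMap.add_apply]
    refine Submodule.add_mem _ (named_consL hx.1 ih) (Submodule.smul_mem _ _ ?_)
    exact named_addG (by simpa using hx) (by simp)
      (named_consL (x := (Leg.one, _)) hx.2.1 (named_consL (x := (Leg.one, _)) hx.2.2 ih))

theorem newNames_sublist {W W' : List (L × ℕ × ℕ × ℕ)} (h : W.Sublist W') :
    (newNames W).Sublist (newNames W') := by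
  induction h with
  | slnil => exact List.Sublist.refl _
  | cons a _ ih => exact ih.trans (List.sublist_append_right _ _)
  | cons_cons a _ ih => exact ih.append_left _

theorem mem_newNames {W : List (L × ℕ × ℕ × ℕ)} {x} (hx : x ∈ W) :
    x.2.2.1 ∈ newNames W ∧ x.2.2.2 ∈ newNames W := by
  simp only [newNames, List.mem_flatMap]
  exact ⟨⟨x, hx, by simp⟩, ⟨x, hx, by simp⟩⟩

/-- The images under `toCurvature` of the diagrams that occur in the relations on legs, with
coherent choices of the names of new edges. -/
theorem exists_split_local {P : Presentation Leg} (hP : GraphLike P) (k₁ k₂ k₃ : Leg) {x y z : ℕ}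
    (T K) (u v : List (Leg × ℕ)) (hx : x ≠ z) (hy : y ≠ z) (hu : ∀ a ∈ u, a.2 ≠ z)
    (hv : z ∉ Diagram.ends ⟨T, K, v⟩) :
    ∃ (U : List (Leg × ℕ × ℕ × ℕ)) (c : Comb Leg) (F : Set ℕ) (p q p' q' r s : ℕ),
      [p, q, p', q', z, r, s].Nodup ∧ F = {p, q, p', q', z, r, s} ∧ x ∉ F ∧ y ∉ F ∧
      (∀ a ∈ U, (∃ b ∈ u, b.1 = a.1) ∧ a.2.1 ∉ F ∧ a.2.2.1 ∉ F ∧ a.2.2.2 ∉ F) ∧ c ∈ named Fᶜ ∧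
      P.cls (toCurvature (gen ⟨T, K, u ++ (k₁, x) :: (k₂, y) :: v⟩)) =
        P.cls (splitG id curvCoeff U (splitL k₁ (curvCoeff k₁) x p q
          (splitL k₂ (curvCoeff k₂) y p' q' c))) ∧
      P.cls (toCurvature (gen ⟨T, K, u ++ (k₂, y) :: (k₁, x) :: v⟩)) =
        P.cls (splitG id curvCoeff U (splitL k₂ (curvCoeff k₂) y p' q'
          (splitL k₁ (curvCoeff k₁) x p q c))) ∧
      P.cls (toCurvature (gen ⟨(x, z, y) ::ₘ T, K, u ++ (k₃, z) :: v⟩)) =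
        P.cls (splitG id curvCoeff U (addG {(x, z, y)} 0 (splitL k₃ (curvCoeff k₃) z r s c))) ∧
      P.cls (toCurvature (gen ⟨T, (x, y) ::ₘ K, u ++ v⟩)) =
        P.cls (splitG id curvCoeff U (addG 0 {(x, y)} c)) := by
  classical
  let E : Finset ℕ := (x ::ₘ y ::ₘ z ::ₘ Diagram.ends ⟨T, K, u ++ v⟩).toFinset
  obtain ⟨W, hW, hnd, hfr⟩ := exists_newNames (u ++ (k₁, x) :: (k₂, y) :: (k₃, z) :: v) E
  obtain ⟨U, W1, rfl, hU, h1⟩ := List.map_eq_append_iff.1 hW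
  obtain ⟨X, W2, rfl, hX, h2⟩ := List.map_eq_cons_iff.1 h1
  obtain ⟨Y, W3, rfl, hY, h3⟩ := List.map_eq_cons_iff.1 h2
  obtain ⟨Z, V, rfl, hZ, hV⟩ := List.map_eq_cons_iff.1 h3
  obtain ⟨k₁', x', p, q⟩ := X
  obtain ⟨k₂', y', p', q'⟩ := Y
  obtain ⟨k₃', z', r, s⟩ := Z
  simp only [Prod.mk.injEq] at hX hY hZ
  obtain ⟨rfl, rfl⟩ := hX
  obtain ⟨rfl, rfl⟩ := hY
  obtain ⟨rfl, rfl⟩ := hZ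
  have hu2 : ∀ a ∈ U, (a.1, a.2.1) ∈ u := fun a ha => hU ▸ List.mem_map_of_mem (f := fun x =>
    (x.1, x.2.1)) ha
  have hv2 : ∀ a ∈ V, (a.1, a.2.1) ∈ v := fun a ha => hV ▸ List.mem_map_of_mem (f := fun x =>
    (x.1, x.2.1)) ha
  have hEx : x' ∈ E := by simp [E]
  have hEy : y' ∈ E := by simp [E]
  have hEz : z' ∈ E := by simp [E]
  have hE : ∀ n ∈ Diagram.ends ⟨T, K, u ++ v⟩, n ∈ E := fun n hn => by
    simp only [E, Multiset.mem_toFinset, Multiset.mem_cons]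
    exact Or.inr (Or.inr (Or.inr hn))
  have hEu : ∀ a ∈ u, a.2 ∈ E := fun a ha => hE _ (by
    rw [ends_append, Multiset.mem_add, Multiset.mem_coe]
    exact Or.inl (List.mem_map_of_mem ha))
  have hEv : ∀ a ∈ v, a.2 ∈ E := fun a ha => hE _ (by
    rw [ends_append, Multiset.mem_add, ends_mk, Multiset.mem_add, Multiset.mem_coe]
    exact Or.inr (Or.inr (List.mem_map_of_mem ha)))
  have main : ∀ (A : List (Leg × ℕ × ℕ × ℕ)) (T' : Multiset (ℕ × ℕ × ℕ)) (K' : Multiset (ℕ × ℕ)),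
      (∃ B, A.Perm B ∧ B.Sublist (U ++ (k₁', x', p, q) :: (k₂', y', p', q') ::
        (k₃', z', r, s) :: V)) →
      (∀ n ∈ Diagram.ends ⟨T', K', oldLegs A⟩, n ∈ E) →
      P.cls (toCurvature (gen ⟨T', K', oldLegs A⟩)) =
        P.cls (splitG id curvCoeff A (gen ⟨T', K', []⟩)) := by
    rintro A T' K' ⟨B, hAB, hB⟩ hA
    rw [toCurvature_gen, cls_splitG hP]
    · exact (newNames_perm hAB).nodup_iff.2 (hnd.sublist (newNames_sublist hB))
    · intro n hn hn'
      exact hfr n ((newNames_sublist hB).subset ((newNames_perm hAB).subset hn)) (hA n hn')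
  have hUV : (newNames (U ++ (k₁', x', p, q) :: (k₂', y', p', q') :: (k₃', z', r, s) :: V)) =
      newNames U ++ ([p, q, p', q', r, s] ++ newNames V) := by
    simp [newNames]
  have hnd' := hnd
  rw [hUV, List.nodup_append, List.nodup_append] at hnd'
  obtain ⟨-, ⟨hnd6, -, hdis2⟩, hdis1⟩ := hnd'
  have hz6 : ∀ n ∈ E, n ∉ [p, q, p', q', r, s] := fun n hn hn' => hfr n (by
    rw [hUV]; simp only [List.mem_append]; exact Or.inr (Or.inl hn')) hn
  have hF : ∀ n, n ∈ ({p, q, p', q', z', r, s} : Set ℕ) ↔ n = z' ∨ n ∈ [p, q, p', q', r, s] := by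
    intro n
    simp only [Set.mem_insert_iff, Set.mem_singleton_iff, List.mem_cons, List.not_mem_nil, or_false]
    tauto
  have hFE : ∀ n ∈ E, n ≠ z' → n ∉ ({p, q, p', q', z', r, s} : Set ℕ) := fun n hn hn' h => by
    rcases (hF n).1 h with h | h
    · exact hn' h
    · exact hz6 n hn h
  have hFU : ∀ n ∈ newNames U, n ∉ ({p, q, p', q', z', r, s} : Set ℕ) := fun n hn h => by
    rcases (hF n).1 h with rfl | h
    · exact hfr n (by rw [hUV]; simp only [List.mem_append]; exact Or.inl hn) hEz
    · exact hdis1 n hn n (by simp only [List.mem_append]; exact Or.inl h) rfl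
  have hFV : ∀ n ∈ newNames V, n ∉ ({p, q, p', q', z', r, s} : Set ℕ) := fun n hn h => by
    rcases (hF n).1 h with rfl | h
    · exact hfr n (by rw [hUV]; simp only [List.mem_append]; exact Or.inr (Or.inr hn)) hEz
    · exact hdis2 n h n hn rfl
  have hvz : ∀ n ∈ Diagram.ends ⟨T, K, v⟩, n ≠ z' := by rintro n hn rfl; exact hv hn
  have old : ∀ A : List (Leg × ℕ × ℕ × ℕ), oldLegs (U ++ (A ++ V)) = u ++ (oldLegs A ++ v) := by
    intro A
    rw [← hU, ← hV]
    simp [oldLegs]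
  refine ⟨U, splitG id curvCoeff V (gen ⟨T, K, []⟩), _, p, q, p', q', r, s, ?_, rfl,
    hFE _ hEx hx, hFE _ hEy hy, fun a ha => ⟨⟨_, hu2 a ha, rfl⟩, hFE _ (hEu _ (hu2 a ha))
    (hu _ (hu2 a ha)), hFU _ (mem_newNames ha).1, hFU _ (mem_newNames ha).2⟩, ?_, ?_, ?_, ?_, ?_⟩
  · have hz := hz6 z' hEz
    simp only [List.nodup_cons, List.mem_cons, List.not_mem_nil, or_false, not_or,
      List.nodup_nil, and_true, not_false_eq_true] at hnd6 hz ⊢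
    obtain ⟨⟨n1, n2, n3, n5, n6⟩, ⟨n7, n8, n10, n11⟩, ⟨n12, n14, n15⟩, ⟨n17, n18⟩, n21⟩ := hnd6
    obtain ⟨z1, z2, z3, z4, z5, z6⟩ := hz
    exact ⟨⟨n1, n2, n3, Ne.symm z1, n5, n6⟩, ⟨n7, n8, Ne.symm z2, n10, n11⟩,
      ⟨n12, Ne.symm z3, n14, n15⟩, ⟨Ne.symm z4, n17, n18⟩, ⟨z5, z6⟩, n21⟩
  · refine splitG_named _ _ (fun a ha => ?_) (gen_mem_supported.2 fun n hn => ?_)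
    · refine ⟨hFE _ (hEv _ (hv2 a ha)) (hvz _ ?_), hFV _ (mem_newNames ha).1,
        hFV _ (mem_newNames ha).2⟩
      rw [ends_mk, Multiset.mem_add, Multiset.mem_coe]
      exact Or.inr (List.mem_map_of_mem (f := Prod.snd) (hv2 a ha))
    · have hn' : n ∈ Diagram.ends ⟨T, K, v⟩ := by
        simp only [ends_mk, List.map_nil, Multiset.coe_nil, add_zero] at hn ⊢
        exact Multiset.mem_add.2 (Or.inl hn)
      refine hFE _ (hE n ?_) (hvz n hn')
      rw [ends_append, Multiset.mem_add]
      exact Or.inr hn'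
  · have := main (U ++ ([(k₁', x', p, q), (k₂', y', p', q')] ++ V)) T K
      ⟨_, List.Perm.refl _, List.Sublist.append_left (by simp) _⟩ (fun n hn => ?_)
    · rw [old, splitG_append, splitG_append] at this
      exact this
    · rw [old] at hn
      simp only [oldLegs, List.map_cons, List.map_nil, List.cons_append, List.nil_append,
        ends_append, ends_cons, Multiset.mem_add, Multiset.mem_cons] at hn hE
      grind
  · have := main (U ++ ([(k₂', y', p', q'), (k₁', x', p, q)] ++ V)) T K
      ⟨U ++ ([(k₁', x', p, q), (k₂', y', p', q')] ++ V),
        ((List.Perm.swap _ _ _).append_right _).append_left _,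
        List.Sublist.append_left (by simp) _⟩ (fun n hn => ?_)
    · rw [old, splitG_append, splitG_append] at this
      exact this
    · rw [old] at hn
      simp only [oldLegs, List.map_cons, List.map_nil, List.cons_append, List.nil_append,
        ends_append, ends_cons, Multiset.mem_add, Multiset.mem_cons] at hn hE
      grind
  · have := main (U ++ ([(k₃', z', r, s)] ++ V)) ((x', z', y') ::ₘ T) K
      ⟨_, List.Perm.refl _, List.Sublist.append_left (by simp) _⟩ (fun n hn => ?_)
    · have e : (gen ⟨(x', z', y') ::ₘ T, K, []⟩ : Comb Leg) =
          addG {(x', z', y')} 0 (gen ⟨T, K, []⟩) := by simp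
      rw [old, splitG_append, splitG_append, e, splitG_addG, splitG_addG] at this
      exact this
    · rw [old] at hn
      simp only [oldLegs, List.map_cons, List.map_nil, List.cons_append, List.nil_append, ends_tri,
        ends_append, ends_cons, Multiset.mem_add, Multiset.mem_cons] at hn hE
      grind
  · have := main (U ++ ([] ++ V)) T ((x', y') ::ₘ K)
      ⟨_, List.Perm.refl _, List.Sublist.append_left
        (((List.sublist_cons_self _ _).trans (List.sublist_cons_self _ _)).trans
          (List.sublist_cons_self _ _)) _⟩ (fun n hn => ?_)
    · have e : (gen ⟨T, (x', y') ::ₘ K, []⟩ : Comb Leg) =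
          addG 0 {(x', y')} (gen ⟨T, K, []⟩) := by simp
      rw [old, splitG_append, splitG_append, e, splitG_addG] at this
      exact this
    · rw [old] at hn
      simp only [oldLegs, List.map_nil, List.nil_append, ends_link,
        ends_append, Multiset.mem_add, Multiset.mem_cons] at hn hE
      grind

theorem splitL_of_ne {k : Leg} (hk : k ≠ .two) (e p q : ℕ) :
    splitL k (curvCoeff k) e p q = consL (k, e) := by
  rw [splitL, curvCoeff, if_neg hk, zero_smul, add_zero]

theorem not_op_of_type_zero {D : Diagram Leg} (hD : D ∈ opDiagrams (0, 0)) :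
    ∀ x ∈ D.legs, x.1.isOp = false := by
  intro x hx
  have h := (mem_opDiagrams.1 hD).2.2.2
  have h2 : x.1.opGrade = 0 := by
    rw [List.sum_eq_zero_iff] at h
    exact h _ (List.mem_map_of_mem (f := fun x => x.1.opGrade) hx)
  obtain ⟨l, n⟩ := x
  rcases l with _ | _ | _ | (_ | _) <;> simp_all [Leg.isOp, Leg.opGrade, Param.grade]

theorem fresh_of_valid {T K x y z} {u v : List (Leg × ℕ)} {k : Leg}
    (h : Diagram.Valid ⟨(x, z, y) ::ₘ T, K, u ++ (k, z) :: v⟩) :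
    x ≠ z ∧ y ≠ z ∧ (∀ a ∈ u, a.2 ≠ z) ∧ z ∉ Diagram.ends ⟨T, K, v⟩ := by
  have hz := h z
  rw [ends_tri, ends_append, ends_cons] at hz
  have hz' : z ∉ x ::ₘ y ::ₘ (((u.map Prod.snd : List ℕ) : Multiset ℕ) +
      Diagram.ends ⟨T, K, v⟩) := by
    rw [← Multiset.count_eq_zero]
    simp only [Multiset.count_cons, Multiset.count_add, if_true] at hz ⊢
    omega
  simp only [Multiset.mem_cons, Multiset.mem_add, not_or, Multiset.mem_coe, List.mem_map] at hz'
  exact ⟨Ne.symm hz'.1, Ne.symm hz'.2.1, fun a ha h => hz'.2.2.1 ⟨a, ha, h⟩, hz'.2.2.2⟩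

theorem mem_of_stu {T K x y z} {u v : List (Leg × ℕ)} {k k' l : Leg} {A : Set (Diagram Leg)}
    (h : gen ⟨T, K, u ++ (k, x) :: (k', y) :: v⟩ - gen ⟨T, K, u ++ (k', y) :: (k, x) :: v⟩
      - gen ⟨(x, z, y) ::ₘ T, K, u ++ (l, z) :: v⟩ ∈ Finsupp.supported ℚ ℚ A) :
    ⟨(x, z, y) ::ₘ T, K, u ++ (l, z) :: v⟩ ∈ A := by
  refine h (Finsupp.mem_support_iff.2 ?_)
  have h1 : ∀ w, (⟨T, K, w⟩ : Diagram Leg) ≠ ⟨(x, z, y) ::ₘ T, K, u ++ (l, z) :: v⟩ := by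
    intro w h
    have := congrArg (fun D => Multiset.card D.tri) h
    simp at this
  simp [gen, Finsupp.sub_apply, Finsupp.single_eq_of_ne (h1 _).symm]

theorem splitG_mem {P : Presentation Leg} {f : L → Leg} {a : L → ℚ} {W : List (L × ℕ × ℕ × ℕ)}
    {d : Comb Leg} {F : Set ℕ} (hW : ∀ x ∈ W, (f x.1).isOp = false ∧ x.2.1 ∉ F ∧ x.2.2.1 ∉ F ∧
      x.2.2.2 ∉ F) (h : d ∈ nullSub P F) : splitG f a W d ∈ nullSub P F := by
  have := splitG_cls_eq (f := f) (a := a) hW (c := d) (d := 0) (by simpa using h)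
  simpa using this

theorem not_op_of_split {u : List (Leg × ℕ)} (hu : ∀ a ∈ u, a.1.isOp = false)
    {U : List (Leg × ℕ × ℕ × ℕ)} {F : Set ℕ}
    (hU : ∀ a ∈ U, (∃ b ∈ u, b.1 = a.1) ∧ a.2.1 ∉ F ∧ a.2.2.1 ∉ F ∧ a.2.2.2 ∉ F) :
    ∀ a ∈ U, (id a.1).isOp = false ∧ a.2.1 ∉ F ∧ a.2.2.1 ∉ F ∧ a.2.2.2 ∉ F := by
  intro a ha
  obtain ⟨⟨b, hb, hba⟩, h⟩ := hU a ha
  exact ⟨hba ▸ hu b hb, h⟩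

theorem stuHead_mem_nullSub {F : Set ℕ} {q t x y z} (hz : z ∈ F) (hx : x ∉ F) (hy : y ∉ F)
    {c : Comb Leg} (hc : c ∈ named Fᶜ) : stuHead z x y c ∈ nullSub (sp q t) F := by
  refine locN_mem_nullSub hz (locN_of ?_)
  have := LocRel.stu (q := q) (z := z) [] x y c (by simp) (by simp) (by rintro rfl; exact hx hz)
    (by rintro rfl; exact hy hz) (named_mono (by simpa using hz) hc)
  rwa [consW_nil] at this

/-- The map `toCurvature` is well defined: since curvature legs commute with legs of grade 1, the
commutators of the sums (curvature leg) `+ 1/2` fork are those of the curvature legs and of the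
halved forks, and the halved forks have the commutators of legs of grade 2 by the Clifford
relation. -/
theorem wellDefined_toCurvature (t) : WellDefined spWHat (sp 1 t) toCurvature := by
  have hP := graphLike_sp 1 t
  refine wellDefined_of_rel fun r hr hs => ?_
  rcases hr with ((hr | hr) | hr) | hr
  · exact cls_split_graphRel (P := spWHat) hP (fun D hD => hD.1) _ _ hr hs
  · obtain ⟨T, K, u, v, x, y, z, rfl⟩ := hr
    have hD := mem_of_stu hs
    obtain ⟨hx, hy, hu, hv⟩ := fresh_of_valid hD.1
    have hu' := fun a ha => not_op_of_type_zero hD a (List.mem_append_left _ ha)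
    obtain ⟨U, c, F, p, q, p', q', r, s, hnd, hF, hxF, hyF, hU, hc, e1, e2, e3, -⟩ :=
      exists_split_local hP .two .two .two T K u v hx hy hu hv
    rw [map_sub, map_sub, map_sub, map_sub, e1, e2, e3, ← map_sub, ← map_sub, ← map_sub, ← map_sub]
    refine nullSub_cls (F := F) (splitG_mem (not_op_of_split hu' hU) ?_)
    have hz : z ∈ F := by rw [hF]; simp
    have h0 := nullSub_mono (Set.empty_subset F) (nullSub_splitL (P := sp 1 t) swapHead_two_one
      (1 / 2) x p q y p' q' c)
    have h1 := stuHead_mem_nullSub (q := 1) (t := t) hz hxF hyF hc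
    have h2 := fork_comm_fork (t := t) hF hnd hxF hyF hc
    convert Submodule.add_mem _ (Submodule.add_mem _ h0 h1)
      (Submodule.smul_mem _ ((1 / 2 : ℚ) ^ 2) h2) using 1
    simp only [curvCoeff, if_true, stuHead, splitL, LinearMap.sub_apply, LinearMap.add_apply,
      LinearMap.comp_apply, LinearMap.smul_apply, map_add, map_sub, map_smul]
    module
  · obtain ⟨T, K, u, v, x, y, z, rfl⟩ := hr
    have hD := mem_of_stu hs
    obtain ⟨hx, hy, hu, hv⟩ := fresh_of_valid hD.1
    have hu' := fun a ha => not_op_of_type_zero hD a (List.mem_append_left _ ha)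
    obtain ⟨U, c, F, p, q, p', q', r, s, hnd, hF, hxF, hyF, hU, hc, e1, e2, e3, -⟩ :=
      exists_split_local hP .two .one .one T K u v hx hy hu hv
    rw [map_sub, map_sub, map_sub, map_sub, e1, e2, e3, ← map_sub, ← map_sub, ← map_sub, ← map_sub]
    refine nullSub_cls (F := F) (splitG_mem (not_op_of_split hu' hU) ?_)
    rw [splitL_of_ne (k := .one) (by decide), splitL_of_ne (k := .one) (by decide)]
    have hpF : p ∈ F := by rw [hF]; simp
    have hqF : q ∈ F := by rw [hF]; simp
    have hzF : z ∈ F := by rw [hF]; simp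
    have hpq : p ≠ q := by
      rintro rfl
      simp at hnd
    have h1 := nullSub_mono (Set.empty_subset F) (swapHead_two_one (t := t) x y c)
    have h2 := fork_comm_one (t := t) hpF hqF hzF hpq hxF hyF hc
    have hs : sgn .two .one = 1 := by norm_num [sgn, Leg.grade]
    convert Submodule.add_mem _ h1 (Submodule.smul_mem _ (1 / 2 : ℚ) h2) using 1
    simp only [curvCoeff, if_true, swapHead, splitL, LinearMap.sub_apply, LinearMap.add_apply, hs,
      LinearMap.comp_apply, LinearMap.smul_apply, map_add, map_sub, map_smul, consL_addG]
    module
  · obtain ⟨T, K, u, v, x, y, rfl⟩ := hr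
    have hD : (⟨T, K, u ++ (.one, x) :: (.one, y) :: v⟩ : Diagram Leg) ∈ opDiagrams (0, 0) := by
      refine hs (Finsupp.mem_support_iff.2 ?_)
      have hne : (⟨T, (x, y) ::ₘ K, u ++ v⟩ : Diagram Leg) ≠
          ⟨T, K, u ++ (.one, x) :: (.one, y) :: v⟩ := by
        intro h
        have := congrArg (fun D => Multiset.card D.link) h
        simp at this
      simp only [gen, Finsupp.sub_apply, Finsupp.add_apply, Finsupp.single_eq_same,
        Finsupp.single_eq_of_ne hne.symm]
      classical
      rw [Finsupp.single_apply]
      split_ifs <;> norm_num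
    have hu' := fun a ha => not_op_of_type_zero hD a (List.mem_append_left _ ha)
    obtain ⟨z, hz⟩ := Infinite.exists_notMem_finset
      (Diagram.ends ⟨T, K, u ++ (.one, x) :: (.one, y) :: v⟩).toFinset
    rw [Multiset.mem_toFinset, ends_append, ends_cons, ends_cons] at hz
    simp only [Multiset.mem_cons, Multiset.mem_add, not_or, Multiset.mem_coe, List.mem_map] at hz
    obtain ⟨hzu, hzx, hzy, hzv⟩ := hz
    obtain ⟨U, c, F, p, q, p', q', r, s, hnd, hF, hxF, hyF, hU, hc, e1, e2, -, e4⟩ :=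
      exists_split_local hP .one .one .one T K u v (Ne.symm hzx) (Ne.symm hzy)
        (fun a ha h => hzu ⟨a, ha, h⟩) hzv
    rw [map_sub, map_add, map_sub, map_add, e1, e2, e4, ← map_add, ← map_sub, ← map_add, ← map_sub]
    refine nullSub_cls (F := F) (splitG_mem (not_op_of_split hu' hU) ?_)
    rw [splitL_of_ne (by decide), splitL_of_ne (by decide)]
    convert nullSub_mono (Set.empty_subset F) (cliffHead_mem_nullSub (q := 1) (t := t) x y c)
      using 1
    simp only [cliffHead, LinearMap.sub_apply, LinearMap.add_apply, LinearMap.comp_apply,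
      LinearMap.smul_apply, one_smul]

end Weil

namespace Weil

/-! ### Types of products -/

/-- The parameter-grade of a list of legs. -/
def parS (w : List (Leg × ℕ)) : ℕ := (w.map fun x => x.1.parGrade).sum

/-- The operator-grade of a list of legs. -/
def opS (w : List (Leg × ℕ)) : ℕ := (w.map fun x => x.1.opGrade).sum

@[simp] theorem parS_nil : parS [] = 0 := rfl
@[simp] theorem opS_nil : opS [] = 0 := rfl
@[simp] theorem parS_cons (x w) : parS (x :: w) = x.1.parGrade + parS w := by simp [parS]
@[simp] theorem opS_cons (x w) : opS (x :: w) = x.1.opGrade + opS w := by simp [opS]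

theorem parGrade_of_op {l : Leg} (h : l.isOp) : l.parGrade = 0 := by
  obtain ⟨p, rfl⟩ := eq_op_of_isOp h
  rfl

theorem opGrade_of_not_op {l : Leg} (h : l.isOp = false) : l.opGrade = 0 := by
  cases l <;> simp_all [Leg.isOp, Leg.opGrade]

theorem parS_of_op {w : List (Leg × ℕ)} (h : ∀ x ∈ w, x.1.isOp) : parS w = 0 := by
  induction w with
  | nil => rfl
  | cons x w ih =>
    rw [parS_cons, parGrade_of_op (h x (by simp)), ih fun y hy => h y (by simp [hy])]

theorem mem_opDiagrams' {t : ℕ × ℕ} {D : Diagram Leg} : D ∈ opDiagrams t ↔ D.Valid ∧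
    Normal D.legs ∧ parS D.legs = t.1 ∧ opS D.legs = t.2 := mem_opDiagrams

theorem mem_opDiagrams_self {D : Diagram Leg} (h : D ∈ Good) :
    D ∈ opDiagrams (parS D.legs, opS D.legs) := mem_opDiagrams'.2 ⟨h.1, h.2, rfl, rfl⟩

theorem opDiagrams_unique {t t' : ℕ × ℕ} {D : Diagram Leg} (h : D ∈ opDiagrams t)
    (h' : D ∈ opDiagrams t') : t = t' := by
  obtain ⟨-, -, h1, h2⟩ := mem_opDiagrams'.1 h
  obtain ⟨-, -, h1', h2'⟩ := mem_opDiagrams'.1 h'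
  exact Prod.ext (h1.symm.trans h1') (h2.symm.trans h2')

theorem normal_of_ops {w : List (Leg × ℕ)} (h : ∀ x ∈ w, x.1.isOp) : Normal w :=
  List.pairwise_of_forall_mem_list fun _ _ b hb _ => h b hb

theorem pushC_type (k : ℚ) {o : Leg × ℕ} (ho : o.1.isOp) (T K) {w : List (Leg × ℕ)}
    (hw : Normal w) : pushC k o (gen ⟨T, K, w⟩) ∈ Finsupp.supported ℚ ℚ {F | Normal F.legs ∧
      ((parS F.legs = parS w ∧ opS F.legs = opS w + o.1.opGrade) ∨
        (k ≠ 0 ∧ parS F.legs + o.1.opGrade = parS w ∧ opS F.legs = opS w))} := by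
  induction w generalizing T K with
  | nil =>
    rw [pushC_nil]
    exact gen_mem_supported.2 ⟨by simp [Normal], Or.inl (by simp [parGrade_of_op ho])⟩
  | cons y w ih =>
    rw [← consL_gen y ⟨T, K, w⟩]
    cases hy : y.1.isOp
    · rw [pushC_consL _ _ hy]
      rw [normal_cons_of_not_op hy] at hw
      refine Submodule.add_mem _ (Submodule.smul_mem _ _ ?_) ?_
      · refine map_mem_of_gen (fun F hF => ?_) (ih T K hw)
        rw [consL_gen]
        refine gen_mem_supported.2 ⟨(normal_cons_of_not_op hy).2 hF.1, ?_⟩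
        rcases hF.2 with h | h
        · left
          simp only [parS_cons, opS_cons, h]
          exact ⟨trivial, by ring⟩
        · right
          simp only [parS_cons, opS_cons]
          exact ⟨h.1, by omega, by omega⟩
      · split_ifs with hm
        · by_cases hk : k = 0
          · rw [hk, zero_smul]
            exact Submodule.zero_mem _
          rw [addG_gen]
          refine Submodule.smul_mem _ _ (gen_mem_supported.2 ⟨hw, Or.inr ⟨hk, ?_, ?_⟩⟩)
          · obtain ⟨p, hp⟩ := eq_op_of_isOp ho
            rw [hp] at hm ⊢
            obtain ⟨l, n⟩ := y
            cases l <;> simp_all [matchesParam, Leg.opGrade, Leg.parGrade, add_comm]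
          · simp [opGrade_of_not_op hy]
        · rw [zero_smul]
          exact Submodule.zero_mem _
    · rw [pushC_consL_op _ _ hy, consL_gen, consL_gen]
      have hw' := (normal_cons_of_op hy).1 hw
      refine gen_mem_supported.2 ⟨(normal_cons_of_op ho).2 ?_, Or.inl ?_⟩
      · intro x hx
        rcases List.mem_cons.1 hx with rfl | hx
        · exact hy
        · exact hw' x hx
      · simp only [parS_cons, opS_cons, parGrade_of_op ho]
        exact ⟨by ring, by ring⟩

/-- The types `r` which occur in the product of vectors of types `p` and `q`: operator legs
of total grade `g` have been glued, with `g = 0` if `k = 0`. -/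
def Rule (k : ℚ) (p q r : ℕ × ℕ) : Prop :=
  ∃ g, g ≤ p.2 ∧ g ≤ q.1 ∧ (k = 0 → g = 0) ∧ r.1 + g = p.1 + q.1 ∧ r.2 + g = p.2 + q.2

theorem actW_type (k : ℚ) {w v : List (Leg × ℕ)} (hw : Normal w) (hv : Normal v) (T K) :
    actW k w (gen ⟨T, K, v⟩) ∈ Finsupp.supported ℚ ℚ {F | Normal F.legs ∧
      Rule k (parS w, opS w) (parS v, opS v) (parS F.legs, opS F.legs)} := by
  induction w with
  | nil => exact gen_mem_supported.2 ⟨hv, 0, by simp⟩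
  | cons x w ih =>
    cases hx : x.1.isOp
    · have ih := ih ((normal_cons_of_not_op hx).1 hw)
      rw [actW, LinearMap.comp_apply, act_of_not_op _ hx]
      refine map_mem_of_gen (fun F hF => ?_) ih
      obtain ⟨hF, g, h1, h2, h3, h4, h5⟩ := hF
      rw [consL_gen]
      refine gen_mem_supported.2 ⟨(normal_cons_of_not_op hx).2 hF, g, ?_, h2, h3, ?_, ?_⟩
      all_goals simp only [parS_cons, opS_cons] at *; omega
    · have hops := (normal_cons_of_op hx).1 hw
      have ih := ih (normal_of_ops hops)
      rw [actW, LinearMap.comp_apply, act_of_op _ hx]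
      refine map_mem_of_gen (fun F hF => ?_) ih
      obtain ⟨hF, g, h1, h2, h3, h4, h5⟩ := hF
      obtain ⟨T', K', w'⟩ := F
      refine Finsupp.supported_mono ?_ (pushC_type k hx T' K' hF)
      have hp := parS_of_op hops
      have hx' := parGrade_of_op hx
      rintro G ⟨hG, h | h⟩
      · refine ⟨hG, g, ?_, h2, h3, ?_, ?_⟩ <;> simp only [parS_cons, opS_cons] at * <;> omega
      · refine ⟨hG, g + x.1.opGrade, ?_, ?_, fun hk => absurd hk h.1, ?_, ?_⟩ <;>
          simp only [parS_cons, opS_cons] at * <;> omega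

theorem parS_rename (f : ℕ → ℕ) (D : Diagram Leg) : parS (D.rename f).legs = parS D.legs := by
  simp [parS, Diagram.rename, Function.comp_def]

theorem opS_rename (f : ℕ → ℕ) (D : Diagram Leg) : opS (D.rename f).legs = opS D.legs := by
  simp [opS, Diagram.rename, Function.comp_def]

theorem star_gen_type (k : ℚ) {D E : Diagram Leg} {p q} (hD : D ∈ opDiagrams p)
    (hE : E ∈ opDiagrams q) : star k (gen D) (gen E) ∈
      Finsupp.supported ℚ ℚ {F | ∃ r, F ∈ opDiagrams r ∧ Rule k p q r} := by
  have h1 := star_gen_endsIn k D E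
  obtain ⟨vD, nD, pD, oD⟩ := mem_opDiagrams'.1 hD
  obtain ⟨vE, nE, pE, oE⟩ := mem_opDiagrams'.1 hE
  have h2 : star k (gen D) (gen E) ∈ Finsupp.supported ℚ ℚ {F | Normal F.legs ∧
      Rule k p q (parS F.legs, opS F.legs)} := by
    rw [star, ren_gen, ren_gen, actC_gen, LinearMap.comp_apply]
    have := actW_type k (normal_rename left nD) (normal_rename right nE) (E.rename right).tri
      (E.rename right).link
    rw [parS_rename, parS_rename, opS_rename, opS_rename, pD, oD, pE, oE] at this
    refine map_mem_of_gen (fun F hF => ?_) this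
    rw [addG_gen]
    exact gen_mem_supported.2 hF
  intro F hF
  have hv : F.Valid := by
    intro e
    rw [show F.ends = _ from h1 hF]
    exact valid_left_right vD vE e
  obtain ⟨hn, hr⟩ := h2 hF
  exact ⟨_, mem_opDiagrams_self ⟨hv, hn⟩, hr⟩

/-- The combinations of operator Weil diagrams, of any type. -/
def goodC : Submodule ℚ (Comb Leg) := Finsupp.supported ℚ ℚ Good

theorem star_bilin_mem {N : Submodule ℚ (Comb Leg)} {A B : Set (Diagram Leg)} {k : ℚ}
    (h : ∀ D ∈ A, ∀ E ∈ B, star k (gen D) (gen E) ∈ N) {c d : Comb Leg}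
    (hc : c ∈ Finsupp.supported ℚ ℚ A) (hd : d ∈ Finsupp.supported ℚ ℚ B) : star k c d ∈ N := by
  refine map_mem_of_gen (f := (actC k).flip (ren right d) ∘ₗ ren left) (fun D hD => ?_) hc
  exact map_mem_of_gen (f := actC k (ren left (gen D)) ∘ₗ ren right) (fun E hE => h D hD E hE) hd

theorem star_good (k : ℚ) {c d : Comb Leg} (hc : c ∈ goodC) (hd : d ∈ goodC) :
    star k c d ∈ goodC :=
  star_bilin_mem (fun _ hD _ hE => Finsupp.supported_mono
    (by rintro F ⟨r, h, -⟩; exact opDiagrams_subset _ h)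
    (star_gen_type k (mem_opDiagrams_self hD) (mem_opDiagrams_self hE))) hc hd

theorem star_type (k : ℚ) {c d : Comb Leg} {p q}
    (hc : c ∈ Finsupp.supported ℚ ℚ (opDiagrams p)) (hd : d ∈ Finsupp.supported ℚ ℚ (opDiagrams q)) :
    star k c d ∈ Finsupp.supported ℚ ℚ {F | ∃ r, F ∈ opDiagrams r ∧ Rule k p q r} :=
  star_bilin_mem (fun _ hD _ hE => star_gen_type k hD hE) hc hd

/-! ### Products of power series -/

section
variable {P : ℕ × ℕ → Presentation Leg} {q k : ℚ} {m : Comb Leg →ₗ[ℚ] Comb Leg →ₗ[ℚ] Comb Leg}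

theorem cls_eq_zero_of_supported {Q : Presentation Leg} {A : Set (Diagram Leg)}
    (h : ∀ D ∈ A, D ∉ Q.adm) {c : Comb Leg} (hc : c ∈ Finsupp.supported ℚ ℚ A) : Q.cls c = 0 :=
  eq_of_gen (f := Q.cls) (g := 0) (fun D hD => cls_gen_of_notMem (h D hD)) hc

theorem part_cls (hP : P = sp q) (hm : IsStar k m) {s t r} {c d : Comb Leg}
    (hc : c ∈ Finsupp.supported ℚ ℚ (opDiagrams s)) (hd : d ∈ Finsupp.supported ℚ ℚ (opDiagrams t)) :
    part P m s t r ((P s).cls c) ((P t).cls d) = (P r).cls (m c d) := by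
  subst hP
  exact induced₂_cls (hm.wellDefined₂ q s t r) hc hd

theorem part_eq_zero (hP : P = sp q) (hm : IsStar k m) {s t r} (h : ¬ Rule k s t r) (v w) :
    part P m s t r v w = 0 := by
  obtain ⟨c, hc, rfl⟩ := exists_cls_eq _ v
  obtain ⟨d, hd, rfl⟩ := exists_cls_eq _ w
  subst hP
  rw [part_cls rfl hm hc hd, hm.eq (Finsupp.supported_mono (opDiagrams_subset _) hc)
    (Finsupp.supported_mono (opDiagrams_subset _) hd)]
  refine cls_eq_zero_of_supported ?_ (star_type k hc hd)
  rintro F ⟨r', hF, hr⟩ hF'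
  exact h (opDiagrams_unique hF hF' ▸ hr)

theorem mul_congr (hP : P = sp q) (hm : IsStar k m) {v v' w w' : Series P} {r}
    (h : ∀ s t, Rule k s t r → part P m s t r (v s) (w t) = part P m s t r (v' s) (w' t)) :
    mul m v w r = mul m v' w' r := by
  refine finsum_congr fun s => ?_
  by_cases hs : Rule k s.1 s.2 r
  · exact h _ _ hs
  · rw [part_eq_zero hP hm hs, part_eq_zero hP hm hs]

/-- The product of two finite combinations of diagrams, as power series, is their product. -/
theorem mul_of (hP : P = sp q) (hm : IsStar k m) {c d : Comb Leg} (hc : c ∈ goodC)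
    (hd : d ∈ goodC) : mul m (Series.of P c) (Series.of P d) = Series.of P (star k c d) := by
  rw [← hm.eq hc hd]
  funext r
  let f : Comb Leg → Comb Leg → (ℕ × ℕ) × (ℕ × ℕ) → (P r).Space := fun c d s =>
    part P m s.1 s.2 r ((P s.1).cls c) ((P s.2).cls d)
  suffices h : (Function.support (f c d)).Finite ∧ ∑ᶠ s, f c d s = (P r).cls (m c d) from h.2
  have cls0 : ∀ {D : Diagram Leg} {p s}, D ∈ opDiagrams p → s ≠ p → (P s).cls (gen D) = 0 := by
    intro D p s hD hs
    refine cls_gen_of_notMem fun h => hs ?_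
    subst hP
    exact opDiagrams_unique h hD
  refine supported_induction (p := fun c => (Function.support (f c d)).Finite ∧
    ∑ᶠ s, f c d s = (P r).cls (m c d)) hc ⟨?_, ?_⟩ ?_ ?_ fun D hD => ?_
  · rw [show f 0 d = 0 by funext s; simp [f], Function.support_zero]
    exact Set.finite_empty
  · simp [f]
  · rintro x y ⟨hx, hx'⟩ ⟨hy, hy'⟩
    have e : f (x + y) d = fun s => f x d s + f y d s := by
      funext s; simp [f, LinearMap.add_apply]
    rw [e]
    refine ⟨(hx.union hy).subset (Function.support_add _ _), ?_⟩
    rw [finsum_add_distrib hx hy, hx', hy', map_add, LinearMap.add_apply, map_add]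
  · rintro a x ⟨hx, hx'⟩
    have e : f (a • x) d = fun s => a • f x d s := by
      funext s; simp [f, LinearMap.smul_apply]
    rw [e]
    refine ⟨hx.subset (Function.support_const_smul_subset a _), ?_⟩
    rw [← smul_finsum' a hx, hx', map_smul, LinearMap.smul_apply, map_smul]
  · refine supported_induction (p := fun d => (Function.support (f (gen D) d)).Finite ∧
      ∑ᶠ s, f (gen D) d s = (P r).cls (m (gen D) d)) hd ⟨?_, ?_⟩ ?_ ?_ fun E hE => ?_
    · rw [show f (gen D) 0 = 0 by funext s; simp [f], Function.support_zero]
      exact Set.finite_empty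
    · simp [f]
    · rintro x y ⟨hx, hx'⟩ ⟨hy, hy'⟩
      have e : f (gen D) (x + y) = fun s => f (gen D) x s + f (gen D) y s := by
        funext s; simp [f]
      rw [e]
      refine ⟨(hx.union hy).subset (Function.support_add _ _), ?_⟩
      rw [finsum_add_distrib hx hy, hx', hy', map_add, map_add]
    · rintro a x ⟨hx, hx'⟩
      have e : f (gen D) (a • x) = fun s => a • f (gen D) x s := by
        funext s; simp [f]
      rw [e]
      refine ⟨hx.subset (Function.support_const_smul_subset a _), ?_⟩
      rw [← smul_finsum' a hx, hx', map_smul, map_smul]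
    · have hD' := mem_opDiagrams_self hD
      have hE' := mem_opDiagrams_self hE
      set s := (parS D.legs, opS D.legs)
      set t := (parS E.legs, opS E.legs)
      have h0 : ∀ x, x ≠ (s, t) → f (gen D) (gen E) x = 0 := by
        intro x hx
        simp only [f]
        by_cases h1 : x.1 = s
        · have h2 : x.2 ≠ t := fun h2 => hx (Prod.ext h1 h2)
          rw [cls0 hE' h2, map_zero]
        · rw [cls0 hD' h1, map_zero, LinearMap.zero_apply]
      refine ⟨(Set.finite_singleton (s, t)).subset fun x hx => ?_, ?_⟩
      · by_contra hne
        exact hx (h0 x hne)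
      · rw [finsum_eq_single _ _ h0]
        exact part_cls hP hm (gen_mem_supported.2 hD') (gen_mem_supported.2 hE')

/-- Products in which nothing is glued converge. -/
theorem converges_zero (hP : P = sp q) (hm : IsStar 0 m) (v w : Series P) : Converges m v w := by
  intro r
  refine ((Set.finite_Iic r).prod (Set.finite_Iic r)).subset fun s hs => ?_
  obtain ⟨g, -, -, hg, h1, h2⟩ : Rule 0 s.1 s.2 r := by
    by_contra h
    exact hs (part_eq_zero hP hm h _ _)
  rw [hg rfl] at h1 h2
  simp only [Set.mem_prod, Set.mem_Iic, Prod.le_def]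
  omega

/-- The operator-grade exceeds the parameter-grade by at most `B`. -/
def Low (B : ℕ) (v : Series P) : Prop := ∀ p, v p ≠ 0 → p.2 ≤ p.1 + B

theorem converges_of_low (hP : P = sp q) (hm : IsStar k m) {B : ℕ} {v : Series P} (hv : Low B v)
    (w : Series P) : Converges m v w := by
  intro r
  refine ((Set.finite_Iic (r.1, r.1 + B)).prod (Set.finite_Iic (r.1 + B, r.2))).subset
    fun s hs => ?_
  obtain ⟨g, h0, h0', -, h1, h2⟩ : Rule k s.1 s.2 r := by
    by_contra h
    exact hs (part_eq_zero hP hm h _ _)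
  have := hv s.1 fun h => hs (by rw [h, map_zero, LinearMap.zero_apply])
  simp only [Set.mem_prod, Set.mem_Iic, Prod.le_def]
  omega

/-- Agreement of power series up to parameter-grade `N`. -/
def Agree (N : ℕ) (v w : Series P) : Prop := ∀ t : ℕ × ℕ, t.1 ≤ N → v t = w t

theorem Agree.mul_zero (hP : P = sp q) (hm : IsStar 0 m) {N} {v v' w w' : Series P}
    (hv : Agree N v v') (hw : Agree N w w') : Agree N (mul m v w) (mul m v' w') := by
  intro r hr
  refine mul_congr hP hm fun s t ⟨g, _, _, hg, h1, h2⟩ => ?_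
  rw [hg rfl] at h1 h2
  rw [hv s (by omega), hw t (by omega)]

theorem Agree.mul_low (hP : P = sp q) (hm : IsStar k m) {N B} {v v' w w' : Series P}
    (hl : Low B v) (hv : Agree N v v') (hw : Agree (N + B) w w') :
    Agree N (mul m v w) (mul m v' w') := by
  intro r hr
  refine mul_congr hP hm fun s t ⟨g, h0, h0', _, h1, h2⟩ => ?_
  rw [← hv s (by omega)]
  by_cases hs : v s = 0
  · rw [hs, map_zero, LinearMap.zero_apply, LinearMap.zero_apply]
  · have := hl s hs
    rw [hw t (by omega)]

end

end Weil

namespace Weil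

/-! ### Exponentials -/

/-- Powers with respect to `star k`. -/
def powC (k : ℚ) (x : Comb Leg) : ℕ → Comb Leg
  | 0 => gen ⟨0, 0, []⟩
  | n + 1 => star k x (powC k x n)

/-- A truncated exponential. -/
def expC (k : ℚ) (x : Comb Leg) (M : ℕ) : Comb Leg :=
  ∑ n ∈ Finset.range (M + 1), ((Nat.factorial n : ℚ))⁻¹ • powC k x n

theorem empty_mem_opDiagrams : (⟨0, 0, []⟩ : Diagram Leg) ∈ opDiagrams (0, 0) :=
  mem_opDiagrams'.2 ⟨fun e => by simp, by simp [Normal], rfl, rfl⟩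

theorem powC_good {k : ℚ} {x : Comb Leg} (hx : x ∈ goodC) (n : ℕ) : powC k x n ∈ goodC := by
  induction n with
  | zero => exact gen_mem_supported.2 (opDiagrams_subset _ empty_mem_opDiagrams)
  | succ n ih => exact star_good k hx ih

theorem expC_good {k : ℚ} {x : Comb Leg} (hx : x ∈ goodC) (M : ℕ) : expC k x M ∈ goodC :=
  Submodule.sum_mem _ fun n _ => Submodule.smul_mem _ _ (powC_good hx n)

/-- The `n`-th power of `x` has parameter-grade at least `n`. -/
def Grows (k : ℚ) (x : Comb Leg) : Prop := ∀ n, powC k x n ∈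
  Finsupp.supported ℚ ℚ {D | ∃ t, D ∈ opDiagrams t ∧ n ≤ t.1}

theorem powC_zero_grows {x : Comb Leg}
    (hx : x ∈ Finsupp.supported ℚ ℚ {D | ∃ t, D ∈ opDiagrams t ∧ 1 ≤ t.1}) : Grows 0 x := by
  intro n
  induction n with
  | zero => exact gen_mem_supported.2 ⟨_, empty_mem_opDiagrams, Nat.zero_le _⟩
  | succ n ih =>
    refine star_bilin_mem ?_ hx ih
    rintro D ⟨p, hD, hp⟩ E ⟨q, hE, hq⟩
    refine Finsupp.supported_mono ?_ (star_gen_type 0 hD hE)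
    rintro F ⟨r, hF, g, -, -, hg, h1, -⟩
    have := hg rfl
    exact ⟨r, hF, by omega⟩

section
variable {P : ℕ × ℕ → Presentation Leg} {q k : ℚ} {m : Comb Leg →ₗ[ℚ] Comb Leg →ₗ[ℚ] Comb Leg}
  {x : Comb Leg}

theorem pow_of (hP : P = sp q) (hm : IsStar k m) (hx : x ∈ goodC) (n : ℕ) :
    pow m (Series.of P x) n = Series.of P (powC k x n) := by
  induction n with
  | zero => rfl
  | succ n ih => rw [pow, ih, mul_of hP hm hx (powC_good hx n)]; rfl

theorem pow_eq_zero (hP : P = sp q) (hm : IsStar k m) (hx : x ∈ goodC) (hg : Grows k x) {n : ℕ}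
    {t : ℕ × ℕ} (h : t.1 < n) : pow m (Series.of P x) n t = 0 := by
  rw [pow_of hP hm hx]
  refine cls_eq_zero_of_supported ?_ (hg n)
  rintro D ⟨t', hD, ht'⟩ hD'
  subst hP
  rw [opDiagrams_unique hD hD'] at ht'
  omega

theorem expConverges_of (hP : P = sp q) (hm : IsStar k m) (hx : x ∈ goodC) (hg : Grows k x)
    (hc : ∀ w : Series P, Converges m (Series.of P x) w) : ExpConverges m (Series.of P x) := by
  refine ⟨fun n => hc _, fun t => (Set.finite_Iic t.1).subset fun n hn => ?_⟩
  by_contra h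
  exact hn (pow_eq_zero hP hm hx hg (not_le.1 h))

theorem exp_agree (hP : P = sp q) (hm : IsStar k m) (hx : x ∈ goodC) (hg : Grows k x) (M : ℕ) :
    Agree M (exp m (Series.of P x)) (Series.of P (expC k x M)) := by
  intro t ht
  rw [exp, finsum_eq_sum_of_support_subset (s := Finset.range (M + 1))]
  · simp only [Series.of, expC, map_sum, map_smul]
    refine Finset.sum_congr rfl fun n _ => ?_
    rw [pow_of hP hm hx]
    rfl
  · intro n hn
    rw [Finset.coe_range, Set.mem_Iio]
    by_contra h
    refine hn ?_
    simp only
    rw [pow_eq_zero hP hm hx hg (by omega), smul_zero]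

end

/-! ### Operators which do not meet parameters of their kind -/

/-- There are no `b`-legs. -/
def noB : Set (Diagram Leg) := {D | ∀ x ∈ D.legs, x.1 ≠ .par .b}

theorem pushC_noB (k : ℚ) (n : ℕ) {D : Diagram Leg} (hD : D ∈ noB) :
    pushC k (.op .b, n) (gen D) = pushC 0 (.op .b, n) (gen D) ∧
      pushC k (.op .b, n) (gen D) ∈ Finsupp.supported ℚ ℚ noB := by
  obtain ⟨T, K, w⟩ := D
  induction w with
  | nil =>
    rw [pushC_nil, pushC_nil]
    exact ⟨rfl, gen_mem_supported.2 (by simp [noB])⟩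
  | cons y w ih =>
    have hw : (⟨T, K, w⟩ : Diagram Leg) ∈ noB := fun x hx => hD x (by simp [hx])
    have hy : y.1 ≠ .par .b := hD y (by simp)
    obtain ⟨ih1, ih2⟩ := ih hw
    rw [← consL_gen y ⟨T, K, w⟩]
    cases hy' : y.1.isOp
    · have hm : matchesParam (.op .b) y.1 = false := by
        obtain ⟨l, e⟩ := y
        rcases l with _ | _ | (_ | _) | (_ | _) <;> simp_all [matchesParam]
      simp only [pushC_consL _ _ hy', hm, Bool.false_eq_true, if_false, zero_smul, add_zero]
      refine ⟨by rw [ih1], Submodule.smul_mem _ _ (map_mem_of_gen (fun F hF => ?_) ih2)⟩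
      rw [consL_gen]
      refine gen_mem_supported.2 fun x hx => ?_
      rcases List.mem_cons.1 hx with rfl | hx
      · exact hy
      · exact hF x hx
    · rw [pushC_consL_op _ _ hy', pushC_consL_op _ _ hy', consL_gen, consL_gen]
      refine ⟨rfl, gen_mem_supported.2 fun x hx => ?_⟩
      rcases List.mem_cons.1 hx with rfl | hx
      · simp
      · exact hD x hx

theorem forkOp_mem : (⟨{(0, 1, 2)}, 0, [(.par .a, 0), (.op .b, 1), (.op .b, 2)]⟩ : Diagram Leg) ∈
    opDiagrams (2, 2) := by
  refine mem_opDiagrams'.2 ⟨fun e => ?_, by simp [Normal, Leg.isOp], rfl, rfl⟩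
  by_cases h0 : e = 0
  · subst h0; decide
  by_cases h1 : e = 1
  · subst h1; decide
  by_cases h2 : e = 2
  · subst h2; decide
  left
  simp [Multiset.count_eq_zero, h0, h1, h2]

theorem star_forkOp (k : ℚ) (c : Comb Leg) : star k forkOp c =
    addG {(left 0, left 1, left 2)} 0 (consL (.par .a, left 0)
      (pushC k (.op .b, left 1) (pushC k (.op .b, left 2) (ren right c)))) := by
  have h0 : Leg.isOp (.par .a) = false := rfl
  have h1 : Leg.isOp (.op .b) = true := rfl
  simp [star, forkOp, Diagram.rename, actW, act, h0, h1]

/-- The forks with operator legs have no `b`-legs, so that their powers under operation are those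
under juxtaposition. -/
theorem powC_forkOp (r : ℚ) (n : ℕ) : powC 1 (r • forkOp) n ∈
    Finsupp.supported ℚ ℚ {D | D ∈ opDiagrams (2 * n, 2 * n) ∧ D ∈ noB} := by
  induction n with
  | zero => exact gen_mem_supported.2 ⟨empty_mem_opDiagrams, by simp [noB]⟩
  | succ n ih =>
    have e : powC 1 (r • forkOp) (n + 1) = r • star 1 forkOp (powC 1 (r • forkOp) n) := by
      simp [powC, star]
    rw [e]
    refine Submodule.smul_mem _ _ ?_
    refine map_mem_of_gen (f := actC 1 (ren left forkOp) ∘ₗ ren right) (fun D hD => ?_) ih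
    obtain ⟨hD, hD'⟩ := hD
    have hD'' : D.rename right ∈ noB := by
      intro x hx
      obtain ⟨y, hy, rfl⟩ := List.mem_map.1 hx
      exact hD' y hy
    change star 1 forkOp (gen D) ∈ _
    obtain ⟨p1, p2⟩ := pushC_noB 1 (left 2) hD''
    have p3 : pushC 1 (.op .b, left 1) (pushC 1 (.op .b, left 2) (gen (D.rename right))) =
        pushC 0 (.op .b, left 1) (pushC 1 (.op .b, left 2) (gen (D.rename right))) :=
      eq_of_gen (fun E hE => (pushC_noB 1 (left 1) hE).1) p2
    have p4 : pushC 1 (.op .b, left 1) (pushC 1 (.op .b, left 2) (gen (D.rename right))) ∈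
        Finsupp.supported ℚ ℚ noB :=
      map_mem_of_gen (fun E hE => (pushC_noB 1 (left 1) hE).2) p2
    have h0 : star 1 forkOp (gen D) = star 0 forkOp (gen D) := by
      rw [star_forkOp, star_forkOp, ren_gen, p3, p1]
    intro F hF
    constructor
    · rw [h0] at hF
      obtain ⟨s, hs, g, -, -, hg, h1, h2⟩ := star_gen_type 0 forkOp_mem hD hF
      have hg := hg rfl
      rw [hg] at h1 h2
      have : s = (2 * (n + 1), 2 * (n + 1)) := by
        ext <;> simp_all <;> omega
      exact this ▸ hs
    · have : star 1 forkOp (gen D) ∈ Finsupp.supported ℚ ℚ noB := by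
        rw [star_forkOp, ren_gen]
        refine map_mem_of_gen (f := addG _ _ ∘ₗ consL _) (fun E hE => ?_) p4
        rw [LinearMap.comp_apply, consL_gen, addG_gen]
        refine gen_mem_supported.2 fun x hx => ?_
        rcases List.mem_cons.1 hx with rfl | hx
        · simp
        · exact hE x hx
      exact this hF

theorem forkOp_grows (r : ℚ) : Grows 1 (r • forkOp) := fun n =>
  Finsupp.supported_mono (by rintro D ⟨hD, -⟩; exact ⟨_, hD, by omega⟩) (powC_forkOp r n)

/-! ### The map `λ` on power series -/

theorem ctr_oneCoeff_type (e : ℕ) (T K) (w : List (Leg × ℕ)) :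
    ctr oneCoeff 1 e (gen ⟨T, K, w⟩) ∈ Finsupp.supported ℚ ℚ
      {F | F.legs.Sublist w ∧ parS F.legs = parS w ∧ opS F.legs = opS w} := by
  induction w generalizing T K with
  | nil => rw [ctr_nil]; exact Submodule.zero_mem _
  | cons y w ih =>
    rw [← consL_gen y ⟨T, K, w⟩, ctr_consL]
    refine Submodule.add_mem _ ?_ (Submodule.smul_mem _ _ ?_)
    · by_cases hy : y.1 = .one
      · rw [addG_gen]
        refine Submodule.smul_mem _ _ (gen_mem_supported.2 ⟨List.sublist_cons_self _ _, ?_, ?_⟩) <;>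
        · simp [hy, Leg.parGrade, Leg.opGrade]
      · have h0 : oneCoeff y.1 = 0 := by
          obtain ⟨l, n⟩ := y
          cases l <;> simp_all [oneCoeff]
        rw [h0, zero_smul]
        exact Submodule.zero_mem _
    · refine map_mem_of_gen (fun F hF => ?_) (ih T K)
      rw [consL_gen]
      obtain ⟨h1, h2, h3⟩ := hF
      exact gen_mem_supported.2 ⟨h1.cons_cons _, by simp [h2], by simp [h3]⟩

theorem lam_type (T K) (w : List (Leg × ℕ)) : lam (gen ⟨T, K, w⟩) ∈ Finsupp.supported ℚ ℚ
    {F | F.legs.Sublist w ∧ parS F.legs = parS w ∧ opS F.legs = opS w} := by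
  induction w generalizing T K with
  | nil => rw [lam_gen_nil]; exact gen_mem_supported.2 ⟨List.Sublist.refl _, rfl, rfl⟩
  | cons y w ih =>
    rw [← consL_gen y ⟨T, K, w⟩, lam_consL]
    refine Submodule.add_mem _ ?_ ?_
    · refine map_mem_of_gen (fun F hF => ?_) (ih T K)
      rw [consL_gen]
      obtain ⟨h1, h2, h3⟩ := hF
      exact gen_mem_supported.2 ⟨h1.cons_cons _, by simp [h2], by simp [h3]⟩
    · split_ifs with hy
      · refine Submodule.smul_mem _ _ (map_mem_of_gen (fun F hF => ?_) (ih T K))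
        obtain ⟨h1, h2, h3⟩ := hF
        obtain ⟨T', K', w'⟩ := F
        refine Finsupp.supported_mono ?_ (ctr_oneCoeff_type y.2 T' K' w')
        rintro G ⟨g1, g2, g3⟩
        refine ⟨(g1.trans h1).trans (List.sublist_cons_self _ _), ?_, ?_⟩
        · simp only at h2
          simp [g2, h2, hy, Leg.parGrade]
        · simp only at h3
          simp [g3, h3, hy, Leg.opGrade]
      · rw [zero_smul]
        exact Submodule.zero_mem _

theorem lam_mem_opDiagrams {t} {D : Diagram Leg} (hD : D ∈ opDiagrams t) :
    lam (gen D) ∈ Finsupp.supported ℚ ℚ (opDiagrams t) := by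
  intro F hF
  obtain ⟨v, n, h1, h2⟩ := mem_opDiagrams'.1 hD
  obtain ⟨g1, g2, g3⟩ := lam_type D.tri D.link D.legs hF
  refine mem_opDiagrams'.2 ⟨fun e => ?_, n.sublist g1, g2.trans h1, g3.trans h2⟩
  rw [show F.ends = _ from lam_endsIn D hF]
  exact v e

theorem lam_good {c : Comb Leg} (hc : c ∈ goodC) : lam c ∈ goodC :=
  map_mem_of_gen (fun _ hD => Finsupp.supported_mono (opDiagrams_subset _)
    (lam_mem_opDiagrams (mem_opDiagrams_self hD))) hc

theorem induced_lam (t : ℕ × ℕ) {c : Comb Leg} (hc : c ∈ goodC) :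
    induced (sp 1 t) (sp 0 t) lam ((sp 1 t).cls c) = (sp 0 t).cls (lam c) := by
  refine eq_of_gen (f := induced (sp 1 t) (sp 0 t) lam ∘ₗ (sp 1 t).cls)
    (g := (sp 0 t).cls ∘ₗ lam) (fun D hD => ?_) hc
  by_cases h : D ∈ opDiagrams t
  · exact induced_cls (wellDefined_lam t t) (gen_mem_supported.2 h)
  · rw [LinearMap.comp_apply, LinearMap.comp_apply, cls_gen_of_notMem (P := sp 1 t) h, map_zero]
    refine (cls_eq_zero_of_supported (Q := sp 0 t) ?_
      (lam_mem_opDiagrams (mem_opDiagrams_self hD))).symm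
    intro F hF hF'
    exact h (opDiagrams_unique hF hF' ▸ mem_opDiagrams_self hD)

theorem spF_fun : spF = sp 1 := funext spF_eq

theorem spWedge_fun : spWedge = sp 0 := funext spWedge_eq

theorem lamSeries_of {c : Comb Leg} (hc : c ∈ goodC) :
    lamSeries (Series.of spF c) = Series.of spWedge (lam c) := by
  funext t
  simp only [lamSeries, Series.of]
  rw [spF_eq, spWedge_eq]
  exact induced_lam t hc

theorem lamSeries_agree {N} {v w : Series spF} (h : Agree N v w) :
    Agree N (lamSeries v) (lamSeries w) := by
  intro t ht
  rw [lamSeries, lamSeries, h t ht]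

end Weil

namespace Weil

/-! ### Convergence -/

theorem edgeFA_mem : (⟨0, 0, [(.two, 0), (.par .a, 0)]⟩ : Diagram Leg) ∈ opDiagrams (2, 0) := by
  refine mem_opDiagrams'.2 ⟨fun e => ?_, by simp [Normal, Leg.isOp], rfl, rfl⟩
  by_cases h0 : e = 0
  · subst h0; decide
  left
  simp [Multiset.count_eq_zero, h0]

theorem edgeB_mem : (⟨0, 0, [(.par .b, 0), (.one, 0)]⟩ : Diagram Leg) ∈ opDiagrams (1, 0) := by
  refine mem_opDiagrams'.2 ⟨fun e => ?_, by simp [Normal, Leg.isOp], rfl, rfl⟩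
  by_cases h0 : e = 0
  · subst h0; decide
  left
  simp [Multiset.count_eq_zero, h0]

theorem forkA_mem : (⟨{(0, 1, 2)}, 0, [(.par .a, 0), (.one, 1), (.one, 2)]⟩ : Diagram Leg) ∈
    opDiagrams (2, 0) := by
  refine mem_opDiagrams'.2 ⟨fun e => ?_, by simp [Normal, Leg.isOp], rfl, rfl⟩
  by_cases h0 : e = 0
  · subst h0; decide
  by_cases h1 : e = 1
  · subst h1; decide
  by_cases h2 : e = 2
  · subst h2; decide
  left
  simp [Multiset.count_eq_zero, h0, h1, h2]

/-- The combination `1/2 k + l`. -/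
def innerC : Comb Leg := (1 / 2 : ℚ) • forkA + edgeB

theorem edgeFA_good : edgeFA ∈ goodC := gen_mem_supported.2 (opDiagrams_subset _ edgeFA_mem)

theorem forkOp_good (r : ℚ) : r • forkOp ∈ goodC :=
  Submodule.smul_mem _ _ (gen_mem_supported.2 (opDiagrams_subset _ forkOp_mem))

theorem innerC_good : innerC ∈ goodC :=
  Submodule.add_mem _ (Submodule.smul_mem _ _ (gen_mem_supported.2 (opDiagrams_subset _ forkA_mem)))
    (gen_mem_supported.2 (opDiagrams_subset _ edgeB_mem))

theorem edgeFA_grows : Grows 0 edgeFA :=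
  powC_zero_grows (gen_mem_supported.2 ⟨_, edgeFA_mem, by simp⟩)

theorem innerC_grows : Grows 0 innerC :=
  powC_zero_grows (Submodule.add_mem _ (Submodule.smul_mem _ _
    (gen_mem_supported.2 ⟨_, forkA_mem, by simp⟩)) (gen_mem_supported.2 ⟨_, edgeB_mem, by simp⟩))

theorem low_of {P : ℕ × ℕ → Presentation Leg} {q : ℚ} (hP : P = sp q) {B : ℕ} {c : Comb Leg}
    (hc : c ∈ Finsupp.supported ℚ ℚ {D | ∃ t, D ∈ opDiagrams t ∧ t.2 ≤ t.1 + B}) :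
    Low B (Series.of P c) := by
  intro t ht
  by_contra h
  refine ht (cls_eq_zero_of_supported ?_ hc)
  rintro D ⟨t', hD, ht'⟩ hD'
  subst hP
  exact h (opDiagrams_unique hD hD' ▸ ht')

theorem low_forkOp (r : ℚ) : Low 0 (Series.of spWedge (r • forkOp)) :=
  low_of spWedge_fun (Submodule.smul_mem _ _ (gen_mem_supported.2 ⟨_, forkOp_mem, by simp⟩))

theorem expConverges_edgeFA : ExpConverges hash (Series.of spWedge edgeFA) :=
  expConverges_of spWedge_fun isStar_hash edgeFA_good edgeFA_grows
    fun w => converges_zero spWedge_fun isStar_hash _ w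

theorem expConverges_inner : ExpConverges hash innerTerm :=
  expConverges_of spF_fun isStar_hash innerC_good innerC_grows
    fun w => converges_zero spF_fun isStar_hash _ w

theorem expConverges_forkOp (r : ℚ) :
    ExpConverges operate (Series.of spWedge (r • forkOp)) :=
  expConverges_of spWedge_fun isStar_operate (forkOp_good r) (forkOp_grows r)
    fun w => converges_of_low spWedge_fun isStar_operate (low_forkOp r) w

theorem low_expForkOp : Low 0 expForkOp := by
  intro t ht
  by_contra h
  refine ht ?_
  rw [expForkOp, exp]
  refine finsum_eq_zero_of_forall_eq_zero fun n => ?_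
  rw [pow_of spWedge_fun isStar_operate (forkOp_good _)]
  refine smul_eq_zero_of_right _ (cls_eq_zero_of_supported ?_ (powC_forkOp _ n))
  rintro D ⟨hD, -⟩ hD'
  rw [spWedge_eq] at hD'
  rw [← opDiagrams_unique hD hD'] at h
  exact h le_rfl

theorem partialA_of {c : Comb Unit} (hc : c ∈ Finsupp.supported ℚ ℚ spB.adm) :
    partialA (spB.cls c) = Series.of spWedge (toPartialA c) := by
  funext t
  rw [partialA, Series.of, spWedge_eq]
  exact induced_cls (wellDefined_toPartialA t) hc

theorem toPartialA_mem {D : Diagram Unit} (hD : D.Valid) :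
    toPartialA (gen D) ∈ Finsupp.supported ℚ ℚ (opDiagrams (0, 2 * D.legs.length)) := by
  have h := toPartialA_endsIn D
  rw [toPartialA_gen] at h ⊢
  have h : Diagram.ends _ = D.ends := gen_mem_supported.1 h
  refine gen_mem_supported.2 (mem_opDiagrams'.2 ⟨(valid_congr h).2 hD, normal_of_ops ?_, ?_, ?_⟩)
  · intro x hx
    obtain ⟨y, -, rfl⟩ := List.mem_map.1 hx
    rfl
  · refine parS_of_op fun x hx => ?_
    obtain ⟨y, -, rfl⟩ := List.mem_map.1 hx
    rfl
  · simp [opS, Function.comp_def, Leg.opGrade, Param.grade, mul_comm]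

/-- Valid diagrams with boundedly many legs. -/
def fewLegs (M : ℕ) : Set (Diagram Unit) := {D | D.Valid ∧ 2 * D.legs.length ≤ M}

theorem exists_fewLegs {c : Comb Unit} (hc : c ∈ Finsupp.supported ℚ ℚ spB.adm) :
    ∃ M, c ∈ Finsupp.supported ℚ ℚ (fewLegs M) := by
  refine ⟨c.support.sup fun D => 2 * D.legs.length, fun D hD => ⟨hc hD, ?_⟩⟩
  exact Finset.le_sup (f := fun D : Diagram Unit => 2 * D.legs.length) hD

theorem toPartialA_supported {M : ℕ} {c : Comb Unit} (hc : c ∈ Finsupp.supported ℚ ℚ (fewLegs M)) :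
    toPartialA c ∈ Finsupp.supported ℚ ℚ {D | ∃ t, D ∈ opDiagrams t ∧ t.2 ≤ t.1 + M} :=
  map_mem_of_gen (fun D hD => Finsupp.supported_mono
    (by intro E hE; exact ⟨_, hE, by have := hD.2; simpa using this⟩) (toPartialA_mem hD.1)) hc

theorem toPartialA_good {M : ℕ} {c : Comb Unit} (hc : c ∈ Finsupp.supported ℚ ℚ (fewLegs M)) :
    toPartialA c ∈ goodC :=
  Finsupp.supported_mono (by rintro D ⟨t, hD, -⟩; exact opDiagrams_subset _ hD)
    (toPartialA_supported hc)

theorem converges_partialA (v : spB.Space) (w : Series spWedge) :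
    Converges operate (partialA v) w := by
  obtain ⟨c, hc, rfl⟩ := exists_cls_eq _ v
  obtain ⟨M, hM⟩ := exists_fewLegs hc
  rw [partialA_of hc]
  exact converges_of_low spWedge_fun isStar_operate (low_of spWedge_fun (toPartialA_supported hM)) w

/-! ### The right hand side of the formula, by finite sums -/

/-- For diagrams with at most `M` legs, all exponentials on the right hand side may be cut off after
the `M`-th power: at most `M` parameters can be removed. -/
theorem setZero_eq {M : ℕ} {c : Comb Unit} (hc : c ∈ Finsupp.supported ℚ ℚ (fewLegs M)) :
    setZero (mul operate (partialA (spB.cls c)) (mul hash expEdge seriesX)) =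
      (spWedge (0, 0)).cls (star 1 (toPartialA c) (star 0 (expC 0 edgeFA M)
        (star 1 (expC 1 ((-1 / 2 : ℚ) • forkOp) M) (lam (expC 0 innerC M))))) := by
  have hc' : c ∈ Finsupp.supported ℚ ℚ spB.adm := Finsupp.supported_mono (fun D hD => hD.1) hc
  have g1 := expC_good (k := 0) edgeFA_good M
  have g2 := expC_good (k := 1) (forkOp_good (-1 / 2)) M
  have g3 := lam_good (expC_good (k := 0) innerC_good M)
  have a1 : Agree M expEdge _ := exp_agree spWedge_fun isStar_hash edgeFA_good edgeFA_grows M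
  have a2 : Agree M expForkOp _ := exp_agree spWedge_fun isStar_operate (forkOp_good (-1 / 2))
    (forkOp_grows _) M
  have a3 := lamSeries_agree (exp_agree spF_fun isStar_hash innerC_good innerC_grows M)
  rw [lamSeries_of (expC_good innerC_good M)] at a3
  have a4 : Agree M seriesX _ := Agree.mul_low spWedge_fun isStar_operate low_expForkOp a2 a3
  have a5 := Agree.mul_zero spWedge_fun isStar_hash a1 a4
  rw [mul_of spWedge_fun isStar_operate g2 g3, mul_of spWedge_fun isStar_hash g1 (star_good _ g2 g3)]
    at a5
  rw [setZero, partialA_of hc']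
  rw [Agree.mul_low (N := 0) spWedge_fun isStar_operate
    (low_of spWedge_fun (toPartialA_supported hc)) (fun t _ => rfl) (by rwa [zero_add]) (0, 0) le_rfl,
    mul_of spWedge_fun isStar_operate (toPartialA_good hc) (star_good _ g1 (star_good _ g2 g3))]
  rfl

/-! ### Renaming of products -/

/-- The function which is `f` on names of the left factor and `g` on names of the right factor. -/
def glue (f g : ℕ → ℕ) (n : ℕ) : ℕ := if n % 2 = 0 then f (n / 2) else g (n / 2)

theorem glue_left (f g : ℕ → ℕ) : glue f g ∘ left = f := by
  funext n
  simp [glue, left]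

theorem glue_right (f g : ℕ → ℕ) : glue f g ∘ right = g := by
  funext n
  have h1 : (2 * n + 1) % 2 = 1 := by omega
  have h2 : (2 * n + 1) / 2 = n := by omega
  simp [glue, right, h1, h2]

theorem glue_injective {f g : ℕ → ℕ} (hf : f.Injective) (hg : g.Injective)
    (hfg : ∀ a b, f a ≠ g b) : (glue f g).Injective := by
  intro a b h
  simp only [glue] at h
  split_ifs at h with ha hb hb
  · have := hf h; omega
  · exact absurd h (hfg _ _)
  · exact absurd h.symm (hfg _ _)
  · have := hg h; omega

theorem ren_glue (f g : ℕ → ℕ) (k : ℚ) (c d : Comb Leg) :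
    ren (glue f g) (star k c d) = actC k (ren f c) (ren g d) := by
  rw [star, ← actC_ren, ren_ren, ren_ren, glue_left, glue_right]

/-- Products may be computed with any choice of disjoint names. -/
theorem GraphLike.cls_actC {P : Presentation Leg} (hP : GraphLike P) {f g : ℕ → ℕ}
    (hf : f.Injective) (hg : g.Injective) (hfg : ∀ a b, f a ≠ g b) (k : ℚ) (c d : Comb Leg) :
    P.cls (actC k (ren f c) (ren g d)) = P.cls (star k c d) := by
  rw [← ren_glue, hP.cls_ren_inj (glue_injective hf hg hfg)]

theorem GraphLike.cls_star_assoc {P : Presentation Leg} (hP : GraphLike P) (k : ℚ)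
    (c d e : Comb Leg) : P.cls (star k (star k c d) e) = P.cls (star k c (star k d e)) := by
  have h : ren (glue (left ∘ left) (glue (left ∘ right) right)) (star k c (star k d e)) =
      star k (star k c d) e := by
    rw [ren_glue, ren_glue, star, star, ← actC_ren, actC_assoc, ren_ren, ren_ren]
  rw [← h, hP.cls_ren_inj]
  have l := left_injective
  have r := right_injective
  refine glue_injective (l.comp l) (glue_injective (l.comp r) r fun a b => left_ne_right _ _) ?_
  intro a b
  rw [glue]
  split_ifs
  · exact fun h => left_ne_right _ _ (l h)
  · exact left_ne_right _ _

/-- If the actions of `c` and `d` commute up to relations, then so do products with `c` and `d`. -/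
theorem GraphLike.cls_star_comm {P : Presentation Leg} (hP : GraphLike P) {k k' : ℚ}
    {c d : Comb Leg} (h : ∀ f g e, P.cls (actC k (ren f c) (actC k' (ren g d) e)) =
      P.cls (actC k' (ren g d) (actC k (ren f c) e))) (e : Comb Leg) :
    P.cls (star k c (star k' d e)) = P.cls (star k' d (star k c e)) := by
  have h1 : ren (glue (right ∘ left) (glue left (right ∘ right))) (star k c (star k' d e)) =
      actC k (ren (right ∘ left) c) (actC k' (ren left d) (ren (right ∘ right) e)) := by
    rw [ren_glue, ren_glue]
  have h2 : star k' d (star k c e) =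
      actC k' (ren left d) (actC k (ren (right ∘ left) c) (ren (right ∘ right) e)) := by
    rw [star, star, ← actC_ren, ren_ren, ren_ren]
  have l := left_injective
  have r := right_injective
  rw [h2, ← h, ← h1, hP.cls_ren_inj]
  refine glue_injective (r.comp l) (glue_injective l (r.comp r) fun a b => left_ne_right _ _) ?_
  intro a b
  rw [glue]
  split_ifs
  · exact (left_ne_right _ _).symm
  · exact fun h => left_ne_right _ _ (r h)

end Weil

namespace Weil

/-! ### Multiplication from the left -/

/-- Multiplication by `x` from the left. -/
def starL (k : ℚ) (x : Comb Leg) : Comb Leg →ₗ[ℚ] Comb Leg := actC k (ren left x) ∘ₗ ren right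

theorem starL_apply (k : ℚ) (x c : Comb Leg) : starL k x c = star k x c := rfl

theorem starL_add (k : ℚ) (x y : Comb Leg) : starL k (x + y) = starL k x + starL k y := by
  refine LinearMap.ext fun c => ?_
  simp [starL]

/-- The empty diagram. -/
def emptyD : Comb Leg := gen ⟨0, 0, []⟩

theorem emptyD_good : emptyD ∈ goodC :=
  gen_mem_supported.2 (opDiagrams_subset _ empty_mem_opDiagrams)

theorem starL_good {k : ℚ} {x c : Comb Leg} (hx : x ∈ goodC) (hc : c ∈ goodC) :
    starL k x c ∈ goodC := star_good k hx hc

theorem starL_pow_succ (k : ℚ) (x : Comb Leg) (n : ℕ) (c : Comb Leg) :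
    (starL k x ^ (n + 1)) c = starL k x ((starL k x ^ n) c) := by
  rw [pow_succ', Module.End.mul_apply]

theorem starL_pow_good {k : ℚ} {x c : Comb Leg} (hx : x ∈ goodC) (hc : c ∈ goodC) (n : ℕ) :
    (starL k x ^ n) c ∈ goodC := by
  induction n with
  | zero => exact hc
  | succ n ih => rw [starL_pow_succ]; exact starL_good hx ih

theorem powC_eq (k : ℚ) (x : Comb Leg) (n : ℕ) : powC k x n = (starL k x ^ n) emptyD := by
  induction n with
  | zero => rfl
  | succ n ih => rw [starL_pow_succ, ← ih]; rfl

section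
variable {P : ℕ × ℕ → Presentation Leg} {q k : ℚ}

theorem Series.of_add (c d : Comb Leg) :
    Series.of P (c + d) = Series.of P c + Series.of P d := by
  funext t; simp [Series.of]

theorem Series.of_smul (r : ℚ) (c : Comb Leg) : Series.of P (r • c) = r • Series.of P c := by
  funext t; simp [Series.of]

theorem Series.of_sum {ι : Type*} (s : Finset ι) (f : ι → Comb Leg) :
    Series.of P (∑ i ∈ s, f i) = ∑ i ∈ s, Series.of P (f i) := by
  funext t; simp [Series.of, Finset.sum_apply]

/-- The product `star k`, for `k = 0` and `k = 1`, is one of the products of diagrams. -/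
def IsProd (k : ℚ) : Prop := ∃ m, IsStar k m

theorem isProd_zero : IsProd 0 := ⟨_, isStar_hash⟩

theorem isProd_one : IsProd 1 := ⟨_, isStar_operate⟩

theorem of_starL_congr (hP : P = sp q) (hk : IsProd k) {x c d : Comb Leg} (hx : x ∈ goodC)
    (hc : c ∈ goodC) (hd : d ∈ goodC) (h : Series.of P c = Series.of P d) :
    Series.of P (starL k x c) = Series.of P (starL k x d) := by
  obtain ⟨m, hm⟩ := hk
  rw [starL_apply, starL_apply, ← mul_of hP hm hx hc, ← mul_of hP hm hx hd, h]

theorem of_starL_pow_congr (hP : P = sp q) (hk : IsProd k) {x c d : Comb Leg} (hx : x ∈ goodC)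
    (hc : c ∈ goodC) (hd : d ∈ goodC) (h : Series.of P c = Series.of P d) (n : ℕ) :
    Series.of P ((starL k x ^ n) c) = Series.of P ((starL k x ^ n) d) := by
  induction n with
  | zero => exact h
  | succ n ih =>
    rw [starL_pow_succ, starL_pow_succ]
    exact of_starL_congr hP hk hx (starL_pow_good hx hc n) (starL_pow_good hx hd n) ih

/-- Multiplication by a power is repeated multiplication. -/
theorem of_star_powC (hP : P = sp q) (hk : IsProd k) {x c : Comb Leg} (hx : x ∈ goodC)
    (hc : c ∈ goodC) (n : ℕ) :
    Series.of P (star k (powC k x n) c) = Series.of P ((starL k x ^ n) c) := by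
  have hG : ∀ t, GraphLike (P t) := fun t => by subst hP; exact graphLike_sp q t
  induction n with
  | zero =>
    funext t
    have : star k (powC k x 0) c = ren right c := by
      simp [star, powC, Diagram.rename, actW, addG_zero]
    rw [this]
    exact (hG t).cls_ren_inj right_injective c
  | succ n ih =>
    have h : Series.of P (star k (powC k x (n + 1)) c) =
        Series.of P (starL k x (star k (powC k x n) c)) :=
      funext fun t => (hG t).cls_star_assoc k x (powC k x n) c
    rw [h, starL_pow_succ]
    exact of_starL_congr hP hk hx (star_good k (powC_good hx n) hc) (starL_pow_good hx hc n) ih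

theorem of_star_expC (hP : P = sp q) (hk : IsProd k) {x c : Comb Leg} (hx : x ∈ goodC)
    (hc : c ∈ goodC) (M : ℕ) : Series.of P (star k (expC k x M) c) =
      ∑ n ∈ Finset.range (M + 1), ((Nat.factorial n : ℚ))⁻¹ • Series.of P ((starL k x ^ n) c) := by
  have : star k (expC k x M) c = ∑ n ∈ Finset.range (M + 1),
      ((Nat.factorial n : ℚ))⁻¹ • star k (powC k x n) c := by
    simp [star, expC, LinearMap.sum_apply]
  rw [this, Series.of_sum]
  refine Finset.sum_congr rfl fun n _ => ?_
  rw [Series.of_smul, of_star_powC hP hk hx hc]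

theorem of_pow_comm {k' : ℚ} (hP : P = sp q) (hk : IsProd k) (hk' : IsProd k') {x y : Comb Leg}
    (hx : x ∈ goodC) (hy : y ∈ goodC) (h : ∀ c, Series.of P (starL k x (starL k' y c)) =
      Series.of P (starL k' y (starL k x c))) {c : Comb Leg} (hc : c ∈ goodC) (i s : ℕ) :
    Series.of P ((starL k x ^ i) ((starL k' y ^ s) c)) =
      Series.of P ((starL k' y ^ s) ((starL k x ^ i) c)) := by
  have h2 : ∀ {c : Comb Leg}, c ∈ goodC → ∀ s, Series.of P (starL k x ((starL k' y ^ s) c)) =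
      Series.of P ((starL k' y ^ s) (starL k x c)) := by
    intro c hc s
    induction s with
    | zero => rfl
    | succ s ih =>
      rw [starL_pow_succ, starL_pow_succ, h]
      exact of_starL_congr hP hk' hy (starL_good hx (starL_pow_good hy hc s))
        (starL_pow_good hy (starL_good hx hc) s) ih
  induction i with
  | zero => rfl
  | succ i ih =>
    rw [starL_pow_succ, starL_pow_succ, ← h2 (starL_pow_good hx hc i)]
    exact of_starL_congr hP hk hx (starL_pow_good hx (starL_pow_good hy hc s) i)
      (starL_pow_good hy (starL_pow_good hx hc i) s) ih

/-- The divided powers of a sum, if the summands commute up to relations. -/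
theorem of_pow_add (hP : P = sp q) (hk : IsProd k) {x y : Comb Leg}
    (hx : x ∈ goodC) (hy : y ∈ goodC) (h : ∀ c, Series.of P (starL k x (starL k y c)) =
      Series.of P (starL k y (starL k x c))) {c : Comb Leg} (hc : c ∈ goodC) (N : ℕ) :
    Series.of P (∑ p ∈ Finset.HasAntidiagonal.antidiagonal N, (((Nat.factorial p.1 : ℚ))⁻¹ *
      ((Nat.factorial p.2 : ℚ))⁻¹) • (starL k x ^ p.1) ((starL k y ^ p.2) c)) =
    ((Nat.factorial N : ℚ))⁻¹ • Series.of P ((starL k (x + y) ^ N) c) := by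
  set w : ℕ → ℚ := fun n => ((Nat.factorial n : ℚ))⁻¹ with hw
  have w_succ : ∀ n, ((n + 1 : ℕ) : ℚ) * w (n + 1) = w n := by
    intro n
    have h1 : ((Nat.factorial n : ℕ) : ℚ) ≠ 0 := by exact_mod_cast Nat.factorial_ne_zero n
    have h2 : ((n + 1 : ℕ) : ℚ) ≠ 0 := by exact_mod_cast Nat.succ_ne_zero n
    simp only [hw, Nat.factorial_succ]
    push_cast at h2 ⊢
    field_simp
  set X : ℕ → ℕ → Comb Leg := fun i m => (starL k x ^ i) ((starL k y ^ m) c) with hX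
  have hX' : ∀ i m, X i m ∈ goodC := fun i m => starL_pow_good hx (starL_pow_good hy hc m) i
  have hxy : x + y ∈ goodC := Submodule.add_mem _ hx hy
  let B : ℕ → Comb Leg := fun N => ∑ p ∈ Finset.HasAntidiagonal.antidiagonal N, (w p.1 * w p.2) • X p.1 p.2
  have hB : ∀ N, B N ∈ goodC := fun N =>
    Submodule.sum_mem _ fun p _ => Submodule.smul_mem _ _ (hX' _ _)
  change Series.of P (B N) = w N • _
  have step : ∀ N, Series.of P (starL k (x + y) (B N)) =
      ((N + 1 : ℕ) : ℚ) • Series.of P (B (N + 1)) := by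
    intro N
    have e1 : Series.of P (starL k (x + y) (B N)) = ∑ p ∈ Finset.HasAntidiagonal.antidiagonal N, ((w p.1 * w p.2) •
        Series.of P (X (p.1 + 1) p.2) + (w p.1 * w p.2) • Series.of P (X p.1 (p.2 + 1))) := by
      simp only [B, map_sum, map_smul, Series.of_sum, Series.of_smul]
      refine Finset.sum_congr rfl fun p _ => ?_
      rw [starL_add, LinearMap.add_apply, Series.of_add, smul_add]
      congr 2
      · rw [hX]; simp only; rw [starL_pow_succ]
      · have := of_pow_comm hP hk hk hx hy h (starL_pow_good (k := k) hy hc p.2) p.1 1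
        rw [pow_one] at this
        rw [hX]; simp only; rw [← this, starL_pow_succ]
    have e2 : ((N + 1 : ℕ) : ℚ) • Series.of P (B (N + 1)) =
        (∑ p ∈ Finset.HasAntidiagonal.antidiagonal (N + 1), ((p.1 : ℚ) * w p.1 * w p.2) • Series.of P (X p.1 p.2)) +
        ∑ p ∈ Finset.HasAntidiagonal.antidiagonal (N + 1), (w p.1 * ((p.2 : ℚ) * w p.2)) •
          Series.of P (X p.1 p.2) := by
      simp only [B, Series.of_sum, Series.of_smul]
      rw [Finset.smul_sum, ← Finset.sum_add_distrib]
      refine Finset.sum_congr rfl fun p hp => ?_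
      rw [← Finset.HasAntidiagonal.mem_antidiagonal.1 hp]
      push_cast
      module
    rw [e1, e2, Finset.Nat.antidiagonal_succ, Finset.sum_cons, ← Finset.Nat.antidiagonal_succ,
      Finset.Nat.antidiagonal_succ', Finset.sum_cons, Finset.sum_map, Finset.sum_map,
      Finset.sum_add_distrib]
    simp only [Function.Embedding.prodMap, Function.Embedding.coeFn_mk, Prod.map_fst, Prod.map_snd,
      Function.Embedding.refl_apply, Nat.succ_eq_add_one, w_succ, Nat.cast_zero, zero_mul, mul_zero]
    module
  induction N with
  | zero => simp [B, hw, hX]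
  | succ N ih =>
    have h1 : ((N + 1 : ℕ) : ℚ) ≠ 0 := by exact_mod_cast Nat.succ_ne_zero N
    have hU := starL_pow_good (k := k) hxy hc N
    rw [← Series.of_smul] at ih
    have h2 := of_starL_congr hP hk hxy (hB N) (Submodule.smul_mem _ _ hU) ih
    rw [step, map_smul, Series.of_smul, ← starL_pow_succ, ← w_succ, mul_smul] at h2
    exact smul_right_injective _ h1 h2

end

/-! ### Commutation with the edge joining a curvature leg and an `a`-leg -/

/-- The action of the edge joining a curvature leg and an `a`-leg. -/
def edgeOp (n : ℕ) : Comb Leg →ₗ[ℚ] Comb Leg := consL (.two, n) ∘ₗ consL (.par .a, n)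

/-- The action of half a fork with an `a`-leg and two legs of grade 1. -/
def forkAOp (x y z : ℕ) : Comb Leg →ₗ[ℚ] Comb Leg :=
  (1 / 2 : ℚ) • addG {(x, y, z)} 0 ∘ₗ consL (.par .a, x) ∘ₗ consL (.one, y) ∘ₗ consL (.one, z)

/-- The action of the edge joining a `b`-leg and a leg of grade 1. -/
def edgeBOp (n : ℕ) : Comb Leg →ₗ[ℚ] Comb Leg := consL (.par .b, n) ∘ₗ consL (.one, n)

/-- The action of the fork with an `a`-leg and two `∂_b`-legs. -/
def forkOpOp (x y z : ℕ) : Comb Leg →ₗ[ℚ] Comb Leg :=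
  addG {(x, y, z)} 0 ∘ₗ consL (.par .a, x) ∘ₗ pushC 1 (.op .b, y) ∘ₗ pushC 1 (.op .b, z)

theorem actC_edgeFA (k : ℚ) (f : ℕ → ℕ) (c : Comb Leg) :
    actC k (ren f edgeFA) c = edgeOp (f 0) c := by
  have h0 : Leg.isOp (.par .a) = false := rfl
  have h1 : Leg.isOp .two = false := rfl
  simp [edgeFA, Diagram.rename, actW, act, h0, h1, edgeOp, addG_zero]

theorem actC_innerC (k : ℚ) (f : ℕ → ℕ) (c : Comb Leg) :
    actC k (ren f innerC) c = forkAOp (f 0) (f 1) (f 2) c + edgeBOp (f 0) c := by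
  have h0 : ∀ p, Leg.isOp (.par p) = false := fun _ => rfl
  have h1 : Leg.isOp .one = false := rfl
  simp [innerC, forkA, edgeB, Diagram.rename, actW, act, h0, h1, forkAOp, edgeBOp, addG_zero]

theorem actC_forkOp (f : ℕ → ℕ) (c : Comb Leg) :
    actC 1 (ren f forkOp) c = forkOpOp (f 0) (f 1) (f 2) c := by
  have h0 : Leg.isOp (.par .a) = false := rfl
  have h1 : Leg.isOp (.op .b) = true := rfl
  simp [forkOp, Diagram.rename, actW, act, h0, h1, forkOpOp]

theorem edgeOp_addG (n T K) (c : Comb Leg) : edgeOp n (addG T K c) = addG T K (edgeOp n c) := by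
  simp [edgeOp, consL_addG]

theorem edgeOp_pushC (n e : ℕ) (c : Comb Leg) :
    edgeOp n (pushC 1 (.op .b, e) c) = pushC 1 (.op .b, e) (edgeOp n c) := by
  have h1 : matchesParam (.op .b) (.par .a) = false := rfl
  have h2 : matchesParam (.op .b) .two = false := rfl
  have s1 : sgn (.op .b) (.par .a) = 1 := by norm_num [sgn, Leg.grade, Param.grade]
  have s2 : sgn (.op .b) .two = 1 := by norm_num [sgn, Leg.grade, Param.grade]
  rw [edgeOp, LinearMap.comp_apply, LinearMap.comp_apply, pushC_consL _ _ rfl, pushC_consL _ _ rfl,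
    s1, s2, h1, h2]
  simp

theorem sgn_par_a (l : Leg) : sgn (.par .a) l = 1 := by
  rw [sgn, show (Leg.par .a).grade = 2 from rfl, pow_mul]
  simp

section
variable {q : ℚ} {t : ℕ × ℕ}

theorem edgeOp_consL {y : Leg × ℕ} (hy : y.1 = .one ∨ ∃ p, y.1 = .par p) (n : ℕ) (c : Comb Leg) :
    edgeOp n (consL y c) - consL y (edgeOp n c) ∈ nullSub (sp q t) ∅ := by
  have hop : y.1.isOp = false := by rcases hy with h | ⟨p, h⟩ <;> rw [h] <;> rfl
  have h1 := nullSub_consL (x := (.two, n)) rfl (by simp)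
    (swapHead_mem_nullSub (q := q) (t := t) (a := (.par .a, n)) rfl hop
      (Or.inr (Or.inl ⟨_, rfl⟩)) c)
  have h2 := swapHead_mem_nullSub (q := q) (t := t) (a := (.two, n)) rfl hop (by
    rcases hy with h | h
    · exact Or.inl ⟨rfl, h⟩
    · exact Or.inr (Or.inr (Or.inl h))) (consL (.par .a, n) c)
  have s2 : sgn .two y.1 = 1 := by
    simp only [sgn, grade_two, pow_mul]
    simp
  convert Submodule.add_mem _ h1 h2 using 1
  simp only [swapHead, edgeOp, LinearMap.sub_apply, LinearMap.comp_apply, LinearMap.smul_apply,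
    map_sub, map_smul, sgn_par_a, s2]
  module

theorem edgeOp_forkOpOp (n x y z : ℕ) (c : Comb Leg) :
    edgeOp n (forkOpOp x y z c) - forkOpOp x y z (edgeOp n c) ∈ nullSub (sp q t) ∅ := by
  have h := nullSub_tri (x := x) (y := y) (z := z) (F := ∅) (by simp) (by simp) (by simp)
    (edgeOp_consL (q := q) (t := t) (y := (.par .a, x)) (Or.inr ⟨_, rfl⟩) n
      (pushC 1 (.op .b, y) (pushC 1 (.op .b, z) c)))
  convert h using 1
  simp only [forkOpOp, LinearMap.comp_apply, edgeOp_addG, map_sub, edgeOp_pushC]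

theorem edgeOp_innerOp (n x y z x' : ℕ) (c : Comb Leg) :
    edgeOp n (forkAOp x y z c + edgeBOp x' c) -
      (forkAOp x y z (edgeOp n c) + edgeBOp x' (edgeOp n c)) ∈ nullSub (sp q t) ∅ := by
  have one : ∀ (p : ℕ) c, edgeOp n (consL (.one, p) c) - consL (.one, p) (edgeOp n c) ∈
      nullSub (sp q t) ∅ := fun p c => edgeOp_consL (y := (.one, p)) (Or.inl rfl) n c
  have par : ∀ (s : Param) (p : ℕ) c, edgeOp n (consL (.par s, p) c) -
      consL (.par s, p) (edgeOp n c) ∈ nullSub (sp q t) ∅ :=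
    fun s p c => edgeOp_consL (y := (.par s, p)) (Or.inr ⟨_, rfl⟩) n c
  have h1 := par .a x (consL (.one, y) (consL (.one, z) c))
  have h2 := nullSub_consL (x := (.par .a, x)) rfl (by simp) (one y (consL (.one, z) c))
  have h3 := nullSub_consL (x := (.par .a, x)) rfl (by simp)
    (nullSub_consL (x := (.one, y)) rfl (by simp) (one z c))
  have h := nullSub_tri (x := x) (y := y) (z := z) (F := ∅) (by simp) (by simp) (by simp)
    (Submodule.add_mem _ (Submodule.add_mem _ h1 h2) h3)
  have h4 := par .b x' (consL (.one, x') c)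
  have h5 := nullSub_consL (x := (.par .b, x')) rfl (by simp) (one x' c)
  convert Submodule.add_mem _ (Submodule.smul_mem _ (1 / 2 : ℚ) h) (Submodule.add_mem _ h4 h5)
    using 1
  simp only [forkAOp, edgeBOp, LinearMap.comp_apply, LinearMap.smul_apply, edgeOp_addG, map_sub,
    map_add, map_smul]
  module

end

theorem of_edge_forkOp {P : ℕ × ℕ → Presentation Leg} {q : ℚ} (hP : P = sp q) (r : ℚ)
    (c : Comb Leg) : Series.of P (starL 0 edgeFA (starL 1 (r • forkOp) c)) =
      Series.of P (starL 1 (r • forkOp) (starL 0 edgeFA c)) := by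
  subst hP
  funext t
  refine (graphLike_sp q t).cls_star_comm (fun f g e => ?_) c
  simp only [map_smul, LinearMap.smul_apply, actC_edgeFA, actC_forkOp]
  congr 1
  exact sub_eq_zero.1 (by rw [← map_sub]; exact nullSub_cls (edgeOp_forkOpOp _ _ _ _ _))

theorem of_edge_inner {P : ℕ × ℕ → Presentation Leg} {q : ℚ} (hP : P = sp q) (c : Comb Leg) :
    Series.of P (starL 0 edgeFA (starL 0 innerC c)) =
      Series.of P (starL 0 innerC (starL 0 edgeFA c)) := by
  subst hP
  funext t
  refine (graphLike_sp q t).cls_star_comm (fun f g e => ?_) c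
  rw [actC_innerC, actC_edgeFA, actC_edgeFA, actC_innerC]
  exact sub_eq_zero.1 (by rw [← map_sub]; exact nullSub_cls (edgeOp_innerOp _ _ _ _ _ _))

theorem lam_edgeOp (n : ℕ) (c : Comb Leg) : lam (edgeOp n c) = edgeOp n (lam c) := by
  simp [edgeOp, lam_consL]

theorem lam_starL_edgeFA (c : Comb Leg) : lam (starL 0 edgeFA c) = starL 0 edgeFA (lam c) := by
  rw [starL, LinearMap.comp_apply, LinearMap.comp_apply, actC_edgeFA, actC_edgeFA, lam_edgeOp,
    lam_ren]

theorem lam_starL_edgeFA_pow (i : ℕ) (c : Comb Leg) :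
    lam ((starL 0 edgeFA ^ i) c) = (starL 0 edgeFA ^ i) (lam c) := by
  induction i with
  | zero => rfl
  | succ i ih => rw [starL_pow_succ, starL_pow_succ, lam_starL_edgeFA, ih]

end Weil

namespace Weil

/-! ### The exponential of a sum -/

section
variable {P : ℕ × ℕ → Presentation Leg} {q k : ℚ}

theorem Agree.left_mul (hP : P = sp q) {m} (hm : IsStar k m) {N B} {x c d : Comb Leg}
    (hx : x ∈ goodC) (hl : Low B (Series.of P x)) (hc : c ∈ goodC) (hd : d ∈ goodC)
    (h : Agree (N + B) (Series.of P c) (Series.of P d)) :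
    Agree N (Series.of P (starL k x c)) (Series.of P (starL k x d)) := by
  rw [starL_apply, starL_apply, ← mul_of hP hm hx hc, ← mul_of hP hm hx hd]
  exact Agree.mul_low hP hm hl (fun t _ => rfl) h

theorem Agree.left_pow (hP : P = sp q) {m} (hm : IsStar k m) {N} {x c d : Comb Leg}
    (hx : x ∈ goodC) (hl : Low 0 (Series.of P x)) (hc : c ∈ goodC) (hd : d ∈ goodC)
    (h : Agree N (Series.of P c) (Series.of P d)) (s : ℕ) :
    Agree N (Series.of P ((starL k x ^ s) c)) (Series.of P ((starL k x ^ s) d)) := by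
  induction s with
  | zero => exact h
  | succ s ih =>
    rw [starL_pow_succ, starL_pow_succ]
    exact Agree.left_mul hP hm hx hl (starL_pow_good hx hc s) (starL_pow_good hx hd s) ih

end

/-- A sum over a box differs from the sum over a triangle by terms of high degree. -/
theorem sum_box {V : Type*} [AddCommMonoid V] (M : ℕ) (g : ℕ → ℕ → V)
    (hg : ∀ i m, M < i + m → g i m = 0) :
    ∑ i ∈ Finset.range (M + 1), ∑ m ∈ Finset.range (M + 1), g i m =
      ∑ N ∈ Finset.range (M + 1), ∑ p ∈ Finset.HasAntidiagonal.antidiagonal N, g p.1 p.2 := by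
  rw [← Finset.sum_product' (f := g)]
  rw [← Finset.sum_filter_of_ne (p := fun p : ℕ × ℕ => p.1 + p.2 < M + 1)]
  · rw [← Finset.sum_fiberwise_of_maps_to (g := fun p : ℕ × ℕ => p.1 + p.2)
      (t := Finset.range (M + 1))]
    · refine Finset.sum_congr rfl fun N hN => Finset.sum_congr ?_ fun _ _ => rfl
      ext p
      simp only [Finset.mem_filter, Finset.mem_product, Finset.mem_range,
        Finset.HasAntidiagonal.mem_antidiagonal] at hN ⊢
      omega
    · intro p hp
      exact Finset.mem_range.2 (Finset.mem_filter.1 hp).2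
  · intro p _ hp
    by_contra h
    exact hp (hg _ _ (by omega))

theorem starL_pow_grows {c : Comb Leg} {x : Comb Leg} {n₀ : ℕ}
    (hx : x ∈ Finsupp.supported ℚ ℚ {D | ∃ t, D ∈ opDiagrams t ∧ 1 ≤ t.1})
    (hc : c ∈ Finsupp.supported ℚ ℚ {D | ∃ t, D ∈ opDiagrams t ∧ n₀ ≤ t.1}) (n : ℕ) :
    (starL 0 x ^ n) c ∈ Finsupp.supported ℚ ℚ {D | ∃ t, D ∈ opDiagrams t ∧ n + n₀ ≤ t.1} := by
  induction n with
  | zero => simpa using hc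
  | succ n ih =>
    rw [starL_pow_succ]
    refine star_bilin_mem ?_ hx ih
    rintro D ⟨p, hD, hp⟩ E ⟨q, hE, hq⟩
    refine Finsupp.supported_mono ?_ (star_gen_type 0 hD hE)
    rintro F ⟨r, hF, g, -, -, hg, h1, -⟩
    have := hg rfl
    exact ⟨r, hF, by omega⟩

/-- The exponentials of `j` and of `1/2 k + l` combine to the exponential of the sum. -/
theorem agree_exp_add (M : ℕ) : Agree M
    (Series.of spF (∑ i ∈ Finset.range (M + 1), ((Nat.factorial i : ℚ))⁻¹ •
      (starL 0 edgeFA ^ i) (expC 0 innerC M)))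
    (Series.of spF (expC 0 (edgeFA + innerC) M)) := by
  intro t ht
  have hx := edgeFA_good
  have hy := innerC_good
  set w : ℕ → ℚ := fun n => ((Nat.factorial n : ℚ))⁻¹ with hw
  have e1 : Series.of spF (expC 0 (edgeFA + innerC) M) = ∑ N ∈ Finset.range (M + 1),
      ∑ p ∈ Finset.HasAntidiagonal.antidiagonal N, (w p.1 * w p.2) •
        Series.of spF ((starL 0 edgeFA ^ p.1) ((starL 0 innerC ^ p.2) emptyD)) := by
    rw [expC, Series.of_sum]
    refine Finset.sum_congr rfl fun N _ => ?_
    rw [Series.of_smul, powC_eq, ← of_pow_add spF_fun isProd_zero hx hy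
      (of_edge_inner spF_fun) emptyD_good, Series.of_sum]
    exact Finset.sum_congr rfl fun p _ => Series.of_smul _ _
  have e2 : Series.of spF (∑ i ∈ Finset.range (M + 1), w i •
      (starL 0 edgeFA ^ i) (expC 0 innerC M)) = ∑ i ∈ Finset.range (M + 1),
      ∑ m ∈ Finset.range (M + 1), (w i * w m) •
        Series.of spF ((starL 0 edgeFA ^ i) ((starL 0 innerC ^ m) emptyD)) := by
    rw [Series.of_sum]
    refine Finset.sum_congr rfl fun i _ => ?_
    rw [Series.of_smul, expC, map_sum, Series.of_sum, Finset.smul_sum]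
    refine Finset.sum_congr rfl fun m _ => ?_
    rw [map_smul, Series.of_smul, powC_eq, smul_smul]
  rw [e1, e2]
  simp only [Finset.sum_apply, Pi.smul_apply]
  refine sum_box M (fun i m => (w i * w m) •
    Series.of spF ((starL 0 edgeFA ^ i) ((starL 0 innerC ^ m) emptyD)) t) fun i m him => ?_
  refine smul_eq_zero_of_right _ ?_
  have h0 : emptyD ∈ Finsupp.supported ℚ ℚ {D | ∃ t, D ∈ opDiagrams t ∧ 0 ≤ t.1} :=
    gen_mem_supported.2 ⟨_, empty_mem_opDiagrams, le_rfl⟩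
  have h1 : edgeFA ∈ Finsupp.supported ℚ ℚ {D | ∃ t, D ∈ opDiagrams t ∧ 1 ≤ t.1} :=
    gen_mem_supported.2 ⟨_, edgeFA_mem, by simp⟩
  have h2 : innerC ∈ Finsupp.supported ℚ ℚ {D | ∃ t, D ∈ opDiagrams t ∧ 1 ≤ t.1} :=
    Submodule.add_mem _ (Submodule.smul_mem _ _ (gen_mem_supported.2 ⟨_, forkA_mem, by simp⟩))
      (gen_mem_supported.2 ⟨_, edgeB_mem, by simp⟩)
  refine cls_eq_zero_of_supported ?_ (starL_pow_grows h1 (starL_pow_grows h2 h0 m) i)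
  rintro D ⟨t', hD, ht'⟩ hD'
  rw [spF_eq] at hD'
  rw [opDiagrams_unique hD hD'] at ht'
  omega

/-- The right hand side of the formula, after collecting the exponentials of `j`, `k` and `l`. -/
theorem cls_rhs {M : ℕ} {x : Comb Leg} (hx : x ∈ goodC) (hl : Low M (Series.of spWedge x)) :
    (spWedge (0, 0)).cls (star 1 x (star 0 (expC 0 edgeFA M)
        (star 1 (expC 1 ((-1 / 2 : ℚ) • forkOp) M) (lam (expC 0 innerC M))))) =
      ∑ s ∈ Finset.range (M + 1), ∑ N ∈ Finset.range (M + 1),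
        (((Nat.factorial s : ℚ))⁻¹ * ((Nat.factorial N : ℚ))⁻¹) •
          (spWedge (0, 0)).cls (star 1 x ((starL 1 ((-1 / 2 : ℚ) • forkOp) ^ s)
            (lam (powC 0 (edgeFA + innerC) N)))) := by
  have hj := edgeFA_good
  have hy := innerC_good
  set z : Comb Leg := (-1 / 2 : ℚ) • forkOp with hz'
  have hz : z ∈ goodC := forkOp_good _
  have hY := lam_good (expC_good (k := 0) hy M)
  have hZ := star_good 1 (expC_good (k := 1) hz M) hY
  have hju : edgeFA + innerC ∈ goodC := Submodule.add_mem _ hj hy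
  set w : ℕ → ℚ := fun n => ((Nat.factorial n : ℚ))⁻¹ with hw
  -- the edges `j` are moved to the right
  have e1 : Series.of spWedge (star 0 (expC 0 edgeFA M) (star 1 (expC 1 z M)
      (lam (expC 0 innerC M)))) = Series.of spWedge (∑ s ∈ Finset.range (M + 1), w s •
        (starL 1 z ^ s) (lam (∑ i ∈ Finset.range (M + 1), w i •
          (starL 0 edgeFA ^ i) (expC 0 innerC M)))) := by
    rw [of_star_expC spWedge_fun isProd_zero hj hZ]
    have h1 : ∀ i, Series.of spWedge ((starL 0 edgeFA ^ i)
        (star 1 (expC 1 z M) (lam (expC 0 innerC M)))) = ∑ s ∈ Finset.range (M + 1), w s •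
          Series.of spWedge ((starL 1 z ^ s) (lam ((starL 0 edgeFA ^ i) (expC 0 innerC M)))) := by
      intro i
      have h2 : Series.of spWedge (star 1 (expC 1 z M) (lam (expC 0 innerC M))) =
          Series.of spWedge (∑ s ∈ Finset.range (M + 1), w s •
            (starL 1 z ^ s) (lam (expC 0 innerC M))) := by
        rw [of_star_expC spWedge_fun isProd_one hz hY, Series.of_sum]
        exact Finset.sum_congr rfl fun s _ => (Series.of_smul _ _).symm
      rw [of_starL_pow_congr spWedge_fun isProd_zero hj hZ (Submodule.sum_mem _ fun s _ =>
        Submodule.smul_mem _ _ (starL_pow_good hz hY s)) h2 i, map_sum, Series.of_sum]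
      refine Finset.sum_congr rfl fun s _ => ?_
      rw [map_smul, Series.of_smul, of_pow_comm spWedge_fun isProd_zero isProd_one hj hz
        (of_edge_forkOp spWedge_fun _) hY, lam_starL_edgeFA_pow]
    simp only [h1, map_sum, map_smul, Series.of_sum, Series.of_smul, Finset.smul_sum]
    rw [Finset.sum_comm]
    refine Finset.sum_congr rfl fun s _ => Finset.sum_congr rfl fun i _ => ?_
    rw [smul_smul, smul_smul, mul_comm]
  have hJ : (∑ i ∈ Finset.range (M + 1), w i • (starL 0 edgeFA ^ i) (expC 0 innerC M)) ∈ goodC :=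
    Submodule.sum_mem _ fun i _ => Submodule.smul_mem _ _ (starL_pow_good hj (expC_good hy M) i)
  have hU := expC_good (k := 0) hju M
  have sm : ∀ {c : Comb Leg}, c ∈ goodC → (∑ s ∈ Finset.range (M + 1), w s •
      (starL 1 z ^ s) (lam c)) ∈ goodC := fun hc =>
    Submodule.sum_mem _ fun s _ => Submodule.smul_mem _ _ (starL_pow_good hz (lam_good hc) s)
  have e2 : Agree M (Series.of spWedge (∑ s ∈ Finset.range (M + 1), w s • (starL 1 z ^ s)
      (lam (∑ i ∈ Finset.range (M + 1), w i • (starL 0 edgeFA ^ i) (expC 0 innerC M)))))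
      (Series.of spWedge (∑ s ∈ Finset.range (M + 1), w s • (starL 1 z ^ s)
        (lam (expC 0 (edgeFA + innerC) M)))) := by
    have h := lamSeries_agree (agree_exp_add M)
    rw [lamSeries_of hJ, lamSeries_of hU] at h
    intro t ht
    rw [Series.of_sum, Series.of_sum, Finset.sum_apply, Finset.sum_apply]
    refine Finset.sum_congr rfl fun s _ => ?_
    rw [Series.of_smul, Series.of_smul, Pi.smul_apply, Pi.smul_apply,
      Agree.left_pow spWedge_fun isStar_operate hz (low_forkOp _) (lam_good hJ) (lam_good hU) h s
        t ht]
  have e3 := Agree.left_mul (N := 0) spWedge_fun isStar_operate hx hl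
    (star_good 0 (expC_good (k := 0) hj M) hZ) (sm hU) (by rw [zero_add, e1]; exact e2) (0, 0) le_rfl
  simp only [Series.of] at e3
  rw [starL_apply, starL_apply] at e3
  rw [e3]
  simp only [expC, map_sum, map_smul, Finset.smul_sum, smul_smul, ← starL_apply]
  rfl

end Weil

namespace Weil

/-! ### Gluing parameter legs -/

/-- Gluing the end `e` to the legs with parameter `p`, in all possible ways. -/
def del (p : Param) (e : ℕ) : Comb Leg →ₗ[ℚ] Comb Leg := ctr (opCoeff 1 (.op p)) p.grade e

theorem homog_opCoeff (p : Param) : Homog (opCoeff 1 (.op p)) p.grade :=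
  (contr_opCoeff 1 (.op p)).homog

theorem del_addG (p e T K) (c : Comb Leg) : del p e (addG T K c) = addG T K (del p e c) :=
  ctr_addG ..

theorem del_ren (p e) (f : ℕ → ℕ) (c : Comb Leg) : del p (f e) (ren f c) = ren f (del p e c) :=
  ctr_ren ..

theorem del_named {s : Set ℕ} {e : ℕ} (he : e ∈ s) (p) {c : Comb Leg} (hc : c ∈ named s) :
    del p e c ∈ named s := ctr_named he _ _ hc

theorem del_del (p p' e e') (c : Comb Leg) : del p e (del p' e' c) =
    (-1 : ℚ) ^ (p.grade * p'.grade) • del p' e' (del p e c) :=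
  ctr_ctr (homog_opCoeff p) (homog_opCoeff p') e e' c

theorem del_a_comm (p e e') (c : Comb Leg) :
    del .a e (del p e' c) = del p e' (del .a e c) := by
  rw [del_del, show Param.a.grade = 2 from rfl, pow_mul]
  simp

theorem del_consL (p e) (y : Leg × ℕ) (c : Comb Leg) : del p e (consL y c) =
    opCoeff 1 (.op p) y.1 • addG 0 {(e, y.2)} c +
      (-1 : ℚ) ^ (p.grade * y.1.grade) • consL y (del p e c) := ctr_consL ..

/-- Two legs with parameter `b` are glued to the ends `y` and `z`. -/
def delB (y z : ℕ) : Comb Leg →ₗ[ℚ] Comb Leg := del .b y ∘ₗ del .b z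

theorem delB_addG (y z T K) (c : Comb Leg) : delB y z (addG T K c) = addG T K (delB y z c) := by
  simp [delB, del_addG]

theorem delB_ren (y z) (f : ℕ → ℕ) (c : Comb Leg) :
    delB (f y) (f z) (ren f c) = ren f (delB y z c) := by
  simp [delB, del_ren]

theorem delB_named {s : Set ℕ} {y z : ℕ} (hy : y ∈ s) (hz : z ∈ s) {c : Comb Leg}
    (hc : c ∈ named s) : delB y z c ∈ named s := del_named hy _ (del_named hz _ hc)

theorem del_delB (p e y z) (c : Comb Leg) : del p e (delB y z c) = delB y z (del p e c) := by
  simp only [delB, LinearMap.comp_apply]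
  rw [del_del, del_del p .b e z, map_smul, smul_smul, neg_one_pow_mul_self, one_smul]

theorem delB_consL_par_a (y z n) (c : Comb Leg) :
    delB y z (consL (.par .a, n) c) = consL (.par .a, n) (delB y z c) := by
  have h : ∀ y c, del .b y (consL (.par .a, n) c) = consL (.par .a, n) (del .b y c) := by
    intro y c
    rw [del_consL, show opCoeff 1 (.op .b) (.par .a) = 0 from rfl, zero_smul, zero_add,
      show Param.b.grade * (Leg.par .a).grade = 2 from rfl, neg_one_sq, one_smul]
  rw [delB, LinearMap.comp_apply, LinearMap.comp_apply, h, h]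

/-- The action of `r` times a fork with an `a`-leg and two `∂_b`-legs, without the terms which
still contain operator legs. -/
def zOp (r : ℚ) (t : ℕ × ℕ × ℕ) : Comb Leg →ₗ[ℚ] Comb Leg :=
  r • addG {t} 0 ∘ₗ consL (.par .a, t.1) ∘ₗ delB t.2.1 t.2.2

theorem zOp_addG (r t T K) (c : Comb Leg) : zOp r t (addG T K c) = addG T K (zOp r t c) := by
  simp only [zOp, LinearMap.comp_apply, LinearMap.smul_apply, delB_addG, consL_addG, map_smul]
  rw [addG_comm]

theorem zOp_ren (r t) (f : ℕ → ℕ) (c : Comb Leg) :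
    zOp r (f t.1, f t.2.1, f t.2.2) (ren f c) = ren f (zOp r t c) := by
  simp only [zOp, LinearMap.comp_apply, LinearMap.smul_apply, delB_ren, ren_addG, ren_consL,
    map_smul, Multiset.map_singleton, Multiset.map_zero]

theorem zOp_delB (r t y z) (c : Comb Leg) : zOp r t (delB y z c) = delB y z (zOp r t c) := by
  have h : ∀ y z c, delB t.2.1 t.2.2 (delB y z c) = delB y z (delB t.2.1 t.2.2 c) := by
    intro y z c
    rw [delB, LinearMap.comp_apply, LinearMap.comp_apply, del_delB, del_delB]
  simp only [zOp, LinearMap.comp_apply, LinearMap.smul_apply, h, map_smul, delB_addG,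
    delB_consL_par_a]

theorem del_a_zOp (e r t) (c : Comb Leg) : del .a e (zOp r t c) =
    r • addG {t} {(e, t.1)} (delB t.2.1 t.2.2 c) + zOp r t (del .a e c) := by
  have h : opCoeff 1 (.op .a) (.par .a) = 1 := rfl
  simp only [zOp, LinearMap.comp_apply, LinearMap.smul_apply, map_smul, del_addG, del_consL, h,
    del_delB, map_add, addG_addG, add_zero, zero_add, Leg.grade, Param.grade]
  norm_num

theorem zOp_named {s : Set ℕ} {r t} (ht : t.1 ∈ s ∧ t.2.1 ∈ s ∧ t.2.2 ∈ s) {c : Comb Leg}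
    (hc : c ∈ named s) : zOp r t c ∈ named s := by
  refine Submodule.smul_mem _ r (named_addG (by simpa using ht) (by simp) ?_)
  exact named_consL ht.1 (delB_named ht.2.1 ht.2.2 hc)

/-- The product of the operators `zOp`. -/
def zOps (r : ℚ) : List (ℕ × ℕ × ℕ) → Comb Leg →ₗ[ℚ] Comb Leg
  | [] => LinearMap.id
  | t :: zs => zOp r t ∘ₗ zOps r zs

/-- The names of the edges of a list of vertices. -/
def flatNames (zs : List (ℕ × ℕ × ℕ)) : List ℕ := zs.flatMap fun t => [t.1, t.2.1, t.2.2]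

theorem flatNames_cons (t zs) : flatNames (t :: zs) = t.1 :: t.2.1 :: t.2.2 :: flatNames zs := rfl

theorem zOps_append (r) (u v : List (ℕ × ℕ × ℕ)) (c : Comb Leg) :
    zOps r (u ++ v) c = zOps r u (zOps r v c) := by
  induction u with
  | nil => rfl
  | cons t u ih => simp [zOps, ih]

theorem zOps_addG (r zs T K) (c : Comb Leg) : zOps r zs (addG T K c) = addG T K (zOps r zs c) := by
  induction zs with
  | nil => rfl
  | cons t zs ih => simp [zOps, ih, zOp_addG]

theorem zOps_delB (r zs y z) (c : Comb Leg) :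
    zOps r zs (delB y z c) = delB y z (zOps r zs c) := by
  induction zs with
  | nil => rfl
  | cons t zs ih => simp [zOps, ih, zOp_delB]

theorem zOps_ren (r zs) (f : ℕ → ℕ) (c : Comb Leg) :
    zOps r (zs.map fun t => (f t.1, f t.2.1, f t.2.2)) (ren f c) = ren f (zOps r zs c) := by
  induction zs with
  | nil => rfl
  | cons t zs ih => simp [zOps, ih, zOp_ren]

theorem zOps_named {s : Set ℕ} {r} {zs : List (ℕ × ℕ × ℕ)} (h : ∀ n ∈ flatNames zs, n ∈ s)
    {c : Comb Leg} (hc : c ∈ named s) : zOps r zs c ∈ named s := by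
  induction zs with
  | nil => exact hc
  | cons t zs ih =>
    rw [flatNames_cons] at h
    have hs : zOps r zs c ∈ named s := ih fun n hn => h n (by simp [hn])
    rw [zOps, LinearMap.comp_apply]
    exact zOp_named ⟨h t.1 (by simp), h t.2.1 (by simp), h t.2.2 (by simp)⟩ hs

/-- The ends of a list are glued to `a`-legs. -/
def delA : List ℕ → Comb Leg →ₗ[ℚ] Comb Leg
  | [] => LinearMap.id
  | e :: E => del .a e ∘ₗ delA E

theorem delA_addG (E T K) (c : Comb Leg) : delA E (addG T K c) = addG T K (delA E c) := by
  induction E with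
  | nil => rfl
  | cons e E ih => simp [delA, ih, del_addG]

theorem delA_ren (E) (f : ℕ → ℕ) (c : Comb Leg) :
    delA (E.map f) (ren f c) = ren f (delA E c) := by
  induction E with
  | nil => rfl
  | cons e E ih => simp [delA, ih, del_ren]

theorem delA_named {s : Set ℕ} {E : List ℕ} (h : ∀ n ∈ E, n ∈ s) {c : Comb Leg}
    (hc : c ∈ named s) : delA E c ∈ named s := by
  induction E with
  | nil => exact hc
  | cons e E ih =>
    have he : e ∈ s := h e List.mem_cons_self
    have hE : delA E c ∈ named s := ih fun n hn => h n (List.mem_cons_of_mem _ hn)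
    rw [delA, LinearMap.comp_apply]
    exact del_named he .a hE

theorem delA_del (E p e) (c : Comb Leg) : delA E (del p e c) = del p e (delA E c) := by
  induction E with
  | nil => rfl
  | cons e' E ih => simp [delA, ih, del_a_comm]

/-! ### Vanishing of diagrams with parameter or operator legs -/

/-- Diagrams with a parameter leg. -/
def hasPar : Set (Diagram Leg) := {D | ∃ x ∈ D.legs, ∃ p, x.1 = .par p}

/-- Diagrams with an operator leg. -/
def hasOp : Set (Diagram Leg) := {D | ∃ x ∈ D.legs, x.1.isOp}

theorem addG_hasPar (T K) {c : Comb Leg} (hc : c ∈ Finsupp.supported ℚ ℚ hasPar) :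
    addG T K c ∈ Finsupp.supported ℚ ℚ hasPar :=
  map_mem_of_gen (fun D hD => by rw [addG_gen]; exact gen_mem_supported.2 hD) hc

theorem consL_par (p : Param) (n : ℕ) (c : Comb Leg) :
    consL (.par p, n) c ∈ Finsupp.supported ℚ ℚ hasPar := by
  refine map_mem_of_gen (s := Set.univ) (fun D _ => ?_) (fun _ _ => Set.mem_univ _)
  rw [consL_gen]
  exact gen_mem_supported.2 ⟨_, List.mem_cons_self, _, rfl⟩

theorem parGrade_pos {p : Param} : 0 < (Leg.par p).parGrade := by
  cases p <;> decide

theorem hasPar_not_mem {D : Diagram Leg} (hD : D ∈ hasPar) : D ∉ opDiagrams (0, 0) := by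
  intro h
  obtain ⟨x, hx, p, hp⟩ := hD
  have h' := (mem_opDiagrams.1 h).2.2.1
  rw [List.sum_eq_zero_iff] at h'
  have := h' _ (List.mem_map_of_mem (f := fun x => x.1.parGrade) hx)
  simp only [hp] at this
  exact absurd this (parGrade_pos).ne'

theorem cls_hasPar (q : ℚ) {c : Comb Leg} (hc : c ∈ Finsupp.supported ℚ ℚ hasPar) :
    (sp q (0, 0)).cls c = 0 :=
  cls_eq_zero_of_supported (fun _ hD => hasPar_not_mem hD) hc

theorem cls_hasOp (q : ℚ) {c : Comb Leg} (hc : c ∈ Finsupp.supported ℚ ℚ hasOp) :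
    (sp q (0, 0)).cls c = 0 := by
  refine cls_eq_zero_of_supported ?_ hc
  rintro D ⟨x, hx, hx'⟩ h
  rw [not_op_of_type_zero h x hx] at hx'
  exact absurd hx' (by decide)

/-! ### Gluing half-edges to forks -/

/-- A list of names may be replaced by another one. -/
theorem exists_rename {l l' : List ℕ} {S : Set ℕ} (hlen : l.length = l'.length) (hl : l.Nodup)
    (hl' : l'.Nodup) (hS : ∀ n ∈ l, n ∉ S) (hS' : ∀ n ∈ l', n ∉ S) :
    ∃ f : ℕ → ℕ, (∀ n ∈ S, f n = n) ∧ l.map f = l' ∧ Set.InjOn f (S ∪ {n | n ∈ l}) := by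
  induction l generalizing l' with
  | nil =>
    obtain rfl := List.length_eq_zero_iff.1 hlen.symm
    exact ⟨id, fun _ _ => rfl, rfl, Set.injOn_id _⟩
  | cons a l ih =>
    cases l' with
    | nil => simp at hlen
    | cons b l' =>
      rw [List.nodup_cons] at hl hl'
      obtain ⟨f, h1, h2, h3⟩ := ih (l' := l') (by simpa using hlen) hl.2 hl'.2
        (fun n hn => hS n (by simp [hn])) (fun n hn => hS' n (by simp [hn]))
      have ha : ∀ n ∈ l, n ≠ a := by rintro n hn rfl; exact hl.1 hn
      have hmap : l.map (Function.update f a b) = l' := by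
        rw [← h2]
        exact List.map_congr_left fun n hn => Function.update_of_ne (ha n hn) _ _
      have hSa : ∀ n ∈ S, n ≠ a := by rintro n hn rfl; exact hS n (by simp) hn
      have hb : ∀ n ∈ S ∪ {n | n ∈ l}, f n ≠ b := by
        rintro n (hn | hn) rfl
        · rw [h1 n hn] at hS'
          exact hS' n (by simp) hn
        · exact hl'.1 (h2 ▸ List.mem_map_of_mem hn)
      have hne : ∀ n ∈ S ∪ {n | n ∈ l}, n ≠ a := by
        rintro n (hn | hn)
        · exact hSa n hn
        · exact ha n hn
      have hmem : ∀ m ∈ S ∪ {n | n ∈ a :: l}, m = a ∨ m ∈ S ∪ {n | n ∈ l} := by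
        rintro m (hm | hm)
        · exact Or.inr (Or.inl hm)
        · obtain h | h := List.mem_cons.1 hm
          · exact Or.inl h
          · exact Or.inr (Or.inr h)
      refine ⟨Function.update f a b, fun n hn => ?_, ?_, fun m hm n hn hmn => ?_⟩
      · rw [Function.update_of_ne (hSa n hn), h1 n hn]
      · rw [List.map_cons, hmap, Function.update_self]
      · obtain h | hm := hmem m hm <;> obtain h' | hn := hmem n hn
        · rw [h, h']
        · rw [h, Function.update_self, Function.update_of_ne (hne n hn)] at hmn
          exact absurd hmn.symm (hb n hn)
        · rw [h', Function.update_self, Function.update_of_ne (hne m hm)] at hmn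
          exact absurd hmn (hb m hm)
        · rw [Function.update_of_ne (hne n hn), Function.update_of_ne (hne m hm)] at hmn
          exact h3 hm hn hmn

theorem flatNames_map (f : ℕ → ℕ) (zs) : flatNames (zs.map fun t => (f t.1, f t.2.1, f t.2.2)) =
    (flatNames zs).map f := by
  induction zs with
  | nil => rfl
  | cons t zs ih => rw [List.map_cons, flatNames_cons, flatNames_cons, ih]; simp

theorem flatNames_injective : flatNames.Injective := by
  intro u
  induction u with
  | nil =>
    intro v h
    cases v with
    | nil => rfl
    | cons t v => simp [flatNames] at h
  | cons t u ih =>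
    intro v h
    cases v with
    | nil => simp [flatNames] at h
    | cons t' v =>
      rw [flatNames_cons, flatNames_cons] at h
      simp only [List.cons.injEq] at h
      obtain ⟨h1, h2, h3, h4⟩ := h
      rw [ih h4, Prod.ext h1 (Prod.ext h2 h3)]

theorem length_flatNames (zs) : (flatNames zs).length = 3 * zs.length := by
  induction zs with
  | nil => rfl
  | cons t zs ih => rw [flatNames_cons]; simp [ih]; ring

section
variable {q : ℚ}

/-- The value of gluing the ends `E` to a product of forks, and these to `X`. -/
def forkVal (q r : ℚ) (T : Multiset (ℕ × ℕ × ℕ)) (K : Multiset (ℕ × ℕ)) (E : List ℕ) (X : Comb Leg)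
    (zs : List (ℕ × ℕ × ℕ)) : (sp q (0, 0)).Space :=
  (sp q (0, 0)).cls (addG T K (delA E (zOps r zs X)))

/-- The names in a set `S`. -/
structure NamesIn (S : Set ℕ) (T : Multiset (ℕ × ℕ × ℕ)) (K : Multiset (ℕ × ℕ)) (E : List ℕ)
    (X : Comb Leg) : Prop where
  tri : ∀ t ∈ T, t.1 ∈ S ∧ t.2.1 ∈ S ∧ t.2.2 ∈ S
  link : ∀ k ∈ K, k.1 ∈ S ∧ k.2 ∈ S
  ends : ∀ e ∈ E, e ∈ S
  comb : X ∈ named S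

/-- A half-edge glued to the `a`-leg of a fork. -/
theorem forkVal_glue {r : ℚ} {S : Set ℕ} {T K E X} (h : NamesIn S T K E X) {e y z : ℕ} (he : e ∈ S)
    {t : ℕ × ℕ × ℕ} {zs zs' : List (ℕ × ℕ × ℕ)} (hlen : zs.length = zs'.length)
    (hnd : (flatNames (t :: zs)).Nodup) (hS : ∀ n ∈ flatNames (t :: zs), n ∉ S)
    (hnd' : (y :: z :: flatNames zs').Nodup) (hS' : ∀ n ∈ y :: z :: flatNames zs', n ∉ S) :
    (sp q (0, 0)).cls (addG T K (delA E (addG {t} {(e, t.1)}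
      (delB t.2.1 t.2.2 (zOps r zs X))))) =
      forkVal q r ({(e, y, z)} + T) K E (delB y z X) zs' := by
  have hP := graphLike_sp q (0, 0)
  obtain ⟨x, y', z'⟩ := t
  rw [flatNames_cons] at hnd hS
  simp only at hnd hS ⊢
  have hx := (List.nodup_cons.1 hnd).1
  have hxS : x ∉ S := hS x (by simp)
  set U : Set ℕ := S ∪ {n | n ∈ y' :: z' :: flatNames zs} with hU
  have hSU : S ⊆ U := Set.subset_union_left
  have hlU : ∀ n ∈ y' :: z' :: flatNames zs, n ∈ U := fun n hn => Or.inr hn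
  have hxU : x ∉ U := by
    rintro (h | h)
    · exact hxS h
    · exact hx h
  have hX := named_mono hSU h.comb
  have hc : addG T K (delA E (delB y' z' (zOps r zs X))) ∈ named U :=
    named_addG (fun a ha => ⟨hSU (h.tri a ha).1, hSU (h.tri a ha).2.1, hSU (h.tri a ha).2.2⟩)
      (fun k hk => ⟨hSU (h.link k hk).1, hSU (h.link k hk).2⟩)
      (delA_named (fun n hn => hSU (h.ends n hn)) (delB_named (hlU _ (by simp)) (hlU _ (by simp))
        (zOps_named (fun n hn => hlU _ (by simp [hn])) hX)))
  set c := addG T K (delA E (delB y' z' (zOps r zs X))) with hcdef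
  have hex : e ≠ x := by rintro rfl; exact hxS he
  have hy'x : y' ≠ x := by rintro rfl; exact hx (by simp)
  have hz'x : z' ≠ x := by rintro rfl; exact hx (by simp)
  -- the bivalent point is smoothed
  have h1 : (sp q (0, 0)).cls (addG 0 {(e, x)} (addG {(x, y', z')} 0 c)) =
      (sp q (0, 0)).cls (addG {(e, y', z')} 0 c) := by
    have hd : ∀ D ∈ {D : Diagram Leg | ∀ n ∈ D.ends, n ∈ U},
        (sp q (0, 0)).cls (addG 0 {(e, x)} (addG {(x, y', z')} 0 (gen D))) =
          (sp q (0, 0)).cls (addG {(e, y', z')} 0 (gen D)) := by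
      intro D hD
      have h0 : D.ends.count x = 0 := Multiset.count_eq_zero_of_notMem fun h => hxU (hD x h)
      have hD1 : (⟨{(x, y', z')} + D.tri, 0 + D.link, D.legs⟩ : Diagram Leg).ends.count x = 1 := by
        have : (⟨{(x, y', z')} + D.tri, 0 + D.link, D.legs⟩ : Diagram Leg) =
          ⟨(x, y', z') ::ₘ D.tri, D.link, D.legs⟩ := by simp
        rw [this, ends_tri]
        simp only [Multiset.count_cons, Ne.symm hy'x, Ne.symm hz'x, if_true, if_false]
        rw [show Diagram.ends ⟨D.tri, D.link, D.legs⟩ = D.ends from rfl, h0]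
      have hs := hP.cls_smooth hex hD1
      rw [addG_gen, hs, ren_gen, ← ren_gen, ← addG_gen, ren_addG]
      rw [ren_eq_self (s := U) (fun n hn => if_neg (by rintro rfl; exact hxU hn))
        (gen_mem_supported.2 hD)]
      simp [hy'x, hz'x]
    exact eq_of_gen (f := (sp q (0, 0)).cls ∘ₗ addG 0 {(e, x)} ∘ₗ addG {(x, y', z')} 0)
      (g := (sp q (0, 0)).cls ∘ₗ addG {(e, y', z')} 0) hd hc
  -- the names are changed
  obtain ⟨f, f1, f2, f3⟩ := exists_rename (l := y' :: z' :: flatNames zs)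
    (l' := y :: z :: flatNames zs') (S := S) (by simp [length_flatNames, hlen])
    (List.nodup_cons.1 hnd).2 hnd' (fun n hn => hS n (by simp_all)) hS'
  simp only [List.map_cons, List.cons.injEq, ← flatNames_map] at f2
  obtain ⟨fy, fz, fzs⟩ := f2
  have fzs := flatNames_injective fzs
  have h2 : ren f (addG {(e, y', z')} 0 c) =
      addG {(e, y, z)} 0 (addG T K (delA E (delB y z (zOps r zs' X)))) := by
    have e1 := ren_prefix (F := Sᶜ) (f := f) (fun n hn => f1 n (by simpa using hn)) (T := T) (K := K)
      (u := []) (fun t ht => by simpa using h.tri t ht) (fun k hk => by simpa using h.link k hk)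
      (by simp) (delA E (delB y' z' (zOps r zs X)))
    have e2 : E.map f = E :=
      (List.map_congr_left fun n hn => f1 n (h.ends n hn)).trans (List.map_id E)
    rw [consW_nil, consW_nil] at e1
    rw [ren_addG, hcdef, e1, ← delA_ren, ← delB_ren, ← zOps_ren, fzs, e2, fy, fz,
      ren_eq_self f1 h.comb]
    simp [f1 e he, fy, fz]
  have h3 := hP.cls_ren (f := f) f3 (c := addG {(e, y', z')} 0 c)
    (named_addG (by
      intro t ht
      rw [Multiset.mem_singleton.1 ht]
      exact ⟨hSU he, hlU y' (by simp), hlU z' (by simp)⟩) (by simp) hc)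
  have e3 : addG T K (delA E (addG {(x, y', z')} {(e, x)} (delB y' z' (zOps r zs X)))) =
      addG 0 {(e, x)} (addG {(x, y', z')} 0 c) := by
    rw [hcdef, delA_addG, addG_comm T K, addG_addG 0, zero_add, add_zero]
  rw [e3, h1, ← h3, h2, forkVal, zOps_delB, addG_addG, zero_add]

/-- The derivation property of gluing a half-edge to a product of forks. -/
theorem forkVal_cons {r : ℚ} {S : Set ℕ} {T K E X} (h : NamesIn S T K E X) {e y z : ℕ} (he : e ∈ S)
    {zs zs' : List (ℕ × ℕ × ℕ)} (hlen : zs.length = zs'.length + 1)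
    (hnd : (flatNames zs).Nodup) (hS : ∀ n ∈ flatNames zs, n ∉ S)
    (hnd' : (y :: z :: flatNames zs').Nodup) (hS' : ∀ n ∈ y :: z :: flatNames zs', n ∉ S) :
    forkVal q r T K (e :: E) X zs =
      ((zs.length : ℚ) * r) • forkVal q r ({(e, y, z)} + T) K E (delB y z X) zs' +
        forkVal q r T K E (del .a e X) zs := by
  have key : ∀ (u v : List (ℕ × ℕ × ℕ)), (u ++ v).length = zs'.length + 1 →
      (flatNames (u ++ v)).Nodup → (∀ n ∈ flatNames (u ++ v), n ∉ S) →
      (sp q (0, 0)).cls (addG T K (delA E (zOps r u (del .a e (zOps r v X))))) =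
        ((v.length : ℚ) * r) • forkVal q r ({(e, y, z)} + T) K E (delB y z X) zs' +
        forkVal q r T K E (del .a e X) (u ++ v) := by
    intro u v
    induction v generalizing u with
    | nil =>
      intro _ _ _
      simp [forkVal, zOps]
    | cons t v ih =>
      intro hlen hnd hS
      have hperm : (flatNames (u ++ t :: v)).Perm (flatNames (t :: (u ++ v))) :=
        List.Perm.flatMap_right _ List.perm_middle
      have g := forkVal_glue (q := q) (r := r) h he (t := t) (zs := u ++ v) (zs' := zs')
        (by simp at hlen ⊢; omega) (hperm.nodup_iff.1 hnd)
        (fun n hn => hS n (hperm.mem_iff.2 hn)) hnd' hS'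
      have i := ih (u ++ [t]) (by simpa using hlen) (by simpa using hnd) (by simpa using hS)
      rw [zOps_append, zOps, zOps, LinearMap.comp_apply, LinearMap.id_apply] at i
      rw [zOps, LinearMap.comp_apply, del_a_zOp]
      simp only [map_add, map_smul]
      rw [zOps_addG, zOps_delB, ← zOps_append, g, i, List.length_cons, List.append_assoc,
        List.singleton_append]
      push_cast
      module
  have := key [] zs (by simpa using hlen) (by simpa using hnd) (by simpa using hS)
  rw [List.nil_append] at this
  rw [← this, forkVal, delA, LinearMap.comp_apply, ← delA_del]
  rfl

theorem forkVal_nil {r : ℚ} {T K X t zs} : forkVal q r T K [] X (t :: zs) = 0 := by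
  refine cls_hasPar q ?_
  rw [delA, LinearMap.id_apply, zOps, LinearMap.comp_apply, zOp, LinearMap.smul_apply, map_smul]
  exact Submodule.smul_mem _ _ (addG_hasPar T K (addG_hasPar _ _ (consL_par _ _ _)))

end

end Weil

namespace Weil

/-! ### Contraction of diagrams with curvature legs and legs of grade 1 -/

/-- Gluing a leg of grade 2 to the `a`-legs, or a leg of grade 1 to the `b`-legs. -/
def delLeg (x : Leg × ℕ) : Comb Leg →ₗ[ℚ] Comb Leg :=
  if x.1 = .two then del .a x.2 else if x.1 = .one then del .b x.2 else 0

theorem delLeg_two (e : ℕ) : delLeg (.two, e) = del .a e := rfl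

theorem delLeg_one (e : ℕ) : delLeg (.one, e) = del .b e := rfl

theorem delLeg_cases {p : (Comb Leg →ₗ[ℚ] Comb Leg) → Prop} (x : Leg × ℕ)
    (h : ∀ r, p (del r x.2)) (h0 : p 0) : p (delLeg x) := by
  unfold delLeg
  split_ifs
  exacts [h _, h _, h0]

/-- The legs of a list are glued to parameter legs. -/
def delW : List (Leg × ℕ) → Comb Leg →ₗ[ℚ] Comb Leg
  | [] => LinearMap.id
  | x :: w => delLeg x ∘ₗ delW w

/-- All the legs of a diagram are glued to parameter legs of `X`. -/
def contract (X : Comb Leg) : Comb Leg →ₗ[ℚ] Comb Leg :=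
  extend fun D => addG D.tri D.link (delW D.legs X)

theorem contract_gen (X : Comb Leg) (D : Diagram Leg) :
    contract X (gen D) = addG D.tri D.link (delW D.legs X) := extend_gen _ _

theorem contract_addG (X : Comb Leg) (T K) (c : Comb Leg) :
    contract X (addG T K c) = addG T K (contract X c) := by
  refine LinearMap.congr_fun (f := contract X ∘ₗ addG T K) (g := addG T K ∘ₗ contract X)
    (comb_ext fun D => ?_) c
  simp [contract_gen, addG_addG]

theorem contract_consL (X : Comb Leg) (x) (c : Comb Leg) :
    contract X (consL x c) = delLeg x (contract X c) := by
  refine LinearMap.congr_fun (f := contract X ∘ₗ consL x) (g := delLeg x ∘ₗ contract X)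
    (comb_ext fun D => ?_) c
  have h : delLeg x (addG D.tri D.link (delW D.legs X)) =
      addG D.tri D.link (delLeg x (delW D.legs X)) :=
    delLeg_cases (p := fun f => f (addG D.tri D.link (delW D.legs X)) =
      addG D.tri D.link (f (delW D.legs X))) x (fun r => del_addG ..) (by simp)
  simp [contract_gen, h, delW]

/-- Operators which commute with all `del p e` commute with contractions. -/
theorem contract_map {f : Comb Leg →ₗ[ℚ] Comb Leg}
    (hf : ∀ T K c, f (addG T K c) = addG T K (f c)) (h : ∀ p e c, f (del p e c) = del p e (f c))
    (X c : Comb Leg) : contract (f X) c = f (contract X c) := by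
  refine LinearMap.congr_fun (f := contract (f X)) (g := f ∘ₗ contract X)
    (comb_ind (fun T K => ?_) fun x T K w ih => ?_) c
  · simp [contract_gen, delW, hf]
  · have h2 : ∀ c, f (delLeg x c) = delLeg x (f c) := fun c =>
      delLeg_cases (p := fun g => f (g c) = g (f c)) x (fun r => h _ _ _) (by simp)
    have := ih T K
    rw [LinearMap.comp_apply] at this ⊢
    rw [contract_consL, contract_consL, this, h2]

theorem contract_splitL (X : Comb Leg) (r e y z) (c : Comb Leg) :
    contract X (splitL .two r e y z c) =
      del .a e (contract X c) + r • addG {(e, y, z)} 0 (delB y z (contract X c)) := by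
  simp only [splitL, LinearMap.add_apply, LinearMap.smul_apply, LinearMap.comp_apply, map_add,
    map_smul, contract_consL, contract_addG, delLeg_two, delLeg_one, delB]

/-- The exponential of the fork with an `a`-leg and two `∂_b`-legs turns gluing to `a`-legs into
the contraction after hair-splitting. -/
theorem sum_forkVal {L : Type} {q r : ℚ} {zs : ℕ → List (ℕ × ℕ × ℕ)} {Z : Set ℕ}
    (hlen : ∀ s, (zs s).length = s) (hnd : ∀ s, (flatNames (zs s)).Nodup)
    (hZ : ∀ s, ∀ n ∈ flatNames (zs s), n ∈ Z) {W : List (L × ℕ × ℕ × ℕ)} {S : Set ℕ} {T K X}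
    (h : NamesIn S T K (W.map fun x => x.2.1) X) (hS : ∀ n ∈ S, n ∉ Z) (hW : (newNames W).Nodup)
    (hW' : ∀ n ∈ newNames W, n ∉ S ∧ n ∉ Z) {M : ℕ} (hM : W.length ≤ M) :
    ∑ s ∈ Finset.range (M + 1), ((Nat.factorial s : ℚ))⁻¹ •
        forkVal q r T K (W.map fun x => x.2.1) X (zs s) =
      (sp q (0, 0)).cls (contract X (splitG (fun _ => .two) (fun _ => r) W (gen ⟨T, K, []⟩))) := by
  have hzs0 : zs 0 = [] := List.length_eq_zero_iff.1 (hlen 0)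
  induction W generalizing S T X M with
  | nil =>
    rw [Finset.sum_eq_single 0 (fun s _ hs => ?_) (by simp), hzs0]
    · simp [forkVal, splitG, contract_gen, delW, delA, zOps]
    · cases hz : zs s with
      | nil => exact absurd (by rw [← hlen s, hz]; rfl) hs
      | cons t u => rw [List.map_nil, forkVal_nil, smul_zero]
  | cons x W ih =>
    obtain ⟨l, e, y, z⟩ := x
    obtain ⟨M, rfl⟩ : ∃ M', M = M' + 1 := ⟨M - 1, by simp at hM; omega⟩
    have hN : newNames ((l, e, y, z) :: W) = y :: z :: newNames W := rfl
    rw [hN] at hW hW'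
    have hWW := (List.nodup_cons.1 (List.nodup_cons.1 hW).2).2
    have he : e ∈ S := h.ends _ (by simp)
    have hSU : S ⊆ S ∪ {y, z} := Set.subset_union_left
    have hT : NamesIn (S ∪ {y, z}) ({(e, y, z)} + T) K (W.map fun x => x.2.1) (delB y z X) := by
      refine ⟨fun t ht => ?_, fun k hk => ⟨hSU (h.link k hk).1, hSU (h.link k hk).2⟩,
        fun n hn => hSU (h.ends n (by simp_all)),
        delB_named (by simp) (by simp) (named_mono hSU h.comb)⟩
      rcases Multiset.mem_add.1 ht with ht | ht
      · rw [Multiset.mem_singleton.1 ht]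
        exact ⟨hSU he, by simp, by simp⟩
      · exact ⟨hSU (h.tri t ht).1, hSU (h.tri t ht).2.1, hSU (h.tri t ht).2.2⟩
    have ih1 := ih hT (by
        rintro n (hn | rfl | rfl)
        · exact hS n hn
        · exact (hW' n (by simp)).2
        · exact (hW' n (by simp)).2) hWW (fun n hn => ⟨by
          rintro (hn' | rfl | rfl)
          · exact (hW' n (by simp [hn])).1 hn'
          · exact (List.nodup_cons.1 hW).1 (by simp [hn])
          · exact (List.nodup_cons.1 (List.nodup_cons.1 hW).2).1 hn, (hW' n (by simp [hn])).2⟩)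
      (M := M) (by simpa using hM)
    have ih2 := ih (X := del .a e X) ⟨h.tri, h.link, fun n hn => h.ends n (by simp_all),
        del_named he _ h.comb⟩ hS hWW (fun n hn => hW' n (by simp [hn])) (M := M + 1)
      (by simp at hM ⊢; omega)
    have step : ∀ s, forkVal q r T K (e :: W.map fun x => x.2.1) X (zs (s + 1)) =
        (((s + 1 : ℕ) : ℚ) * r) • forkVal q r ({(e, y, z)} + T) K (W.map fun x => x.2.1)
          (delB y z X) (zs s) + forkVal q r T K (W.map fun x => x.2.1) (del .a e X) (zs (s + 1)) := by
      intro s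
      have := forkVal_cons (q := q) (r := r) (E := W.map fun x => x.2.1) (y := y) (z := z)
        (zs := zs (s + 1)) (zs' := zs s) ⟨h.tri, h.link, fun n hn => h.ends n (by simp_all), h.comb⟩
        he (by rw [hlen, hlen]) (hnd _) (fun n hn hn' => hS n hn' (hZ _ n hn)) ?_ ?_
      · rwa [hlen] at this
      · have hy := hW' y (by simp)
        have hz := hW' z (by simp)
        have hyz : y ≠ z := by rintro rfl; exact (List.nodup_cons.1 hW).1 (by simp)
        refine List.nodup_cons.2 ⟨?_, List.nodup_cons.2 ⟨fun h => hz.2 (hZ _ _ h), hnd _⟩⟩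
        rintro (h | h)
        · exact hyz rfl
        · exact hy.2 (hZ _ _ ‹_›)
      · intro n hn hn'
        rcases List.mem_cons.1 hn with rfl | hn
        · exact (hW' n (by simp)).1 hn'
        rcases List.mem_cons.1 hn with rfl | hn
        · exact (hW' n (by simp)).1 hn'
        · exact hS n hn' (hZ _ n hn)
    have step0 : forkVal q r T K (e :: W.map fun x => x.2.1) X (zs 0) =
        forkVal q r T K (W.map fun x => x.2.1) (del .a e X) (zs 0) := by
      rw [hzs0, forkVal, forkVal, delA, LinearMap.comp_apply, zOps, LinearMap.id_apply,
        LinearMap.id_apply, delA_del]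
    have hg : (gen ⟨{(e, y, z)} + T, K, []⟩ : Comb Leg) =
        addG {(e, y, z)} 0 (gen ⟨T, K, []⟩) := by simp
    rw [hg, splitG_addG, contract_map (fun T K c => delB_addG ..) fun p e' c => (del_delB ..).symm,
      contract_addG, delB_addG] at ih1
    rw [contract_map (fun T K c => del_addG ..) fun p e' c => del_a_comm ..] at ih2
    rw [splitG, LinearMap.comp_apply, contract_splitL, map_add, map_smul, ← ih1, ← ih2,
      Finset.sum_range_succ', Finset.sum_range_succ' (n := M + 1), List.map_cons, step0,
      Finset.smul_sum, add_right_comm, ← Finset.sum_add_distrib]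
    congr 1
    refine Finset.sum_congr rfl fun s _ => ?_
    have h1 : ((s + 1 : ℕ) : ℚ) ≠ 0 := by exact_mod_cast Nat.succ_ne_zero s
    rw [step, smul_add, smul_smul, smul_smul, Nat.factorial_succ, Nat.cast_mul, mul_inv,
      mul_comm ((s + 1 : ℕ) : ℚ)⁻¹, mul_mul_mul_comm, mul_comm r, ← mul_assoc,
      mul_inv_cancel_right₀ h1, add_comm]

end Weil

namespace Weil

/-! ### Operator legs may be replaced by gluings -/

theorem del_hasOp (p e) {c : Comb Leg} (hc : c ∈ Finsupp.supported ℚ ℚ hasOp) :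
    del p e c ∈ Finsupp.supported ℚ ℚ hasOp := by
  refine map_mem_of_gen (fun D hD => ?_) hc
  obtain ⟨T, K, w⟩ := D
  induction w generalizing T K with
  | nil => obtain ⟨x, hx, -⟩ := hD; simp at hx
  | cons x w ih =>
    rw [← consL_gen x ⟨T, K, w⟩, del_consL]
    cases hx : x.1.isOp with
    | true =>
      have h0 : opCoeff 1 (.op p) x.1 = 0 := by
        obtain ⟨l, n⟩ := x
        cases l <;> first | rfl | simp [Leg.isOp] at hx
      rw [h0, zero_smul, zero_add]
      refine Submodule.smul_mem _ _ (map_mem_of_gen (s := Set.univ) (fun D _ => ?_)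
        (fun _ _ => Set.mem_univ _))
      rw [consL_gen]
      exact gen_mem_supported.2 ⟨x, List.mem_cons_self, hx⟩
    | false =>
      obtain ⟨y, hy, hy'⟩ := hD
      have hw : (⟨T, K, w⟩ : Diagram Leg) ∈ hasOp := by
        rcases List.mem_cons.1 hy with rfl | hy
        · rw [hx] at hy'; exact absurd hy' (by decide)
        · exact ⟨y, hy, hy'⟩
      refine Submodule.add_mem _ (Submodule.smul_mem _ _ ?_) (Submodule.smul_mem _ _ ?_)
      · rw [addG_gen]
        obtain ⟨z, hz⟩ := hw
        exact gen_mem_supported.2 ⟨z, hz⟩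
      · refine map_mem_of_gen (fun D hD => ?_) (ih T K hw)
        obtain ⟨z, hz, hz'⟩ := hD
        rw [consL_gen]
        exact gen_mem_supported.2 ⟨z, List.mem_cons_of_mem _ hz, hz'⟩

theorem consL_hasOp (x) {c : Comb Leg} (hc : c ∈ Finsupp.supported ℚ ℚ hasOp) :
    consL x c ∈ Finsupp.supported ℚ ℚ hasOp := by
  refine map_mem_of_gen (fun D hD => ?_) hc
  obtain ⟨z, hz, hz'⟩ := hD
  rw [consL_gen]
  exact gen_mem_supported.2 ⟨z, List.mem_cons_of_mem _ hz, hz'⟩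

theorem addG_hasOp (T K) {c : Comb Leg} (hc : c ∈ Finsupp.supported ℚ ℚ hasOp) :
    addG T K c ∈ Finsupp.supported ℚ ℚ hasOp :=
  map_mem_of_gen (fun D hD => by rw [addG_gen]; exact gen_mem_supported.2 hD) hc

/-- Pushing an operator leg to the right amounts to gluing it, up to diagrams with operator
legs. -/
theorem pushC_sub_del (p e) (c : Comb Leg) :
    pushC 1 (.op p, e) c - del p e c ∈ Finsupp.supported ℚ ℚ hasOp := by
  have head : ∀ (x : Leg × ℕ) (c : Comb Leg), x.1.isOp → consL x c ∈ Finsupp.supported ℚ ℚ hasOp :=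
    fun x c hx => map_mem_of_gen (s := Set.univ) (fun D _ => by
      rw [consL_gen]
      exact gen_mem_supported.2 ⟨x, List.mem_cons_self, hx⟩) (fun _ _ => Set.mem_univ _)
  refine map_mem_of_gen (s := Set.univ) (f := pushC 1 (.op p, e) - del p e) (fun D _ => ?_)
    (fun _ _ => Set.mem_univ _)
  obtain ⟨T, K, w⟩ := D
  induction w generalizing T K with
  | nil =>
    rw [LinearMap.sub_apply, pushC_nil, del, ctr_nil, sub_zero]
    exact gen_mem_supported.2 ⟨_, List.mem_cons_self, rfl⟩
  | cons x w ih =>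
    rw [← consL_gen x ⟨T, K, w⟩, LinearMap.sub_apply, del_consL]
    cases hx : x.1.isOp with
    | true =>
      have h0 : opCoeff 1 (.op p) x.1 = 0 := by
        obtain ⟨l, n⟩ := x
        cases l <;> first | rfl | simp [Leg.isOp] at hx
      rw [h0, zero_smul, zero_add, pushC_consL_op _ _ hx]
      exact Submodule.sub_mem _ (head _ _ rfl) (Submodule.smul_mem _ _ (head _ _ hx))
    | false =>
      have := Submodule.smul_mem _ ((-1 : ℚ) ^ (p.grade * x.1.grade)) (consL_hasOp x (ih T K trivial))
      rw [pushC_consL _ _ hx]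
      convert this using 1
      rw [LinearMap.sub_apply, map_sub, smul_sub, opCoeff, sgn]
      simp only [show (Leg.op p).grade = p.grade from rfl]
      abel

theorem pushC_hasOp (p e) {c : Comb Leg} (hc : c ∈ Finsupp.supported ℚ ℚ hasOp) :
    pushC 1 (.op p, e) c ∈ Finsupp.supported ℚ ℚ hasOp := by
  have := Submodule.add_mem _ (pushC_sub_del p e c) (del_hasOp p e hc)
  rwa [sub_add_cancel] at this

/-- Equality up to diagrams with operator legs. -/
def EqOp (c d : Comb Leg) : Prop := c - d ∈ Finsupp.supported ℚ ℚ hasOp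

theorem EqOp.trans {c d e : Comb Leg} (h : EqOp c d) (h' : EqOp d e) : EqOp c e := by
  have := Submodule.add_mem _ h h'
  rwa [sub_add_sub_cancel] at this

theorem EqOp.map {f : Comb Leg →ₗ[ℚ] Comb Leg} (hf : ∀ {c}, c ∈ Finsupp.supported ℚ ℚ hasOp →
    f c ∈ Finsupp.supported ℚ ℚ hasOp) {c d : Comb Leg} (h : EqOp c d) : EqOp (f c) (f d) := by
  rw [EqOp, ← map_sub]
  exact hf h

theorem EqOp.pushC (p e) {c d : Comb Leg} (h : EqOp c d) :
    EqOp (pushC 1 (.op p, e) c) (del p e d) :=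
  (EqOp.map (pushC_hasOp p e) h).trans (pushC_sub_del p e d)

theorem EqOp.forkOp {x y z : ℕ} {c d : Comb Leg} (h : EqOp c d) (r : ℚ) :
    EqOp (r • forkOpOp x y z c) (zOp r (x, y, z) d) := by
  have h1 := EqOp.map (addG_hasOp {(x, y, z)} 0) (EqOp.map (consL_hasOp (.par .a, x))
    ((h.pushC .b z).pushC .b y))
  have := Submodule.smul_mem _ r h1
  rwa [smul_sub] at this

theorem EqOp.partialA {c d : Comb Leg} (h : EqOp c d) (w : List (Unit × ℕ)) :
    EqOp (actW 1 (w.map fun x => (.op .a, x.2)) c) (delA (w.map Prod.snd) d) := by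
  induction w with
  | nil => exact h
  | cons x w ih => exact ih.pushC .a x.2

/-! ### Names of the edges of products -/

/-- Names of the edges of the `i`-th factor `1/2 k + l + j`. The names of different origins differ
modulo 4: the residue is 0 for a given diagram, 1 for the forks with operator legs, 2 for the
factors `1/2 k + l + j`, and 3 for the legs of the forks in hair-splitting. -/
def nmU (i n : ℕ) : ℕ := 4 * Nat.pair i n + 2

/-- Names of the edges of the `i`-th fork with operator legs. -/
def nmZ (i n : ℕ) : ℕ := 4 * Nat.pair i n + 1

/-- Names of the edges of a product of factors `1/2 k + l + j`. -/
def nameU : ℕ → ℕ → ℕ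
  | 0 => fun n => 4 * n + 3
  | N + 1 => glue (nmU N) (nameU N)

/-- Names of the edges of a product of forks with operator legs and factors `1/2 k + l + j`. -/
def nameZ (N : ℕ) : ℕ → ℕ → ℕ
  | 0 => nameU N
  | s + 1 => glue (nmZ s) (nameZ N s)

theorem nmU_injective (i : ℕ) : (nmU i).Injective := fun a b h => by
  have : Nat.pair i a = Nat.pair i b := by simp only [nmU] at h; omega
  exact (Nat.pair_eq_pair.1 this).2

theorem nmZ_injective (i : ℕ) : (nmZ i).Injective := fun a b h => by
  have : Nat.pair i a = Nat.pair i b := by simp only [nmZ] at h; omega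
  exact (Nat.pair_eq_pair.1 this).2

theorem glue_cases {p : ℕ → Prop} {f g : ℕ → ℕ} (hf : ∀ n, p (f n)) (hg : ∀ n, p (g n)) (n : ℕ) :
    p (glue f g n) := by
  unfold glue
  split_ifs
  exacts [hf _, hg _]

theorem nameU_mem (N n : ℕ) : (∃ i < N, ∃ m, nameU N n = nmU i m) ∨ nameU N n % 4 = 3 := by
  induction N generalizing n with
  | zero => right; simp only [nameU]; omega
  | succ N ih =>
    refine glue_cases (p := fun k => (∃ i < N + 1, ∃ m, k = nmU i m) ∨ k % 4 = 3)
      (fun n => Or.inl ⟨N, by omega, n, rfl⟩) (fun n => ?_) n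
    rcases ih n with ⟨i, hi, m, h⟩ | h
    · exact Or.inl ⟨i, by omega, m, h⟩
    · exact Or.inr h

theorem nameU_injective (N : ℕ) : (nameU N).Injective := by
  induction N with
  | zero => intro a b h; simp only [nameU] at h; omega
  | succ N ih =>
    refine glue_injective (nmU_injective N) ih fun a b h => ?_
    rcases nameU_mem N b with ⟨i, hi, m, h'⟩ | h'
    · have : Nat.pair N a = Nat.pair i m := by rw [h', nmU, nmU] at h; omega
      have := (Nat.pair_eq_pair.1 this).1
      omega
    · rw [← h, nmU] at h'; omega

theorem nameZ_mem (N s n : ℕ) :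
    (∃ i < s, ∃ m, nameZ N s n = nmZ i m) ∨ 2 ≤ nameZ N s n % 4 := by
  induction s generalizing n with
  | zero =>
    right
    rcases nameU_mem N n with ⟨i, -, m, h⟩ | h
    · rw [nameZ, h, nmU]; omega
    · rw [nameZ, h]; omega
  | succ s ih =>
    refine glue_cases (p := fun k => (∃ i < s + 1, ∃ m, k = nmZ i m) ∨ 2 ≤ k % 4)
      (fun n => Or.inl ⟨s, by omega, n, rfl⟩) (fun n => ?_) n
    rcases ih n with ⟨i, hi, m, h⟩ | h
    · exact Or.inl ⟨i, by omega, m, h⟩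
    · exact Or.inr h

theorem nameZ_injective (N s : ℕ) : (nameZ N s).Injective := by
  induction s with
  | zero => exact nameU_injective N
  | succ s ih =>
    refine glue_injective (nmZ_injective s) ih fun a b h => ?_
    rcases nameZ_mem N s b with ⟨i, hi, m, h'⟩ | h'
    · have : Nat.pair s a = Nat.pair i m := by rw [h', nmZ, nmZ] at h; omega
      have := (Nat.pair_eq_pair.1 this).1
      omega
    · rw [← h, nmZ] at h'; omega

/-- The action of the `i`-th factor `1/2 k + l + j`. -/
def uOp (i : ℕ) : Comb Leg →ₗ[ℚ] Comb Leg :=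
  edgeOp (nmU i 0) + forkAOp (nmU i 0) (nmU i 1) (nmU i 2) + edgeBOp (nmU i 0)

/-- The power of `1/2 k + l + j`, with names as in `nmU`. -/
def blkU : ℕ → Comb Leg
  | 0 => emptyD
  | N + 1 => uOp N (blkU N)

/-- The names of the forks with operator legs. -/
def zNames : ℕ → List (ℕ × ℕ × ℕ)
  | 0 => []
  | s + 1 => (nmZ s 0, nmZ s 1, nmZ s 2) :: zNames s

theorem zNames_length (s : ℕ) : (zNames s).length = s := by
  induction s with
  | zero => rfl
  | succ s ih => rw [zNames, List.length_cons, ih]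

theorem mem_zNames {s n : ℕ} (h : n ∈ flatNames (zNames s)) : ∃ i < s, ∃ m, n = nmZ i m := by
  induction s with
  | zero => simp [zNames, flatNames] at h
  | succ s ih =>
    rw [zNames, flatNames_cons] at h
    simp only [List.mem_cons] at h
    rcases h with h | h | h | h
    · exact ⟨s, by omega, _, h⟩
    · exact ⟨s, by omega, _, h⟩
    · exact ⟨s, by omega, _, h⟩
    · obtain ⟨i, hi, m, h⟩ := ih h
      exact ⟨i, by omega, m, h⟩

theorem zNames_nodup (s : ℕ) : (flatNames (zNames s)).Nodup := by
  induction s with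
  | zero => simp [zNames, flatNames]
  | succ s ih =>
    have h : ∀ m, nmZ s m ∉ flatNames (zNames s) := by
      intro m hm
      obtain ⟨i, hi, m', h⟩ := mem_zNames hm
      have : Nat.pair s m = Nat.pair i m' := by simp only [nmZ] at h; omega
      have := (Nat.pair_eq_pair.1 this).1
      omega
    have h' : ∀ m n, m ≠ n → nmZ s m ≠ nmZ s n := fun m n hmn h => hmn (nmZ_injective s h)
    rw [zNames, flatNames_cons]
    simp [ih, h, h' 0 1, h' 0 2, h' 1 2]

theorem ren_powC (N : ℕ) : ren (nameU N) (powC 0 (edgeFA + innerC) N) = blkU N := by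
  induction N with
  | zero => simp [powC, blkU, emptyD, Diagram.rename]
  | succ N ih =>
    rw [powC, nameU, ren_glue, ih, map_add, map_add, LinearMap.add_apply, actC_edgeFA, actC_innerC,
      blkU, uOp]
    simp only [LinearMap.add_apply]
    abel

theorem ren_pow_forkOp (r : ℚ) (N s : ℕ) : EqOp (ren (nameZ N s) ((starL 1 (r • forkOp) ^ s)
    (lam (powC 0 (edgeFA + innerC) N)))) (zOps r (zNames s) (lam (blkU N))) := by
  induction s with
  | zero =>
    rw [pow_zero, Module.End.one_apply, nameZ, ← lam_ren, ren_powC, EqOp]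
    simp [zNames, zOps]
  | succ s ih =>
    rw [starL_pow_succ, starL_apply, nameZ, ren_glue, map_smul, map_smul, LinearMap.smul_apply,
      actC_forkOp]
    exact ih.forkOp r

/-- The terms on the right hand side of the formula, as contractions. -/
theorem cls_star_partialA (q r : ℚ) (D : Diagram Unit) (N s : ℕ) :
    (sp q (0, 0)).cls (star 1 (toPartialA (gen D)) ((starL 1 (r • forkOp) ^ s)
      (lam (powC 0 (edgeFA + innerC) N)))) =
    forkVal q r (D.rename (4 * ·)).tri (D.rename (4 * ·)).link
      ((D.rename (4 * ·)).legs.map Prod.snd) (lam (blkU N)) (zNames s) := by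
  have hinj : (4 * · : ℕ → ℕ).Injective := fun a b h => by simpa using h
  have e : ren (4 * ·) (toPartialA (gen D)) = gen ⟨(D.rename (4 * ·)).tri, (D.rename (4 * ·)).link,
      (D.rename (4 * ·)).legs.map fun x => (.op .a, x.2)⟩ := by
    simp [toPartialA, Diagram.rename]
    rfl
  rw [← (graphLike_sp q (0, 0)).cls_actC hinj (nameZ_injective N s) (fun a b h => ?_), e, actC_gen,
    LinearMap.comp_apply, forkVal, ← sub_eq_zero, ← map_sub]
  · exact cls_hasOp q (EqOp.map (addG_hasOp _ _)
      ((ren_pow_forkOp r N s).partialA (D.rename (4 * ·)).legs))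
  · rcases nameZ_mem N s b with ⟨i, -, m, h'⟩ | h'
    · rw [h', nmZ] at h; omega
    · rw [← h] at h'; omega

end Weil

namespace Weil

/-! ### Sums over the rearrangements of a word -/

section
variable {V V' : Type*} [AddCommGroup V] [Module ℚ V] [AddCommGroup V'] [Module ℚ V']

/-- The sum over all ways to move a leg to the left end, with signs. -/
def pickSum : List (Leg × ℕ) → (Leg × ℕ → List (Leg × ℕ) → V) → V
  | [], _ => 0
  | x :: w, f => f x w + pickSum w fun y r => sgn x.1 y.1 • f y (x :: r)

theorem map_pickSum (g : V →ₗ[ℚ] V') (w : List (Leg × ℕ)) (f : Leg × ℕ → List (Leg × ℕ) → V) :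
    g (pickSum w f) = pickSum w fun y r => g (f y r) := by
  induction w generalizing f with
  | nil => exact map_zero g
  | cons x w ih => simp [pickSum, ih]

theorem pickSum_congr {w : List (Leg × ℕ)} {f g : Leg × ℕ → List (Leg × ℕ) → V}
    (h : ∀ y r, (y :: r).Perm w → f y r = g y r) : pickSum w f = pickSum w g := by
  induction w generalizing f g with
  | nil => rfl
  | cons x w ih =>
    rw [pickSum, pickSum, h x w (List.Perm.refl _),
      ih fun y r hr => by rw [h y (x :: r) ((List.Perm.swap _ _ _).trans (hr.cons x))]]

theorem pickSum_sub (w : List (Leg × ℕ)) (f g : Leg × ℕ → List (Leg × ℕ) → V) :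
    (pickSum w fun y r => f y r - g y r) = pickSum w f - pickSum w g := by
  induction w generalizing f g with
  | nil => simp [pickSum]
  | cons x w ih => simp only [pickSum, smul_sub, ih]; abel

theorem pickSum_mem {N : Submodule ℚ V} {w : List (Leg × ℕ)} {f : Leg × ℕ → List (Leg × ℕ) → V}
    (h : ∀ y r, (y :: r).Perm w → f y r ∈ N) : pickSum w f ∈ N := by
  induction w generalizing f with
  | nil => exact Submodule.zero_mem _
  | cons x w ih =>
    exact Submodule.add_mem _ (h x w (List.Perm.refl _)) (ih fun y r hr =>
      Submodule.smul_mem _ _ (h y (x :: r) ((List.Perm.swap _ _ _).trans (hr.cons x))))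

/-- The signed sum over all rearrangements of a word, if its length is `N`. -/
def arrSum : ℕ → List (Leg × ℕ) → (List (Leg × ℕ) → V) → V
  | 0, w, f => if w = [] then f [] else 0
  | N + 1, w, f => pickSum w fun y r => arrSum N r fun v => f (y :: v)

theorem map_arrSum (g : V →ₗ[ℚ] V') (N) (w : List (Leg × ℕ)) (f : List (Leg × ℕ) → V) :
    g (arrSum N w f) = arrSum N w fun v => g (f v) := by
  induction N generalizing w f with
  | zero => rw [arrSum, arrSum]; split_ifs <;> simp
  | succ N ih => simp only [arrSum, map_pickSum, ih]

theorem arrSum_congr {N} {w : List (Leg × ℕ)} {f g : List (Leg × ℕ) → V}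
    (h : ∀ v, v.Perm w → v.length = N → f v = g v) : arrSum N w f = arrSum N w g := by
  induction N generalizing w f g with
  | zero =>
    rw [arrSum, arrSum]
    split_ifs with hw
    · rw [h [] (by rw [hw]) rfl]
    · rfl
  | succ N ih =>
    exact pickSum_congr fun y r hr => ih fun v hv hl =>
      h (y :: v) ((hv.cons y).trans hr) (by rw [List.length_cons, hl])

theorem arrSum_mem {S : Submodule ℚ V} {N} {w : List (Leg × ℕ)} {f : List (Leg × ℕ) → V}
    (h : ∀ v, v.Perm w → v.length = N → f v ∈ S) : arrSum N w f ∈ S := by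
  induction N generalizing w f with
  | zero =>
    rw [arrSum]
    split_ifs with hw
    · exact h [] (by rw [hw]) rfl
    · exact Submodule.zero_mem _
  | succ N ih =>
    exact pickSum_mem fun y r hr => ih fun v hv hl =>
      h (y :: v) ((hv.cons y).trans hr) (by rw [List.length_cons, hl])

theorem arrSum_of_ne {N} {w : List (Leg × ℕ)} (h : w.length ≠ N) (f : List (Leg × ℕ) → V) :
    arrSum N w f = 0 :=
  (Submodule.mem_bot ℚ).1 (arrSum_mem fun _ hv hl => absurd (hv.length_eq ▸ hl) h)

end

theorem sym_eq_pickSum (T K) (x : Leg × ℕ) (w : List (Leg × ℕ)) : sym (gen ⟨T, K, x :: w⟩) =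
    pickSum (x :: w) fun y r => consL y (sym (gen ⟨T, K, r⟩)) := by
  have hc : ∀ (x : Leg × ℕ) w, (gen ⟨T, K, x :: w⟩ : Comb Leg) = consL x (gen ⟨T, K, w⟩) := by
    simp
  induction w generalizing x with
  | nil => rw [hc, sym_consL, sym_nil, ins_nil]; simp [pickSum]
  | cons y w ih =>
    have h : consL x (sym (gen ⟨T, K, y :: w⟩)) =
        pickSum (y :: w) fun z r => consL x (consL z (sym (gen ⟨T, K, r⟩))) := by
      rw [ih, map_pickSum]
    rw [hc, sym_consL, ih, map_pickSum]
    change _ = consL x (sym (gen ⟨T, K, y :: w⟩)) +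
      pickSum (y :: w) fun z r => sgn x.1 z.1 • consL z (sym (gen ⟨T, K, x :: r⟩))
    rw [h, ← sub_eq_iff_eq_add, ← pickSum_sub]
    exact pickSum_congr fun z r _ => by rw [hc x r, sym_consL, ins_consL, add_sub_cancel_right]

theorem sym_eq_arrSum (T K) (w : List (Leg × ℕ)) :
    sym (gen ⟨T, K, w⟩) = arrSum w.length w fun v => gen ⟨T, K, v⟩ := by
  obtain ⟨N, hN⟩ : ∃ N, w.length = N := ⟨_, rfl⟩
  rw [hN]
  induction N generalizing w with
  | zero => rw [List.length_eq_zero_iff.1 hN]; simp [arrSum]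
  | succ N ih =>
    cases w with
    | nil => simp at hN
    | cons x w =>
      rw [sym_eq_pickSum, arrSum]
      refine pickSum_congr fun y r hr => ?_
      have := hr.length_eq
      rw [ih r (by simp only [List.length_cons] at this hN; omega), map_arrSum]
      simp

/-! ### Contraction with a power of `1/2 k + l + j` -/

theorem del_two (p e n) (c : Comb Leg) :
    del p e (consL (.two, n) c) = consL (.two, n) (del p e c) := by
  rw [del_consL, show opCoeff 1 (.op p) .two = 0 from rfl, show Leg.two.grade = 2 from rfl,
    mul_comm, pow_mul]
  simp

theorem del_one (p e n) (c : Comb Leg) :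
    del p e (consL (.one, n) c) = (-1 : ℚ) ^ p.grade • consL (.one, n) (del p e c) := by
  rw [del_consL, show opCoeff 1 (.op p) .one = 0 from rfl, show Leg.one.grade = 1 from rfl, mul_one]
  simp

theorem del_one_one (p e n m) (c : Comb Leg) : del p e (consL (.one, n) (consL (.one, m) c)) =
    consL (.one, n) (consL (.one, m) (del p e c)) := by
  rw [del_one, del_one, map_smul, smul_smul, neg_one_pow_mul_self, one_smul]

/-- A leg `y` which has been glued to the parameter leg of the `i`-th factor `1/2 k + l + j`. -/
def stick (i : ℕ) (y : Leg × ℕ) : Comb Leg →ₗ[ℚ] Comb Leg :=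
  if y.1 = .two then addG 0 {(y.2, nmU i 0)} ∘ₗ (consL (.two, nmU i 0) +
    (1 / 2 : ℚ) • addG {(nmU i 0, nmU i 1, nmU i 2)} 0 ∘ₗ consL (.one, nmU i 1) ∘ₗ
      consL (.one, nmU i 2))
  else if y.1 = .one then addG 0 {(y.2, nmU i 0)} ∘ₗ consL (.one, nmU i 0) else 0

/-- Gluing a leg to parameter legs is a derivation: the leg is glued to the first factor
`1/2 k + l + j`, or to the remaining ones. -/
theorem delLeg_uOp (i : ℕ) (x : Leg × ℕ) (c : Comb Leg) :
    delLeg x (uOp i c) = uOp i (delLeg x c) + stick i x c := by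
  have aa : opCoeff 1 (.op .a) (.par .a) = 1 := rfl
  have ab : opCoeff 1 (.op .a) (.par .b) = 0 := rfl
  have ba : opCoeff 1 (.op .b) (.par .a) = 0 := rfl
  have bb : opCoeff 1 (.op .b) (.par .b) = 1 := rfl
  have h1 : ∀ p, opCoeff 1 (.op p) .one = 0 := fun _ => rfl
  have h2 : ∀ p, opCoeff 1 (.op p) .two = 0 := fun _ => rfl
  unfold delLeg stick
  split_ifs
  · simp only [uOp, edgeOp, forkAOp, edgeBOp, LinearMap.add_apply, LinearMap.comp_apply,
      LinearMap.smul_apply, map_add, map_smul, del_addG, del_consL, aa, ab, h1, h2, Leg.grade,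
      Param.grade, consL_addG, addG_comm 0]
    module
  · simp only [uOp, edgeOp, forkAOp, edgeBOp, LinearMap.add_apply, LinearMap.comp_apply,
      LinearMap.smul_apply, map_add, map_smul, del_addG, del_consL, ba, bb, h1, h2, Leg.grade,
      Param.grade, consL_addG, addG_comm 0]
    module
  · simp

theorem delLeg_stick (i : ℕ) (x y : Leg × ℕ) (c : Comb Leg) :
    delLeg x (stick i y c) = sgn x.1 y.1 • stick i y (delLeg x c) := by
  have key : ∀ p e, del p e (stick i y c) =
      ((-1 : ℚ) ^ (p.grade * y.1.grade)) • stick i y (del p e c) := by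
    intro p e
    obtain ⟨l, n⟩ := y
    unfold stick
    split_ifs with h h'
    · simp only at h
      subst h
      rw [show Leg.two.grade = 2 from rfl, mul_comm, pow_mul, neg_one_sq, one_pow, one_smul]
      simp [del_addG, del_two, del_one_one]
    · simp only at h'
      subst h'
      simp [del_addG, del_one, Leg.grade]
    · simp
  obtain ⟨l, n⟩ := x
  unfold delLeg
  split_ifs with h h'
  · simp only at h
    subst h
    exact key .a n
  · simp only at h'
    subst h'
    exact key .b n
  · simp

theorem delW_uOp (i : ℕ) (w : List (Leg × ℕ)) (c : Comb Leg) :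
    delW w (uOp i c) = uOp i (delW w c) + pickSum w fun y r => stick i y (delW r c) := by
  induction w with
  | nil => simp [delW, pickSum]
  | cons x w ih =>
    rw [delW, LinearMap.comp_apply, ih, map_add, delLeg_uOp, map_pickSum, pickSum, add_assoc]
    simp only [delLeg_stick]
    rfl

/-- New names for the replacement of legs by forks, depending on the position of the leg. -/
def posNames {L : Type} (p q : ℕ → ℕ) : List (L × ℕ) → List (L × ℕ × ℕ × ℕ)
  | [] => []
  | x :: w => (x.1, x.2, p w.length, q w.length) :: posNames p q w

theorem oldLegs_posNames {L : Type} (p q) (w : List (L × ℕ)) : oldLegs (posNames p q w) = w := by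
  induction w with
  | nil => rfl
  | cons x w ih => exact congrArg _ ih

theorem mem_posNames {L : Type} {p q} {w : List (L × ℕ)} {n} (h : n ∈ newNames (posNames p q w)) :
    ∃ i < w.length, n = p i ∨ n = q i := by
  induction w with
  | nil => simp [posNames, newNames] at h
  | cons x w ih =>
    have h' : n = p w.length ∨ n = q w.length ∨ n ∈ newNames (posNames p q w) := by
      simpa [posNames, newNames] using h
    rcases h' with h | h | h
    · exact ⟨_, by simp, Or.inl h⟩
    · exact ⟨_, by simp, Or.inr h⟩
    · obtain ⟨i, hi, h⟩ := ih h
      exact ⟨i, by simp; omega, h⟩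

theorem nodup_posNames {L : Type} {p q : ℕ → ℕ} (hp : p.Injective) (hq : q.Injective)
    (hpq : ∀ i j, p i ≠ q j) (w : List (L × ℕ)) : (newNames (posNames p q w)).Nodup := by
  induction w with
  | nil => simp [posNames, newNames]
  | cons x w ih =>
    have h1 : p w.length ∉ newNames (posNames p q w) := fun h => by
      obtain ⟨i, hi, h | h⟩ := mem_posNames h
      · exact absurd (hp h) (by omega)
      · exact hpq _ _ h
    have h2 : q w.length ∉ newNames (posNames p q w) := fun h => by
      obtain ⟨i, hi, h | h⟩ := mem_posNames h
      · exact hpq _ _ h.symm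
      · exact absurd (hq h) (by omega)
    have : newNames (posNames p q (x :: w)) =
        p w.length :: q w.length :: newNames (posNames p q w) := rfl
    rw [this]
    simp [h1, h2, hpq, ih]

/-- The replacement of the legs of grade 2 of a word by (curvature leg) `+ 1/2` fork. -/
def curvW (w : List (Leg × ℕ)) : Comb Leg :=
  splitG id curvCoeff (posNames (nmU · 1) (nmU · 2) w) emptyD

/-- The names of the first `N` factors `1/2 k + l + j`. -/
def namesU (N : ℕ) : Set ℕ := {n | ∃ i < N, ∃ m, n = nmU i m}

theorem namesU_mod {N n : ℕ} (h : n ∈ namesU N) : n % 4 = 2 := by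
  obtain ⟨i, -, m, rfl⟩ := h
  rw [nmU]; omega

theorem nmU_notMem (N m : ℕ) : nmU N m ∉ namesU N := by
  rintro ⟨i, hi, m', h⟩
  have : Nat.pair N m = Nat.pair i m' := by simp only [nmU] at h; omega
  have := (Nat.pair_eq_pair.1 this).1
  omega

theorem namesU_mono (N : ℕ) : namesU N ⊆ namesU (N + 1) := by
  rintro n ⟨i, hi, h⟩
  exact ⟨i, by omega, h⟩

theorem nmU_mem (N m : ℕ) : nmU N m ∈ namesU (N + 1) := ⟨N, by omega, m, rfl⟩

theorem consL_hasPar (x) {c : Comb Leg} (hc : c ∈ Finsupp.supported ℚ ℚ hasPar) :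
    consL x c ∈ Finsupp.supported ℚ ℚ hasPar := by
  refine map_mem_of_gen (fun D hD => ?_) hc
  obtain ⟨z, hz, hz'⟩ := hD
  rw [consL_gen]
  exact gen_mem_supported.2 ⟨z, List.mem_cons_of_mem _ hz, hz'⟩

theorem hasPar_mem_nullSub {q : ℚ} {F : Set ℕ} {c : Comb Leg}
    (hc : c ∈ Finsupp.supported ℚ ℚ hasPar) : c ∈ nullSub (sp q (0, 0)) F := by
  intro T K u _ _ hu
  clear hu
  refine cls_hasPar q (addG_hasPar T K ?_)
  induction u with
  | nil => rwa [consW_nil]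
  | cons x u ih =>
    rw [consW_cons]
    exact consL_hasPar x ih

theorem uOp_hasPar (i : ℕ) (c : Comb Leg) : uOp i c ∈ Finsupp.supported ℚ ℚ hasPar := by
  refine Submodule.add_mem _ (Submodule.add_mem _ ?_ (Submodule.smul_mem _ _ ?_)) ?_
  · exact consL_hasPar _ (consL_par _ _ _)
  · exact addG_hasPar _ _ (consL_par _ _ _)
  · exact consL_par _ _ _

theorem once_consL {e : ℕ} {s : Set ℕ} (he : e ∉ s) {c : Comb Leg} (hc : c ∈ named s) (l : Leg) :
    consL (l, e) c ∈ once e := by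
  refine map_mem_of_gen (f := consL (l, e)) (fun D hD => ?_) hc
  rw [consL_gen]
  refine gen_mem_supported.2 ?_
  rw [Set.mem_ofPred_eq, ends_cons, Multiset.count_cons_self,
    show Diagram.ends ⟨D.tri, D.link, D.legs⟩ = D.ends from rfl,
    Multiset.count_eq_zero_of_notMem fun h => he (hD e h)]

theorem once_tri {e p q : ℕ} {s : Set ℕ} (he : e ∉ s) (hp : p ≠ e) (hq : q ≠ e) {c : Comb Leg}
    (hc : c ∈ named s) (k l : Leg) : addG {(e, p, q)} 0 (consL (k, p) (consL (l, q) c)) ∈ once e := by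
  refine map_mem_of_gen (f := addG {(e, p, q)} 0 ∘ₗ consL (k, p) ∘ₗ consL (l, q))
    (fun D hD => ?_) hc
  have : D.ends.count e = 0 := Multiset.count_eq_zero_of_notMem fun h => he (hD e h)
  simp only [LinearMap.comp_apply, consL_gen, addG_gen, zero_add, Multiset.singleton_add]
  refine gen_mem_supported.2 ?_
  rw [Set.mem_ofPred_eq, ends_tri, ends_cons, ends_cons]
  simp only [Multiset.count_cons, hp.symm, hq.symm, if_true, if_false]
  rw [show Diagram.ends ⟨D.tri, D.link, D.legs⟩ = D.ends from rfl, this]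

/-- The bivalent point at a leg which has been glued to a factor `1/2 k + l + j` is smoothed. -/
theorem stick_sub_splitL {N : ℕ} {y : Leg × ℕ} (hy : y.1 = .two ∨ y.1 = .one) (hy' : y.2 % 4 ≠ 2)
    {c : Comb Leg} (hc : c ∈ named ({n | n % 4 ≠ 2} ∪ namesU N)) :
    stick N y c - splitL y.1 (curvCoeff y.1) y.2 (nmU N 1) (nmU N 2) c ∈
      nullSub (sp 1 (0, 0)) (namesU (N + 1)) := by
  have hP := graphLike_sp 1 (0, 0)
  set n := nmU N 0 with hn
  have hnm : n ∉ {n | n % 4 ≠ 2} ∪ namesU N := by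
    rintro (h | h)
    · exact h (namesU_mod (nmU_mem N 0))
    · exact nmU_notMem N 0 h
  have hyn : y.2 ≠ n := fun h => hy' (h ▸ namesU_mod (nmU_mem N 0))
  have h1n : nmU N 1 ≠ n := fun h => absurd (nmU_injective N h) (by decide)
  have h2n : nmU N 2 ≠ n := fun h => absurd (nmU_injective N h) (by decide)
  have hr : ren (fun m => if m = n then y.2 else m) c = c :=
    ren_eq_self (fun m hm => if_neg (by rintro rfl; exact hnm hm)) hc
  have ho := once_consL hnm hc
  have ho' := once_tri hnm h1n h2n hc .one .one
  obtain ⟨l, e⟩ := y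
  simp only at hyn hr
  rcases hy with rfl | rfl
  · have s1 := nullSub_smooth hP hyn (nmU_mem N 0) (Submodule.add_mem _ (ho .two)
      (Submodule.smul_mem _ (1 / 2 : ℚ) ho'))
    convert s1 using 2
    · simp [stick, hn]
    · simp [splitL, curvCoeff, ren_addG, ren_consL, hr, h1n, h2n]
  · have s1 := nullSub_smooth hP hyn (nmU_mem N 0) (ho .one)
    rw [ren_consL, hr, if_pos rfl] at s1
    change stick N (.one, e) c - splitL .one (curvCoeff .one) e (nmU N 1) (nmU N 2) c ∈ _
    rw [splitL_of_ne (by decide)]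
    exact s1

theorem stick_nullSub {P : Presentation Leg} {F : Set ℕ} {N : ℕ} {y : Leg × ℕ} (hy : y.2 ∉ F)
    (hN : ∀ m, nmU N m ∉ F) {c : Comb Leg} (hc : c ∈ nullSub P F) :
    stick N y c ∈ nullSub P F := by
  have h1 : ∀ {c}, c ∈ nullSub P F → addG 0 {(y.2, nmU N 0)} c ∈ nullSub P F := fun hc =>
    nullSub_addG (by simp) (by simp [hy, hN]) hc
  have h2 : ∀ k m {c}, k = Leg.two ∨ k = Leg.one → c ∈ nullSub P F →
      consL (k, nmU N m) c ∈ nullSub P F := fun k m c hk hc =>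
    nullSub_consL (by rcases hk with rfl | rfl <;> rfl) (hN m) hc
  unfold stick
  split_ifs
  · exact h1 (Submodule.add_mem _ (h2 _ _ (Or.inl rfl) hc) (Submodule.smul_mem _ _
      (nullSub_tri (hN 0) (hN 1) (hN 2) (h2 _ _ (Or.inr rfl) (h2 _ _ (Or.inr rfl) hc)))))
  · exact h1 (h2 _ _ (Or.inr rfl) hc)
  · exact Submodule.zero_mem _

/-- Gluing the legs of a word to a power of `1/2 k + l + j` replaces the legs of grade 2 by
(curvature leg) `+ 1/2` fork and symmetrizes; the power must be the number of legs, as otherwise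
legs or parameters remain. -/
theorem delW_blkU (N : ℕ) {w : List (Leg × ℕ)}
    (hw : ∀ x ∈ w, (x.1 = .two ∨ x.1 = .one) ∧ x.2 % 4 ≠ 2) :
    delW w (blkU N) - arrSum N w curvW ∈ nullSub (sp 1 (0, 0)) (namesU N) := by
  induction N generalizing w with
  | zero =>
    cases w with
    | nil => simp [delW, arrSum, blkU, curvW, posNames, splitG]
    | cons x w =>
      have h : ∀ w : List (Leg × ℕ), delW w emptyD = 0 ∨ delW w emptyD = emptyD := by
        intro w
        induction w with
        | nil => exact Or.inr rfl
        | cons x w ih =>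
          rw [delW, LinearMap.comp_apply]
          rcases ih with h | h <;> rw [h]
          · exact Or.inl (map_zero _)
          · exact Or.inl (delLeg_cases (p := fun f => f emptyD = 0) x (fun r => ctr_nil ..) rfl)
      have h0 : delW (x :: w) emptyD = 0 := by
        rw [delW, LinearMap.comp_apply]
        rcases h w with h | h <;> rw [h]
        · exact map_zero _
        · exact delLeg_cases (p := fun f => f emptyD = 0) x (fun r => ctr_nil ..) rfl
      simp [blkU, h0, arrSum]
  | succ N ih =>
    have e : (arrSum (N + 1) w curvW : Comb Leg) = pickSum w fun y r =>
        splitL y.1 (curvCoeff y.1) y.2 (nmU N 1) (nmU N 2) (arrSum N r curvW) := by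
      rw [arrSum]
      refine pickSum_congr fun y r _ => ?_
      rw [map_arrSum]
      refine arrSum_congr fun v _ hv => ?_
      rw [curvW, posNames, splitG, hv]
      rfl
    rw [blkU, delW_uOp, e, add_sub_assoc, ← pickSum_sub]
    refine Submodule.add_mem _ (hasPar_mem_nullSub (uOp_hasPar _ _)) (pickSum_mem fun y r hr => ?_)
    have hy := hw y (hr.subset (by simp))
    have hr' : ∀ x ∈ r, (x.1 = .two ∨ x.1 = .one) ∧ x.2 % 4 ≠ 2 := fun x hx =>
      hw x (hr.subset (by simp [hx]))
    have hm : (arrSum N r curvW : Comb Leg) ∈ named ({n | n % 4 ≠ 2} ∪ namesU N) := by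
      refine arrSum_mem fun v hv hl => splitG_named _ _ (fun x hx => ?_)
        (gen_mem_supported.2 (by simp))
      have h1 : (x.1, x.2.1) ∈ v := by
        have : (x.1, x.2.1) ∈ oldLegs (posNames (nmU · 1) (nmU · 2) v) :=
          List.mem_map_of_mem (f := fun x => (x.1, x.2.1)) hx
        rwa [oldLegs_posNames] at this
      have h2 : ∀ n ∈ newNames (posNames (nmU · 1) (nmU · 2) v), n ∈ namesU N := fun n hn => by
        obtain ⟨i, hi, h | h⟩ := mem_posNames hn
        · exact ⟨i, by omega, _, h⟩
        · exact ⟨i, by omega, _, h⟩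
      exact ⟨Or.inl (hr' _ (hv.subset h1)).2, Or.inr (h2 _ (mem_newNames hx).1),
        Or.inr (h2 _ (mem_newNames hx).2)⟩
    have h1 := stick_sub_splitL hy.1 hy.2 hm
    have h2 : stick N y (delW r (blkU N) - arrSum N r curvW) ∈
        nullSub (sp 1 (0, 0)) (namesU (N + 1)) :=
      nullSub_mono (namesU_mono N)
        (stick_nullSub (fun h => hy.2 (namesU_mod h)) (nmU_notMem N) (ih hr'))
    have := Submodule.add_mem _ h2 h1
    rwa [map_sub, sub_add_sub_cancel] at this

end Weil

namespace Weil

/-! ### The map `λ` and contractions -/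

/-- The contractions in `λ` and the gluings to parameter legs are of different kinds of legs; a
gluing to `b`-legs changes the sign of a contraction as it does for adding a leg of grade 1. -/
theorem lam_del (p e) (c : Comb Leg) : lam (del p e c) = del p e (lam c) := by
  refine LinearMap.congr_fun (f := lam ∘ₗ del p e) (g := del p e ∘ₗ lam)
    (comb_ind (fun T K => ?_) fun x T K w ih => ?_) c
  · rw [LinearMap.comp_apply, LinearMap.comp_apply, lam_gen_nil, del, ctr_nil, map_zero]
  · have ih := ih T K
    rw [LinearMap.comp_apply, LinearMap.comp_apply] at ih ⊢
    have h : del p e (ctr oneCoeff 1 x.2 (lam (gen ⟨T, K, w⟩))) = (-1 : ℚ) ^ (p.grade * 1) •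
        ctr oneCoeff 1 x.2 (del p e (lam (gen ⟨T, K, w⟩))) :=
      ctr_ctr (homog_opCoeff p) contr_oneCoeff.homog e x.2 _
    rw [del_consL, map_add, map_smul, map_smul, lam_addG, lam_consL, lam_consL, ih, map_add,
      del_consL, map_smul, h]
    split_ifs with hx
    · rw [hx, show Leg.one.grade = 1 from rfl]
      module
    · module

/-- The map induced by `λ` on diagrams without parameters. -/
theorem mapLambda_cls (c : Comb Leg) :
    mapLambda ((spF (0, 0)).cls c) = (spWedge (0, 0)).cls (lam c) := by
  rw [mapLambda, spF_eq, spWedge_eq]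
  refine LinearMap.congr_fun (f := induced (sp 1 (0, 0)) (sp 0 (0, 0)) lam ∘ₗ (sp 1 (0, 0)).cls)
    (g := (sp 0 (0, 0)).cls ∘ₗ lam) (comb_ext fun D => ?_) c
  by_cases h : D ∈ opDiagrams (0, 0)
  · exact induced_cls (wellDefined_lam _ _) (gen_mem_supported.2 h)
  · rw [LinearMap.comp_apply, LinearMap.comp_apply, cls_gen_of_notMem (P := sp 1 (0, 0)) h, map_zero]
    -- `λ` preserves the ends and the grades of the parameter and operator legs
    refine (cls_eq_zero_of_supported (A := {E | E.ends = D.ends ∧ parS E.legs = parS D.legs ∧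
      opS E.legs = opS D.legs}) ?_ fun E hE => ?_).symm
    · rintro E ⟨h1, h2, h3⟩ hE
      obtain ⟨e1, -, e3, e4⟩ := mem_opDiagrams'.1 hE
      have h4 : opS D.legs = 0 := h3 ▸ e4
      refine h (mem_opDiagrams'.2 ⟨(valid_congr h1).1 e1, ?_, h2 ▸ e3, h4⟩)
      refine List.pairwise_of_forall_mem_list fun x hx y _ hx' => absurd hx' ?_
      have h5 := (List.sum_eq_zero_iff.1 h4) _ (List.mem_map_of_mem (f := fun x => x.1.opGrade) hx)
      obtain ⟨l, n⟩ := x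
      cases l with
      | op p => cases p <;> exact absurd h5 (by simp [Leg.opGrade, Param.grade])
      | _ => exact Bool.false_ne_true
    · obtain ⟨-, g2, g3⟩ := lam_type D.tri D.link D.legs hE
      exact ⟨lam_endsIn D hE, g2, g3⟩

/-- The map `λ` commutes with contractions, which only remove the parameter legs. -/
theorem lam_contract (X c : Comb Leg) : contract (lam X) c = lam (contract X c) :=
  contract_map lam_addG lam_del X c

/-! ### The composition of the maps, by contractions -/

/-- Diagrams whose legs are ordinary legs of grade 1 and 2. -/
def ordinary : Set (Diagram Leg) := {D | ∀ x ∈ D.legs, x.1 = .two ∨ x.1 = .one}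

theorem ordinary_mem {D : Diagram Leg} (h : D ∈ ordinary) (hD : D.Valid) :
    D ∈ opDiagrams (0, 0) := by
  refine mem_opDiagrams'.2 ⟨hD, List.pairwise_of_forall_mem_list fun x hx y _ hx' => ?_,
    List.sum_eq_zero fun n hn => ?_, List.sum_eq_zero fun n hn => ?_⟩
  · rcases h x hx with h | h <;> rw [h] at hx' <;> exact absurd hx' (by decide)
  all_goals
    obtain ⟨x, hx, rfl⟩ := List.mem_map.1 hn
    rcases h x hx with h | h <;> rw [h] <;> rfl

theorem cls_addG_curvW {D : Diagram Leg} (hn : ∀ n ∈ D.ends, n % 4 ≠ 2) {v : List (Leg × ℕ)}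
    (hv : v.Perm D.legs) : (sp 1 (0, 0)).cls (addG D.tri D.link (curvW v)) =
      (sp 1 (0, 0)).cls (toCurvature (gen ⟨D.tri, D.link, v⟩)) := by
  have e : addG D.tri D.link emptyD = gen ⟨D.tri, D.link, []⟩ := by simp [emptyD]
  have hU : ∀ n ∈ newNames (posNames (nmU · 1) (nmU · 2) v), n % 4 = 2 := fun n hn => by
    obtain ⟨i, -, h | h⟩ := mem_posNames hn <;> rw [h, nmU] <;> omega
  have hinj : ∀ m, (nmU · m).Injective := fun m a b h => by
    have : Nat.pair a m = Nat.pair b m := by simp only [nmU] at h; omega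
    exact (Nat.pair_eq_pair.1 this).1
  rw [curvW, ← splitG_addG, e, cls_splitG (graphLike_sp 1 (0, 0)), oldLegs_posNames, toCurvature_gen]
  · refine nodup_posNames (hinj 1) (hinj 2) (fun i j h => ?_) v
    have : Nat.pair i 1 = Nat.pair j 2 := by simp only [nmU] at h; omega
    exact absurd (Nat.pair_eq_pair.1 this).2 (by decide)
  · intro n hn' h
    rw [oldLegs_posNames, mem_ends_perm hv] at h
    exact hn n h (hU n hn')

/-- The contraction with the exponential of `1/2 k + l + j` is the average, followed by the change
to curvature legs. -/
theorem sum_contract_blkU {M : ℕ} {D : Diagram Leg} (h : D ∈ ordinary)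
    (hn : ∀ n ∈ D.ends, n % 4 ≠ 2) (hM : D.legs.length ≤ M) :
    ∑ N ∈ Finset.range (M + 1), ((Nat.factorial N : ℚ))⁻¹ •
      (sp 1 (0, 0)).cls (contract (blkU N) (gen D)) =
        (sp 1 (0, 0)).cls (toCurvature (average (gen D))) := by
  have key : ∀ N, (sp 1 (0, 0)).cls (contract (blkU N) (gen D)) =
      arrSum N D.legs fun v => (sp 1 (0, 0)).cls (toCurvature (gen ⟨D.tri, D.link, v⟩)) := by
    intro N
    have hU : ∀ {n}, n ∈ D.ends → n ∉ namesU N := fun h h' => hn _ h (namesU_mod h')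
    simp only [Diagram.ends, Multiset.mem_add, Multiset.mem_bind, Multiset.mem_coe, List.mem_map,
      Multiset.insert_eq_cons, Multiset.mem_cons, Multiset.mem_singleton] at hU
    have h1 := delW_blkU N (w := D.legs) fun x hx => ⟨h x hx, hn _ (by
      simp only [Diagram.ends, Multiset.mem_add, Multiset.mem_coe]
      exact Or.inr (List.mem_map_of_mem hx))⟩
    have h2 := h1 D.tri D.link [] (fun t ht => by grind) (fun k hk => by grind) (by simp)
    rw [consW_nil, map_sub, map_sub, sub_eq_zero] at h2
    rw [contract_gen, h2]
    have := map_arrSum ((sp 1 (0, 0)).cls ∘ₗ addG D.tri D.link) N D.legs curvW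
    simp only [LinearMap.comp_apply] at this
    rw [this]
    exact arrSum_congr fun v hv _ => cls_addG_curvW hn hv
  have e := map_arrSum ((sp 1 (0, 0)).cls ∘ₗ toCurvature) D.legs.length D.legs
    fun v => gen ⟨D.tri, D.link, v⟩
  rw [← sym_eq_arrSum] at e
  simp only [LinearMap.comp_apply] at e
  rw [Finset.sum_eq_single D.legs.length (fun N _ hN => ?_) (fun h => ?_), key, ← e, average_gen,
    map_smul, map_smul]
  · rw [key, arrSum_of_ne hN.symm, smul_zero]
  · exact absurd (Finset.mem_range.2 (by omega)) h

theorem average_ordinary {D : Diagram Leg} (h : D ∈ ordinary) (hD : D.Valid) :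
    average (gen D) ∈ Finsupp.supported ℚ ℚ (opDiagrams (0, 0)) := by
  rw [average_gen]
  have := arrSum_mem (S := Finsupp.supported ℚ ℚ (opDiagrams (0, 0))) (N := D.legs.length)
    (w := D.legs) (f := fun v => gen ⟨D.tri, D.link, v⟩) fun v hv _ =>
      gen_mem_supported.2 (ordinary_mem (fun x hx => h x (hv.subset hx))
        ((valid_congr (mem_ends_perm (T := D.tri) (K := D.link) hv)).2 hD))
  rw [← sym_eq_arrSum] at this
  exact Submodule.smul_mem _ _ this

theorem splitG_ordinary {L : Type} (r : ℚ) (W : List (L × ℕ × ℕ × ℕ)) (T K) :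
    splitG (fun _ => .two) (fun _ => r) W (gen ⟨T, K, []⟩) ∈
      Finsupp.supported ℚ ℚ {D : Diagram Leg | D ∈ ordinary ∧ D.legs.length ≤ 2 * W.length} := by
  have hc : ∀ (x : Leg × ℕ) (n : ℕ) {c : Comb Leg}, x.1 = .two ∨ x.1 = .one →
      c ∈ Finsupp.supported ℚ ℚ {D : Diagram Leg | D ∈ ordinary ∧ D.legs.length ≤ n} →
      consL x c ∈ Finsupp.supported ℚ ℚ {D : Diagram Leg | D ∈ ordinary ∧ D.legs.length ≤ n + 1} := by
    intro x n c hx hc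
    refine map_mem_of_gen (fun D hD => ?_) hc
    rw [consL_gen]
    refine gen_mem_supported.2 ⟨fun y hy => ?_, by simpa using hD.2⟩
    rcases List.mem_cons.1 hy with rfl | hy
    exacts [hx, hD.1 y hy]
  induction W with
  | nil => exact gen_mem_supported.2 ⟨fun x hx => by simp at hx, by simp⟩
  | cons x W ih =>
    rw [splitG, LinearMap.comp_apply, splitL, LinearMap.add_apply]
    refine Submodule.add_mem _ (Finsupp.supported_mono ?_ (hc (.two, _) _ (Or.inl rfl) ih))
      (Submodule.smul_mem _ _ ?_)
    · rintro D ⟨h1, h2⟩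
      exact ⟨h1, by rw [List.length_cons]; omega⟩
    · have h := hc (.one, x.2.2.1) _ (Or.inr rfl) (hc (.one, x.2.2.2) _ (Or.inr rfl) ih)
      rw [LinearMap.comp_apply, LinearMap.comp_apply]
      refine map_mem_of_gen (fun D hD => ?_) h
      rw [addG_gen]
      exact gen_mem_supported.2 hD

/-- The new names in hair-splitting. -/
def hairNames {L : Type} (w : List (L × ℕ)) : List (L × ℕ × ℕ × ℕ) :=
  posNames (8 * · + 3) (8 * · + 7) w

theorem hairNames_nodup {L : Type} (w : List (L × ℕ)) : (newNames (hairNames w)).Nodup :=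
  nodup_posNames (fun a b h => by omega) (fun a b h => by omega)
    (fun i j h => by omega) w

theorem hairNames_mod {L : Type} {w : List (L × ℕ)} {n} (h : n ∈ newNames (hairNames w)) :
    n % 4 = 3 := by
  obtain ⟨i, -, h | h⟩ := mem_posNames h <;> omega

theorem length_posNames {L : Type} (p q) (w : List (L × ℕ)) :
    (posNames p q w).length = w.length := by
  rw [← congrArg List.length (oldLegs_posNames p q w), oldLegs, List.length_map]

/-- The left hand side of the formula. -/
theorem cls_lhs {M : ℕ} {D : Diagram Unit} (hD : D ∈ fewLegs M) :
    mapLambda (mapBF (mapPi (mapChi (mapUpsilon (spB.cls (gen D)))))) =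
      ∑ N ∈ Finset.range (M + 1), ((Nat.factorial N : ℚ))⁻¹ •
        (spWedge (0, 0)).cls (contract (lam (blkU N)) (splitG (fun _ => .two) (fun _ => -1 / 2)
          (hairNames (D.rename (4 * ·)).legs)
          (gen ⟨(D.rename (4 * ·)).tri, (D.rename (4 * ·)).link, []⟩))) := by
  obtain ⟨hv, hl⟩ := hD
  have hinj : (4 * · : ℕ → ℕ).Injective := fun a b h => by simpa using h
  have hv' : (D.rename (4 * ·)).Valid := (valid_rename_iff hinj.injOn).2 hv
  have hmod : ∀ n ∈ (D.rename (4 * ·)).ends, n % 4 = 0 := fun n hn => by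
    rw [ends_rename] at hn
    obtain ⟨m, -, rfl⟩ := Multiset.mem_map.1 hn
    omega
  have hlen : (D.rename (4 * ·)).legs.length = D.legs.length := List.length_map _
  have hB : spB.cls (gen D) = spB.cls (gen (D.rename (4 * ·))) := by
    rw [← graphLike_spB.cls_ren_inj hinj, ren_gen]
  rw [hB]
  generalize D.rename (4 * ·) = D at *
  obtain ⟨T, K, w⟩ := D
  set G : Comb Leg := splitG (fun _ => .two) (fun _ => -1 / 2) (hairNames w) (gen ⟨T, K, []⟩) with hG
  have hnew : ∀ n ∈ newNames (hairNames w), n ∉ Diagram.ends ⟨T, K, w⟩ := fun n hn h => by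
    have h1 := hairNames_mod hn
    have h2 := hmod n h
    omega
  -- the diagrams of the combination `G`
  have hGs : G ∈ Finsupp.supported ℚ ℚ {E : Diagram Leg | E ∈ ordinary ∧ E.legs.length ≤ M ∧
      E.Valid ∧ ∀ n ∈ E.ends, n % 4 ≠ 2} := by
    intro E hE
    obtain ⟨h1, h2⟩ := splitG_ordinary _ _ _ _ hE
    obtain ⟨s, hs, h3⟩ := splitG_ends _ _ (hairNames_nodup w) _ hE
    have h4 : E.ends = Diagram.ends ⟨T, K, w⟩ + (s.val + s.val) := by
      rw [h3, hairNames, oldLegs_posNames]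
      simp only [ends_mk, List.map_nil, Multiset.coe_nil]
      abel
    refine ⟨h1, ?_, fun e => ?_, fun n hn => ?_⟩
    · rw [hairNames, length_posNames] at h2
      simp only at hlen
      omega
    · rw [h4, Multiset.count_add, Multiset.count_add]
      by_cases he : e ∈ s
      · rw [Multiset.count_eq_zero_of_notMem (hnew e (hs e he)),
          Multiset.count_eq_one_of_mem s.nodup he]
        exact Or.inr rfl
      · rw [Multiset.count_eq_zero_of_notMem (s := s.val) he]
        exact hv' e
    · rw [h4] at hn
      rcases Multiset.mem_add.1 hn with hn | hn
      · have := hmod n hn; omega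
      · have := hairNames_mod (hs n (by simpa using hn)); omega
  have u1 : mapUpsilon (spB.cls (gen ⟨T, K, w⟩)) = spW.cls G := by
    rw [mapUpsilon, induced_cls wellDefined_hairSplit (gen_mem_supported.2 hv'), hairSplit, extend_gen,
      hG, cls_splitG graphLike_spW _ _ (hairNames_nodup w), hairNames, oldLegs_posNames]
    intro n hn
    rw [hairNames, oldLegs_posNames]
    exact hnew n hn
  have u2 : mapChi (spW.cls G) = spWTilde.cls (average G) :=
    induced_cls wellDefined_average
      (Finsupp.supported_mono (by rintro E ⟨h1, -, h2, -⟩; exact ordinary_mem h1 h2) hGs)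
  have u3 : mapPi (spWTilde.cls (average G)) = spWHat.cls (average G) := rfl
  have u4 : mapBF (spWHat.cls (average G)) = (spF (0, 0)).cls (toCurvature (average G)) := by
    rw [mapBF, spF_eq]
    refine induced_cls (wellDefined_toCurvature _) (map_mem_of_gen (fun E hE => ?_) hGs)
    exact average_ordinary hE.1 hE.2.2.1
  have u5 : (spF (0, 0)).cls (toCurvature (average G)) = ∑ N ∈ Finset.range (M + 1),
      ((Nat.factorial N : ℚ))⁻¹ • (spF (0, 0)).cls (contract (blkU N) G) := by
    rw [spF_eq]
    have := eq_of_gen (f := (sp 1 (0, 0)).cls ∘ₗ toCurvature ∘ₗ average)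
      (g := ∑ N ∈ Finset.range (M + 1), ((Nat.factorial N : ℚ))⁻¹ •
        (sp 1 (0, 0)).cls ∘ₗ contract (blkU N)) (fun E hE => ?_) hGs
    · simpa using this
    · have := sum_contract_blkU hE.1 hE.2.2.2 hE.2.1
      simpa using this.symm
  rw [u1, u2, u3, u4, u5, map_sum]
  refine Finset.sum_congr rfl fun N _ => ?_
  rw [map_smul, mapLambda_cls, lam_contract]

theorem uOp_named {s : Set ℕ} {i : ℕ} (h : ∀ m, nmU i m ∈ s) {c : Comb Leg} (hc : c ∈ named s) :
    uOp i c ∈ named s := by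
  have h1 : ∀ l m {c : Comb Leg}, c ∈ named s → consL (l, nmU i m) c ∈ named s :=
    fun l m c hc => named_consL (h m) hc
  refine Submodule.add_mem _ (Submodule.add_mem _ (h1 _ 0 (h1 _ 0 hc)) (Submodule.smul_mem _ _
    (named_addG ?_ (by simp) (h1 _ 0 (h1 _ 1 (h1 _ 2 hc)))))) (h1 _ 0 (h1 _ 0 hc))
  intro t ht
  rw [Multiset.mem_singleton.1 ht]
  exact ⟨h 0, h 1, h 2⟩

theorem blkU_named (N : ℕ) : blkU N ∈ named {n | n % 4 ≠ 1 ∧ n % 4 ≠ 3} := by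
  induction N with
  | zero => exact gen_mem_supported.2 (by simp)
  | succ N ih =>
    have h : ∀ m, nmU N m ∈ {n : ℕ | n % 4 ≠ 1 ∧ n % 4 ≠ 3} := fun m =>
      ⟨by rw [nmU]; omega, by rw [nmU]; omega⟩
    exact uOp_named h ih

/-- The formula, for a diagram. -/
theorem formula_gen {M : ℕ} {D : Diagram Unit} (hD : D ∈ fewLegs M) :
    mapLambda (mapBF (mapPi (mapChi (mapUpsilon (spB.cls (gen D)))))) =
      ∑ s ∈ Finset.range (M + 1), ∑ N ∈ Finset.range (M + 1),
        (((Nat.factorial s : ℚ))⁻¹ * ((Nat.factorial N : ℚ))⁻¹) •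
          (spWedge (0, 0)).cls (star 1 (toPartialA (gen D))
            ((starL 1 ((-1 / 2 : ℚ) • forkOp) ^ s) (lam (powC 0 (edgeFA + innerC) N)))) := by
  rw [cls_lhs hD, Finset.sum_comm, spWedge_eq]
  refine Finset.sum_congr rfl fun N _ => ?_
  simp only [cls_star_partialA, mul_comm ((Nat.factorial _ : ℚ))⁻¹ ((Nat.factorial N : ℚ))⁻¹,
    mul_smul, ← Finset.smul_sum]
  congr 1
  have hmod : ∀ n ∈ (D.rename (4 * ·)).ends, n % 4 = 0 := fun n hn => by
    rw [ends_rename] at hn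
    obtain ⟨m, -, rfl⟩ := Multiset.mem_map.1 hn
    omega
  have hlen : (D.rename (4 * ·)).legs.length = D.legs.length := List.length_map _
  generalize D.rename (4 * ·) = D' at *
  obtain ⟨T, K, w⟩ := D'
  have hw : (hairNames w).map (fun x => x.2.1) = w.map Prod.snd := by
    nth_rw 2 [← oldLegs_posNames (8 * · + 3) (8 * · + 7) w]
    rw [oldLegs, List.map_map]
    rfl
  have hS : ∀ {n}, n ∈ Diagram.ends ⟨T, K, w⟩ → n ∈ {n : ℕ | n % 4 ≠ 1 ∧ n % 4 ≠ 3} := fun h => by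
    have := hmod _ h
    exact ⟨by omega, by omega⟩
  have h : NamesIn {n : ℕ | n % 4 ≠ 1 ∧ n % 4 ≠ 3} T K ((hairNames w).map fun x => x.2.1)
      (lam (blkU N)) := by
    simp only [ends_mk, Multiset.mem_add, Multiset.mem_bind, Multiset.mem_coe,
      Multiset.insert_eq_cons, Multiset.mem_cons, Multiset.mem_singleton] at hS
    refine ⟨fun t ht => ?_, fun k hk => ?_, fun e he => ?_, lam_named (blkU_named N)⟩
    · exact ⟨hS (Or.inl (Or.inl ⟨t, ht, by simp⟩)), hS (Or.inl (Or.inl ⟨t, ht, by simp⟩)),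
        hS (Or.inl (Or.inl ⟨t, ht, by simp⟩))⟩
    · exact ⟨hS (Or.inl (Or.inr ⟨k, hk, by simp⟩)), hS (Or.inl (Or.inr ⟨k, hk, by simp⟩))⟩
    · rw [hw] at he
      exact hS (Or.inr he)
  have := sum_forkVal (q := 0) (r := -1 / 2) (Z := {n | n % 4 = 1}) zNames_length zNames_nodup
    (fun s n hn => by
      obtain ⟨i, -, m, rfl⟩ := mem_zNames hn
      rw [Set.mem_ofPred_eq, nmZ]; omega) h (fun n hn hn' => hn.1 hn') (hairNames_nodup w)
    (fun n hn => ⟨fun h => h.2 (hairNames_mod hn), fun h => by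
      have := hairNames_mod hn
      rw [Set.mem_ofPred_eq] at h
      omega⟩) (M := M) (by
      have := hD.2
      rw [hairNames, length_posNames]
      simp only at hlen
      omega)
  rw [hw] at this
  exact this.symm

/-- The formula: both sides are linear, and for a diagram with at most `M` legs they are the finite
sums compared in `formula_gen`. -/
theorem formula (v : spB.Space) : mapLambda (mapBF (mapPi (mapChi (mapUpsilon v)))) =
    setZero (mul operate (partialA v) (mul hash expEdge seriesX)) := by
  obtain ⟨c, hc, rfl⟩ := exists_cls_eq _ v
  obtain ⟨M, hM⟩ := exists_fewLegs hc
  rw [setZero_eq hM, cls_rhs (toPartialA_good hM) (low_of spWedge_fun (toPartialA_supported hM))]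
  have := eq_of_gen (f := mapLambda ∘ₗ mapBF ∘ₗ mapPi ∘ₗ mapChi ∘ₗ mapUpsilon ∘ₗ spB.cls)
    (g := ∑ s ∈ Finset.range (M + 1), ∑ N ∈ Finset.range (M + 1),
      (((Nat.factorial s : ℚ))⁻¹ * ((Nat.factorial N : ℚ))⁻¹) • (spWedge (0, 0)).cls ∘ₗ
        (actC 1).flip (ren right ((starL 1 ((-1 / 2 : ℚ) • forkOp) ^ s)
          (lam (powC 0 (edgeFA + innerC) N)))) ∘ₗ ren left ∘ₗ toPartialA) (fun D hD => ?_) hM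
  · simpa [star] using this
  · have := formula_gen hD
    simpa [star] using this

end Weil

end

open Weil in
theorem mainTheorem2 :
    -- all the maps and products, given on diagrams, are well defined on the spaces
    (WellDefined spB spW hairSplit ∧
      WellDefined spW spWTilde average ∧
      WellDefined spWHat (spF (0, 0)) toCurvature ∧
      (∀ t, WellDefined (spF t) (spWedge t) lam) ∧
      (∀ t, WellDefined spB (spWedge t) toPartialA) ∧
      (∀ p q r, WellDefined₂ (spF p) (spF q) (spF r) hash) ∧
      (∀ p q r, WellDefined₂ (spWedge p) (spWedge q) (spWedge r) hash) ∧
      (∀ p q r, WellDefined₂ (spWedge p) (spWedge q) (spWedge r) operate)) ∧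
    -- all the exponentials and products converge
    (ExpConverges hash (Series.of spWedge edgeFA) ∧
      ExpConverges hash innerTerm ∧
      ExpConverges operate (Series.of spWedge ((-1 / 2 : ℚ) • forkOp)) ∧
      Converges operate expForkOp (lamSeries (exp hash innerTerm)) ∧
      Converges hash expEdge seriesX ∧
      ∀ v : spB.Space, Converges operate (partialA v) (mul hash expEdge seriesX)) ∧
    -- the formula
    ∀ v : spB.Space,
      mapLambda (mapBF (mapPi (mapChi (mapUpsilon v)))) =
        setZero (mul operate (partialA v) (mul hash expEdge seriesX)) := by
  refine ⟨⟨wellDefined_hairSplit, wellDefined_average, ?_, ?_, ?_, ?_, ?_, ?_⟩,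
    ⟨expConverges_edgeFA, expConverges_inner, expConverges_forkOp _, ?_, ?_, ?_⟩, formula⟩
  · rw [spF_eq]; exact wellDefined_toCurvature _
  · intro t; rw [spF_eq, spWedge_eq]; exact wellDefined_lam t t
  · intro t; rw [spWedge_eq]; exact wellDefined_toPartialA t
  · intro p q r; simp only [spF_eq]; exact isStar_hash.wellDefined₂ _ _ _ _
  · intro p q r; simp only [spWedge_eq]; exact isStar_hash.wellDefined₂ _ _ _ _
  · intro p q r; simp only [spWedge_eq]; exact isStar_operate.wellDefined₂ _ _ _ _
  · exact converges_of_low spWedge_fun isStar_operate low_expForkOp _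
  · exact converges_zero spWedge_fun isStar_hash _ _
  · exact fun v => converges_partialA v _
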